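/- Let $S=\mathbb{Z}_{(3)}$ be the integers localized at the prime $3$, let $R_3=S[X]/(X^2)$, and regard $R_3$–$R_3$ bimodules as modules over $R_3\otimes_S R_3$. All bimodules are $\mathbb{Z}$-graded (quantum grading), with $X\otimes 1$ and $1\otimes X$ acting by maps of degree $-2$; all bimodule maps, cochain maps and homotopies preserve this grading. The bimodule $R_3\otimes R_3$ is graded with $1\otimes 1$ in degree $2$. Write $M\{k\}$ for the grading shift $M\{k\}_q=M_{q-k}$, and $C^\ast[k]=C^{\ast-k}$ for the shift of the homological degree. For $n\in\mathbb{Z}$ let $C^\ast(n;R_3)$ be the complex concentrated in homological degrees $0$ and $1$ with $C^0=R_3\otimes R_3\{-1\}$, $C^1=R_3\otimes R_3\{1\}$ and coboundary the bimodule map with $1\otimes 1\mapsto nX\otimes 1-1\otimes X$. Let $L_3$ be the two-component link that is the closure of the braid word $(\sigma_1\sigma_2\sigma_3)^4\sigma_1\sigma_2$ on four strands, all of whose $14$ crossings are positive; one component is a torus knot $T(3,4)$, the other an unknot. Let $C^\ast_{\mathrm{Kh}}(L_3;\mathbb{Z}_{(3)})$ be the Khovanov complex of this diagram with coefficients in $\mathbb{Z}_{(3)}$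 (the cube of smoothings with the Frobenius algebra $R_3$, comultiplication $\Delta(1)=X\otimes 1+1\otimes X$, $\Delta(X)=X\otimes X$). It is a complex of graded $R_3$–$R_3$ bimodules by means of two basepoints, both placed on the closing strands between the last and the first letter of the word: the left action of $X$ is multiplication by $X$ on the circle through a basepoint at the third strand position, which lies on the $T(3,4)$ component, and the right action is multiplication by $X$ on the circle through a basepoint at the fourth strand position, which lies on the unknotted component. Then there is a complex $F_3^\ast$ of finitely generated graded $R_3$–$R_3$ bimodules, concentrated in homological degrees $0$ to $7$, and a chain homotopy equivalence \[ C^\ast_{\mathrm{Kh}}(L_3;\mathbb{Z}_{(3)})\;\simeq\;F_3^\ast\oplus C^\ast(3;R_3)[8]\{25\} \] of complexes of graded $R_3$–$R_3$ bimodules. -/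

import Mathlib

open CategoryTheory CategoryTheory.Limits
open scoped TensorProduct

noncomputable section

namespace Khovanov

/-- The ring `R_S = S[X] / (X ^ 2)`. -/
abbrev R (S : Type) [CommRing S] : Type := AdjoinRoot (Polynomial.X ^ 2 : Polynomial S)

/-- The ring `R_S ⊗ R_S`; its modules are the `R_S`-`R_S` bimodules. -/
abbrev RR (S : Type) [CommRing S] : Type := R S ⊗[S] R S

/-- `X ⊗ 1`, acting on a bimodule as left multiplication by `X`. -/
def XL (S : Type) [CommRing S] : RR S := AdjoinRoot.root _ ⊗ₜ 1

/-- `1 ⊗ X`, acting on a bimodule as right multiplication by `X`. -/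
def XR (S : Type) [CommRing S] : RR S := 1 ⊗ₜ AdjoinRoot.root _

theorem XL_sq (S : Type) [CommRing S] : XL S ^ 2 = 0 := by
  have h : (AdjoinRoot.root (Polynomial.X ^ 2 : Polynomial S)) ^ 2 = 0 := by
    have := AdjoinRoot.mk_self (f := (Polynomial.X ^ 2 : Polynomial S))
    rwa [map_pow, AdjoinRoot.mk_X] at this
  rw [XL, Algebra.TensorProduct.tmul_pow, h, TensorProduct.zero_tmul]

theorem XR_sq (S : Type) [CommRing S] : XR S ^ 2 = 0 := by
  have h : (AdjoinRoot.root (Polynomial.X ^ 2 : Polynomial S)) ^ 2 = 0 := by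
    have := AdjoinRoot.mk_self (f := (Polynomial.X ^ 2 : Polynomial S))
    rwa [map_pow, AdjoinRoot.mk_X] at this
  rw [XR, Algebra.TensorProduct.tmul_pow, h, TensorProduct.tmul_zero]

section Internal

theorem isInternal_iff_proj {M : Type} [AddCommGroup M] (gr : ℤ → AddSubgroup M) :
    DirectSum.IsInternal gr ↔ ∃ π : ℤ → M →+ M,
      (∀ q, ∀ m ∈ gr q, π q m = m) ∧ (∀ q q', q ≠ q' → ∀ m ∈ gr q', π q m = 0) ∧
      ⨆ q, gr q = ⊤ := by
  constructor
  · intro h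
    let e := AddEquiv.ofBijective _ h
    have he : ∀ q (m : M) (hm : m ∈ gr q), e.symm m = DirectSum.of (fun i => gr i) q ⟨m, hm⟩ := by
      intro q m hm
      rw [AddEquiv.symm_apply_eq]
      exact (DirectSum.coeAddMonoidHom_of gr q ⟨m, hm⟩).symm
    refine ⟨fun q => ((gr q).subtype.comp
      (DFinsupp.evalAddMonoidHom (β := fun i => gr i) q)).comp e.symm.toAddMonoidHom, ?_, ?_, ?_⟩
    · intro q m hm
      change ((e.symm m) q : M) = m
      rw [he q m hm, DirectSum.of_eq_same]
    · intro q q' hq m hm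
      change ((e.symm m) q : M) = 0
      rw [he q' m hm, DirectSum.of_eq_of_ne _ _ _ hq]
      rfl
    · rw [eq_top_iff]
      intro m _
      obtain ⟨x, rfl⟩ := h.2 m
      induction x using DirectSum.induction_on with
      | zero => simp
      | of i x =>
        rw [DirectSum.coeAddMonoidHom_of]
        exact AddSubgroup.mem_iSup_of_mem i x.2
      | add x y hx hy =>
        rw [map_add]
        exact add_mem (hx trivial) (hy trivial)
  · rintro ⟨π, h1, h2, h3⟩
    constructor
    · rw [injective_iff_map_eq_zero]
      intro x hx
      refine DFinsupp.ext fun q => ?_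
      have key : (π q).comp (DirectSum.coeAddMonoidHom gr) =
          (gr q).subtype.comp (DFinsupp.evalAddMonoidHom (β := fun i => gr i) q) := by
        refine DirectSum.addHom_ext fun i y => ?_
        change π q (DirectSum.coeAddMonoidHom gr (DirectSum.of (fun i => gr i) i y)) =
          ((DirectSum.of (fun i => gr i) i y) q : M)
        rw [DirectSum.coeAddMonoidHom_of]
        by_cases hi : q = i
        · subst hi
          rw [h1 _ _ y.2, DirectSum.of_eq_same]
        · rw [h2 _ _ hi _ y.2, DirectSum.of_eq_of_ne _ _ _ hi]
          rfl
      have := DFunLike.congr_fun key x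
      rw [AddMonoidHom.comp_apply, hx, map_zero] at this
      exact Subtype.ext this.symm
    · rw [← AddMonoidHom.range_eq_top, eq_top_iff, ← h3, iSup_le_iff]
      intro q m hm
      exact ⟨DirectSum.of (fun i => gr i) q ⟨m, hm⟩, DirectSum.coeAddMonoidHom_of gr q ⟨m, hm⟩⟩

end Internal

/-- A `ℤ`-graded `R_S`-`R_S` bimodule: a module over `R_S ⊗ R_S` with a decomposition
`⨁ q, gr q` such that scalars from `S` have degree `0` and left and right multiplication
by `X` have degree `-2`. -/
structure GrBimod (S : Type) [CommRing S] where
  carrier : Type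
  [addCommGroup : AddCommGroup carrier]
  [module : Module (RR S) carrier]
  gr : ℤ → AddSubgroup carrier
  isInternal : DirectSum.IsInternal gr
  scalar_mem : ∀ (s : S) (q : ℤ), ∀ m ∈ gr q, algebraMap S (RR S) s • m ∈ gr q
  XL_mem : ∀ (q : ℤ), ∀ m ∈ gr q, XL S • m ∈ gr (q - 2)
  XR_mem : ∀ (q : ℤ), ∀ m ∈ gr q, XR S • m ∈ gr (q - 2)

attribute [instance] GrBimod.addCommGroup GrBimod.module

namespace GrBimod

variable {S : Type} [CommRing S]

instance : CoeSort (GrBimod S) Type := ⟨GrBimod.carrier⟩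

/-- Morphisms: bimodule maps that preserve the grading. -/
@[ext]
structure Hom (M N : GrBimod S) where
  toLin : M →ₗ[RR S] N
  map_gr : ∀ (q : ℤ), ∀ m ∈ M.gr q, toLin m ∈ N.gr q

instance : Category (GrBimod S) where
  Hom M N := Hom M N
  id M := ⟨LinearMap.id, fun _ _ h => h⟩
  comp f g := ⟨g.toLin ∘ₗ f.toLin, fun q m h => g.map_gr q _ (f.map_gr q m h)⟩

@[ext]
theorem hom_ext {M N : GrBimod S} {f g : M ⟶ N} (h : f.toLin = g.toLin) : f = g :=
  Hom.ext h

@[simp]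
theorem id_toLin (M : GrBimod S) : Hom.toLin (𝟙 M) = LinearMap.id := rfl

@[simp]
theorem comp_toLin {M N P : GrBimod S} (f : M ⟶ N) (g : N ⟶ P) :
    (f ≫ g).toLin = g.toLin ∘ₗ f.toLin := rfl

section Additive

variable {M N : GrBimod S}

instance : Zero (M ⟶ N) := ⟨⟨0, fun q _ _ => (N.gr q).zero_mem⟩⟩
instance : Add (M ⟶ N) :=
  ⟨fun f g => ⟨f.toLin + g.toLin, fun q m h => (N.gr q).add_mem (f.map_gr q m h) (g.map_gr q m h)⟩⟩
instance : Neg (M ⟶ N) := ⟨fun f => ⟨-f.toLin, fun q m h => (N.gr q).neg_mem (f.map_gr q m h)⟩⟩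
instance : Sub (M ⟶ N) :=
  ⟨fun f g => ⟨f.toLin - g.toLin, fun q m h => (N.gr q).sub_mem (f.map_gr q m h) (g.map_gr q m h)⟩⟩
instance : SMul ℕ (M ⟶ N) :=
  ⟨fun k f => ⟨k • f.toLin, fun q m h => (N.gr q).nsmul_mem (f.map_gr q m h) k⟩⟩
instance : SMul ℤ (M ⟶ N) :=
  ⟨fun k f => ⟨k • f.toLin, fun q m h => (N.gr q).zsmul_mem (f.map_gr q m h) k⟩⟩

@[simp]
theorem zero_toLin : Hom.toLin (0 : M ⟶ N) = 0 := rfl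

@[simp]
theorem add_toLin (f g : M ⟶ N) : (f + g).toLin = f.toLin + g.toLin := rfl

instance : AddCommGroup (M ⟶ N) :=
  Function.Injective.addCommGroup (fun f : M ⟶ N => f.toLin) (fun _ _ h => hom_ext h)
    rfl (fun _ _ => rfl) (fun _ => rfl) (fun _ _ => rfl) (fun _ _ => rfl) (fun _ _ => rfl)

end Additive

instance : Preadditive (GrBimod S) where
  add_comp _ _ _ f g h := by
    ext x
    exact map_add h.toLin _ _
  comp_add _ _ _ f g h := rfl

/-- The zero bimodule. -/
def zeroObj (S : Type) [CommRing S] : GrBimod S where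
  carrier := PUnit
  gr _ := ⊤
  isInternal := (isInternal_iff_proj _).2
    ⟨fun _ => 0, fun _ _ _ => rfl, fun _ _ _ _ _ => rfl, by simp⟩
  scalar_mem _ _ _ _ := trivial
  XL_mem _ _ _ := trivial
  XR_mem _ _ _ := trivial

instance : HasZeroObject (GrBimod S) :=
  ⟨zeroObj S, (IsZero.iff_id_eq_zero _).2 (by ext; rfl)⟩

/-- The direct sum of two graded bimodules. -/
def prod (M N : GrBimod S) : GrBimod S where
  carrier := M × N
  gr q := (M.gr q).prod (N.gr q)
  isInternal := by
    obtain ⟨π, h1, h2, h3⟩ := (isInternal_iff_proj _).1 M.isInternal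
    obtain ⟨ρ, k1, k2, k3⟩ := (isInternal_iff_proj _).1 N.isInternal
    refine (isInternal_iff_proj _).2 ⟨fun q => (π q).prodMap (ρ q), ?_, ?_, ?_⟩
    · rintro q ⟨a, b⟩ ⟨ha, hb⟩
      exact Prod.ext (h1 q a ha) (k1 q b hb)
    · rintro q q' hq ⟨a, b⟩ ⟨ha, hb⟩
      exact Prod.ext (h2 q q' hq a ha) (k2 q q' hq b hb)
    · rw [eq_top_iff]
      rintro ⟨a, b⟩ -
      have e : ((a, b) : M × N) = AddMonoidHom.inl M N a + AddMonoidHom.inr M N b := by simp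
      rw [e]
      refine add_mem ?_ ?_
      · have : (⊤ : AddSubgroup M) ≤ (⨆ q, (M.gr q).prod (N.gr q)).comap (AddMonoidHom.inl M N) := by
          rw [← h3, iSup_le_iff]
          intro q m hm
          exact le_iSup (fun q => (M.gr q).prod (N.gr q)) q ⟨hm, (N.gr q).zero_mem⟩
        exact this trivial
      · have : (⊤ : AddSubgroup N) ≤ (⨆ q, (M.gr q).prod (N.gr q)).comap (AddMonoidHom.inr M N) := by
          rw [← k3, iSup_le_iff]
          intro q m hm
          exact le_iSup (fun q => (M.gr q).prod (N.gr q)) q ⟨(M.gr q).zero_mem, hm⟩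
        exact this trivial
  scalar_mem s q m h := ⟨M.scalar_mem s q _ h.1, N.scalar_mem s q _ h.2⟩
  XL_mem q m h := ⟨M.XL_mem q _ h.1, N.XL_mem q _ h.2⟩
  XR_mem q m h := ⟨M.XR_mem q _ h.1, N.XR_mem q _ h.2⟩

instance : HasBinaryBiproducts (GrBimod S) where
  has_binary_biproduct M N := hasBinaryBiproduct_of_total
    { pt := prod M N
      fst := ⟨LinearMap.fst _ _ _, fun _ _ h => h.1⟩
      snd := ⟨LinearMap.snd _ _ _, fun _ _ h => h.2⟩
      inl := ⟨LinearMap.inl _ _ _, fun q _ h => ⟨h, (N.gr q).zero_mem⟩⟩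
      inr := ⟨LinearMap.inr _ _ _, fun q _ h => ⟨(M.gr q).zero_mem, h⟩⟩
      inl_fst := rfl
      inl_snd := rfl
      inr_fst := rfl
      inr_snd := rfl } (by
      apply hom_ext
      refine LinearMap.ext fun x => ?_
      exact Prod.ext (add_zero _) (zero_add _))

/-- The grading shift `M{k}`, with `M{k}` in degree `q` equal to `M` in degree `q - k`. -/
def qShift (S : Type) [CommRing S] (k : ℤ) : GrBimod S ⥤ GrBimod S where
  obj M :=
    { carrier := M
      gr := fun q => M.gr (q - k)
      isInternal := by
        obtain ⟨π, h1, h2, h3⟩ := (isInternal_iff_proj _).1 M.isInternal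
        refine (isInternal_iff_proj _).2 ⟨fun q => π (q - k), fun q => h1 _,
          fun q q' hq => h2 _ _ (by simpa using hq), ?_⟩
        rw [← h3]
        exact (Equiv.subRight k).iSup_comp (g := M.gr)
      scalar_mem := fun s q => M.scalar_mem s _
      XL_mem := fun q m h => by
        have := M.XL_mem _ m h
        rwa [sub_right_comm] at this
      XR_mem := fun q m h => by
        have := M.XR_mem _ m h
        rwa [sub_right_comm] at this }
  map f := ⟨f.toLin, fun q => f.map_gr _⟩

instance (k : ℤ) : (qShift S k).Additive where

section Free

variable (S)

/-- The homogeneous parts of `R ⊗ R`, where `1 ∈ R` has degree `1` and `X ∈ R` has degree `-1`,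
so that `X ^ i ⊗ X ^ j` has degree `2 - 2 i - 2 j`. -/
def freeGr (q : ℤ) : AddSubgroup (RR S) :=
  (Submodule.span S {z | ∃ i j : ℕ, 2 - 2 * (i : ℤ) - 2 * j = q ∧ z = XL S ^ i * XR S ^ j}).toAddSubgroup

theorem XL_pow_mul_XR_pow (i j : ℕ) : XL S ^ i * XR S ^ j =
    ((AdjoinRoot.root (Polynomial.X ^ 2 : Polynomial S)) ^ i) ⊗ₜ[S]
      ((AdjoinRoot.root (Polynomial.X ^ 2 : Polynomial S)) ^ j) := by
  simp [XL, XR, Algebra.TensorProduct.tmul_pow]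

theorem freeGr_isInternal : DirectSum.IsInternal (freeGr S) := by
  classical
  let g : Polynomial S := Polynomial.X ^ 2
  have hg : g.Monic := Polynomial.monic_X_pow 2
  let pb := AdjoinRoot.powerBasis' hg
  let b := pb.basis.tensorProduct pb.basis
  have hb : ∀ x, b x = XL S ^ (x.1 : ℕ) * XR S ^ (x.2 : ℕ) := by
    intro x
    rw [XL_pow_mul_XR_pow]
    have := Module.Basis.tensorProduct_apply' pb.basis pb.basis x
    rw [PowerBasis.basis_eq_pow, PowerBasis.basis_eq_pow] at this
    exact this
  have hdim : ∀ i : Fin pb.dim, (i : ℕ) < 2 := by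
    intro i
    have h1 : pb.dim ≤ 2 := by
      change (Polynomial.X ^ 2 : Polynomial S).natDegree ≤ 2
      exact Polynomial.natDegree_X_pow_le 2
    omega
  have hmon : ∀ i j : ℕ, XL S ^ i * XR S ^ j = 0 ∨ ∃ x, XL S ^ i * XR S ^ j = b x ∧
      (x.1 : ℕ) = i ∧ (x.2 : ℕ) = j := by
    intro i j
    by_cases hi : 2 ≤ i
    · left
      rw [pow_eq_zero_of_le hi (XL_sq S), zero_mul]
    by_cases hj : 2 ≤ j
    · left
      rw [pow_eq_zero_of_le hj (XR_sq S), mul_zero]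
    cases subsingleton_or_nontrivial S
    · left
      have := Module.subsingleton S (RR S)
      exact Subsingleton.elim _ _
    have h2 : pb.dim = 2 := by
      change (Polynomial.X ^ 2 : Polynomial S).natDegree = 2
      exact Polynomial.natDegree_X_pow 2
    right
    refine ⟨(⟨i, by omega⟩, ⟨j, by omega⟩), ?_, rfl, rfl⟩
    rw [hb]
  let π : ℤ → RR S →ₗ[S] RR S := fun q => b.constr S fun x =>
    if 2 - 2 * ((x.1 : ℕ) : ℤ) - 2 * ((x.2 : ℕ) : ℤ) = q then b x else 0
  refine (isInternal_iff_proj _).2 ⟨fun q => (π q).toAddMonoidHom, ?_, ?_, ?_⟩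
  · intro q m hm
    refine Submodule.span_induction (p := fun m _ => π q m = m) ?_ ?_ ?_ ?_ hm
    · rintro _ ⟨i, j, hq, rfl⟩
      rcases hmon i j with h | ⟨x, h, rfl, rfl⟩
      · rw [h, map_zero]
      · rw [h, Module.Basis.constr_basis, if_pos hq]
    · exact map_zero _
    · intro x y _ _ hx hy
      rw [map_add, hx, hy]
    · intro s x _ hx
      rw [map_smul, hx]
  · intro q q' hne m hm
    refine Submodule.span_induction (p := fun m _ => π q m = 0) ?_ ?_ ?_ ?_ hm
    · rintro _ ⟨i, j, hq, rfl⟩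
      rcases hmon i j with h | ⟨x, h, rfl, rfl⟩
      · rw [h, map_zero]
      · rw [h, Module.Basis.constr_basis, if_neg]
        intro h'
        exact hne (h'.symm.trans hq)
    · exact map_zero _
    · intro x y _ _ hx hy
      rw [map_add, hx, hy, add_zero]
    · intro s x _ hx
      rw [map_smul, hx, smul_zero]
  · rw [eq_top_iff]
    intro m _
    rw [← b.sum_repr m]
    refine sum_mem fun x _ => ?_
    refine AddSubgroup.mem_iSup_of_mem (2 - 2 * ((x.1 : ℕ) : ℤ) - 2 * ((x.2 : ℕ) : ℤ)) ?_
    exact Submodule.smul_mem _ _ (Submodule.subset_span ⟨x.1, x.2, rfl, hb x⟩)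

theorem freeGr_mul_mem (a b : ℕ) (k q : ℤ) (hk : k = -2 * (a : ℤ) - 2 * b) :
    ∀ m ∈ freeGr S q, (XL S ^ a * XR S ^ b) * m ∈ freeGr S (q + k) := by
  intro m hm
  refine Submodule.span_induction
    (p := fun m _ => (XL S ^ a * XR S ^ b) * m ∈ freeGr S (q + k)) ?_ ?_ ?_ ?_ hm
  · rintro _ ⟨i, j, hq, rfl⟩
    refine Submodule.subset_span ⟨a + i, b + j, ?_, by ring⟩
    push_cast
    omega
  · rw [mul_zero]
    exact zero_mem _
  · intro x y _ _ hx hy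
    rw [mul_add]
    exact add_mem hx hy
  · intro s x _ hx
    rw [mul_smul_comm]
    exact Submodule.smul_mem _ s hx

/-- The graded bimodule `R ⊗ R`. -/
def free : GrBimod S where
  carrier := RR S
  gr := freeGr S
  isInternal := freeGr_isInternal S
  scalar_mem s q m h := by
    rw [smul_eq_mul, ← Algebra.smul_def]
    exact Submodule.smul_mem _ s h
  XL_mem q m h := by
    simpa [sub_eq_add_neg] using freeGr_mul_mem S 1 0 (-2) q (by norm_num) m h
  XR_mem q m h := by
    simpa [sub_eq_add_neg] using freeGr_mul_mem S 0 1 (-2) q (by norm_num) m h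

theorem delta_mem (n q : ℤ) : ∀ m ∈ freeGr S (q - (-1)),
    ((n : RR S) * XL S - XR S) * m ∈ freeGr S (q - 1) := by
  intro m h
  have h1 := (free S).XL_mem _ m h
  have h2 := (free S).XR_mem _ m h
  have e : q - (-1) - 2 = q - 1 := by ring
  rw [e] at h1 h2
  have e2 : ((n : RR S) * XL S - XR S) * m = n • (XL S * m) - XR S * m := by
    rw [zsmul_eq_mul]
    ring
  rw [e2]
  exact (freeGr S (q - 1)).sub_mem ((freeGr S (q - 1)).zsmul_mem h1 n) h2

/-- The coboundary `R ⊗ R {-1} ⟶ R ⊗ R {1}`, `1 ⊗ 1 ↦ n X ⊗ 1 - 1 ⊗ X`. -/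
def delta (n : ℤ) : (qShift S (-1)).obj (free S) ⟶ (qShift S 1).obj (free S) where
  toLin := (LinearMap.mulLeft (RR S) ((n : RR S) * XL S - XR S) : RR S →ₗ[RR S] RR S)
  map_gr q m h := delta_mem S n q m h

/-- The complex `C(n)`, concentrated in homological degrees `0` and `1`. -/
def twoTerm (n : ℤ) : CochainComplex (GrBimod S) ℤ :=
  HomologicalComplex.double (delta S n) (c := ComplexShape.up ℤ) (i₀ := 0) (i₁ := 1) (by simp)

end Free

end GrBimod

section Perm

variable {α : Type} [DecidableEq α] (σ : Equiv.Perm α) (x y : α)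

theorem swap_pow_eq {k : ℕ} (h : ∀ j, 0 < j → j < k → (σ ^ j) y ≠ x ∧ (σ ^ j) y ≠ y) :
    ∀ j, 0 < j → j ≤ k → ((σ * Equiv.swap x y) ^ j) x = (σ ^ j) y := by
  intro j
  induction j with
  | zero => intro h0; omega
  | succ j ih =>
    intro _ hj
    rw [pow_succ', pow_succ', Equiv.Perm.mul_apply, Equiv.Perm.mul_apply σ]
    rcases Nat.eq_zero_or_pos j with rfl | hj0
    · simp
    · rw [ih hj0 (by omega), Equiv.Perm.mul_apply,
        Equiv.swap_apply_of_ne_of_ne (h j hj0 (by omega)).1 (h j hj0 (by omega)).2]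

theorem sameCycle_swap [Finite α] (hxy : x ≠ y) :
    (σ * Equiv.swap x y).SameCycle x y ↔ ¬ σ.SameCycle x y := by
  classical
  have hex : ∃ k, 0 < k ∧ ((σ ^ k) y = x ∨ (σ ^ k) y = y) :=
    ⟨orderOf σ, orderOf_pos σ, Or.inr (by rw [pow_orderOf_eq_one]; rfl)⟩
  have hk := Nat.find_spec hex
  have hmin : ∀ j, 0 < j → j < Nat.find hex → (σ ^ j) y ≠ x ∧ (σ ^ j) y ≠ y := by
    intro j h0 hj
    have := Nat.find_min hex hj
    tauto
  set k := Nat.find hex with hkdef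
  have hpow := swap_pow_eq σ x y hmin
  constructor
  · intro h' hs
    rcases hk.2 with hx | hy
    · -- the cycle of `x` closes up after `k` steps without meeting `y`
      have hper : ((σ * Equiv.swap x y) ^ k) x = x := by rw [hpow k hk.1 le_rfl, hx]
      obtain ⟨m, hm⟩ := h'.exists_nat_pow_eq
      have hmod : ((σ * Equiv.swap x y) ^ (m % k)) x = y := by
        refine Eq.trans ?_ hm
        conv_rhs => rw [← Nat.mod_add_div m k, pow_add, pow_mul, Equiv.Perm.mul_apply]
        have : ∀ l, (((σ * Equiv.swap x y) ^ k) ^ l) x = x := by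
          intro l
          induction l with
          | zero => rfl
          | succ l ih => rw [pow_succ, Equiv.Perm.mul_apply, hper, ih]
        rw [this]
      rcases Nat.eq_zero_or_pos (m % k) with h0 | h0
      · rw [h0] at hmod
        exact hxy hmod
      · rw [hpow _ h0 (Nat.mod_lt _ hk.1).le] at hmod
        exact (hmin _ h0 (Nat.mod_lt _ hk.1)).2 hmod
    · obtain ⟨m, hm⟩ := hs.symm.exists_nat_pow_eq
      have hmod : (σ ^ (m % k)) y = x := by
        rw [← hm]
        conv_rhs => rw [← Nat.mod_add_div m k, pow_add, pow_mul, Equiv.Perm.mul_apply]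
        have : ∀ l, ((σ ^ k) ^ l) y = y := by
          intro l
          induction l with
          | zero => rfl
          | succ l ih => rw [pow_succ, Equiv.Perm.mul_apply, hy, ih]
        rw [this]
      rcases Nat.eq_zero_or_pos (m % k) with h0 | h0
      · rw [h0] at hmod
        exact hxy hmod.symm
      · exact (hmin _ h0 (Nat.mod_lt _ hk.1)).1 hmod
  · intro hs
    rcases hk.2 with hx | hy
    · exact absurd (Equiv.Perm.SameCycle.symm ⟨(k : ℤ), by rw [zpow_natCast]; exact hx⟩) hs
    · exact ⟨(k : ℤ), by rw [zpow_natCast, hpow k hk.1 le_rfl, hy]⟩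

end Perm

/-- If `x` and `y` are not related by the equivalence relation `r`, and `s` arises from `r` by
joining `x` to `y`, then `s` has one class fewer. -/
theorem card_quot_join {α : Type} [Finite α] (r s : α → α → Prop) (x y : α)
    (hxy : ¬ Relation.EqvGen r x y)
    (h : ∀ e f, Relation.EqvGen s e f ↔ Relation.EqvGen r e f ∨
      (Relation.EqvGen r e x ∧ Relation.EqvGen r y f) ∨
      (Relation.EqvGen r e y ∧ Relation.EqvGen r x f)) :
    Nat.card (Quot s) + 1 = Nat.card (Quot r) := by
  classical
  let F : Quot r → Quot s := Quot.lift (Quot.mk s) fun e f hef =>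
    Quot.eqvGen_sound ((h e f).2 (Or.inl (.rel _ _ hef)))
  let G : {c : Quot r // c ≠ Quot.mk r y} → Quot s := fun c => F c.1
  have hG : Function.Bijective G := by
    constructor
    · rintro ⟨c, hc⟩ ⟨d, hd⟩ hcd
      induction c using Quot.ind with | mk e =>
      induction d using Quot.ind with | mk f =>
      have h1 : Relation.EqvGen s e f := Quot.eqvGen_exact hcd
      apply Subtype.ext
      rcases (h e f).1 h1 with h2 | ⟨_, h2⟩ | ⟨h2, _⟩
      · exact Quot.eqvGen_sound h2
      · exact absurd (Quot.eqvGen_sound (h2.symm _ _)) hd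
      · exact absurd (Quot.eqvGen_sound h2) hc
    · intro c
      induction c using Quot.ind with | mk e =>
      by_cases he : Quot.mk r e = Quot.mk r y
      · refine ⟨⟨Quot.mk r x, fun h' => hxy (Quot.eqvGen_exact h')⟩, ?_⟩
        exact Quot.eqvGen_sound ((h x e).2 (Or.inr (Or.inl
          ⟨.refl _, Quot.eqvGen_exact he.symm⟩)))
      · exact ⟨⟨Quot.mk r e, he⟩, rfl⟩
  rw [← Nat.card_congr (Equiv.ofBijective G hG)]
  have h1 := Nat.card_congr (Equiv.sumCompl (fun c : Quot r => c = Quot.mk r y))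
  rw [Nat.card_sum, Nat.card_unique] at h1
  rw [← h1, add_comm]

/-- The smoothing obtained from `v` by changing the smoothing of crossing `t` to `0`. -/
abbrev low {ℓ : ℕ} (v : Fin ℓ → Bool) (t : Fin ℓ) : Fin ℓ → Bool := Function.update v t false

theorem low_ne {ℓ : ℕ} (v : Fin ℓ → Bool) {t s : Fin ℓ} (h : s ≠ t) : low v t s = v s :=
  Function.update_of_ne h _ _

section Braid

variable {n ℓ : ℕ} [NeZero ℓ]

/-- The edges of the closure of a braid word with `ℓ` letters on `n + 1` strands: the edge
`(j, t)` runs at position `j` just below the crossing number `t`; it runs just above the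
crossing number `t - 1`, where the numbers of the crossings are cyclic because the braid
is closed up. -/
abbrev Edge (n ℓ : ℕ) : Type := Fin (n + 1) × Fin ℓ

/-- The edge that meets crossing `t` from below left. -/
def botL (w : Fin ℓ → Fin n) (t : Fin ℓ) : Edge n ℓ := ((w t).castSucc, t)

/-- The edge that meets crossing `t` from below right. -/
def botR (w : Fin ℓ → Fin n) (t : Fin ℓ) : Edge n ℓ := ((w t).succ, t)

/-- The edge that meets crossing `t` from above left. -/
def topL (w : Fin ℓ → Fin n) (t : Fin ℓ) : Edge n ℓ := ((w t).castSucc, t + 1)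

/-- The edge that meets crossing `t` from above right. -/
def topR (w : Fin ℓ → Fin n) (t : Fin ℓ) : Edge n ℓ := ((w t).succ, t + 1)

/-- `Arc w v e f`: the edges `e` and `f` are joined by an arc in the smoothing `v` of the closure
of the positive braid `σ_{w 0} σ_{w 1} ⋯`. The `0`-smoothing of a positive crossing consists of
two vertical arcs, the `1`-smoothing of two horizontal ones. -/
inductive Arc (w : Fin ℓ → Fin n) (v : Fin ℓ → Bool) : Edge n ℓ → Edge n ℓ → Prop
  | strand (t : Fin ℓ) (j : Fin (n + 1)) (hl : j ≠ (w t).castSucc) (hr : j ≠ (w t).succ) :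
      Arc w v (j, t) (j, t + 1)
  | zeroL (t : Fin ℓ) (h : v t = false) : Arc w v (botL w t) (topL w t)
  | zeroR (t : Fin ℓ) (h : v t = false) : Arc w v (botR w t) (topR w t)
  | oneB (t : Fin ℓ) (h : v t = true) : Arc w v (botL w t) (botR w t)
  | oneT (t : Fin ℓ) (h : v t = true) : Arc w v (topL w t) (topR w t)

/-- The circles of a smoothing. -/
abbrev Circles (w : Fin ℓ → Fin n) (v : Fin ℓ → Bool) : Type := Quot (Arc w v)

/-- Two edges lie on the same circle of the smoothing `v`. -/
def SameCircle (w : Fin ℓ → Fin n) (v : Fin ℓ → Bool) (e f : Edge n ℓ) : Prop :=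
  Relation.EqvGen (Arc w v) e f

variable (w : Fin ℓ → Fin n)

theorem SameCircle.refl (v : Fin ℓ → Bool) (e : Edge n ℓ) : SameCircle w v e e := Relation.EqvGen.refl _

variable {w} in
theorem SameCircle.symm {v : Fin ℓ → Bool} {e f : Edge n ℓ} (h : SameCircle w v e f) :
    SameCircle w v f e := Relation.EqvGen.symm _ _ h

variable {w} in
theorem SameCircle.trans {v : Fin ℓ → Bool} {e f g : Edge n ℓ} (h : SameCircle w v e f)
    (h' : SameCircle w v f g) : SameCircle w v e g := Relation.EqvGen.trans _ _ _ h h'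

variable {w} in
theorem Arc.same {v : Fin ℓ → Bool} {e f : Edge n ℓ} (h : Arc w v e f) : SameCircle w v e f :=
  .rel _ _ h

theorem arc_of_low {v : Fin ℓ → Bool} {t : Fin ℓ} {e f : Edge n ℓ} (h : Arc w (low v t) e f) :
    Arc w v e f ∨ (e = botL w t ∧ f = topL w t) ∨ (e = botR w t ∧ f = topR w t) := by
  cases h with
  | strand t' j hl hr => exact Or.inl (.strand t' j hl hr)
  | zeroL t' h =>
    by_cases ht : t' = t
    · subst ht; simp
    · rw [low_ne v ht] at h; exact Or.inl (.zeroL t' h)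
  | zeroR t' h =>
    by_cases ht : t' = t
    · subst ht; simp
    · rw [low_ne v ht] at h; exact Or.inl (.zeroR t' h)
  | oneB t' h =>
    by_cases ht : t' = t
    · subst ht; simp at h
    · rw [low_ne v ht] at h; exact Or.inl (.oneB t' h)
  | oneT t' h =>
    by_cases ht : t' = t
    · subst ht; simp at h
    · rw [low_ne v ht] at h; exact Or.inl (.oneT t' h)

theorem arc_low {v : Fin ℓ → Bool} {t : Fin ℓ} (hv : v t = true) {e f : Edge n ℓ}
    (h : Arc w v e f) :
    Arc w (low v t) e f ∨ (e = botL w t ∧ f = botR w t) ∨ (e = topL w t ∧ f = topR w t) := by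
  cases h with
  | strand t' j hl hr => exact Or.inl (.strand t' j hl hr)
  | zeroL t' h =>
    by_cases ht : t' = t
    · subst ht; simp [hv] at h
    · exact Or.inl (.zeroL t' (by rwa [low_ne v ht]))
  | zeroR t' h =>
    by_cases ht : t' = t
    · subst ht; simp [hv] at h
    · exact Or.inl (.zeroR t' (by rwa [low_ne v ht]))
  | oneB t' h =>
    by_cases ht : t' = t
    · subst ht; simp
    · exact Or.inl (.oneB t' (by rwa [low_ne v ht]))
  | oneT t' h =>
    by_cases ht : t' = t
    · subst ht; simp
    · exact Or.inl (.oneT t' (by rwa [low_ne v ht]))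

/-- The edge at position `j` that enters crossing `s`, when the edges at even positions are
oriented upwards and those at odd positions downwards. -/
def inc : Edge n ℓ ≃ Edge n ℓ where
  toFun x := (x.1, if Even (x.1 : ℕ) then x.2 else x.2 + 1)
  invFun x := (x.1, if Even (x.1 : ℕ) then x.2 else x.2 - 1)
  left_inv x := by ext1 <;> simp; split_ifs <;> simp
  right_inv x := by ext1 <;> simp; split_ifs <;> simp

/-- The edge at position `j` that leaves crossing `s`. -/
def out : Edge n ℓ ≃ Edge n ℓ where
  toFun x := (x.1, if Even (x.1 : ℕ) then x.2 + 1 else x.2)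
  invFun x := (x.1, if Even (x.1 : ℕ) then x.2 - 1 else x.2)
  left_inv x := by ext1 <;> simp; split_ifs <;> simp
  right_inv x := by ext1 <;> simp; split_ifs <;> simp

/-- How the smoothing connects the entering edges to the leaving ones. -/
def turn (v : Fin ℓ → Bool) : Equiv.Perm (Edge n ℓ) where
  toFun x := (if v x.2 then Equiv.swap (w x.2).castSucc (w x.2).succ x.1 else x.1, x.2)
  invFun x := (if v x.2 then Equiv.swap (w x.2).castSucc (w x.2).succ x.1 else x.1, x.2)
  left_inv x := by ext1 <;> simp; split_ifs <;> simp
  right_inv x := by ext1 <;> simp; split_ifs <;> simp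

/-- The edge that follows a given edge on its circle. -/
def next (v : Fin ℓ → Bool) : Equiv.Perm (Edge n ℓ) := inc.symm.trans ((turn w v).trans out)

theorem next_inc (v : Fin ℓ → Bool) (x : Edge n ℓ) : next w v (inc x) = out (turn w v x) := by
  simp [next]

theorem inc_out (t : Fin ℓ) (j : Fin (n + 1)) :
    (inc (j, t) = (j, t) ∧ out (j, t) = (j, t + 1)) ∨
    (inc (j, t) = (j, t + 1) ∧ out (j, t) = (j, t)) := by
  by_cases h : Even (j : ℕ) <;> simp [inc, out, h]

/-- The two ways in which the four edges at a crossing are entering or leaving. -/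
theorem inc_out_crossing (t : Fin ℓ) :
    (inc ((w t).castSucc, t) = botL w t ∧ out ((w t).castSucc, t) = topL w t ∧
      inc ((w t).succ, t) = topR w t ∧ out ((w t).succ, t) = botR w t) ∨
    (inc ((w t).castSucc, t) = topL w t ∧ out ((w t).castSucc, t) = botL w t ∧
      inc ((w t).succ, t) = botR w t ∧ out ((w t).succ, t) = topR w t) := by
  by_cases h : Even ((w t : ℕ)) <;>
    simp [inc, out, h, botL, botR, topL, topR, Nat.even_add_one]

theorem same_next (v : Fin ℓ → Bool) (e : Edge n ℓ) : SameCircle w v e (next w v e) := by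
  obtain ⟨⟨j, t⟩, rfl⟩ := inc.surjective e
  rw [next_inc]
  have hc := inc_out_crossing w t
  have hio := inc_out t j
  cases hv : v t with
  | false =>
    have ht : turn w v (j, t) = (j, t) := by simp [turn, hv]
    rw [ht]
    have harc : SameCircle w v (j, t) (j, t + 1) := by
      by_cases h1 : j = (w t).castSucc
      · subst h1; exact (Arc.zeroL t hv).same
      by_cases h2 : j = (w t).succ
      · subst h2; exact (Arc.zeroR t hv).same
      exact (Arc.strand t j h1 h2).same
    rcases hio with ⟨h1, h2⟩ | ⟨h1, h2⟩
    · rw [h1, h2]; exact harc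
    · rw [h1, h2]; exact harc.symm
  | true =>
    by_cases h1 : j = (w t).castSucc
    · subst h1
      have ht : turn w v ((w t).castSucc, t) = ((w t).succ, t) := by simp [turn, hv]
      rw [ht]
      rcases hc with ⟨h1, h2, h3, h4⟩ | ⟨h1, h2, h3, h4⟩
      · rw [h1, h4]; exact (Arc.oneB t hv).same
      · rw [h1, h4]; exact (Arc.oneT t hv).same
    by_cases h2 : j = (w t).succ
    · subst h2
      have ht : turn w v ((w t).succ, t) = ((w t).castSucc, t) := by simp [turn, hv]
      rw [ht]
      rcases hc with ⟨h1, h2, h3, h4⟩ | ⟨h1, h2, h3, h4⟩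
      · rw [h3, h2]; exact (Arc.oneT t hv).same.symm
      · rw [h3, h2]; exact (Arc.oneB t hv).same.symm
    have ht : turn w v (j, t) = (j, t) := by
      simp [turn, Equiv.swap_apply_of_ne_of_ne h1 h2]
    rw [ht]
    have harc := (Arc.strand (v := v) t j h1 h2).same
    rcases hio with ⟨h1, h2⟩ | ⟨h1, h2⟩
    · rw [h1, h2]; exact harc
    · rw [h1, h2]; exact harc.symm

theorem sameCycle_inc_out (v : Fin ℓ → Bool) (x y : Edge n ℓ) (h : turn w v x = y) :
    (next w v).SameCycle (inc x) (out y) :=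
  ⟨1, by rw [zpow_one, next_inc, h]⟩

theorem sameCycle_of_arc (v : Fin ℓ → Bool) {e f : Edge n ℓ} (h : Arc w v e f) :
    (next w v).SameCycle e f := by
  cases h with
  | strand t j hl hr =>
    have ht : turn w v (j, t) = (j, t) := by
      simp [turn, Equiv.swap_apply_of_ne_of_ne hl hr]
    have := sameCycle_inc_out w v _ _ ht
    rcases inc_out t j with ⟨h1, h2⟩ | ⟨h1, h2⟩ <;> rw [h1, h2] at this
    · exact this
    · exact this.symm
  | zeroL t h =>
    have := sameCycle_inc_out w v ((w t).castSucc, t) _ rfl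
    have ht : turn w v ((w t).castSucc, t) = ((w t).castSucc, t) := by simp [turn, h]
    rw [ht] at this
    rcases inc_out_crossing w t with ⟨h1, h2, h3, h4⟩ | ⟨h1, h2, h3, h4⟩ <;> rw [h1, h2] at this
    · exact this
    · exact this.symm
  | zeroR t h =>
    have := sameCycle_inc_out w v ((w t).succ, t) _ rfl
    have ht : turn w v ((w t).succ, t) = ((w t).succ, t) := by simp [turn, h]
    rw [ht] at this
    rcases inc_out_crossing w t with ⟨h1, h2, h3, h4⟩ | ⟨h1, h2, h3, h4⟩ <;> rw [h3, h4] at this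
    · exact this.symm
    · exact this
  | oneB t h =>
    have h5 := sameCycle_inc_out w v ((w t).castSucc, t) _ rfl
    have h6 := sameCycle_inc_out w v ((w t).succ, t) _ rfl
    have ht : turn w v ((w t).castSucc, t) = ((w t).succ, t) := by simp [turn, h]
    have ht' : turn w v ((w t).succ, t) = ((w t).castSucc, t) := by simp [turn, h]
    rw [ht] at h5
    rw [ht'] at h6
    rcases inc_out_crossing w t with ⟨h1, h2, h3, h4⟩ | ⟨h1, h2, h3, h4⟩
    · rw [h1, h4] at h5; exact h5
    · rw [h3, h2] at h6; exact h6.symm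
  | oneT t h =>
    have h5 := sameCycle_inc_out w v ((w t).castSucc, t) _ rfl
    have h6 := sameCycle_inc_out w v ((w t).succ, t) _ rfl
    have ht : turn w v ((w t).castSucc, t) = ((w t).succ, t) := by simp [turn, h]
    have ht' : turn w v ((w t).succ, t) = ((w t).castSucc, t) := by simp [turn, h]
    rw [ht] at h5
    rw [ht'] at h6
    rcases inc_out_crossing w t with ⟨h1, h2, h3, h4⟩ | ⟨h1, h2, h3, h4⟩
    · rw [h3, h2] at h6; exact h6.symm
    · rw [h1, h4] at h5; exact h5

theorem sameCircle_iff (v : Fin ℓ → Bool) (e f : Edge n ℓ) :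
    SameCircle w v e f ↔ (next w v).SameCycle e f := by
  constructor
  · intro h
    induction h with
    | rel _ _ h => exact sameCycle_of_arc w v h
    | refl _ => exact .refl _ _
    | symm _ _ _ ih => exact ih.symm
    | trans _ _ _ _ _ ih ih' => exact ih.trans ih'
  · intro h
    obtain ⟨k, rfl⟩ := h.exists_nat_pow_eq
    clear h
    induction k with
    | zero => exact .refl _ _ _
    | succ k ih =>
      rw [pow_succ', Equiv.Perm.mul_apply]
      exact ih.trans (same_next w v _)

theorem next_low {v : Fin ℓ → Bool} {t : Fin ℓ} (hv : v t = true) :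
    next w v = next w (low v t) * Equiv.swap (inc ((w t).castSucc, t)) (inc ((w t).succ, t)) := by
  have hlt : (w t).castSucc ≠ (w t).succ := (Fin.castSucc_lt_succ).ne
  refine Equiv.ext fun e => ?_
  obtain ⟨⟨j, s⟩, rfl⟩ := inc.surjective e
  rw [Equiv.Perm.mul_apply, inc.injective.swap_apply, next_inc, next_inc]
  congr 1
  by_cases hs : s = t
  · subst hs
    by_cases h1 : j = (w s).castSucc
    · subst h1
      rw [Equiv.swap_apply_left]
      simp [turn, hv]
    by_cases h2 : j = (w s).succ
    · subst h2
      rw [Equiv.swap_apply_right]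
      simp [turn, hv]
    rw [Equiv.swap_apply_of_ne_of_ne (by simp [h1]) (by simp [h2])]
    simp [turn, Equiv.swap_apply_of_ne_of_ne h1 h2]
  · rw [Equiv.swap_apply_of_ne_of_ne (by simp [hs]) (by simp [hs])]
    simp [turn, hs]

/-- Changing a `0`-smoothing to a `1`-smoothing either merges two circles or splits one. -/
theorem split_iff {v : Fin ℓ → Bool} {t : Fin ℓ} (hv : v t = true) :
    SameCircle w v (botL w t) (topL w t) ↔ ¬ SameCircle w (low v t) (botL w t) (botR w t) := by
  have hlt : (w t).castSucc ≠ (w t).succ := (Fin.castSucc_lt_succ).ne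
  have key := sameCycle_swap (next w (low v t)) (inc ((w t).castSucc, t)) (inc ((w t).succ, t))
    (fun h => hlt (congrArg Prod.fst (inc.injective h)))
  rw [← next_low w hv, ← sameCircle_iff, ← sameCircle_iff] at key
  have hv' : low v t t = false := by simp
  have a1 := (Arc.oneB (w := w) t hv).same
  have a2 := (Arc.oneT (w := w) t hv).same
  have b1 := (Arc.zeroL (w := w) t hv').same
  have b2 := (Arc.zeroR (w := w) t hv').same
  rcases inc_out_crossing w t with ⟨h1, h2, h3, h4⟩ | ⟨h1, h2, h3, h4⟩ <;> rw [h1, h3] at key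
  · constructor
    · intro h h'
      exact key.1 (h.trans a2) (h'.trans b2)
    · intro h
      exact (key.2 fun h' => h (h'.trans b2.symm)).trans a2.symm
  · constructor
    · intro h h'
      exact key.1 (h.symm.trans a1) (b1.symm.trans h')
    · intro h
      exact a1.trans (key.2 fun h' => h (b1.trans h')).symm

theorem join_of_high {v : Fin ℓ → Bool} {t : Fin ℓ} (hv : v t = true) {e f : Edge n ℓ}
    (h : SameCircle w v e f) : SameCircle w (low v t) e f ∨
      (SameCircle w (low v t) e (botL w t) ∧ SameCircle w (low v t) (botR w t) f) ∨
      (SameCircle w (low v t) e (botR w t) ∧ SameCircle w (low v t) (botL w t) f) := by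
  have hv' : low v t t = false := by simp
  have b1 := (Arc.zeroL (w := w) t hv').same
  have b2 := (Arc.zeroR (w := w) t hv').same
  induction h with
  | rel e f h =>
    rcases arc_low w hv h with h | ⟨rfl, rfl⟩ | ⟨rfl, rfl⟩
    · exact Or.inl h.same
    · exact Or.inr (Or.inl ⟨.refl _ _ _, .refl _ _ _⟩)
    · exact Or.inr (Or.inl ⟨b1.symm, b2⟩)
  | refl _ => exact Or.inl (.refl _ _ _)
  | symm e f _ ih =>
    rcases ih with h | ⟨h, h'⟩ | ⟨h, h'⟩
    · exact Or.inl h.symm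
    · exact Or.inr (Or.inr ⟨h'.symm, h.symm⟩)
    · exact Or.inr (Or.inl ⟨h'.symm, h.symm⟩)
  | trans e f g _ _ ih ih' =>
    rcases ih with h | ⟨h, h'⟩ | ⟨h, h'⟩ <;> rcases ih' with k | ⟨k, k'⟩ | ⟨k, k'⟩
    · exact Or.inl (h.trans k)
    · exact Or.inr (Or.inl ⟨h.trans k, k'⟩)
    · exact Or.inr (Or.inr ⟨h.trans k, k'⟩)
    · exact Or.inr (Or.inl ⟨h, h'.trans k⟩)
    · exact Or.inr (Or.inl ⟨h, k'⟩)
    · exact Or.inl (h.trans k')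
    · exact Or.inr (Or.inr ⟨h, h'.trans k⟩)
    · exact Or.inl (h.trans k')
    · exact Or.inr (Or.inr ⟨h, k'⟩)

theorem join_of_low {v : Fin ℓ → Bool} {t : Fin ℓ} (hv : v t = true) {e f : Edge n ℓ}
    (h : SameCircle w (low v t) e f) : SameCircle w v e f ∨
      (SameCircle w v e (botL w t) ∧ SameCircle w v (topL w t) f) ∨
      (SameCircle w v e (topL w t) ∧ SameCircle w v (botL w t) f) := by
  have a1 := (Arc.oneB (w := w) t hv).same
  have a2 := (Arc.oneT (w := w) t hv).same
  induction h with
  | rel e f h =>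
    rcases arc_of_low w h with h | ⟨rfl, rfl⟩ | ⟨rfl, rfl⟩
    · exact Or.inl h.same
    · exact Or.inr (Or.inl ⟨.refl _ _ _, .refl _ _ _⟩)
    · exact Or.inr (Or.inl ⟨a1.symm, a2⟩)
  | refl _ => exact Or.inl (.refl _ _ _)
  | symm e f _ ih =>
    rcases ih with h | ⟨h, h'⟩ | ⟨h, h'⟩
    · exact Or.inl h.symm
    · exact Or.inr (Or.inr ⟨h'.symm, h.symm⟩)
    · exact Or.inr (Or.inl ⟨h'.symm, h.symm⟩)
  | trans e f g _ _ ih ih' =>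
    rcases ih with h | ⟨h, h'⟩ | ⟨h, h'⟩ <;> rcases ih' with k | ⟨k, k'⟩ | ⟨k, k'⟩
    · exact Or.inl (h.trans k)
    · exact Or.inr (Or.inl ⟨h.trans k, k'⟩)
    · exact Or.inr (Or.inr ⟨h.trans k, k'⟩)
    · exact Or.inr (Or.inl ⟨h, h'.trans k⟩)
    · exact Or.inr (Or.inl ⟨h, k'⟩)
    · exact Or.inl (h.trans k')
    · exact Or.inr (Or.inr ⟨h, h'.trans k⟩)
    · exact Or.inl (h.trans k')
    · exact Or.inr (Or.inr ⟨h, k'⟩)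

theorem low_le_of_merge {v : Fin ℓ → Bool} {t : Fin ℓ} (hv : v t = true)
    (hm : ¬ SameCircle w (low v t) (botL w t) (botR w t)) {e f : Edge n ℓ}
    (h : SameCircle w (low v t) e f) : SameCircle w v e f := by
  have h1 := (split_iff w hv).2 hm
  rcases join_of_low w hv h with h | ⟨h, h'⟩ | ⟨h, h'⟩
  · exact h
  · exact h.trans (h1.trans h')
  · exact h.trans (h1.symm.trans h')

theorem le_low_of_split {v : Fin ℓ → Bool} {t : Fin ℓ} (hv : v t = true)
    (hs : SameCircle w (low v t) (botL w t) (botR w t)) {e f : Edge n ℓ}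
    (h : SameCircle w v e f) : SameCircle w (low v t) e f := by
  rcases join_of_high w hv h with h | ⟨h, h'⟩ | ⟨h, h'⟩
  · exact h
  · exact h.trans (hs.trans h')
  · exact h.trans (hs.symm.trans h')

theorem card_circles_merge {v : Fin ℓ → Bool} {t : Fin ℓ} (hv : v t = true)
    (hm : ¬ SameCircle w (low v t) (botL w t) (botR w t)) :
    Nat.card (Circles w v) + 1 = Nat.card (Circles w (low v t)) := by
  have a1 := (Arc.oneB (w := w) t hv).same
  refine card_quot_join _ _ _ _ hm fun e f => ⟨join_of_high w hv, ?_⟩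
  rintro (h | ⟨h, h'⟩ | ⟨h, h'⟩)
  · exact low_le_of_merge w hv hm h
  · exact (low_le_of_merge w hv hm h).trans (a1.trans (low_le_of_merge w hv hm h'))
  · exact (low_le_of_merge w hv hm h).trans (a1.symm.trans (low_le_of_merge w hv hm h'))

theorem card_circles_split {v : Fin ℓ → Bool} {t : Fin ℓ} (hv : v t = true)
    (hs : SameCircle w (low v t) (botL w t) (botR w t)) :
    Nat.card (Circles w (low v t)) + 1 = Nat.card (Circles w v) := by
  have hv' : low v t t = false := by simp
  have b1 := (Arc.zeroL (w := w) t hv').same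
  refine card_quot_join _ _ (botL w t) (topL w t) (fun h => (split_iff w hv).1 h hs)
    fun e f => ⟨join_of_low w hv, ?_⟩
  rintro (h | ⟨h, h'⟩ | ⟨h, h'⟩)
  · exact le_low_of_split w hv hs h
  · exact (le_low_of_split w hv hs h).trans (b1.trans (le_low_of_split w hv hs h'))
  · exact (le_low_of_split w hv hs h).trans (b1.symm.trans (le_low_of_split w hv hs h'))

end Braid
section State

variable {n ℓ : ℕ} [NeZero ℓ] (w : Fin ℓ → Fin n) (S : Type) [CommRing S]

/-- The relations `X_e ^ 2 = 0`, and `X_e = X_f` for edges joined by an arc of the smoothing. -/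
def stateIdeal (v : Fin ℓ → Bool) : Ideal (MvPolynomial (Edge n ℓ) S) :=
  Ideal.span ({p | ∃ e, p = MvPolynomial.X e ^ 2} ∪
    {p | ∃ e f, Arc w v e f ∧ p = MvPolynomial.X e - MvPolynomial.X f})

/-- The module `R ⊗ ⋯ ⊗ R` of the smoothing `v`, with one factor `R = S[X] / (X ^ 2)` for each
circle. It is written as the algebra with one generator `X_e` for each edge, where `X_e` stands
for `X` in the factor of the circle that contains `e`. -/
abbrev StateAlg (v : Fin ℓ → Bool) : Type := MvPolynomial (Edge n ℓ) S ⧸ stateIdeal w S v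

variable {S} in
/-- The class of a polynomial. -/
abbrev cls (v : Fin ℓ → Bool) : MvPolynomial (Edge n ℓ) S →+* StateAlg w S v :=
  Ideal.Quotient.mk (stateIdeal w S v)

open Classical in
/-- The image of `1` under the map that belongs to the change of the crossing `t` from its
`0`-smoothing to its `1`-smoothing, the resulting smoothing being `v`: this is `1` if two circles
merge, and `X ⊗ 1 + 1 ⊗ X` on the two new circles if one circle splits. -/
def mult (v : Fin ℓ → Bool) (t : Fin ℓ) : MvPolynomial (Edge n ℓ) S :=
  if SameCircle w (low v t) (botL w t) (botR w t) then
    MvPolynomial.X (botL w t) + MvPolynomial.X (topL w t)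
  else 1

theorem X_sq_mem (v : Fin ℓ → Bool) (e : Edge n ℓ) :
    (MvPolynomial.X e ^ 2 : MvPolynomial (Edge n ℓ) S) ∈ stateIdeal w S v :=
  Ideal.subset_span (Or.inl ⟨e, rfl⟩)

variable {w} in
theorem SameCircle.sub_mem {v : Fin ℓ → Bool} {e f : Edge n ℓ} (h : SameCircle w v e f) :
    (MvPolynomial.X e - MvPolynomial.X f : MvPolynomial (Edge n ℓ) S) ∈ stateIdeal w S v := by
  induction h with
  | rel e f h => exact Ideal.subset_span (Or.inr ⟨e, f, h, rfl⟩)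
  | refl _ => rw [sub_self]; exact zero_mem _
  | symm e f _ ih => rw [← neg_sub]; exact neg_mem ih
  | trans e f g _ _ ih ih' =>
    have := add_mem ih ih'
    rwa [sub_add_sub_cancel] at this

theorem mult_wd {v : Fin ℓ → Bool} {t : Fin ℓ} (hv : v t = true) :
    stateIdeal w S (low v t) ≤
      Submodule.comap (LinearMap.mulLeft (MvPolynomial (Edge n ℓ) S) (mult w S v t))
        (stateIdeal w S v) := by
  have a1 := ((Arc.oneB (w := w) t hv).same).sub_mem S
  have a2 := ((Arc.oneT (w := w) t hv).same).sub_mem S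
  have key : mult w S v t * (MvPolynomial.X (botL w t) - MvPolynomial.X (topL w t)) ∈
      stateIdeal w S v := by
    by_cases hs : SameCircle w (low v t) (botL w t) (botR w t)
    · rw [mult, if_pos hs]
      have := sub_mem (X_sq_mem w S v (botL w t)) (X_sq_mem w S v (topL w t))
      convert this using 1
      ring
    · exact Ideal.mul_mem_left _ _ (((split_iff w hv).2 hs).sub_mem S)
  refine Ideal.span_le.2 ?_
  rintro _ (⟨e, rfl⟩ | ⟨e, f, h, rfl⟩)
  · change mult w S v t * _ ∈ stateIdeal w S v
    exact Ideal.mul_mem_left _ _ (X_sq_mem w S v e)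
  · change mult w S v t * _ ∈ stateIdeal w S v
    rcases arc_of_low w h with h | ⟨rfl, rfl⟩ | ⟨rfl, rfl⟩
    · exact Ideal.mul_mem_left _ _ (h.same.sub_mem S)
    · exact key
    · have := add_mem (sub_mem key (Ideal.mul_mem_left _ (mult w S v t) a1))
        (Ideal.mul_mem_left _ (mult w S v t) a2)
      convert this using 1
      ring

/-- The merge map (multiplication) or split map (`Δ(1) = X ⊗ 1 + 1 ⊗ X`, `Δ(X) = X ⊗ X`) of
an edge of the cube of smoothings. -/
def edgeMap (v : Fin ℓ → Bool) (t : Fin ℓ) (hv : v t = true) :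
    StateAlg w S (low v t) →ₗ[MvPolynomial (Edge n ℓ) S] StateAlg w S v :=
  Submodule.mapQ (stateIdeal w S (low v t)) (stateIdeal w S v)
    (LinearMap.mulLeft (MvPolynomial (Edge n ℓ) S) (mult w S v t)) (mult_wd w S hv)

theorem edgeMap_cls (v : Fin ℓ → Bool) (t : Fin ℓ) (hv : v t = true)
    (p : MvPolynomial (Edge n ℓ) S) :
    edgeMap w S v t hv (cls w (low v t) p) = cls w v (mult w S v t * p) := rfl

/-- The pairs of edges above and below the crossings `s` and `t` on the left lie on the same
circles. -/
def SamePair (v : Fin ℓ → Bool) (s t : Fin ℓ) : Prop :=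
  (SameCircle w v (botL w s) (botL w t) ∧ SameCircle w v (topL w s) (topL w t)) ∨
    (SameCircle w v (botL w s) (topL w t) ∧ SameCircle w v (topL w s) (botL w t))

theorem face_merge {v : Fin ℓ → Bool} {s t : Fin ℓ} (hst : s ≠ t) (hs : v s = true)
    (ht : v t = true) (h1 : ¬ SameCircle w (low (low v t) s) (botL w s) (botR w s))
    (h2 : SameCircle w (low v s) (botL w s) (botR w s)) :
    ¬ SameCircle w (low (low v s) t) (botL w t) (botR w t) ∧
      SameCircle w (low v t) (botL w t) (botR w t) ∧ SamePair w v s t := by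
  have hcomm : low (low v t) s = low (low v s) t := Function.update_comm hst.symm _ _ _
  have hs' : low v t s = true := by rwa [low_ne v hst]
  have ht' : low v s t = true := by rwa [low_ne v hst.symm]
  have c1 : ¬ SameCircle w (low (low v s) t) (botL w t) (botR w t) := by
    intro h
    rw [hcomm] at h1
    exact h1 (le_low_of_split w ht' h h2)
  have a1 := (Arc.oneB (w := w) s hs').same
  have c2 : SameCircle w (low v t) (botL w t) (botR w t) := by
    have hle : ∀ {e f}, SameCircle w (low (low v s) t) e f → SameCircle w (low v t) e f := by
      intro e f h
      rw [← hcomm] at h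
      exact low_le_of_merge w hs' h1 h
    rcases join_of_high w ht' h2 with h | ⟨h, h'⟩ | ⟨h, h'⟩
    · rw [hcomm] at h1
      exact absurd h h1
    · exact (hle h).symm.trans (a1.trans (hle h').symm)
    · exact (hle h').trans (a1.symm.trans (hle h))
  refine ⟨c1, c2, ?_⟩
  rcases join_of_low w hs ((split_iff w ht').2 c1) with h | ⟨h, h'⟩ | ⟨h, h'⟩
  · exact absurd c2 ((split_iff w ht).1 h)
  · exact Or.inl ⟨h.symm, h'⟩
  · exact Or.inr ⟨h', h.symm⟩

theorem face_split {v : Fin ℓ → Bool} {s t : Fin ℓ} (hst : s ≠ t) (hs : v s = true)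
    (ht : v t = true) (h1 : SameCircle w (low (low v t) s) (botL w s) (botR w s))
    (h2 : ¬ SameCircle w (low v s) (botL w s) (botR w s)) :
    SameCircle w (low (low v s) t) (botL w t) (botR w t) ∧
      ¬ SameCircle w (low v t) (botL w t) (botR w t) ∧ SamePair w v s t := by
  have hcomm : low (low v t) s = low (low v s) t := Function.update_comm hst.symm _ _ _
  have ht' : low v s t = true := by rwa [low_ne v hst.symm]
  rw [hcomm] at h1
  have c1 : SameCircle w (low (low v s) t) (botL w t) (botR w t) := by
    by_contra h
    exact h2 (low_le_of_merge w ht' h h1)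
  have a1 := (Arc.oneB (w := w) s hs).same
  have a2 := (split_iff w hs).2 h2
  have c2 : SameCircle w v (botL w t) (topL w t) ∧ SamePair w v s t := by
    rcases join_of_low w ht' h1 with h | ⟨h, h'⟩ | ⟨h, h'⟩
    · exact absurd h h2
    · have k := low_le_of_merge w hs h2 h
      have k' := low_le_of_merge w hs h2 h'
      have e := k.symm.trans (a1.trans k'.symm)
      exact ⟨e, Or.inl ⟨k, a2.symm.trans (k.trans e)⟩⟩
    · have k := low_le_of_merge w hs h2 h
      have k' := low_le_of_merge w hs h2 h'
      have e := k'.trans (a1.symm.trans k)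
      exact ⟨e, Or.inr ⟨k, a2.symm.trans (k.trans e.symm)⟩⟩
  exact ⟨c1, (split_iff w ht).1 c2.1, c2.2⟩

/-- The faces of the cube commute. -/
theorem mult_comm_mem {v : Fin ℓ → Bool} {s t : Fin ℓ} (hst : s ≠ t) (hs : v s = true)
    (ht : v t = true) :
    mult w S v t * mult w S (low v t) s - mult w S v s * mult w S (low v s) t ∈
      stateIdeal w S v := by
  have sums : SamePair w v s t →
      (MvPolynomial.X (botL w t) + MvPolynomial.X (topL w t) -
        (MvPolynomial.X (botL w s) + MvPolynomial.X (topL w s)) : MvPolynomial (Edge n ℓ) S) ∈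
        stateIdeal w S v := by
    rintro (⟨h1, h2⟩ | ⟨h1, h2⟩)
    all_goals
      have := add_mem (h1.symm.sub_mem S) (h2.symm.sub_mem S)
      convert this using 1
      ring
  have F1 := face_merge w hst hs ht
  have F2 := face_split w hst hs ht
  have F3 := face_merge w hst.symm ht hs
  have F4 := face_split w hst.symm ht hs
  unfold mult
  by_cases p : SameCircle w (low (low v t) s) (botL w s) (botR w s) <;>
  by_cases q : SameCircle w (low v s) (botL w s) (botR w s) <;>
  by_cases p' : SameCircle w (low (low v s) t) (botL w t) (botR w t) <;>
  by_cases q' : SameCircle w (low v t) (botL w t) (botR w t) <;>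
  simp only [p, q, p', q', if_true, if_false, mul_one, one_mul] <;>
  first
  | (rw [mul_comm, sub_self]; exact zero_mem _)
  | (rw [sub_self]; exact zero_mem _)
  | exact sums (F1 p q).2.2
  | (rw [← neg_sub]; exact neg_mem (sums (F2 p q).2.2))
  | exact absurd p' (F1 p q).1
  | exact absurd q' (F2 p q).2.1
  | exact absurd (F1 p q).2.1 q'
  | exact absurd (F2 p q).1 p'
  | exact absurd p (F3 p' q').1
  | exact absurd q (F4 p' q').2.1
  | exact absurd (F3 p' q').2.1 q
  | exact absurd (F4 p' q').1 p

end State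
section Complex

variable {n ℓ : ℕ} [NeZero ℓ] (w : Fin ℓ → Fin n) (S : Type) [CommRing S]

/-- The number of `1`-smoothings of a vertex of the cube. -/
def height {ℓ : ℕ} (v : Fin ℓ → Bool) : ℕ := (Finset.univ.filter fun t => v t = true).card

/-- The sign of the edge of the cube that ends in `v` and changes the crossing `t`. -/
def sgn {ℓ : ℕ} (v : Fin ℓ → Bool) (t : Fin ℓ) : ℤ :=
  (-1) ^ (Finset.univ.filter fun s => s < t ∧ v s = true).card

/-- The vertices of the cube in homological degree `k`. All crossings are positive. -/
abbrev Vertex (ℓ : ℕ) (k : ℤ) : Type := {v : Fin ℓ → Bool // (height v : ℤ) = k}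

/-- The cochain module in homological degree `k`, a (finite) direct sum over the vertices. -/
abbrev Chain (k : ℤ) : Type := (v : Vertex ℓ k) → StateAlg w S v.1

theorem height_low {ℓ : ℕ} {v : Fin ℓ → Bool} {t : Fin ℓ} (h : v t = true) :
    height (low v t) + 1 = height v := by
  have : (Finset.univ.filter fun s => low v t s = true) =
      (Finset.univ.filter fun s => v s = true).erase t := by
    ext s
    by_cases hs : s = t
    · subst hs; simp
    · simp [hs]
  rw [height, height, this, Finset.card_erase_add_one (by simp [h])]

/-- The start of the edge of the cube that ends in `v` and changes the crossing `t`. -/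
abbrev lowVertex {ℓ : ℕ} {k : ℤ} (v : Vertex ℓ (k + 1)) (t : Fin ℓ) (h : v.1 t = true) :
    Vertex ℓ k :=
  ⟨low v.1 t, by
    have h1 := v.2
    have h2 := height_low h
    omega⟩

/-- The coboundary of the cube of smoothings. -/
def dAdd (k : ℤ) : Chain w S k →+ Chain w S (k + 1) where
  toFun f v := ∑ t, if h : v.1 t = true then sgn v.1 t • edgeMap w S v.1 t h (f (lowVertex v t h))
    else 0
  map_zero' := by
    refine funext fun v => Finset.sum_eq_zero fun t _ => ?_
    split_ifs with h
    · exact (congrArg _ (map_zero (edgeMap w S v.1 t h))).trans (smul_zero _)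
    · rfl
  map_add' f g := by
    refine funext fun v => Eq.trans (Finset.sum_congr rfl fun t _ => ?_) Finset.sum_add_distrib
    split_ifs with h
    · exact (congrArg _ (map_add (edgeMap w S v.1 t h) _ _)).trans (smul_add _ _ _)
    · exact (add_zero 0).symm

/-- The coboundary in terms of representing polynomials. -/
def dPoly (p : (Fin ℓ → Bool) → MvPolynomial (Edge n ℓ) S) (v : Fin ℓ → Bool) :
    MvPolynomial (Edge n ℓ) S :=
  ∑ t, if v t = true then sgn v t • (mult w S v t * p (low v t)) else 0

variable {S} in
theorem dAdd_cls {k : ℤ} {f : Chain w S k} {p : (Fin ℓ → Bool) → MvPolynomial (Edge n ℓ) S}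
    (h : ∀ v, f v = cls w v.1 (p v.1)) (v : Vertex ℓ (k + 1)) :
    dAdd w S k f v = cls w v.1 (dPoly w S p v.1) := by
  change (∑ t, if h : v.1 t = true then
    sgn v.1 t • edgeMap w S v.1 t h (f (lowVertex v t h)) else 0) = _
  rw [dPoly, map_sum]
  refine Finset.sum_congr rfl fun t _ => ?_
  split_ifs with ht
  · rw [map_zsmul, ← edgeMap_cls w S v.1 t ht]
    exact congrArg (fun y => sgn v.1 t • edgeMap w S v.1 t ht y) (h (lowVertex v t ht))
  · rw [map_zero]

variable {S} in
theorem exists_rep {k : ℤ} (f : Chain w S k) (P : (Fin ℓ → Bool) → MvPolynomial (Edge n ℓ) S → Prop)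
    (hP : ∀ v, ∃ p, P v.1 p ∧ f v = cls w v.1 p) :
    ∃ p : (Fin ℓ → Bool) → MvPolynomial (Edge n ℓ) S,
      ∀ v : Vertex ℓ k, P v.1 (p v.1) ∧ f v = cls w v.1 (p v.1) := by
  classical
  choose g hg using hP
  refine ⟨fun v => if h : (height v : ℤ) = k then g ⟨v, h⟩ else 0, fun v => ?_⟩
  simp only [v.2, dif_pos]
  exact hg v

variable {S} in
theorem exists_rep' {k : ℤ} (f : Chain w S k) :
    ∃ p : (Fin ℓ → Bool) → MvPolynomial (Edge n ℓ) S, ∀ v : Vertex ℓ k, f v = cls w v.1 (p v.1) := by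
  obtain ⟨p, hp⟩ := exists_rep w f (fun _ _ => True) fun v => by
    obtain ⟨p, hp⟩ := Ideal.Quotient.mk_surjective (f v)
    exact ⟨p, trivial, hp.symm⟩
  exact ⟨p, fun v => (hp v).2⟩

theorem sgn_low_of_le {ℓ : ℕ} (v : Fin ℓ → Bool) {s t : Fin ℓ} (h : s ≤ t) :
    sgn (low v t) s = sgn v s := by
  unfold sgn
  congr 2
  ext r
  by_cases hr : r = t
  · subst hr
    simp [h]
  · simp [hr]

theorem sgn_low_of_lt {ℓ : ℕ} (v : Fin ℓ → Bool) {s t : Fin ℓ} (h : s < t) (hv : v s = true) :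
    sgn (low v s) t = -sgn v t := by
  have : (Finset.univ.filter fun r => r < t ∧ low v s r = true) =
      (Finset.univ.filter fun r => r < t ∧ v r = true).erase s := by
    ext r
    by_cases hr : r = s
    · subst hr; simp
    · simp [hr]
  rw [sgn, sgn, this, ← Finset.card_erase_add_one
    (s := Finset.univ.filter fun r => r < t ∧ v r = true) (a := s) (by simp [h, hv]), pow_succ]
  simp

theorem sgn_comm {ℓ : ℕ} (v : Fin ℓ → Bool) {s t : Fin ℓ} (hst : s ≠ t) (hs : v s = true)
    (ht : v t = true) : sgn v t * sgn (low v t) s = -(sgn v s * sgn (low v s) t) := by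
  rcases lt_or_gt_of_ne hst with h | h
  · rw [sgn_low_of_le v h.le, sgn_low_of_lt v h hs]
    ring
  · rw [sgn_low_of_le v h.le, sgn_low_of_lt v h ht]
    ring

theorem dPoly_dPoly (p : (Fin ℓ → Bool) → MvPolynomial (Edge n ℓ) S) (v : Fin ℓ → Bool) :
    cls w v (dPoly w S (dPoly w S p) v) = 0 := by
  let F : Fin ℓ × Fin ℓ → MvPolynomial (Edge n ℓ) S := fun x =>
    if v x.1 = true ∧ low v x.1 x.2 = true then
      (sgn v x.1 * sgn (low v x.1) x.2) •
        (mult w S v x.1 * mult w S (low v x.1) x.2 * p (low (low v x.1) x.2)) else 0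
  have hF : dPoly w S (dPoly w S p) v = ∑ x, F x := by
    rw [Fintype.sum_prod_type, dPoly]
    refine Finset.sum_congr rfl fun t _ => ?_
    by_cases ht : v t = true
    · rw [if_pos ht, dPoly, Finset.mul_sum, Finset.smul_sum]
      refine Finset.sum_congr rfl fun s _ => ?_
      by_cases hs : low v t s = true
      · rw [if_pos hs]
        simp only [F]
        rw [if_pos ⟨ht, hs⟩, mul_smul_comm, smul_smul, mul_assoc]
      · rw [if_neg hs]
        simp only [F]
        rw [if_neg (fun h => hs h.2), mul_zero, smul_zero]
    · rw [if_neg ht]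
      symm
      refine Finset.sum_eq_zero fun s _ => ?_
      simp only [F]
      rw [if_neg (fun h => ht h.1)]
  rw [hF, map_sum]
  refine Finset.sum_involution (fun x _ => (x.2, x.1)) ?_ ?_ (fun _ _ => Finset.mem_univ _)
    (fun _ _ => rfl)
  · rintro ⟨t, s⟩ -
    rw [← map_add, Ideal.Quotient.eq_zero_iff_mem]
    simp only [F]
    by_cases hst : s = t
    · subst hst
      simp
    · rw [low_ne v hst, low_ne v (Ne.symm hst)]
      by_cases h : v t = true ∧ v s = true
      · rw [if_pos h, if_pos h.symm, sgn_comm v hst h.2 h.1,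
          show low (low v t) s = low (low v s) t from Function.update_comm (Ne.symm hst) _ _ _,
          neg_smul, neg_add_eq_sub, ← smul_sub, ← sub_mul]
        refine zsmul_mem (Ideal.mul_mem_right _ _ ?_) _
        exact mult_comm_mem w S (Ne.symm hst) h.1 h.2
      · rw [if_neg h, if_neg (fun h' => h h'.symm), add_zero]
        exact zero_mem _
  · rintro ⟨t, s⟩ - hne heq
    have : s = t := congrArg Prod.fst heq
    subst this
    apply hne
    simp [F]

theorem dAdd_dAdd (k : ℤ) (f : Chain w S k) : dAdd w S (k + 1) (dAdd w S k f) = 0 := by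
  obtain ⟨p, hp⟩ := exists_rep' w f
  ext v
  rw [dAdd_cls w (dAdd_cls w hp) v]
  exact dPoly_dPoly w S p v.1

theorem X_sq_eq_zero (k : ℤ) (e : Edge n ℓ) :
    (fun v => cls w v.1 (MvPolynomial.X e) : Chain w S k) ^ 2 = 0 := by
  ext v
  change cls w v.1 (MvPolynomial.X e) ^ 2 = 0
  rw [← map_pow, Ideal.Quotient.eq_zero_iff_mem]
  exact X_sq_mem w S v.1 e

/-- The action of `R` that belongs to a basepoint on the edge `e`: `X` acts as `X_e`. -/
def pointAct (k : ℤ) (e : Edge n ℓ) : R S →ₐ[S] Chain w S k :=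
  AdjoinRoot.liftAlgHom _ (Algebra.ofId S (Chain w S k))
    (fun v => cls w v.1 (MvPolynomial.X e)) (by
      rw [Polynomial.eval₂_X_pow]
      exact X_sq_eq_zero w S k e)

/-- The action of `R ⊗ R` that belongs to basepoints on the edges `e` (acting from the left) and
`f` (acting from the right). -/
def bimodAct (e f : Edge n ℓ) (k : ℤ) : RR S →ₐ[S] Chain w S k :=
  Algebra.TensorProduct.productMap (pointAct w S k e) (pointAct w S k f)

theorem bimodAct_XL (e f : Edge n ℓ) (k : ℤ) (v : Vertex ℓ k) :
    bimodAct w S e f k (XL S) v = cls w v.1 (MvPolynomial.X e) := by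
  rw [bimodAct, XL, Algebra.TensorProduct.productMap_apply_tmul, map_one, mul_one, pointAct]
  simp

theorem bimodAct_XR (e f : Edge n ℓ) (k : ℤ) (v : Vertex ℓ k) :
    bimodAct w S e f k (XR S) v = cls w v.1 (MvPolynomial.X f) := by
  rw [bimodAct, XR, Algebra.TensorProduct.productMap_apply_tmul, map_one, one_mul, pointAct]
  simp

theorem pointAct_rep (e : Edge n ℓ) (a : R S) : ∃ b : MvPolynomial (Edge n ℓ) S,
    ∀ k (v : Vertex ℓ k), pointAct w S k e a v = cls w v.1 b := by
  obtain ⟨g, rfl⟩ := AdjoinRoot.mk_surjective a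
  induction g using Polynomial.induction_on' with
  | add g h hg hh =>
    obtain ⟨b, hb⟩ := hg
    obtain ⟨c, hc⟩ := hh
    exact ⟨b + c, fun k v => by rw [map_add, map_add, Pi.add_apply, hb, hc, map_add]⟩
  | monomial m s =>
    refine ⟨MvPolynomial.C s * MvPolynomial.X e ^ m, fun k v => ?_⟩
    rw [← Polynomial.C_mul_X_pow_eq_monomial, map_mul, map_pow, AdjoinRoot.mk_X, AdjoinRoot.mk_C,
      map_mul, map_pow, map_mul, map_pow]
    rw [Pi.mul_apply, Pi.pow_apply]
    congr 1
    · rw [← AdjoinRoot.algebraMap_eq, AlgHom.commutes]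
      rfl
    · rw [pointAct]
      simp

theorem bimodAct_rep (e f : Edge n ℓ) (a : RR S) : ∃ b : MvPolynomial (Edge n ℓ) S,
    ∀ k (v : Vertex ℓ k), bimodAct w S e f k a v = cls w v.1 b := by
  induction a using TensorProduct.induction_on with
  | zero => exact ⟨0, fun k v => by rw [map_zero, map_zero, Pi.zero_apply]⟩
  | add x y hx hy =>
    obtain ⟨b, hb⟩ := hx
    obtain ⟨c, hc⟩ := hy
    exact ⟨b + c, fun k v => by rw [map_add, Pi.add_apply, hb, hc, map_add]⟩
  | tmul x y =>
    obtain ⟨b, hb⟩ := pointAct_rep w S e x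
    obtain ⟨c, hc⟩ := pointAct_rep w S f y
    exact ⟨b * c, fun k v => by
      rw [bimodAct, Algebra.TensorProduct.productMap_apply_tmul, Pi.mul_apply, hb, hc, map_mul]⟩

theorem dAdd_act (e f : Edge n ℓ) (k : ℤ) (a : RR S) (x : Chain w S k) :
    dAdd w S k (bimodAct w S e f k a * x) = bimodAct w S e f (k + 1) a * dAdd w S k x := by
  obtain ⟨p, hp⟩ := exists_rep' w x
  obtain ⟨b, hb⟩ := bimodAct_rep w S e f a
  have h1 : ∀ v, (bimodAct w S e f k a * x) v = cls w v.1 (b * p v.1) := fun v => by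
    rw [Pi.mul_apply, hb, hp, map_mul]
  ext v
  rw [dAdd_cls w (p := fun v => b * p v) h1 v, Pi.mul_apply, hb, dAdd_cls w hp v, ← map_mul]
  congr 1
  rw [dPoly, dPoly, Finset.mul_sum]
  refine Finset.sum_congr rfl fun t _ => ?_
  split_ifs
  · rw [mul_smul_comm]
    congr 1
    ring
  · rw [mul_zero]

/-- The degree of `1 ⊗ ⋯ ⊗ 1` at the vertex `v`: the number of circles, plus the number of
`1`-smoothings, plus the number of (positive) crossings. -/
def oneDegree (v : Fin ℓ → Bool) : ℤ := Nat.card (Circles w v) + height v + ℓ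

/-- The part of quantum degree `q` at the vertex `v`; each factor `X` lowers the degree by `2`. -/
def stateGr (v : Fin ℓ → Bool) (q : ℤ) : AddSubgroup (StateAlg w S v) :=
  (MvPolynomial.weightedHomogeneousSubmodule S (fun _ : Edge n ℓ => (-2 : ℤ))
    (q - oneDegree w v)).toAddSubgroup.map (Ideal.Quotient.mk (stateIdeal w S v)).toAddMonoidHom

/-- The part of quantum degree `q`. -/
def chainGr (k q : ℤ) : AddSubgroup (Chain w S k) :=
  AddSubgroup.pi Set.univ fun v => stateGr w S v.1 q

variable {S} in
theorem mem_stateGr {v : Fin ℓ → Bool} {q : ℤ} {x : StateAlg w S v} :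
    x ∈ stateGr w S v q ↔ ∃ p, MvPolynomial.IsWeightedHomogeneous (fun _ : Edge n ℓ => (-2 : ℤ)) p
      (q - oneDegree w v) ∧ x = cls w v p := by
  constructor
  · rintro ⟨p, hp, rfl⟩
    exact ⟨p, hp, rfl⟩
  · rintro ⟨p, hp, rfl⟩
    exact ⟨p, hp, rfl⟩

variable {S} in
theorem mem_chainGr {k q : ℤ} {x : Chain w S k} :
    x ∈ chainGr w S k q ↔ ∀ v, x v ∈ stateGr w S v.1 q := by
  simp [chainGr, AddSubgroup.mem_pi]

theorem stateIdeal_isHomogeneous (v : Fin ℓ → Bool) (m : ℤ) {p : MvPolynomial (Edge n ℓ) S}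
    (hp : p ∈ stateIdeal w S v) :
    MvPolynomial.weightedHomogeneousComponent (fun _ : Edge n ℓ => (-2 : ℤ)) m p ∈
      stateIdeal w S v := by
  let _ := MvPolynomial.weightedGradedAlgebra S (fun _ : Edge n ℓ => (-2 : ℤ))
  refine MvPolynomial.weightedHomogeneousComponent_mem_of_mem _ _ ?_ hp m
  refine Ideal.homogeneous_span _ _ ?_
  rintro _ (⟨e, rfl⟩ | ⟨e, f, -, rfl⟩)
  · exact ⟨_, (MvPolynomial.isWeightedHomogeneous_X S _ e).pow 2⟩
  · exact ⟨_, (MvPolynomial.isWeightedHomogeneous_X S _ e).sub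
      (MvPolynomial.isWeightedHomogeneous_X S _ f)⟩

theorem stateGr_isInternal (v : Fin ℓ → Bool) : DirectSum.IsInternal (stateGr w S v) := by
  classical
  let c : ℤ → MvPolynomial (Edge n ℓ) S →ₗ[S] MvPolynomial (Edge n ℓ) S := fun q =>
    MvPolynomial.weightedHomogeneousComponent (fun _ : Edge n ℓ => (-2 : ℤ)) (q - oneDegree w v)
  let π : ℤ → StateAlg w S v →+ StateAlg w S v := fun q =>
    QuotientAddGroup.map (stateIdeal w S v).toAddSubgroup (stateIdeal w S v).toAddSubgroup
      (c q).toAddMonoidHom (fun p hp => stateIdeal_isHomogeneous w S v _ hp)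
  have hπ : ∀ q p, π q (cls w v p) = cls w v (c q p) := fun q p => rfl
  refine (isInternal_iff_proj _).2 ⟨π, ?_, ?_, ?_⟩
  · intro q m hm
    obtain ⟨p, hp, rfl⟩ := (mem_stateGr w).1 hm
    rw [hπ]
    congr 1
    exact hp.weightedHomogeneousComponent_same
  · intro q q' hq m hm
    obtain ⟨p, hp, rfl⟩ := (mem_stateGr w).1 hm
    rw [hπ]
    have : c q p = 0 := hp.weightedHomogeneousComponent_ne _ (by
      intro h
      apply hq
      linarith)
    rw [this, map_zero]
  · rw [eq_top_iff]
    intro x _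
    obtain ⟨p, rfl⟩ := Ideal.Quotient.mk_surjective x
    rw [← MvPolynomial.sum_weightedHomogeneousComponent (fun _ : Edge n ℓ => (-2 : ℤ)) p,
      finsum_eq_sum _ (MvPolynomial.weightedHomogeneousComponent_finsupp p), map_sum]
    refine sum_mem fun m _ => ?_
    refine AddSubgroup.mem_iSup_of_mem (m + oneDegree w v) ((mem_stateGr w).2 ⟨_, ?_, rfl⟩)
    rw [add_sub_cancel_right]
    exact MvPolynomial.weightedHomogeneousComponent_mem _ _ _

theorem chainGr_isInternal (k : ℤ) : DirectSum.IsInternal (chainGr w S k) := by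
  classical
  choose π h1 h2 h3 using fun v => (isInternal_iff_proj _).1 (stateGr_isInternal w S v)
  refine (isInternal_iff_proj _).2
    ⟨fun q => AddMonoidHom.mk' (fun x v => π v.1 q (x v)) ?_, ?_, ?_, ?_⟩
  · intro x y
    ext v
    exact map_add _ _ _
  · intro q m hm
    ext v
    exact h1 _ _ _ ((mem_chainGr w).1 hm v)
  · intro q q' hq m hm
    ext v
    exact h2 _ _ _ hq _ ((mem_chainGr w).1 hm v)
  · rw [eq_top_iff]
    intro x _
    rw [← Finset.univ_sum_single x]
    refine sum_mem fun v _ => ?_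
    have : (⊤ : AddSubgroup (StateAlg w S v.1)) ≤
        (⨆ q, chainGr w S k q).comap (AddMonoidHom.single (fun v : Vertex ℓ k => StateAlg w S v.1) v) := by
      rw [← h3 v.1, iSup_le_iff]
      intro q m hm
      refine AddSubgroup.mem_iSup_of_mem q ((mem_chainGr w).2 fun v' => ?_)
      by_cases h : v' = v
      · subst h
        simpa using hm
      · simp [h, zero_mem]
    exact this trivial

theorem mult_isWeightedHomogeneous {v : Fin ℓ → Bool} {t : Fin ℓ} (hv : v t = true) :
    MvPolynomial.IsWeightedHomogeneous (fun _ : Edge n ℓ => (-2 : ℤ)) (mult w S v t)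
      (oneDegree w (low v t) - oneDegree w v) := by
  have hh := height_low hv
  unfold oneDegree
  by_cases hs : SameCircle w (low v t) (botL w t) (botR w t)
  · have hc := card_circles_split w hv hs
    rw [mult, if_pos hs]
    convert (MvPolynomial.isWeightedHomogeneous_X S (fun _ : Edge n ℓ => (-2 : ℤ)) (botL w t)).add
      (MvPolynomial.isWeightedHomogeneous_X S (fun _ : Edge n ℓ => (-2 : ℤ)) (topL w t)) using 1
    omega
  · have hc := card_circles_merge w hv hs
    rw [mult, if_neg hs]
    convert MvPolynomial.isWeightedHomogeneous_one S (fun _ : Edge n ℓ => (-2 : ℤ)) using 1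
    omega

theorem dAdd_mem (k q : ℤ) (x : Chain w S k) (hx : x ∈ chainGr w S k q) :
    dAdd w S k x ∈ chainGr w S (k + 1) q := by
  obtain ⟨p, hp⟩ := exists_rep w x (fun v p =>
    MvPolynomial.IsWeightedHomogeneous (fun _ : Edge n ℓ => (-2 : ℤ)) p (q - oneDegree w v))
    fun v => (mem_stateGr w).1 ((mem_chainGr w).1 hx v)
  refine (mem_chainGr w).2 fun v => (mem_stateGr w).2
    ⟨_, ?_, dAdd_cls w (fun v => (hp v).2) v⟩
  refine MvPolynomial.IsWeightedHomogeneous.sum _ _ _ fun t _ => ?_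
  split_ifs with ht
  · have := (mult_isWeightedHomogeneous w S ht).mul (hp (lowVertex v t ht)).1
    refine Submodule.smul_of_tower_mem (MvPolynomial.weightedHomogeneousSubmodule S _ _) _ ?_
    have e : oneDegree w (low v.1 t) - oneDegree w v.1 + (q - oneDegree w (low v.1 t)) =
        q - oneDegree w v.1 := by ring
    rw [e] at this
    exact this
  · exact MvPolynomial.isWeightedHomogeneous_zero S _ _

theorem chainGr_cls_mul (e : Edge n ℓ) (k q : ℤ) (a x : Chain w S k)
    (ha : ∀ v, a v = cls w v.1 (MvPolynomial.X e)) (hx : x ∈ chainGr w S k q) :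
    a * x ∈ chainGr w S k (q - 2) := by
  refine (mem_chainGr w).2 fun v => (mem_stateGr w).2 ?_
  obtain ⟨p, hp, hxp⟩ := (mem_stateGr w).1 ((mem_chainGr w).1 hx v)
  refine ⟨MvPolynomial.X e * p, ?_, by rw [Pi.mul_apply, ha, hxp, map_mul]⟩
  convert (MvPolynomial.isWeightedHomogeneous_X S (fun _ : Edge n ℓ => (-2 : ℤ)) e).mul hp using 1
  ring

/-- The Khovanov cochain bimodule in homological degree `k` of the closure of a positive braid,
with basepoints on the edges `e` (left action) and `f` (right action). -/
def khObj (e f : Edge n ℓ) (k : ℤ) : GrBimod S where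
  carrier := Chain w S k
  module := Module.compHom (Chain w S k) (bimodAct w S e f k).toRingHom
  gr := chainGr w S k
  isInternal := chainGr_isInternal w S k
  scalar_mem s q x hx := by
    change bimodAct w S e f k (algebraMap S (RR S) s) * x ∈ chainGr w S k q
    rw [AlgHom.commutes, ← Algebra.smul_def]
    refine (mem_chainGr w).2 fun v => (mem_stateGr w).2 ?_
    obtain ⟨p, hp, hxp⟩ := (mem_stateGr w).1 ((mem_chainGr w).1 hx v)
    refine ⟨s • p, Submodule.smul_mem (MvPolynomial.weightedHomogeneousSubmodule S _ _) s hp, ?_⟩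
    rw [Pi.smul_apply, hxp]
    rfl
  XL_mem q x hx := chainGr_cls_mul w S e k q _ x (bimodAct_XL w S e f k) hx
  XR_mem q x hx := chainGr_cls_mul w S f k q _ x (bimodAct_XR w S e f k) hx

/-- The coboundary as a map of graded bimodules. -/
def khD (e f : Edge n ℓ) (k : ℤ) : khObj w S e f k ⟶ khObj w S e f (k + 1) where
  toLin :=
    { toFun := dAdd w S k
      map_add' := map_add (dAdd w S k)
      map_smul' := dAdd_act w S e f k }
  map_gr q x hx := dAdd_mem w S k q x hx

/-- The Khovanov complex of the closure of the positive braid `σ_{w 0} σ_{w 1} ⋯`, as a complex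
of graded bimodules, with basepoints on the edges `e` (left action) and `f` (right action). -/
def khComplex (e f : Edge n ℓ) : CochainComplex (GrBimod S) ℤ :=
  CochainComplex.of (khObj w S e f) (khD w S e f) fun k =>
    GrBimod.hom_ext (LinearMap.ext fun x => dAdd_dAdd w S k x)

end Complex

/-- The braid word `(σ₁ σ₂ σ₃)⁴ σ₁ σ₂` on four strands (with generators numbered from `0`). -/
def wordL3 : Fin 14 → Fin 3 := ![0, 1, 2, 0, 1, 2, 0, 1, 2, 0, 1, 2, 0, 1]

/-- The Khovanov complex of the closure `L₃` of the braid. Both basepoints lie on the closing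
strands, between the last and the first letter of the word: the left one at the third position,
on the component that is a torus knot `T(3,4)`, and the right one at the fourth position, on the
unknotted component. -/
def khL3 (S : Type) [CommRing S] : CochainComplex (GrBimod S) ℤ :=
  khComplex wordL3 S (2, 0) (3, 0)

instance isPrime_span_three : (Ideal.span {(3 : ℤ)}).IsPrime :=
  (Ideal.span_singleton_prime (by norm_num)).2 Int.prime_three

/-- The ring `ℤ₍₃₎`. -/
abbrev Zloc3 : Type := Localization.AtPrime (Ideal.span {(3 : ℤ)})

end Khovanov

end

open CategoryTheory CategoryTheory.Limits
open scoped TensorProduct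

noncomputable section

namespace Khovanov

set_option linter.unusedSectionVars false
set_option linter.unusedDecidableInType false
set_option linter.unusedFintypeInType false

section Colouring

variable {E : Type} [Fintype E] [DecidableEq E]

/-- The colouring `γ` is constant on the cycles of `π`. -/
def Inv (π : Equiv.Perm E) (γ : E → Bool) : Prop := ∀ e, γ (π e) = γ e

theorem Inv.sameCycle {π : Equiv.Perm E} {γ : E → Bool} (h : Inv π γ) {x y : E}
    (hxy : π.SameCycle x y) : γ x = γ y := by
  obtain ⟨k, rfl⟩ := hxy.exists_nat_pow_eq
  clear hxy
  induction k with
  | zero => rfl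
  | succ k ih => rw [pow_succ', Equiv.Perm.mul_apply, h, ih]

theorem sameCycle_iff_forall_inv {π : Equiv.Perm E} {x y : E} :
    π.SameCycle x y ↔ ∀ γ, Inv π γ → γ x = γ y := by
  classical
  refine ⟨fun h γ hγ => hγ.sameCycle h, fun h => ?_⟩
  have := h (fun e => decide (π.SameCycle x e)) (fun e => by
    simp [Equiv.Perm.sameCycle_apply_right])
  rw [decide_eq_decide] at this
  exact this.1 (.refl _ _)

theorem Inv.mul_swap {π : Equiv.Perm E} {γ : E → Bool} (h : Inv π γ) {x y : E} (hxy : γ x = γ y) :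
    Inv (π * Equiv.swap x y) γ := by
  intro e
  rw [Equiv.Perm.mul_apply, h]
  by_cases h1 : e = x
  · subst h1; rw [Equiv.swap_apply_left, hxy]
  by_cases h2 : e = y
  · subst h2; rw [Equiv.swap_apply_right, hxy]
  rw [Equiv.swap_apply_of_ne_of_ne h1 h2]

theorem Inv.of_mul_swap {π : Equiv.Perm E} {γ : E → Bool} {x y : E}
    (h : Inv (π * Equiv.swap x y) γ) (hxy : γ x = γ y) : Inv π γ := by
  have := h.mul_swap hxy
  rwa [mul_assoc, Equiv.swap_mul_self, mul_one] at this

theorem sameCycle_mul_swap_iff {π : Equiv.Perm E} {x y : E} (hne : x ≠ y)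
    (hxy : ¬ π.SameCycle x y) (e f : E) :
    (π * Equiv.swap x y).SameCycle e f ↔ π.SameCycle e f ∨
      (π.SameCycle e x ∧ π.SameCycle y f) ∨ (π.SameCycle e y ∧ π.SameCycle x f) := by
  classical
  have hs := (sameCycle_swap π x y hne).2 hxy
  constructor
  · intro h
    have := sameCycle_iff_forall_inv.1 h (fun g => decide (π.SameCycle e g ∨
      (π.SameCycle e x ∧ π.SameCycle y g) ∨ (π.SameCycle e y ∧ π.SameCycle x g)))
      (Inv.mul_swap (fun g => by simp [Equiv.Perm.sameCycle_apply_right]) (by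
        rw [decide_eq_decide]
        constructor
        · rintro (h | ⟨-, h⟩ | ⟨h, -⟩)
          · exact Or.inr (Or.inl ⟨h, .refl _ _⟩)
          · exact absurd h.symm hxy
          · exact Or.inl h
        · rintro (h | ⟨h, -⟩ | ⟨-, h⟩)
          · exact Or.inr (Or.inr ⟨h, .refl _ _⟩)
          · exact Or.inl h
          · exact absurd h hxy))
    rw [decide_eq_decide] at this
    exact this.1 (Or.inl (.refl _ _))
  · intro h
    have key : ∀ {e f}, π.SameCycle e f → (π * Equiv.swap x y).SameCycle e f := by
      intro e f h
      exact sameCycle_iff_forall_inv.2 fun γ hγ =>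
        (hγ.of_mul_swap (hγ.sameCycle hs)).sameCycle h
    rcases h with h | ⟨h, h'⟩ | ⟨h, h'⟩
    · exact key h
    · exact (key h).trans (hs.trans (key h'))
    · exact (key h).trans (hs.symm.trans (key h'))

/-- The number of cycles of `π` that have the colour `ε`. -/
def cyc (π : Equiv.Perm E) (γ : E → Bool) (ε : Bool) : ℕ :=
  Nat.card (Quot fun x y : {e : E // γ e = ε} => π x.1 = y.1)

theorem eqvGen_iff_sameCycle {π : Equiv.Perm E} {γ : E → Bool} (h : Inv π γ) {ε : Bool}
    (x y : {e : E // γ e = ε}) :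
    Relation.EqvGen (fun x y : {e : E // γ e = ε} => π x.1 = y.1) x y ↔ π.SameCycle x.1 y.1 := by
  constructor
  · intro h
    induction h with
    | rel _ _ h => rw [← h]; exact ⟨1, by simp⟩
    | refl _ => exact .refl _ _
    | symm _ _ _ ih => exact ih.symm
    | trans _ _ _ _ _ ih ih' => exact ih.trans ih'
  · intro hxy
    obtain ⟨y, hy⟩ := y
    obtain ⟨k, rfl⟩ := hxy.exists_nat_pow_eq
    clear hxy
    induction k with
    | zero => exact .refl _
    | succ k ih =>
      have e : (π ^ (k + 1)) x.1 = π ((π ^ k) x.1) := by rw [pow_succ', Equiv.Perm.mul_apply]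
      have h1 : γ ((π ^ k) x.1) = ε := by
        refine Eq.trans ?_ hy
        rw [e, h]
      exact (ih h1).trans _ _ _ (.rel _ _ e.symm)

theorem cyc_merge {π : Equiv.Perm E} {γ : E → Bool} (h : Inv π γ) {x y : E} (hne : x ≠ y)
    (hγ : γ x = γ y) (hxy : ¬ π.SameCycle x y) :
    cyc (π * Equiv.swap x y) γ (γ x) + 1 = cyc π γ (γ x) := by
  refine card_quot_join _ _ ⟨x, rfl⟩ ⟨y, hγ.symm⟩
    (by rwa [eqvGen_iff_sameCycle h]) fun e f => ?_
  rw [eqvGen_iff_sameCycle (h.mul_swap hγ), eqvGen_iff_sameCycle h, eqvGen_iff_sameCycle h,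
    eqvGen_iff_sameCycle h, eqvGen_iff_sameCycle h, eqvGen_iff_sameCycle h]
  exact sameCycle_mul_swap_iff hne hxy e.1 f.1

theorem cyc_split {π : Equiv.Perm E} {γ : E → Bool} (h : Inv π γ) {x y : E} (hne : x ≠ y)
    (hxy : π.SameCycle x y) :
    cyc (π * Equiv.swap x y) γ (γ x) = cyc π γ (γ x) + 1 := by
  have hγ := h.sameCycle hxy
  have := cyc_merge (h.mul_swap hγ) hne hγ (fun h' => (sameCycle_swap π x y hne).1 h' hxy)
  rw [mul_assoc, Equiv.swap_mul_self, mul_one] at this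
  exact this.symm

theorem cyc_of_ne {π : Equiv.Perm E} {γ : E → Bool} {x y : E} {ε : Bool} (hx : γ x ≠ ε)
    (hy : γ y ≠ ε) : cyc (π * Equiv.swap x y) γ ε = cyc π γ ε := by
  have : (fun a b : {e : E // γ e = ε} => (π * Equiv.swap x y) a.1 = b.1) =
      fun a b : {e : E // γ e = ε} => π a.1 = b.1 := by
    funext a b
    rw [Equiv.Perm.mul_apply, Equiv.swap_apply_of_ne_of_ne]
    · rintro h; exact hx (h ▸ a.2)
    · rintro h; exact hy (h ▸ a.2)
  rw [cyc, cyc, this]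

/-- The number of cycles of a permutation, fixed points included. -/
def cycles (π : Equiv.Perm E) : ℕ := Nat.card (Quot fun x y => π x = y)

theorem cyc_const (π : Equiv.Perm E) (ε : Bool) : cyc π (fun _ => ε) ε = cycles π := by
  refine Nat.card_congr (Quot.congr (Equiv.subtypeUnivEquiv fun _ => rfl) ?_)
  rintro ⟨x, -⟩ ⟨y, -⟩
  rfl

theorem cycles_merge {π : Equiv.Perm E} {x y : E} (hne : x ≠ y) (hxy : ¬ π.SameCycle x y) :
    cycles (π * Equiv.swap x y) + 1 = cycles π := by
  rw [← cyc_const _ true, ← cyc_const _ true]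
  exact cyc_merge (γ := fun _ => true) (fun _ => rfl) hne rfl hxy

theorem cycles_split {π : Equiv.Perm E} {x y : E} (hne : x ≠ y) (hxy : π.SameCycle x y) :
    cycles (π * Equiv.swap x y) = cycles π + 1 := by
  rw [← cyc_const _ true, ← cyc_const _ true]
  exact cyc_split (γ := fun _ => true) (fun _ => rfl) hne hxy

end Colouring

section CycleAlgebra

variable {E : Type} [Fintype E] [DecidableEq E] (S : Type) [CommRing S]

/-- The relations `X_e ^ 2 = 0` and `X_e = X_{π e}`. -/
def cycIdeal (π : Equiv.Perm E) : Ideal (MvPolynomial E S) :=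
  Ideal.span ({p | ∃ e, p = MvPolynomial.X e ^ 2} ∪
    {p | ∃ e, p = MvPolynomial.X e - MvPolynomial.X (π e)})

theorem sq_mem_cycIdeal (π : Equiv.Perm E) (e : E) :
    (MvPolynomial.X e ^ 2 : MvPolynomial E S) ∈ cycIdeal S π :=
  Ideal.subset_span (Or.inl ⟨e, rfl⟩)

theorem sub_apply_mem_cycIdeal (π : Equiv.Perm E) (e : E) :
    (MvPolynomial.X e - MvPolynomial.X (π e) : MvPolynomial E S) ∈ cycIdeal S π :=
  Ideal.subset_span (Or.inr ⟨e, rfl⟩)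

theorem sub_mem_cycIdeal {π : Equiv.Perm E} {e f : E} (h : π.SameCycle e f) :
    (MvPolynomial.X e - MvPolynomial.X f : MvPolynomial E S) ∈ cycIdeal S π := by
  obtain ⟨k, rfl⟩ := h.exists_nat_pow_eq
  clear h
  induction k with
  | zero => rw [pow_zero, Equiv.Perm.one_apply, sub_self]; exact zero_mem _
  | succ k ih =>
    have := add_mem ih (sub_apply_mem_cycIdeal S π ((π ^ k) e))
    rwa [sub_add_sub_cancel, ← Equiv.Perm.mul_apply, ← pow_succ'] at this

/-- Setting the deformation parameter to `0`. -/
def spec : MvPolynomial E (Polynomial ℤ) →+* MvPolynomial E S :=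
  MvPolynomial.map (Polynomial.eval₂RingHom (Int.castRingHom S) 0)

/-- The value of a polynomial at a colouring, where the colours stand for the roots of
`X ^ 2 - h X`. -/
def evalCol (γ : E → Bool) : MvPolynomial E (Polynomial ℤ) →+* Polynomial ℤ :=
  MvPolynomial.eval fun e => if γ e then Polynomial.X else 0

@[simp]
theorem evalCol_X (γ : E → Bool) (e : E) :
    evalCol γ (MvPolynomial.X e) = if γ e then Polynomial.X else 0 :=
  MvPolynomial.eval_X _

@[simp]
theorem evalCol_C (γ : E → Bool) (a : Polynomial ℤ) : evalCol γ (MvPolynomial.C a) = a :=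
  MvPolynomial.eval_C _

@[simp]
theorem spec_X (e : E) : spec S (MvPolynomial.X e) = MvPolynomial.X e := MvPolynomial.map_X _ _

/-- A polynomial that vanishes at all colourings constant on the cycles of `π` is a relation. -/
theorem spec_mem_cycIdeal {π : Equiv.Perm E} {f : MvPolynomial E (Polynomial ℤ)}
    (hf : ∀ γ, Inv π γ → evalCol γ f = 0) : spec S f ∈ cycIdeal S π := by
  classical
  let r : Setoid E := Equiv.Perm.SameCycle.setoid π
  let rep : E → E := fun e => (Quotient.mk r e).out
  have hrep : ∀ e, π.SameCycle (rep e) e := fun e =>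
    @Quotient.exact _ r _ _ (Quotient.out_eq (Quotient.mk r e))
  have hrep' : ∀ e, rep (π e) = rep e := fun e => by
    have : Quotient.mk r (π e) = Quotient.mk r e :=
      Quotient.sound (Equiv.Perm.sameCycle_apply_left.2 (.refl _ _))
    simp only [rep, this]
  have h1 : ∀ p : MvPolynomial E (Polynomial ℤ),
      spec S p - spec S (MvPolynomial.rename rep p) ∈ cycIdeal S π := by
    intro p
    induction p using MvPolynomial.induction_on with
    | C a => rw [MvPolynomial.rename_C, sub_self]; exact zero_mem _
    | add p q hp hq =>
      have := add_mem hp hq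
      rw [map_add, map_add, map_add]
      convert this using 1
      ring
    | mul_X p e hp =>
      have := add_mem (Ideal.mul_mem_right (MvPolynomial.X e) _ hp)
        (Ideal.mul_mem_left _ (spec S (MvPolynomial.rename rep p))
          (sub_mem_cycIdeal S (hrep e).symm))
      rw [map_mul, map_mul, map_mul, MvPolynomial.rename_X, spec_X, spec_X]
      convert this using 1
      ring
  obtain ⟨g, -, hg⟩ := MvPolynomial.combinatorial_nullstellensatz_exists_linearCombination
    (fun _ : E => ({0, Polynomial.X} : Finset (Polynomial ℤ))) (fun _ => ⟨0, by simp⟩)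
    (MvPolynomial.rename rep f) (fun x hx => by
      rw [MvPolynomial.eval_rename]
      have hx' : x ∘ rep = fun e => if decide (x (rep e) = Polynomial.X) then Polynomial.X else 0 := by
        funext e
        have := hx (rep e)
        simp only [Finset.mem_insert, Finset.mem_singleton] at this
        rcases this with h | h <;> simp [h, Polynomial.X_ne_zero.symm]
      rw [hx']
      exact hf _ fun e => by simp only [hrep'])
  have h2 : spec S (MvPolynomial.rename rep f) ∈ cycIdeal S π := by
    rw [hg, Finsupp.linearCombination_apply, Finsupp.sum, map_sum]
    refine sum_mem fun e _ => ?_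
    rw [smul_eq_mul, map_mul, map_prod, Finset.prod_pair Polynomial.X_ne_zero.symm]
    refine Ideal.mul_mem_left _ _ ?_
    have : spec S (MvPolynomial.X e - MvPolynomial.C 0) *
        spec S (MvPolynomial.X e - MvPolynomial.C Polynomial.X) = MvPolynomial.X e ^ 2 := by
      rw [map_sub, map_sub, spec_X]
      simp [spec, sq]
    rw [this]
    exact sq_mem_cycIdeal S π e
  have := add_mem (h1 f) h2
  rwa [sub_add_cancel] at this

end CycleAlgebra

section Words

variable {E : Type} [Fintype E] [DecidableEq E]

/-- The permutation reached from `α` by multiplying with a sequence of transpositions. -/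
def wordPerm (α : Equiv.Perm E) : List (E × E) → Equiv.Perm E
  | [] => α
  | p :: w => wordPerm (α * Equiv.swap p.1 p.2) w

theorem wordPerm_append (α : Equiv.Perm E) (w w' : List (E × E)) :
    wordPerm α (w ++ w') = wordPerm (wordPerm α w) w' := by
  induction w generalizing α with
  | nil => rfl
  | cons p w ih => exact ih _

/-- The factor of the map from the algebra of `α` to that of `α * swap x y`: two cycles merge or
one cycle splits. -/
def stepPoly {R : Type} [CommRing R] (h : R) (α : Equiv.Perm E) (x y : E) : MvPolynomial E R :=
  open Classical in
  if α.SameCycle x y then MvPolynomial.X x + MvPolynomial.X y - MvPolynomial.C h else 1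

/-- The factor of a sequence of merges and splits. -/
def wordPoly {R : Type} [CommRing R] (h : R) (α : Equiv.Perm E) : List (E × E) → MvPolynomial E R
  | [] => 1
  | p :: w => stepPoly h α p.1 p.2 * wordPoly h (α * Equiv.swap p.1 p.2) w

theorem wordPoly_append {R : Type} [CommRing R] (h : R) (α : Equiv.Perm E) (w w' : List (E × E)) :
    wordPoly h α (w ++ w') = wordPoly h α w * wordPoly h (wordPerm α w) w' := by
  induction w generalizing α with
  | nil => simp [wordPoly, wordPerm]
  | cons p w ih => simp only [List.cons_append, wordPoly, wordPerm, ih, mul_assoc]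

/-- The product of the factors `X_x + X_y`. -/
def linPoly {R : Type} [CommRing R] (h : R) : List (E × E) → MvPolynomial E R
  | [] => 1
  | p :: w => (MvPolynomial.X p.1 + MvPolynomial.X p.2 - MvPolynomial.C h) * linPoly h w

/-- The colouring agrees on the pairs of the word. -/
def Compat (γ : E → Bool) (w : List (E × E)) : Prop := ∀ p ∈ w, γ p.1 = γ p.2

/-- The number of pairs of the word with a given colour. -/
def cnt (γ : E → Bool) (ε : Bool) (w : List (E × E)) : ℕ := w.countP fun p => γ p.1 == ε

/-- All transpositions of the word are proper. -/
def Proper (w : List (E × E)) : Prop := ∀ p ∈ w, p.1 ≠ p.2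

theorem spec_C_X (S : Type) [CommRing S] :
    spec S (MvPolynomial.C Polynomial.X : MvPolynomial E _) = MvPolynomial.C 0 := by
  simp [spec]

theorem spec_wordPoly (S : Type) [CommRing S] (α : Equiv.Perm E) (w : List (E × E)) :
    spec S (wordPoly Polynomial.X α w) = wordPoly 0 α w := by
  induction w generalizing α with
  | nil => exact map_one _
  | cons p w ih =>
    rw [wordPoly, wordPoly, map_mul, ih, stepPoly, stepPoly]
    congr 1
    split_ifs
    · rw [map_sub, map_add, spec_X, spec_X, spec_C_X]
    · exact map_one _

theorem spec_linPoly (S : Type) [CommRing S] (w : List (E × E)) :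
    spec S (linPoly Polynomial.X w) = linPoly 0 w := by
  induction w with
  | nil => exact map_one _
  | cons p w ih => rw [linPoly, linPoly, map_mul, ih, map_sub, map_add, spec_X, spec_X, spec_C_X]

theorem Inv.of_wordPerm {α : Equiv.Perm E} {w : List (E × E)} {γ : E → Bool}
    (h : Inv (wordPerm α w) γ) (hw : Compat γ w) : Inv α γ := by
  induction w generalizing α with
  | nil => exact h
  | cons p w ih =>
    exact (ih h fun q hq => hw q (List.mem_cons_of_mem _ hq)).of_mul_swap (hw p List.mem_cons_self)

/-- The value of a pair of exponents. -/
def colMon (n : Bool → ℕ) : Polynomial ℤ := (-Polynomial.X) ^ n false * Polynomial.X ^ n true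

theorem colMon_add (m n : Bool → ℕ) : colMon (m + n) = colMon m * colMon n := by
  simp only [colMon, Pi.add_apply, pow_add]
  ring

theorem evalCol_pair {γ : E → Bool} {x y : E} (h : γ x = γ y) :
    evalCol γ (MvPolynomial.X x + MvPolynomial.X y - MvPolynomial.C Polynomial.X) =
      colMon (Pi.single (γ x) 1) := by
  rw [map_sub, map_add, evalCol_X, evalCol_X, evalCol_C, ← h]
  cases γ x <;> simp [colMon]

theorem evalCol_pair_ne {γ : E → Bool} {x y : E} (h : γ x ≠ γ y) :
    evalCol γ (MvPolynomial.X x + MvPolynomial.X y - MvPolynomial.C Polynomial.X) = 0 := by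
  rw [map_sub, map_add, evalCol_X, evalCol_X, evalCol_C]
  cases hx : γ x <;> cases hy : γ y <;> simp_all

theorem evalCol_linPoly {γ : E → Bool} {w : List (E × E)} (h : Compat γ w) :
    evalCol γ (linPoly Polynomial.X w) = colMon fun ε => cnt γ ε w := by
  induction w with
  | nil => simp [linPoly, colMon, cnt]
  | cons p w ih =>
    rw [linPoly, map_mul, ih fun q hq => h q (List.mem_cons_of_mem _ hq),
      evalCol_pair (h p List.mem_cons_self), ← colMon_add]
    congr 1
    funext ε
    rw [Pi.add_apply, cnt, cnt, List.countP_cons, add_comm]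
    congr 1
    cases γ p.1 <;> cases ε <;> simp

theorem evalCol_linPoly_of_not {γ : E → Bool} {w : List (E × E)} (h : ¬ Compat γ w) :
    evalCol γ (linPoly Polynomial.X w) = 0 := by
  induction w with
  | nil => exact absurd (fun _ h => by simp at h) h
  | cons p w ih =>
    rw [linPoly, map_mul]
    by_cases hp : γ p.1 = γ p.2
    · rw [ih, mul_zero]
      intro hw
      apply h
      intro q hq
      rcases List.mem_cons.1 hq with rfl | hq
      · exact hp
      · exact hw q hq
    · rw [evalCol_pair_ne hp, zero_mul]

theorem evalCol_wordPoly {α : Equiv.Perm E} {w : List (E × E)} {γ : E → Bool} (hw : Proper w)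
    (h : Inv (wordPerm α w) γ) (hc : Compat γ w) :
    ∃ n : Bool → ℕ, evalCol γ (wordPoly Polynomial.X α w) = colMon n ∧
      ∀ ε, 2 * n ε + cyc α γ ε = cnt γ ε w + cyc (wordPerm α w) γ ε := by
  induction w generalizing α with
  | nil => exact ⟨0, by simp [wordPoly, colMon], fun ε => by simp [cnt, wordPerm]⟩
  | cons p w ih =>
    have hp := hc p List.mem_cons_self
    have hpp := hw p List.mem_cons_self
    obtain ⟨n, hn, hn'⟩ := ih (fun q hq => hw q (List.mem_cons_of_mem _ hq)) h
      (fun q hq => hc q (List.mem_cons_of_mem _ hq))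
    have hα := h.of_wordPerm hc
    by_cases hs : α.SameCycle p.1 p.2
    · refine ⟨Pi.single (γ p.1) 1 + n, ?_, fun ε => ?_⟩
      · rw [wordPoly, map_mul, hn, stepPoly, if_pos hs, evalCol_pair hp, colMon_add]
      · have h1 := hn' ε
        rw [cnt, List.countP_cons, wordPerm]
        rw [cnt] at h1
        by_cases hε : γ p.1 = ε
        · subst hε
          have := cyc_split hα hpp hs
          simp
          omega
        · have := cyc_of_ne (π := α) hε (hp ▸ hε)
          simp [hε, Ne.symm hε]
          omega
    · refine ⟨n, ?_, fun ε => ?_⟩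
      · rw [wordPoly, map_mul, hn, stepPoly, if_neg hs, map_one, one_mul]
      · have h1 := hn' ε
        rw [cnt, List.countP_cons, wordPerm]
        rw [cnt] at h1
        by_cases hε : γ p.1 = ε
        · subst hε
          have := cyc_merge hα hpp hp hs
          simp
          omega
        · have := cyc_of_ne (π := α) hε (hp ▸ hε)
          simp [hε]
          omega

theorem evalCol_wordPoly_of_not {α : Equiv.Perm E} {w : List (E × E)} {γ : E → Bool}
    (hw : Proper w) (h : Inv (wordPerm α w) γ) (hc : ¬ Compat γ w) :
    evalCol γ (wordPoly Polynomial.X α w) = 0 := by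
  induction w generalizing α with
  | nil => exact absurd (fun _ h => by simp at h) hc
  | cons p w ih =>
    rw [wordPoly, map_mul]
    by_cases hcw : Compat γ w
    · have hp : γ p.1 ≠ γ p.2 := by
        intro hp
        apply hc
        intro q hq
        rcases List.mem_cons.1 hq with rfl | hq
        · exact hp
        · exact hcw q hq
      have hβ : Inv (α * Equiv.swap p.1 p.2) γ := Inv.of_wordPerm h hcw
      have hs : α.SameCycle p.1 p.2 := by
        by_contra hs
        exact hp (hβ.sameCycle ((sameCycle_swap α _ _ (hw p List.mem_cons_self)).2 hs))
      rw [stepPoly, if_pos hs, evalCol_pair_ne hp, zero_mul]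
    · rw [ih (fun q hq => hw q (List.mem_cons_of_mem _ hq)) h hcw, mul_zero]

variable (S : Type) [CommRing S]

/-- Two sequences of merges and splits with the same endpoints agree up to explicit factors. -/
theorem wordPoly_congr {α : Equiv.Perm E} {w₁ w₂ L : List (E × E)} (h₁ : Proper w₁)
    (h₂ : Proper w₂) (hw : wordPerm α w₁ = wordPerm α w₂)
    (H : ∀ γ, Inv (wordPerm α w₁) γ → (Compat γ w₁ ↔ Compat γ w₂ ∧ Compat γ L) ∧
      (Compat γ w₁ → ∀ ε, cnt γ ε w₁ = cnt γ ε w₂ + 2 * cnt γ ε L)) :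
    wordPoly 0 α w₁ - linPoly 0 L * wordPoly 0 α w₂ ∈ cycIdeal S (wordPerm α w₁) := by
  rw [← spec_wordPoly, ← spec_wordPoly, ← spec_linPoly, ← map_mul, ← map_sub]
  refine spec_mem_cycIdeal S fun γ hγ => ?_
  obtain ⟨H1, H2⟩ := H γ hγ
  rw [map_sub, map_mul, sub_eq_zero]
  by_cases hc : Compat γ w₁
  · obtain ⟨n, hn, hn'⟩ := evalCol_wordPoly h₁ hγ hc
    obtain ⟨m, hm, hm'⟩ := evalCol_wordPoly h₂ (hw ▸ hγ) (H1.1 hc).1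
    rw [hn, hm, evalCol_linPoly (H1.1 hc).2, ← colMon_add]
    congr 1
    funext ε
    have h3 := hn' ε
    have h4 := hm' ε
    have h5 := H2 hc ε
    rw [← hw] at h4
    simp only [Pi.add_apply]
    omega
  · rw [evalCol_wordPoly_of_not h₁ hγ hc]
    by_cases hL : Compat γ L
    · rw [evalCol_wordPoly_of_not h₂ (hw ▸ hγ) (fun h => hc (H1.2 ⟨h, hL⟩)), mul_zero]
    · rw [evalCol_linPoly_of_not hL, zero_mul]

theorem sub_mul_wordPoly_mem {α : Equiv.Perm E} {w : List (E × E)} (hw : Proper w) {x y : E}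
    (H : ∀ γ, Compat γ w → γ x = γ y) :
    (MvPolynomial.X x - MvPolynomial.X y) * wordPoly 0 α w ∈ cycIdeal S (wordPerm α w) := by
  rw [← spec_wordPoly, ← spec_X S x, ← spec_X S y, ← map_sub, ← map_mul]
  refine spec_mem_cycIdeal S fun γ hγ => ?_
  rw [map_mul]
  by_cases hc : Compat γ w
  · rw [map_sub, evalCol_X, evalCol_X, H γ hc, sub_self, zero_mul]
  · rw [evalCol_wordPoly_of_not hw hγ hc, mul_zero]

theorem stepPoly_mul_mem {α : Equiv.Perm E} {x y : E} (hxy : x ≠ y) {p : MvPolynomial E S}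
    (hp : p ∈ cycIdeal S α) : stepPoly 0 α x y * p ∈ cycIdeal S (α * Equiv.swap x y) := by
  have key : stepPoly 0 α x y * (MvPolynomial.X x - MvPolynomial.X y) ∈
      cycIdeal S (α * Equiv.swap x y) := by
    rw [stepPoly]
    split_ifs with h
    · have := sub_mem (sq_mem_cycIdeal S (α * Equiv.swap x y) x)
        (sq_mem_cycIdeal S (α * Equiv.swap x y) y)
      convert this using 1
      rw [MvPolynomial.C_0]
      ring
    · rw [one_mul]
      exact sub_mem_cycIdeal S ((sameCycle_swap α x y hxy).2 h)
  refine Submodule.span_induction (p := fun p _ => stepPoly 0 α x y * p ∈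
    cycIdeal S (α * Equiv.swap x y)) ?_ ?_ ?_ ?_ hp
  · rintro _ (⟨e, rfl⟩ | ⟨e, rfl⟩)
    · exact Ideal.mul_mem_left _ _ (sq_mem_cycIdeal S _ e)
    · have h := Ideal.mul_mem_left _ (stepPoly 0 α x y)
        (sub_apply_mem_cycIdeal S (α * Equiv.swap x y) (Equiv.swap x y e))
      rw [Equiv.Perm.mul_apply, Equiv.swap_apply_self] at h
      by_cases h1 : e = x
      · subst h1
        rw [Equiv.swap_apply_left] at h
        convert add_mem key h using 1
        ring
      by_cases h2 : e = y
      · subst h2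
        rw [Equiv.swap_apply_right] at h
        convert sub_mem h key using 1
        ring
      rwa [Equiv.swap_apply_of_ne_of_ne h1 h2] at h
  · rw [mul_zero]; exact zero_mem _
  · intro p q _ _ hp hq
    rw [mul_add]
    exact add_mem hp hq
  · intro a p _ hp
    rw [smul_eq_mul, mul_left_comm]
    exact Ideal.mul_mem_left _ _ hp

theorem wordPoly_mul_mem {α : Equiv.Perm E} {w : List (E × E)} (hw : Proper w)
    {p : MvPolynomial E S} (hp : p ∈ cycIdeal S α) :
    wordPoly 0 α w * p ∈ cycIdeal S (wordPerm α w) := by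
  induction w generalizing α p with
  | nil => rwa [wordPoly, one_mul]
  | cons q w ih =>
    rw [wordPoly, mul_comm (stepPoly _ _ _ _), mul_assoc]
    exact ih (fun q hq => hw q (List.mem_cons_of_mem _ hq))
      (stepPoly_mul_mem S (hw q List.mem_cons_self) hp)

theorem wordPoly_isWeightedHomogeneous {α : Equiv.Perm E} {w : List (E × E)} (hw : Proper w) :
    MvPolynomial.IsWeightedHomogeneous (fun _ : E => (-2 : ℤ)) (wordPoly (0 : S) α w)
      ((cycles α : ℤ) - cycles (wordPerm α w) - w.length) := by
  induction w generalizing α with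
  | nil =>
    have : (cycles α : ℤ) - cycles (wordPerm α []) - ([] : List (E × E)).length = 0 := by
      simp [wordPerm]
    rw [this]
    exact MvPolynomial.isWeightedHomogeneous_one S _
  | cons q w ih =>
    have h1 := ih (α := α * Equiv.swap q.1 q.2) fun q hq => hw q (List.mem_cons_of_mem _ hq)
    rw [wordPoly, stepPoly, wordPerm]
    split_ifs with h
    · rw [MvPolynomial.C_0, sub_zero]
      have h2 := cycles_split (hw q List.mem_cons_self) h
      convert ((MvPolynomial.isWeightedHomogeneous_X S (fun _ : E => (-2 : ℤ)) q.1).add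
        (MvPolynomial.isWeightedHomogeneous_X S (fun _ : E => (-2 : ℤ)) q.2)).mul h1 using 1
      rw [List.length_cons]
      push_cast [h2]
      ring
    · have h2 := cycles_merge (hw q List.mem_cons_self) h
      rw [one_mul]
      convert h1 using 1
      rw [List.length_cons]
      rw [← h2]
      push_cast
      ring

end Words

section Objects

variable {E : Type} [Fintype E] [DecidableEq E] (S : Type) [CommRing S]

/-- The algebra `S[X_e] / (X_e ^ 2, X_e - X_{π e})`, a tensor product of copies of `S[X] / (X ^ 2)`
over the cycles of `π`. -/
abbrev CycAlg (π : Equiv.Perm E) : Type := MvPolynomial E S ⧸ cycIdeal S π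

/-- All variables have degree `-2`. -/
abbrev wt : E → ℤ := fun _ => -2

/-- The action of `R` through the variable `X_e`. -/
def cycPointAct (π : Equiv.Perm E) (e : E) : R S →ₐ[S] CycAlg S π :=
  AdjoinRoot.liftAlgHom _ (Algebra.ofId S (CycAlg S π))
    (Ideal.Quotient.mk _ (MvPolynomial.X e)) (by
      rw [Polynomial.eval₂_X_pow, ← map_pow, Ideal.Quotient.eq_zero_iff_mem]
      exact sq_mem_cycIdeal S π e)

/-- The action of `R ⊗ R` through two variables. -/
def cycAct (e : E × E) (π : Equiv.Perm E) : RR S →ₐ[S] CycAlg S π :=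
  Algebra.TensorProduct.productMap (cycPointAct S π e.1) (cycPointAct S π e.2)

theorem cycAct_XL (e : E × E) (π : Equiv.Perm E) :
    cycAct S e π (XL S) = Ideal.Quotient.mk _ (MvPolynomial.X e.1) := by
  rw [cycAct, XL, Algebra.TensorProduct.productMap_apply_tmul, map_one, mul_one, cycPointAct]
  simp

theorem cycAct_XR (e : E × E) (π : Equiv.Perm E) :
    cycAct S e π (XR S) = Ideal.Quotient.mk _ (MvPolynomial.X e.2) := by
  rw [cycAct, XR, Algebra.TensorProduct.productMap_apply_tmul, map_one, one_mul, cycPointAct]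
  simp

/-- The homogeneous parts, where `1` has degree `b`. -/
def cycGr (A : Equiv.Perm E × ℤ) (q : ℤ) : AddSubgroup (CycAlg S A.1) :=
  (MvPolynomial.weightedHomogeneousSubmodule S (wt (E := E)) (q - A.2)).toAddSubgroup.map
    (Ideal.Quotient.mk (cycIdeal S A.1)).toAddMonoidHom

variable {S} in
theorem mem_cycGr {A : Equiv.Perm E × ℤ} {q : ℤ} {x : CycAlg S A.1} :
    x ∈ cycGr S A q ↔ ∃ p, MvPolynomial.IsWeightedHomogeneous (wt (E := E)) p (q - A.2) ∧
      x = Ideal.Quotient.mk _ p := by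
  constructor
  · rintro ⟨p, hp, rfl⟩
    exact ⟨p, hp, rfl⟩
  · rintro ⟨p, hp, rfl⟩
    exact ⟨p, hp, rfl⟩

theorem cycIdeal_isHomogeneous (π : Equiv.Perm E) (m : ℤ) {p : MvPolynomial E S}
    (hp : p ∈ cycIdeal S π) :
    MvPolynomial.weightedHomogeneousComponent (wt (E := E)) m p ∈ cycIdeal S π := by
  let _ := MvPolynomial.weightedGradedAlgebra S (wt (E := E))
  refine MvPolynomial.weightedHomogeneousComponent_mem_of_mem _ _ ?_ hp m
  refine Ideal.homogeneous_span _ _ ?_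
  rintro _ (⟨e, rfl⟩ | ⟨e, rfl⟩)
  · exact ⟨_, (MvPolynomial.isWeightedHomogeneous_X S _ e).pow 2⟩
  · exact ⟨_, (MvPolynomial.isWeightedHomogeneous_X S _ e).sub
      (MvPolynomial.isWeightedHomogeneous_X S _ (π e))⟩

theorem cycGr_isInternal (A : Equiv.Perm E × ℤ) : DirectSum.IsInternal (cycGr S A) := by
  classical
  let c : ℤ → MvPolynomial E S →ₗ[S] MvPolynomial E S := fun q =>
    MvPolynomial.weightedHomogeneousComponent (wt (E := E)) (q - A.2)
  let π : ℤ → CycAlg S A.1 →+ CycAlg S A.1 := fun q =>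
    QuotientAddGroup.map (cycIdeal S A.1).toAddSubgroup (cycIdeal S A.1).toAddSubgroup
      (c q).toAddMonoidHom (fun p hp => cycIdeal_isHomogeneous S A.1 _ hp)
  have hπ : ∀ q p, π q (Ideal.Quotient.mk _ p) = Ideal.Quotient.mk _ (c q p) := fun q p => rfl
  refine (isInternal_iff_proj _).2 ⟨π, ?_, ?_, ?_⟩
  · intro q m hm
    obtain ⟨p, hp, rfl⟩ := mem_cycGr.1 hm
    rw [hπ]
    congr 1
    exact hp.weightedHomogeneousComponent_same
  · intro q q' hq m hm
    obtain ⟨p, hp, rfl⟩ := mem_cycGr.1 hm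
    rw [hπ]
    have : c q p = 0 := hp.weightedHomogeneousComponent_ne _ (by
      intro h
      apply hq
      linarith)
    rw [this, map_zero]
  · rw [eq_top_iff]
    intro x _
    obtain ⟨p, rfl⟩ := Ideal.Quotient.mk_surjective x
    rw [← MvPolynomial.sum_weightedHomogeneousComponent (wt (E := E)) p,
      finsum_eq_sum _ (MvPolynomial.weightedHomogeneousComponent_finsupp p), map_sum]
    refine sum_mem fun m _ => ?_
    refine AddSubgroup.mem_iSup_of_mem (m + A.2) (mem_cycGr.2 ⟨_, ?_, rfl⟩)
    rw [add_sub_cancel_right]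
    exact MvPolynomial.weightedHomogeneousComponent_mem _ _ _

theorem cycGr_X_mul (A : Equiv.Perm E × ℤ) (e : E) (q : ℤ) (x : CycAlg S A.1)
    (hx : x ∈ cycGr S A q) : Ideal.Quotient.mk _ (MvPolynomial.X e) * x ∈ cycGr S A (q - 2) := by
  obtain ⟨p, hp, rfl⟩ := mem_cycGr.1 hx
  refine mem_cycGr.2 ⟨MvPolynomial.X e * p, ?_, by rw [map_mul]⟩
  convert (MvPolynomial.isWeightedHomogeneous_X S (wt (E := E)) e).mul hp using 1
  simp only [wt]
  ring

/-- The graded bimodule on the algebra of a permutation, where the class of `1` has a given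
degree and `R ⊗ R` acts through two variables. -/
def cycObj (e : E × E) (A : Equiv.Perm E × ℤ) : GrBimod S where
  carrier := CycAlg S A.1
  module := Module.compHom (CycAlg S A.1) (cycAct S e A.1).toRingHom
  gr := cycGr S A
  isInternal := cycGr_isInternal S A
  scalar_mem s q x hx := by
    change cycAct S e A.1 (algebraMap S (RR S) s) * x ∈ cycGr S A q
    rw [AlgHom.commutes, ← Algebra.smul_def]
    obtain ⟨p, hp, rfl⟩ := mem_cycGr.1 hx
    exact mem_cycGr.2 ⟨s • p,
      Submodule.smul_mem (MvPolynomial.weightedHomogeneousSubmodule S _ _) s hp, rfl⟩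
  XL_mem q x hx := by
    change cycAct S e A.1 (XL S) * x ∈ _
    rw [cycAct_XL]
    exact cycGr_X_mul S A _ q x hx
  XR_mem q x hx := by
    change cycAct S e A.1 (XR S) * x ∈ _
    rw [cycAct_XR]
    exact cycGr_X_mul S A _ q x hx

/-- The class of a polynomial. -/
def elt (e : E × E) (A : Equiv.Perm E × ℤ) : MvPolynomial E S →+ cycObj S e A :=
  (Ideal.Quotient.mk (cycIdeal S A.1)).toAddMonoidHom

variable {S} {e : E × E} {A B C : Equiv.Perm E × ℤ}

theorem elt_surjective (x : cycObj S e A) : ∃ p, elt S e A p = x :=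
  Ideal.Quotient.mk_surjective (I := cycIdeal S A.1) x

theorem elt_eq_iff {p q : MvPolynomial E S} :
    elt S e A p = elt S e A q ↔ p - q ∈ cycIdeal S A.1 :=
  Ideal.Quotient.eq

theorem algebraMap_smul_elt (s : S) (p : MvPolynomial E S) :
    algebraMap S (RR S) s • elt S e A p = elt S e A (s • p) := by
  change cycAct S e A.1 (algebraMap S (RR S) s) * Ideal.Quotient.mk (cycIdeal S A.1) p = _
  rw [AlgHom.commutes, ← Algebra.smul_def]
  rfl

theorem XL_smul_elt (p : MvPolynomial E S) :
    XL S • elt S e A p = elt S e A (MvPolynomial.X e.1 * p) := by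
  change cycAct S e A.1 (XL S) * _ = _
  rw [cycAct_XL]
  exact (map_mul (Ideal.Quotient.mk (cycIdeal S A.1)) _ _).symm

theorem XR_smul_elt (p : MvPolynomial E S) :
    XR S • elt S e A p = elt S e A (MvPolynomial.X e.2 * p) := by
  change cycAct S e A.1 (XR S) * _ = _
  rw [cycAct_XR]
  exact (map_mul (Ideal.Quotient.mk (cycIdeal S A.1)) _ _).symm

theorem mem_gr_iff {q : ℤ} {x : cycObj S e A} : x ∈ (cycObj S e A).gr q ↔
    ∃ p, MvPolynomial.IsWeightedHomogeneous (wt (E := E)) p (q - A.2) ∧ x = elt S e A p :=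
  mem_cycGr

/-- Additive maps that commute with the scalars of `S` and with both actions of `X` are bimodule
maps. -/
theorem map_rr_smul {M N : Type} [AddCommGroup M] [AddCommGroup N] [Module (RR S) M]
    [Module (RR S) N] (f : M →+ N)
    (h0 : ∀ (s : S) (m : M), f (algebraMap S (RR S) s • m) = algebraMap S (RR S) s • f m)
    (h1 : ∀ m, f (XL S • m) = XL S • f m) (h2 : ∀ m, f (XR S • m) = XR S • f m)
    (a : RR S) (m : M) : f (a • m) = a • f m := by
  have hpow : ∀ r : RR S, (∀ m, f (r • m) = r • f m) → ∀ k m, f (r ^ k • m) = r ^ k • f m := by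
    intro r hr k
    induction k with
    | zero => intro m; rw [pow_zero, one_smul, one_smul]
    | succ k ih =>
      intro m
      have e : r ^ (k + 1) = r ^ k * r := pow_succ r k
      rw [e, mul_smul, ih, hr, mul_smul]
  have hl : ∀ (x : R S) (m : M), f ((x ⊗ₜ[S] 1 : RR S) • m) = (x ⊗ₜ[S] 1 : RR S) • f m := by
    intro x
    obtain ⟨g, rfl⟩ := AdjoinRoot.mk_surjective x
    induction g using Polynomial.induction_on' with
    | add g h hg hh =>
      intro m
      rw [map_add, TensorProduct.add_tmul, add_smul, map_add, hg, hh, add_smul]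
    | monomial k s =>
      have e : (AdjoinRoot.mk (Polynomial.X ^ 2 : Polynomial S) (Polynomial.monomial k s)) ⊗ₜ[S]
          (1 : R S) = algebraMap S (RR S) s * XL S ^ k := by
        rw [← Polynomial.C_mul_X_pow_eq_monomial, map_mul, map_pow, AdjoinRoot.mk_X,
          AdjoinRoot.mk_C, XL, Algebra.TensorProduct.tmul_pow, one_pow,
          Algebra.TensorProduct.algebraMap_apply, Algebra.TensorProduct.tmul_mul_tmul, mul_one]
        rfl
      intro m
      rw [e, mul_smul, mul_smul, h0, hpow _ h1]
  have hr : ∀ (x : R S) (m : M), f ((1 ⊗ₜ[S] x : RR S) • m) = (1 ⊗ₜ[S] x : RR S) • f m := by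
    intro x
    obtain ⟨g, rfl⟩ := AdjoinRoot.mk_surjective x
    induction g using Polynomial.induction_on' with
    | add g h hg hh =>
      intro m
      rw [map_add, TensorProduct.tmul_add, add_smul, map_add, hg, hh, add_smul]
    | monomial k s =>
      have e : (1 : R S) ⊗ₜ[S] (AdjoinRoot.mk (Polynomial.X ^ 2 : Polynomial S)
          (Polynomial.monomial k s)) = algebraMap S (RR S) s * XR S ^ k := by
        rw [← Polynomial.C_mul_X_pow_eq_monomial, map_mul, map_pow, AdjoinRoot.mk_X,
          AdjoinRoot.mk_C, XR, Algebra.TensorProduct.tmul_pow, one_pow,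
          Algebra.TensorProduct.algebraMap_apply', Algebra.TensorProduct.tmul_mul_tmul, mul_one]
        rfl
      intro m
      rw [e, mul_smul, mul_smul, h0, hpow _ h2]
  induction a using TensorProduct.induction_on generalizing m with
  | zero => rw [zero_smul, zero_smul, map_zero]
  | add x y hx hy => rw [add_smul, add_smul, map_add, hx, hy]
  | tmul x y =>
    have e : x ⊗ₜ[S] y = (x ⊗ₜ[S] 1 : RR S) * (1 ⊗ₜ[S] y : RR S) := by
      rw [Algebra.TensorProduct.tmul_mul_tmul, mul_one, one_mul]
    rw [e, mul_smul, mul_smul, hl, hr]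

/-- The map of polynomials induces a map of graded bimodules. -/
structure Good (e : E × E) (A B : Equiv.Perm E × ℤ)
    (φ : MvPolynomial E S →ₗ[S] MvPolynomial E S) : Prop where
  ideal : ∀ p ∈ cycIdeal S A.1, φ p ∈ cycIdeal S B.1
  left : ∀ p, φ (MvPolynomial.X e.1 * p) - MvPolynomial.X e.1 * φ p ∈ cycIdeal S B.1
  right : ∀ p, φ (MvPolynomial.X e.2 * p) - MvPolynomial.X e.2 * φ p ∈ cycIdeal S B.1
  deg : ∀ d p, MvPolynomial.IsWeightedHomogeneous (wt (E := E)) p d →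
    ∃ p', MvPolynomial.IsWeightedHomogeneous (wt (E := E)) p' (d + A.2 - B.2) ∧
      φ p - p' ∈ cycIdeal S B.1

theorem Good.id (e : E × E) (A : Equiv.Perm E × ℤ) :
    Good e A A (LinearMap.id : MvPolynomial E S →ₗ[S] _) where
  ideal p hp := hp
  left p := by simp
  right p := by simp
  deg d p hp := ⟨p, by rwa [add_sub_cancel_right], by simp⟩

theorem Good.zsmul {φ : MvPolynomial E S →ₗ[S] MvPolynomial E S} (h : Good e A B φ) (n : ℤ) :
    Good e A B (n • φ) where
  ideal p hp := zsmul_mem (h.ideal p hp) n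
  left p := by
    convert zsmul_mem (h.left p) n using 1
    simp only [LinearMap.smul_apply, mul_smul_comm, smul_sub]
  right p := by
    convert zsmul_mem (h.right p) n using 1
    simp only [LinearMap.smul_apply, mul_smul_comm, smul_sub]
  deg d p hp := by
    obtain ⟨p', h1, h2⟩ := h.deg d p hp
    refine ⟨n • p', ?_, ?_⟩
    · exact Submodule.smul_of_tower_mem (MvPolynomial.weightedHomogeneousSubmodule S _ _) n h1
    · convert zsmul_mem h2 n using 1
      simp only [LinearMap.smul_apply, smul_sub]

theorem Good.zero (e : E × E) (A B : Equiv.Perm E × ℤ) :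
    Good e A B (0 : MvPolynomial E S →ₗ[S] MvPolynomial E S) where
  ideal p hp := zero_mem _
  left p := by simp
  right p := by simp
  deg d p hp := ⟨0, MvPolynomial.isWeightedHomogeneous_zero _ _ _, by simp⟩

/-- Multiplication by a fixed polynomial. -/
abbrev mulBy (z : MvPolynomial E S) : MvPolynomial E S →ₗ[S] MvPolynomial E S :=
  LinearMap.mulLeft S z

theorem Good.mulBy {z : MvPolynomial E S}
    (h : ∀ p ∈ cycIdeal S A.1, z * p ∈ cycIdeal S B.1)
    (hz : MvPolynomial.IsWeightedHomogeneous (wt (E := E)) z (A.2 - B.2)) :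
    Good e A B (mulBy z) where
  ideal := h
  left p := by
    rw [LinearMap.mulLeft_apply, LinearMap.mulLeft_apply, mul_left_comm, sub_self]
    exact zero_mem _
  right p := by
    rw [LinearMap.mulLeft_apply, LinearMap.mulLeft_apply, mul_left_comm, sub_self]
    exact zero_mem _
  deg d p hp := ⟨z * p, by convert hz.mul hp using 1; ring, by simp⟩

/-- The map of graded bimodules induced by a map of polynomials. -/
def Good.hom {φ : MvPolynomial E S →ₗ[S] MvPolynomial E S} (h : Good e A B φ) :
    cycObj S e A ⟶ cycObj S e B :=
  let f : cycObj S e A →+ cycObj S e B :=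
    QuotientAddGroup.map (cycIdeal S A.1).toAddSubgroup (cycIdeal S B.1).toAddSubgroup
      φ.toAddMonoidHom h.ideal
  have hf : ∀ p, f (elt S e A p) = elt S e B (φ p) := fun _ => rfl
  { toLin :=
      { toFun := f
        map_add' := map_add f
        map_smul' := map_rr_smul f
          (fun s m => by
            obtain ⟨p, rfl⟩ := elt_surjective m
            rw [algebraMap_smul_elt, hf, hf, algebraMap_smul_elt, map_smul])
          (fun m => by
            obtain ⟨p, rfl⟩ := elt_surjective m
            rw [XL_smul_elt, hf, hf, XL_smul_elt, elt_eq_iff]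
            exact h.left p)
          (fun m => by
            obtain ⟨p, rfl⟩ := elt_surjective m
            rw [XR_smul_elt, hf, hf, XR_smul_elt, elt_eq_iff]
            exact h.right p) }
    map_gr := by
      intro q m hm
      obtain ⟨p, hp, rfl⟩ := mem_gr_iff.1 hm
      obtain ⟨p', h1, h2⟩ := h.deg _ p hp
      refine mem_gr_iff.2 ⟨p', ?_, elt_eq_iff.2 h2⟩
      rwa [sub_add_cancel] at h1 }

theorem cycObj_hom_ext {N : GrBimod S} {f g : cycObj S e A ⟶ N}
    (h : ∀ p, f.toLin (elt S e A p) = g.toLin (elt S e A p)) : f = g := by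
  refine GrBimod.hom_ext (LinearMap.ext fun x => ?_)
  obtain ⟨p, rfl⟩ := elt_surjective x
  exact h p

open Classical in
/-- The map of graded bimodules induced by a map of polynomials, and `0` if there is none. -/
def polyHom (e : E × E) (A B : Equiv.Perm E × ℤ) (φ : MvPolynomial E S →ₗ[S] MvPolynomial E S) :
    cycObj S e A ⟶ cycObj S e B :=
  if h : Good e A B φ then h.hom else 0

theorem Good.polyHom_elt {φ : MvPolynomial E S →ₗ[S] MvPolynomial E S} (h : Good e A B φ)
    (p : MvPolynomial E S) : (polyHom e A B φ).toLin (elt S e A p) = elt S e B (φ p) := by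
  rw [polyHom, dif_pos h]
  rfl

theorem polyHom_zero (e : E × E) (A B : Equiv.Perm E × ℤ) :
    polyHom e A B (0 : MvPolynomial E S →ₗ[S] _) = 0 :=
  cycObj_hom_ext fun p => by
    rw [(Good.zero e A B).polyHom_elt, LinearMap.zero_apply, map_zero]
    rfl

end Objects

section Twisted

universe u

variable {C : Type u} [Category.{0} C] [Preadditive C]

/-- The matrix has degree `k` with respect to given degrees of its rows and columns. -/
def HasDeg {M N : Mat_ C} (hM : M.ι → ℤ) (hN : N.ι → ℤ) (k : ℤ) (f : M ⟶ N) : Prop :=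
  ∀ i j, hN j ≠ hM i + k → f i j = 0

section HasDeg

variable {M N P : Mat_ C} {hM : M.ι → ℤ} {hN : N.ι → ℤ} {hP : P.ι → ℤ} {k l : ℤ}

theorem HasDeg.comp {f : M ⟶ N} {g : N ⟶ P} (hf : HasDeg hM hN k f) (hg : HasDeg hN hP l g) :
    HasDeg hM hP (k + l) (f ≫ g) := by
  intro i j hij
  rw [Mat_.comp_apply]
  refine Finset.sum_eq_zero fun m _ => ?_
  by_cases h : hN m = hM i + k
  · rw [hg m j (by omega), comp_zero]
  · rw [hf i m h, zero_comp]

theorem HasDeg.add {f g : M ⟶ N} (hf : HasDeg hM hN k f) (hg : HasDeg hM hN k g) :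
    HasDeg hM hN k (f + g) := fun i j hij => by
  rw [Mat_.add_apply, hf i j hij, hg i j hij, add_zero]

theorem HasDeg.neg {f : M ⟶ N} (hf : HasDeg hM hN k f) : HasDeg hM hN k (-f) := fun i j hij => by
  change -(f i j) = 0
  rw [hf i j hij, neg_zero]

theorem HasDeg.sub {f g : M ⟶ N} (hf : HasDeg hM hN k f) (hg : HasDeg hM hN k g) :
    HasDeg hM hN k (f - g) := by
  rw [sub_eq_add_neg]
  exact hf.add hg.neg

theorem HasDeg.zero : HasDeg hM hN k 0 := fun _ _ _ => rfl

theorem HasDeg.id : HasDeg hM hM 0 (𝟙 M) := fun i j hij => by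
  classical
  rw [Mat_.id_apply_of_ne]
  rintro rfl
  exact hij (add_zero _).symm

theorem HasDeg.cast {f : M ⟶ N} (hf : HasDeg hM hN k f) (h : k = l) : HasDeg hM hN l f := h ▸ hf

end HasDeg

variable (C) in
/-- A complex in the additive closure of `C`, with a homological degree for each summand. -/
structure Tw where
  obj : Mat_ C
  h : obj.ι → ℤ
  d : obj ⟶ obj
  d_sq : d ≫ d = 0
  deg : HasDeg h h 1 d

/-- Homotopy equivalence. -/
def Tw.Equiv (M N : Tw C) : Prop :=
  ∃ (f : M.obj ⟶ N.obj) (g : N.obj ⟶ M.obj) (H : M.obj ⟶ M.obj) (K : N.obj ⟶ N.obj),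
    HasDeg M.h N.h 0 f ∧ HasDeg N.h M.h 0 g ∧ HasDeg M.h M.h (-1) H ∧ HasDeg N.h N.h (-1) K ∧
    M.d ≫ f = f ≫ N.d ∧ N.d ≫ g = g ≫ M.d ∧
    f ≫ g = 𝟙 _ + (M.d ≫ H + H ≫ M.d) ∧ g ≫ f = 𝟙 _ + (N.d ≫ K + K ≫ N.d)

theorem Tw.Equiv.trans {M N P : Tw C} (h : M.Equiv N) (k : N.Equiv P) : M.Equiv P := by
  obtain ⟨f, g, H, K, hf, hg, hH, hK, h1, h2, h3, h4⟩ := h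
  obtain ⟨f', g', H', K', hf', hg', hH', hK', h1', h2', h3', h4'⟩ := k
  refine ⟨f ≫ f', g' ≫ g, H + f ≫ H' ≫ g, K' + g' ≫ K ≫ f', hf.comp hf', hg'.comp hg,
    hH.add ((hf.comp (hH'.comp hg)).cast (by ring)),
    hK'.add ((hg'.comp (hK.comp hf')).cast (by ring)), ?_, ?_, ?_, ?_⟩
  · rw [← Category.assoc, h1, Category.assoc, h1', Category.assoc]
  · rw [← Category.assoc, h2', Category.assoc, h2, Category.assoc]
  · have : (f ≫ f') ≫ g' ≫ g = f ≫ (f' ≫ g') ≫ g := by simp only [Category.assoc]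
    rw [this, h3']
    simp only [Preadditive.add_comp, Preadditive.comp_add, Category.id_comp, Category.assoc, h3,
      ← h2]
    rw [← Category.assoc f N.d, ← h1, Category.assoc]
    abel
  · have : (g' ≫ g) ≫ f ≫ f' = g' ≫ (g ≫ f) ≫ f' := by simp only [Category.assoc]
    rw [this, h4]
    simp only [Preadditive.add_comp, Preadditive.comp_add, Category.id_comp, Category.assoc, h4',
      h1']
    rw [← Category.assoc g' N.d, ← h2', Category.assoc]
    abel

theorem Tw.Equiv.refl (M : Tw C) : M.Equiv M :=
  ⟨𝟙 _, 𝟙 _, 0, 0, HasDeg.id, HasDeg.id, HasDeg.zero, HasDeg.zero, by simp, by simp, by simp,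
    by simp⟩

/-- Transport of a complex along an isomorphism of the underlying objects. -/
def Tw.conj (M : Tw C) (N : Mat_ C) (hN : N.ι → ℤ) (f : M.obj ⟶ N) (g : N ⟶ M.obj)
    (hf : HasDeg M.h hN 0 f) (hg : HasDeg hN M.h 0 g) (hfg : f ≫ g = 𝟙 _) : Tw C where
  obj := N
  h := hN
  d := g ≫ M.d ≫ f
  d_sq := by
    have : (g ≫ M.d ≫ f) ≫ g ≫ M.d ≫ f = g ≫ M.d ≫ (f ≫ g) ≫ M.d ≫ f := by
      simp only [Category.assoc]
    rw [this, hfg, Category.id_comp, ← Category.assoc M.d, M.d_sq, zero_comp, comp_zero]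
  deg := (hg.comp (M.deg.comp hf)).cast (by ring)

theorem Tw.equiv_conj (M : Tw C) (N : Mat_ C) (hN : N.ι → ℤ) (f : M.obj ⟶ N) (g : N ⟶ M.obj)
    (hf : HasDeg M.h hN 0 f) (hg : HasDeg hN M.h 0 g) (hfg : f ≫ g = 𝟙 _) (hgf : g ≫ f = 𝟙 _) :
    M.Equiv (M.conj N hN f g hf hg hfg) := by
  refine ⟨f, g, 0, 0, hf, hg, HasDeg.zero, HasDeg.zero, ?_, ?_, ?_, ?_⟩
  · simp only [conj]
    rw [← Category.assoc f, hfg, Category.id_comp]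
  · simp only [conj, Category.assoc]
    rw [hfg, Category.comp_id]
  · rw [comp_zero, zero_comp, add_zero, add_zero]
    exact hfg
  · rw [comp_zero, zero_comp, add_zero, add_zero]
    exact hgf

section Retract

variable (M : Tw C) (A : Mat_ C) (hA : A.ι → ℤ) (i : A ⟶ M.obj) (p : M.obj ⟶ A)
  (H : M.obj ⟶ M.obj)

/-- The deformation retract that belongs to a contraction of a complementary summand. -/
theorem Tw.exists_retract (hi : HasDeg hA M.h 0 i) (hp : HasDeg M.h hA 0 p)
    (hH : HasDeg M.h M.h (-1) H) (hip : i ≫ p = 𝟙 _) (hHdH : H ≫ M.d ≫ H = H) (hHH : H ≫ H = 0)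
    (hiH : i ≫ H = 0) (hHp : H ≫ p = 0)
    (he : (𝟙 _ - M.d ≫ H - H ≫ M.d) ≫ (𝟙 _ - p ≫ i) ≫ (𝟙 _ - M.d ≫ H - H ≫ M.d) = 0) :
    ∃ hd hdeg, M.Equiv ⟨A, hA, i ≫ (M.d - M.d ≫ H ≫ M.d) ≫ p, hd, hdeg⟩ := by
  set e := 𝟙 _ - M.d ≫ H - H ≫ M.d with hedef
  have hdd : ∀ {X} (x : M.obj ⟶ X), M.d ≫ M.d ≫ x = 0 := fun x => by
    rw [← Category.assoc, M.d_sq, zero_comp]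
  have hde : M.d ≫ e = M.d - M.d ≫ H ≫ M.d := by
    simp [hedef, Preadditive.comp_sub, hdd]
  have hed : e ≫ M.d = M.d - M.d ≫ H ≫ M.d := by
    simp [hedef, Preadditive.sub_comp, M.d_sq]
  have hee : e ≫ e = e := by
    have h1 : H ≫ e = 0 := by
      simp only [hedef, Preadditive.comp_sub, Category.comp_id, hHdH]
      rw [← Category.assoc, hHH, zero_comp, sub_zero, sub_self]
    conv_lhs => rw [hedef]
    rw [Preadditive.sub_comp, Preadditive.sub_comp, Category.id_comp, Category.assoc,
      Category.assoc, h1, comp_zero, sub_zero]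
    have : M.d ≫ e = e ≫ M.d := by rw [hde, hed]
    rw [this, ← Category.assoc, h1, zero_comp, sub_zero]
  have hdeg0 : HasDeg M.h M.h 0 e :=
    (HasDeg.id.sub ((M.deg.comp hH).cast (by ring))).sub ((hH.comp M.deg).cast (by ring))
  have hiep : (i ≫ e) ≫ e ≫ p = 𝟙 _ := by
    rw [Category.assoc, ← Category.assoc e, hee]
    simp only [hedef, Preadditive.comp_sub, Preadditive.sub_comp, Category.id_comp, hip,
      Category.assoc, hHp, comp_zero, sub_zero]
    rw [← Category.assoc, hiH, zero_comp, sub_zero]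
  have hdA : i ≫ (M.d - M.d ≫ H ≫ M.d) ≫ p = (i ≫ e) ≫ M.d ≫ e ≫ p := by
    rw [← hde]
    have : (i ≫ e) ≫ M.d ≫ e ≫ p = i ≫ (e ≫ M.d) ≫ e ≫ p := by simp only [Category.assoc]
    rw [this, hed, ← hde]
    simp only [Category.assoc]
    rw [← Category.assoc e, hee]
  have hfg : (e ≫ p) ≫ i ≫ e = e := by
    rw [Preadditive.sub_comp (𝟙 _) (p ≫ i) e, Category.id_comp, Preadditive.comp_sub, hee,
      sub_eq_zero] at he
    rw [Category.assoc, ← Category.assoc p]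
    exact he.symm
  rw [hdA]
  refine ⟨?_, (((hi.comp hdeg0).comp (M.deg.comp (hdeg0.comp hp)))).cast (by ring),
    e ≫ p, i ≫ e, -H, 0, hdeg0.comp hp, hi.comp hdeg0, hH.neg, HasDeg.zero, ?_, ?_, ?_, ?_⟩
  · have : ((i ≫ e) ≫ M.d ≫ e ≫ p) ≫ (i ≫ e) ≫ M.d ≫ e ≫ p =
        (i ≫ e) ≫ M.d ≫ ((e ≫ p) ≫ i ≫ e) ≫ M.d ≫ e ≫ p := by simp only [Category.assoc]
    rw [this, hfg]
    have : (i ≫ e) ≫ M.d ≫ e ≫ M.d ≫ e ≫ p = (i ≫ e) ≫ M.d ≫ (e ≫ M.d) ≫ e ≫ p := by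
      simp only [Category.assoc]
    rw [this, hed, ← hde, Category.assoc M.d e, hdd, comp_zero]
  · have : (e ≫ p) ≫ (i ≫ e) ≫ M.d ≫ e ≫ p = ((e ≫ p) ≫ i ≫ e) ≫ M.d ≫ e ≫ p := by
      simp only [Category.assoc]
    change M.d ≫ e ≫ p = (e ≫ p) ≫ (i ≫ e) ≫ M.d ≫ e ≫ p
    rw [this, hfg, ← Category.assoc e, hed, ← hde, Category.assoc, ← Category.assoc e e, hee]
  · change ((i ≫ e) ≫ M.d ≫ e ≫ p) ≫ i ≫ e = (i ≫ e) ≫ M.d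
    have : ((i ≫ e) ≫ M.d ≫ e ≫ p) ≫ i ≫ e = (i ≫ e) ≫ M.d ≫ (e ≫ p) ≫ i ≫ e := by
      simp only [Category.assoc]
    rw [this, hfg, hde, ← hed, Category.assoc, ← Category.assoc e e, hee, Category.assoc]
  · rw [hfg]
    simp only [hedef, Preadditive.comp_neg, Preadditive.neg_comp]
    abel
  · rw [hiep]
    simp

end Retract

/-- The summands selected by a map of the index sets. -/
abbrev matSel (M : Mat_ C) {κ : Type} [Fintype κ] (u : κ → M.ι) : Mat_ C := ⟨κ, fun x => M.X (u x)⟩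

/-- The inclusion of the selected summands. -/
def matIncl (M : Mat_ C) {κ : Type} [Fintype κ] (u : κ → M.ι) : matSel M u ⟶ M :=
  fun x j => 𝟙 M (u x) j

/-- The projection to the selected summands. -/
def matProj (M : Mat_ C) {κ : Type} [Fintype κ] (u : κ → M.ι) : M ⟶ matSel M u :=
  fun i x => 𝟙 M i (u x)

section Select

variable {M : Mat_ C} {κ κ' : Type} [Fintype κ] [Fintype κ'] (u : κ → M.ι) (u' : κ' → M.ι)

theorem matIncl_comp_apply {N : Mat_ C} (f : M ⟶ N) (x : κ) (j : N.ι) :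
    (matIncl M u ≫ f) x j = f (u x) j :=
  (congrFun (congrFun (Category.id_comp f) (u x)) j :)

theorem comp_matProj_apply {N : Mat_ C} (f : N ⟶ M) (i : N.ι) (x : κ) :
    (f ≫ matProj M u) i x = f i (u x) :=
  (congrFun (congrFun (Category.comp_id f) i) (u x) :)

theorem matIncl_matProj (hu : Function.Injective u) : matIncl M u ≫ matProj M u = 𝟙 _ := by
  classical
  funext x y
  rw [comp_matProj_apply]
  change 𝟙 M (u x) (u y) = _
  by_cases h : x = y
  · subst h
    rw [Mat_.id_apply_self, Mat_.id_apply_self]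
  · rw [Mat_.id_apply_of_ne _ _ _ (hu.ne h), Mat_.id_apply_of_ne _ _ _ h]

theorem matIncl_matProj_of_ne (h : ∀ x y, u x ≠ u' y) : matIncl M u ≫ matProj M u' = 0 := by
  classical
  funext x y
  rw [comp_matProj_apply]
  exact Mat_.id_apply_of_ne _ _ _ (h x y)

theorem HasDeg.incl (h : M.ι → ℤ) : HasDeg (M := matSel M u) (h ∘ u) h 0 (matIncl M u) :=
  fun x j hij => HasDeg.id (hM := h) (u x) j hij

theorem HasDeg.proj (h : M.ι → ℤ) : HasDeg (N := matSel M u) h (h ∘ u) 0 (matProj M u) :=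
  fun i x hij => HasDeg.id (hM := h) i (u x) hij

theorem sum_matProj_matIncl {α : Type} [Fintype α] (r : α → M.ι)
    (hb : Function.Bijective (Sum.elim r (Sum.elim u u'))) :
    matProj M r ≫ matIncl M r + (matProj M u ≫ matIncl M u + matProj M u' ≫ matIncl M u') =
      𝟙 M := by
  funext i j
  rw [← Category.id_comp (𝟙 M), Mat_.add_apply, Mat_.add_apply, Mat_.comp_apply, Mat_.comp_apply,
    Mat_.comp_apply, Mat_.comp_apply, ← (Equiv.ofBijective _ hb).sum_comp, Fintype.sum_sum_type,
    Fintype.sum_sum_type]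
  rfl

end Select

/-- Gaussian elimination of an invertible block. -/
theorem Tw.exists_elim (M : Tw C) {α κ : Type} [Fintype α] [Fintype κ] (r : α → M.obj.ι)
    (k t : κ → M.obj.ι) (hb : Function.Bijective (Sum.elim r (Sum.elim k t)))
    (c : matSel M.obj t ⟶ matSel M.obj k)
    (h1 : (matIncl _ k ≫ M.d ≫ matProj _ t) ≫ c = 𝟙 _)
    (h2 : c ≫ (matIncl _ k ≫ M.d ≫ matProj _ t) = 𝟙 _)
    (hc : HasDeg (M.h ∘ t) (M.h ∘ k) (-1) c) :
    ∃ hd hdeg, M.Equiv ⟨matSel M.obj r, M.h ∘ r, fun i j => M.d (r i) (r j) -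
      ∑ y, (∑ x, M.d (r i) (t x) ≫ c x y) ≫ M.d (k y) (r j), hd, hdeg⟩ := by
  have hr : Function.Injective r := fun x y h => by
    simpa using hb.1 (a₁ := Sum.inl x) (a₂ := Sum.inl y) h
  have hrt : ∀ x y, r x ≠ t y := fun x y h => by
    simpa using hb.1 (a₁ := Sum.inl x) (a₂ := Sum.inr (Sum.inr y)) h
  have hrk : ∀ x y, r x ≠ k y := fun x y h => by
    simpa using hb.1 (a₁ := Sum.inl x) (a₂ := Sum.inr (Sum.inl y)) h
  have hkt : ∀ x y, k x ≠ t y := fun x y h => by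
    simpa using hb.1 (a₁ := Sum.inr (Sum.inl x)) (a₂ := Sum.inr (Sum.inr y)) h
  have e1 := matIncl_matProj r hr
  have e2 := matIncl_matProj_of_ne r t hrt
  have e3 := matIncl_matProj_of_ne k r fun x y => (hrk y x).symm
  have e4 := matIncl_matProj_of_ne k t hkt
  have e5 := sum_matProj_matIncl k t r hb
  set H := matProj _ t ≫ c ≫ matIncl _ k with hH
  have e6 : (𝟙 _ - M.d ≫ H - H ≫ M.d) ≫ matProj _ t = 0 := by
    simp only [Preadditive.sub_comp, Category.id_comp, hH, Category.assoc] at h2 ⊢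
    rw [e4, h2]
    simp
  have e7 : matIncl _ k ≫ (𝟙 _ - M.d ≫ H - H ≫ M.d) = 0 := by
    have h1' : matIncl _ k ≫ M.d ≫ matProj _ t ≫ c ≫ matIncl _ k = matIncl _ k := by
      have := congrArg (· ≫ matIncl _ k) h1
      simpa only [Category.assoc, Category.id_comp] using this
    simp only [Preadditive.comp_sub, Category.comp_id, hH, Category.assoc, h1']
    rw [← Category.assoc (matIncl _ k) (matProj _ t), e4, zero_comp, sub_zero, sub_self]
  obtain ⟨hd, hdeg, hE⟩ := M.exists_retract (matSel M.obj r) (M.h ∘ r) (matIncl _ r) (matProj _ r) H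
    (HasDeg.incl r M.h) (HasDeg.proj r M.h)
    (((HasDeg.proj t M.h).comp (hc.comp (HasDeg.incl k M.h))).cast (by ring)) e1
    (by
      have : H ≫ M.d ≫ H = matProj _ t ≫ (c ≫ (matIncl _ k ≫ M.d ≫ matProj _ t)) ≫ c ≫
        matIncl _ k := by simp only [hH, Category.assoc]
      rw [this, h2, Category.id_comp])
    (by
      have : H ≫ H = matProj _ t ≫ c ≫ (matIncl _ k ≫ matProj _ t) ≫ c ≫
        matIncl _ k := by simp only [hH, Category.assoc]
      rw [this, e4, zero_comp, comp_zero, comp_zero])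
    (by rw [hH, ← Category.assoc, e2, zero_comp])
    (by rw [hH, Category.assoc, Category.assoc, e3, comp_zero, comp_zero])
    (by
      have e8 : 𝟙 M.obj - matProj _ r ≫ matIncl _ r =
          matProj _ k ≫ matIncl _ k + matProj _ t ≫ matIncl _ t := by
        rw [← e5, add_sub_cancel_left]
      rw [e8, Preadditive.add_comp, Preadditive.comp_add, Category.assoc (matProj _ k) (matIncl _ k),
        Category.assoc (matProj _ t) (matIncl _ t), e7,
        comp_zero, comp_zero, zero_add, ← Category.assoc, e6, zero_comp])
  have hd' : matIncl _ r ≫ (M.d - M.d ≫ H ≫ M.d) ≫ matProj _ r = fun i j => M.d (r i) (r j) -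
      ∑ y, (∑ x, M.d (r i) (t x) ≫ c x y) ≫ M.d (k y) (r j) := by
    funext i j
    rw [matIncl_comp_apply, comp_matProj_apply]
    refine congrArg (M.d (r i) (r j) - ·) ?_
    have : M.d ≫ H ≫ M.d = ((M.d ≫ matProj _ t) ≫ c) ≫ matIncl _ k ≫ M.d := by
      simp only [hH, Category.assoc]
    rw [this, Mat_.comp_apply]
    refine Finset.sum_congr rfl fun y _ => ?_
    rw [matIncl_comp_apply, Mat_.comp_apply]
    congr 1
    exact Finset.sum_congr rfl fun x _ => by rw [comp_matProj_apply]
  revert hd hdeg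
  rw [hd']
  exact fun hd hdeg hE => ⟨hd, hdeg, hE⟩

section Realize

/-- The projection to the summands of degree `n`. -/
def Tw.part (M : Tw C) (n : ℤ) : M.obj ⟶ M.obj := fun i j => if M.h i = n then 𝟙 M.obj i j else 0

theorem Tw.part_comp_apply (M : Tw C) {N : Mat_ C} (n : ℤ) (f : M.obj ⟶ N) (i j) :
    (M.part n ≫ f) i j = if M.h i = n then f i j else 0 := by
  rw [Mat_.comp_apply]
  split_ifs with h
  · conv_rhs => rw [← Category.id_comp f, Mat_.comp_apply]
    simp only [part, if_pos h]
  · refine Finset.sum_eq_zero fun m _ => ?_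
    simp only [part, if_neg h, zero_comp]

theorem Tw.comp_part_apply (M : Tw C) {N : Mat_ C} (n : ℤ) (f : N ⟶ M.obj) (i j) :
    (f ≫ M.part n) i j = if M.h j = n then f i j else 0 := by
  classical
  have hp : ∀ m, M.part n m j = if M.h j = n then 𝟙 M.obj m j else 0 := fun m => by
    by_cases h : m = j
    · subst h; rfl
    · simp [part, Mat_.id_apply_of_ne _ _ _ h]
  rw [Mat_.comp_apply]
  split_ifs with h
  · conv_rhs => rw [← Category.comp_id f, Mat_.comp_apply]
    simp only [hp, if_pos h]
  · refine Finset.sum_eq_zero fun m _ => ?_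
    rw [hp, if_neg h, comp_zero]

theorem HasDeg.part_comp {M N : Tw C} {k : ℤ} {f : M.obj ⟶ N.obj} (hf : HasDeg M.h N.h k f)
    (n m : ℤ) (h : m = n + k) : M.part n ≫ f = f ≫ N.part m := by
  funext i j
  rw [M.part_comp_apply, N.comp_part_apply]
  by_cases hij : N.h j = M.h i + k
  · have : M.h i = n ↔ N.h j = m := by omega
    simp only [this]
  · rw [hf i j hij, ite_self, ite_self]

theorem Tw.part_part_of_ne (M : Tw C) {n m : ℤ} (h : n ≠ m) : M.part n ≫ M.part m = 0 := by
  funext i j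
  rw [M.part_comp_apply]
  split_ifs with h1
  · simp only [part]
    rw [if_neg (by omega)]
    rfl
  · rfl

/-- A cochain complex of `C` that is the direct sum of the summands of `M`. -/
structure Tw.Realizes (M : Tw C) (K : CochainComplex C ℤ) where
  pr : ∀ n, (Mat_.embedding C).obj (K.X n) ⟶ M.obj
  inj : ∀ n, M.obj ⟶ (Mat_.embedding C).obj (K.X n)
  pr_inj : ∀ n, pr n ≫ inj n = 𝟙 _
  inj_pr : ∀ n, inj n ≫ pr n = M.part n
  map_d : ∀ n, (Mat_.embedding C).map (K.d n (n + 1)) = pr n ≫ M.d ≫ inj (n + 1)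

variable {M N : Tw C} {K L : CochainComplex C ℤ}

theorem Tw.Realizes.pr_part (r : M.Realizes K) (n : ℤ) : r.pr n ≫ M.part n = r.pr n := by
  rw [← r.inj_pr, ← Category.assoc, r.pr_inj, Category.id_comp]

theorem Tw.Realizes.part_inj (r : M.Realizes K) (n : ℤ) : M.part n ≫ r.inj n = r.inj n := by
  rw [← r.inj_pr, Category.assoc, r.pr_inj, Category.comp_id]

theorem Tw.Realizes.part_inj_of_ne (r : M.Realizes K) {n m : ℤ} (h : n ≠ m) :
    M.part n ≫ r.inj m = 0 := by
  rw [← r.part_inj, ← Category.assoc, M.part_part_of_ne h, zero_comp]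

theorem Tw.Realizes.sandwich (r : M.Realizes K) {k : ℤ} {A : Tw C} {X Z : Mat_ C}
    {f : A.obj ⟶ M.obj} (hf : HasDeg A.h M.h k f) (g : M.obj ⟶ Z) {n m : ℤ} {p : X ⟶ A.obj}
    (hp : p ≫ A.part n = p) (hm : m = n + k) :
    p ≫ f ≫ r.inj m ≫ r.pr m ≫ g = p ≫ f ≫ g := by
  rw [← Category.assoc (r.inj m), r.inj_pr, ← Category.assoc f, ← hf.part_comp n m hm,
    Category.assoc, ← Category.assoc p, hp]

/-- The map of complexes induced by a matrix. -/
def Tw.Realizes.map (r : M.Realizes K) (s : N.Realizes L) {f : M.obj ⟶ N.obj}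
    (hf : HasDeg M.h N.h 0 f) (hd : M.d ≫ f = f ≫ N.d) : K ⟶ L where
  f n := (Mat_.embedding C).preimage (r.pr n ≫ f ≫ s.inj n)
  comm' n m hnm := by
    obtain rfl : n + 1 = m := hnm
    apply (Mat_.embedding C).map_injective
    rw [Functor.map_comp, Functor.map_comp, Functor.map_preimage, Functor.map_preimage, r.map_d,
      s.map_d]
    simp only [Category.assoc]
    rw [s.sandwich hf _ (r.pr_part n) (by ring), r.sandwich M.deg _ (r.pr_part n) rfl,
      ← Category.assoc f, ← hd, Category.assoc]

/-- The homotopy induced by a matrix. -/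
def Tw.Realizes.homotopy (r : M.Realizes K) {φ : K ⟶ K} {f H : M.obj ⟶ M.obj}
    (hφ : ∀ n, (Mat_.embedding C).map (φ.f n) = r.pr n ≫ f ≫ r.inj n)
    (hH : HasDeg M.h M.h (-1) H) (hf : f = 𝟙 _ + (M.d ≫ H + H ≫ M.d)) : Homotopy φ (𝟙 K) where
  hom n m := (Mat_.embedding C).preimage (r.pr n ≫ H ≫ r.inj m)
  zero n m hnm := by
    apply (Mat_.embedding C).map_injective
    rw [Functor.map_preimage, Functor.map_zero]
    rw [← r.pr_part n, Category.assoc, ← Category.assoc _ H, hH.part_comp n (n - 1) (by ring),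
      Category.assoc, r.part_inj_of_ne, comp_zero, comp_zero]
    rintro rfl
    exact hnm (by simp)
  comm n := by
    apply (Mat_.embedding C).map_injective
    rw [dNext_eq _ (show (ComplexShape.up ℤ).Rel n (n + 1) by simp),
      prevD_eq _ (show (ComplexShape.up ℤ).Rel (n - 1) n by simp), hφ, Functor.map_add,
      Functor.map_add, Functor.map_comp, Functor.map_comp, Functor.map_preimage,
      Functor.map_preimage, r.map_d]
    have h : (Mat_.embedding C).map (K.d (n - 1) n) = r.pr (n - 1) ≫ M.d ≫ r.inj n := by
      have := r.map_d (n - 1)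
      rw [sub_add_cancel] at this
      exact this
    rw [h]
    simp only [Category.assoc]
    rw [r.sandwich M.deg _ (r.pr_part n) rfl, r.sandwich hH _ (r.pr_part n) (by ring), hf,
      HomologicalComplex.id_f, CategoryTheory.Functor.map_id]
    simp only [Preadditive.add_comp, Preadditive.comp_add, Category.id_comp, Category.assoc,
      r.pr_inj]
    abel

theorem Tw.Equiv.nonempty_homotopyEquiv (h : M.Equiv N) (r : M.Realizes K) (s : N.Realizes L) :
    Nonempty (HomotopyEquiv K L) := by
  obtain ⟨f, g, H, H', hf, hg, hH, hH', h1, h2, h3, h4⟩ := h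
  refine ⟨⟨r.map s hf h1, s.map r hg h2, r.homotopy (f := f ≫ g) (fun n => ?_) hH h3,
    s.homotopy (f := g ≫ f) (fun n => ?_) hH' h4⟩⟩
  · rw [HomologicalComplex.comp_f, Functor.map_comp]
    simp only [Realizes.map, Functor.map_preimage, Category.assoc]
    rw [s.sandwich hf _ (r.pr_part n) (by ring)]
  · rw [HomologicalComplex.comp_f, Functor.map_comp]
    simp only [Realizes.map, Functor.map_preimage, Category.assoc]
    rw [r.sandwich hg _ (s.pr_part n) (by ring)]

end Realize

end Twisted

section Bubble

variable {E : Type} [Fintype E] [DecidableEq E] {S : Type} [CommRing S]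

/-- The cycles of `α₁` are those of `α`, except that the loop `L` has been cut off. -/
structure Bubble (α α₁ : Equiv.Perm E) (L : Finset E) (x y z : E) : Prop where
  eq : α₁ = α * Equiv.swap x y
  inv : ∀ e, α₁ e ∈ L ↔ e ∈ L
  hx : x ∈ L
  hy : y ∉ L
  hz : z ∈ L
  same : ∀ e ∈ L, α₁.SameCycle e z

namespace Bubble

variable {α α₁ : Equiv.Perm E} {L : Finset E} {x y z : E}

theorem ne (h : Bubble α α₁ L x y z) : x ≠ y := fun e => h.hy (e ▸ h.hx)

theorem mem_iff (h : Bubble α α₁ L x y z) {e f : E} (hef : α₁.SameCycle e f) : e ∈ L ↔ f ∈ L := by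
  have := Inv.sameCycle (π := α₁) (γ := fun e => decide (e ∈ L))
    (fun e => by rw [decide_eq_decide]; exact h.inv e) hef
  rwa [decide_eq_decide] at this

theorem not_same (h : Bubble α α₁ L x y z) : ¬ α₁.SameCycle x y := fun e => h.hy ((h.mem_iff e).1 h.hx)

theorem eq' (h : Bubble α α₁ L x y z) : α = α₁ * Equiv.swap x y := by
  rw [h.eq, mul_assoc, Equiv.swap_mul_self, mul_one]

theorem same_of_mem (h : Bubble α α₁ L x y z) {e : E} (he : e ∈ L) : α.SameCycle e y := by
  rw [h.eq', sameCycle_mul_swap_iff h.ne h.not_same]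
  exact Or.inr (Or.inl ⟨(h.same e he).trans (h.same x h.hx).symm, .refl _ _⟩)

theorem sameCycle_iff (h : Bubble α α₁ L x y z) {e f : E} (he : e ∉ L) (hf : f ∉ L) :
    α.SameCycle e f ↔ α₁.SameCycle e f := by
  rw [h.eq', sameCycle_mul_swap_iff h.ne h.not_same]
  constructor
  · rintro (h1 | ⟨h1, -⟩ | ⟨-, h1⟩)
    · exact h1
    · exact absurd ((h.mem_iff h1).2 h.hx) he
    · exact absurd ((h.mem_iff h1).1 h.hx) hf
  · exact Or.inl

theorem same_split (h : Bubble α α₁ L x y z) : α.SameCycle x y := h.same_of_mem h.hx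

theorem cycles_eq (h : Bubble α α₁ L x y z) : cycles α₁ = cycles α + 1 := by
  rw [h.eq]
  exact cycles_split h.ne h.same_split

end Bubble

variable (S) in
/-- The map on polynomials that puts `X_y` for all variables of the loop. -/
def birth (L : Finset E) (y : E) : MvPolynomial E S →ₐ[S] MvPolynomial E S :=
  MvPolynomial.aeval fun e => if e ∈ L then MvPolynomial.X y else MvPolynomial.X e

variable (S) in
/-- Splitting off the variables of the loop. -/
def loopExp (L : Finset E) : MvPolynomial E S →ₐ[S] DualNumber (MvPolynomial E S) :=
  MvPolynomial.aeval fun e => if e ∈ L then DualNumber.eps else TrivSqZeroExt.inl (MvPolynomial.X e)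

variable (S) in
/-- The coefficient of the variable of the loop. -/
def death (L : Finset E) : MvPolynomial E S →ₗ[S] MvPolynomial E S where
  toFun p := (loopExp S L p).snd
  map_add' p q := by rw [map_add, TrivSqZeroExt.snd_add]
  map_smul' s p := by rw [map_smul, TrivSqZeroExt.snd_smul, RingHom.id_apply]

variable (S) in
/-- The part without the variable of the loop. -/
def rest (L : Finset E) : MvPolynomial E S →ₗ[S] MvPolynomial E S where
  toFun p := (loopExp S L p).fst
  map_add' p q := by rw [map_add, TrivSqZeroExt.fst_add]
  map_smul' s p := by rw [map_smul, TrivSqZeroExt.fst_smul, RingHom.id_apply]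

section

variable {L : Finset E} {y : E}

theorem birth_X_of_mem {e : E} (he : e ∈ L) :
    birth S L y (MvPolynomial.X e) = MvPolynomial.X y := by
  rw [birth, MvPolynomial.aeval_X, if_pos he]

theorem birth_X_of_not_mem {e : E} (he : e ∉ L) :
    birth S L y (MvPolynomial.X e) = MvPolynomial.X e := by
  rw [birth, MvPolynomial.aeval_X, if_neg he]

theorem death_mul (p q : MvPolynomial E S) :
    death S L (p * q) = rest S L p * death S L q + death S L p * rest S L q := by
  change (loopExp S L (p * q)).snd = _
  rw [map_mul, TrivSqZeroExt.snd_mul]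
  simp only [death, rest, LinearMap.coe_mk, AddHom.coe_mk, smul_eq_mul, MulOpposite.smul_eq_mul_unop,
    MulOpposite.unop_op]

theorem rest_mul (p q : MvPolynomial E S) : rest S L (p * q) = rest S L p * rest S L q := by
  change (loopExp S L (p * q)).fst = _
  rw [map_mul, TrivSqZeroExt.fst_mul]
  rfl

theorem loopExp_X_of_mem {e : E} (he : e ∈ L) :
    loopExp S L (MvPolynomial.X e) = DualNumber.eps := by
  rw [loopExp, MvPolynomial.aeval_X, if_pos he]

theorem loopExp_X_of_not_mem {e : E} (he : e ∉ L) :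
    loopExp S L (MvPolynomial.X e) = TrivSqZeroExt.inl (MvPolynomial.X e) := by
  rw [loopExp, MvPolynomial.aeval_X, if_neg he]

theorem death_X_of_mem {e : E} (he : e ∈ L) : death S L (MvPolynomial.X e) = 1 := by
  change (loopExp S L _).snd = _
  rw [loopExp_X_of_mem he, DualNumber.snd_eps]

theorem rest_X_of_mem {e : E} (he : e ∈ L) : rest S L (MvPolynomial.X e) = 0 := by
  change (loopExp S L _).fst = _
  rw [loopExp_X_of_mem he, DualNumber.fst_eps]

theorem death_X_of_not_mem {e : E} (he : e ∉ L) : death S L (MvPolynomial.X e) = 0 := by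
  change (loopExp S L _).snd = _
  rw [loopExp_X_of_not_mem he, TrivSqZeroExt.snd_inl]

theorem rest_X_of_not_mem {e : E} (he : e ∉ L) :
    rest S L (MvPolynomial.X e) = MvPolynomial.X e := by
  change (loopExp S L _).fst = _
  rw [loopExp_X_of_not_mem he, TrivSqZeroExt.fst_inl]

theorem death_C (s : S) : death S L (MvPolynomial.C s) = 0 := by
  change (loopExp S L _).snd = _
  rw [loopExp, MvPolynomial.aeval_C]
  exact TrivSqZeroExt.snd_inl _ _

theorem rest_C (s : S) : rest S L (MvPolynomial.C s) = MvPolynomial.C s := by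
  change (loopExp S L _).fst = _
  rw [loopExp, MvPolynomial.aeval_C]
  exact TrivSqZeroExt.fst_inl _ _

theorem death_one : death S L 1 = 0 := by simpa using death_C (L := L) (1 : S)

theorem rest_one : rest S L 1 = 1 := by simpa using rest_C (L := L) (1 : S)

/-- The polynomial does not involve the variables of the loop. -/
def Avoids (L : Finset E) (p : MvPolynomial E S) : Prop := death S L p = 0 ∧ rest S L p = p

theorem Avoids.mul {p q : MvPolynomial E S} (hp : Avoids L p) (hq : Avoids L q) :
    Avoids L (p * q) := by
  constructor
  · rw [death_mul, hp.1, hq.1, mul_zero, zero_mul, add_zero]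
  · rw [rest_mul, hp.2, hq.2]

theorem Avoids.add {p q : MvPolynomial E S} (hp : Avoids L p) (hq : Avoids L q) :
    Avoids L (p + q) := by
  constructor
  · rw [map_add, hp.1, hq.1, add_zero]
  · rw [map_add, hp.2, hq.2]

theorem Avoids.C (s : S) : Avoids L (MvPolynomial.C s) := ⟨death_C s, rest_C s⟩

theorem Avoids.one : Avoids L (1 : MvPolynomial E S) := ⟨death_one, rest_one⟩

theorem Avoids.X {e : E} (he : e ∉ L) : Avoids L (MvPolynomial.X e : MvPolynomial E S) :=
  ⟨death_X_of_not_mem he, rest_X_of_not_mem he⟩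

theorem Avoids.stepPoly {a b : E} (ha : a ∉ L) (hb : b ∉ L) (π : Equiv.Perm E) :
    Avoids L (stepPoly (0 : S) π a b) := by
  rw [Khovanov.stepPoly]
  split_ifs
  · rw [MvPolynomial.C_0, sub_zero]
    exact (Avoids.X ha).add (Avoids.X hb)
  · exact Avoids.one

theorem Avoids.wordPoly {w : List (E × E)} (hw : ∀ p ∈ w, p.1 ∉ L ∧ p.2 ∉ L) (π : Equiv.Perm E) :
    Avoids L (wordPoly (0 : S) π w) := by
  induction w generalizing π with
  | nil => exact Avoids.one
  | cons p w ih =>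
    exact (Avoids.stepPoly (hw p List.mem_cons_self).1 (hw p List.mem_cons_self).2 π).mul
      (ih (fun q hq => hw q (List.mem_cons_of_mem _ hq)) _)

theorem avoids_birth (hy : y ∉ L) (p : MvPolynomial E S) : Avoids L (birth S L y p) := by
  induction p using MvPolynomial.induction_on with
  | C s => rw [birth, MvPolynomial.aeval_C]; exact Avoids.C s
  | add p q hp hq => rw [map_add]; exact hp.add hq
  | mul_X p e hp =>
    rw [map_mul]
    refine hp.mul ?_
    by_cases he : e ∈ L
    · rw [birth_X_of_mem he]; exact Avoids.X hy
    · rw [birth_X_of_not_mem he]; exact Avoids.X he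

theorem Avoids.death_mul {q : MvPolynomial E S} (hq : Avoids L q) (p : MvPolynomial E S) :
    death S L (p * q) = death S L p * q := by
  rw [Khovanov.death_mul, hq.1, hq.2, mul_zero, zero_add]

theorem sub_mem_of_subst {π : Equiv.Perm E} (f : MvPolynomial E S →ₐ[S] MvPolynomial E S)
    (hf : ∀ e, MvPolynomial.X e - f (MvPolynomial.X e) ∈ cycIdeal S π) (p : MvPolynomial E S) :
    p - f p ∈ cycIdeal S π := by
  induction p using MvPolynomial.induction_on with
  | C s =>
    have : f (MvPolynomial.C s) = MvPolynomial.C s := f.commutes s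
    rw [this, sub_self]
    exact zero_mem _
  | add p q hp hq =>
    rw [map_add]
    convert add_mem hp hq using 1
    ring
  | mul_X p e hp =>
    rw [map_mul]
    convert add_mem (Ideal.mul_mem_right (MvPolynomial.X e) _ hp)
      (Ideal.mul_mem_left _ (f p) (hf e)) using 1
    ring

theorem sub_birth_mem {π : Equiv.Perm E} (h : ∀ e ∈ L, π.SameCycle e y) (p : MvPolynomial E S) :
    p - birth S L y p ∈ cycIdeal S π := by
  refine sub_mem_of_subst _ (fun e => ?_) p
  by_cases he : e ∈ L
  · rw [birth_X_of_mem he]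
    exact sub_mem_cycIdeal S (h e he)
  · rw [birth_X_of_not_mem he, sub_self]
    exact zero_mem _

theorem birth_of_avoids {p : MvPolynomial E S} (hp : Avoids L p) : birth S L y p = p := by
  have key : ∀ p : MvPolynomial E S, birth S L y (rest S L p) = rest S L p := by
    intro p
    induction p using MvPolynomial.induction_on with
    | C s => rw [rest_C, birth, MvPolynomial.aeval_C]; rfl
    | add p q hp hq => rw [map_add, map_add, hp, hq]
    | mul_X p e hp =>
      rw [rest_mul, map_mul, hp]
      congr 1
      by_cases he : e ∈ L
      · rw [rest_X_of_mem he, map_zero]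
      · rw [rest_X_of_not_mem he, birth_X_of_not_mem he]
  have := key p
  rwa [hp.2] at this

theorem birth_isWeightedHomogeneous {p : MvPolynomial E S} {d : ℤ}
    (hp : MvPolynomial.IsWeightedHomogeneous (wt (E := E)) p d) :
    MvPolynomial.IsWeightedHomogeneous (wt (E := E)) (birth S L y p) d := by
  have h1 : ∀ m : E →₀ ℕ, MvPolynomial.IsWeightedHomogeneous (wt (E := E))
      (birth S L y (MvPolynomial.monomial m 1)) (Finsupp.weight (wt (E := E)) m) := by
    intro m
    rw [birth, MvPolynomial.aeval_monomial, map_one, one_mul, Finsupp.weight_apply, Finsupp.prod,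
      Finsupp.sum]
    refine MvPolynomial.IsWeightedHomogeneous.prod _ _ _ fun e _ => ?_
    refine MvPolynomial.IsWeightedHomogeneous.pow ?_ _
    split_ifs
    · exact MvPolynomial.isWeightedHomogeneous_X S _ y
    · exact MvPolynomial.isWeightedHomogeneous_X S _ e
  rw [p.as_sum, map_sum]
  refine MvPolynomial.IsWeightedHomogeneous.sum _ _ _ fun m hm => ?_
  have h2 := h1 m
  rw [hp (MvPolynomial.mem_support_iff.1 hm)] at h2
  have : MvPolynomial.monomial m (p.coeff m) = p.coeff m • MvPolynomial.monomial m (1 : S) := by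
    rw [MvPolynomial.smul_monomial, smul_eq_mul, mul_one]
  rw [this, map_smul]
  exact Submodule.smul_mem (MvPolynomial.weightedHomogeneousSubmodule S _ _) _ h2

theorem loop_isWeightedHomogeneous {p : MvPolynomial E S} {d : ℤ}
    (hp : MvPolynomial.IsWeightedHomogeneous (wt (E := E)) p d) :
    MvPolynomial.IsWeightedHomogeneous (wt (E := E)) (rest S L p) d ∧
      MvPolynomial.IsWeightedHomogeneous (wt (E := E)) (death S L p) (d + 2) := by
  have h1 : ∀ m : E →₀ ℕ, MvPolynomial.IsWeightedHomogeneous (wt (E := E))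
      (rest S L (MvPolynomial.monomial m 1)) (Finsupp.weight (wt (E := E)) m) ∧
      MvPolynomial.IsWeightedHomogeneous (wt (E := E))
      (death S L (MvPolynomial.monomial m 1)) (Finsupp.weight (wt (E := E)) m + 2) := by
    intro m
    induction m using Finsupp.induction_linear with
    | zero =>
      have : (MvPolynomial.monomial 0 1 : MvPolynomial E S) = 1 := rfl
      rw [this, rest_one, death_one, map_zero]
      exact ⟨MvPolynomial.isWeightedHomogeneous_one _ _, MvPolynomial.isWeightedHomogeneous_zero _ _ _⟩
    | add m n hm hn =>
      have : (MvPolynomial.monomial (m + n) 1 : MvPolynomial E S) =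
          MvPolynomial.monomial m 1 * MvPolynomial.monomial n 1 := by
        rw [MvPolynomial.monomial_mul, mul_one]
      rw [this, rest_mul, death_mul, map_add]
      refine ⟨hm.1.mul hn.1, ?_⟩
      have e1 := hm.1.mul hn.2
      have e2 := hm.2.mul hn.1
      rw [← add_assoc] at e1
      rw [add_right_comm] at e2
      exact e1.add e2
    | single e n =>
      induction n with
      | zero =>
        have : (MvPolynomial.monomial (Finsupp.single e 0) 1 : MvPolynomial E S) = 1 := by
          rw [Finsupp.single_zero]; rfl
        rw [this, rest_one, death_one, Finsupp.single_zero, map_zero]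
        exact ⟨MvPolynomial.isWeightedHomogeneous_one _ _,
          MvPolynomial.isWeightedHomogeneous_zero _ _ _⟩
      | succ n ih =>
        have : (MvPolynomial.monomial (Finsupp.single e (n + 1)) 1 : MvPolynomial E S) =
            MvPolynomial.monomial (Finsupp.single e n) 1 * MvPolynomial.X e := by
          rw [MvPolynomial.X, MvPolynomial.monomial_mul, mul_one, Finsupp.single_add]
        rw [this, rest_mul, death_mul, Finsupp.single_add, map_add]
        have hX := MvPolynomial.isWeightedHomogeneous_X S (wt (E := E)) e
        have hw : Finsupp.weight (wt (E := E)) (Finsupp.single e 1) = -2 := by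
          simp [Finsupp.weight_single]
        rw [hw]
        by_cases he : e ∈ L
        · rw [rest_X_of_mem he, death_X_of_mem he, mul_zero, mul_zero, add_zero, mul_one]
          refine ⟨MvPolynomial.isWeightedHomogeneous_zero _ _ _, ?_⟩
          rw [add_assoc, neg_add_cancel, add_zero]
          exact ih.1
        · rw [rest_X_of_not_mem he, death_X_of_not_mem he, mul_zero, zero_add]
          refine ⟨ih.1.mul hX, ?_⟩
          have := ih.2.mul hX
          rwa [add_right_comm] at this
  have h3 : ∀ m ∈ p.support, MvPolynomial.monomial m (p.coeff m) =
      p.coeff m • MvPolynomial.monomial m (1 : S) := fun m _ => by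
    rw [MvPolynomial.smul_monomial, smul_eq_mul, mul_one]
  have h4 : ∀ m ∈ p.support, Finsupp.weight (wt (E := E)) m = d := fun m hm =>
    hp (MvPolynomial.mem_support_iff.1 hm)
  rw [p.as_sum, map_sum, map_sum]
  constructor
  · refine MvPolynomial.IsWeightedHomogeneous.sum _ _ _ fun m hm => ?_
    rw [h3 m hm, map_smul]
    exact Submodule.smul_mem (MvPolynomial.weightedHomogeneousSubmodule S _ _) _ (h4 m hm ▸ (h1 m).1)
  · refine MvPolynomial.IsWeightedHomogeneous.sum _ _ _ fun m hm => ?_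
    rw [h3 m hm, map_smul]
    exact Submodule.smul_mem (MvPolynomial.weightedHomogeneousSubmodule S _ _) _ (h4 m hm ▸ (h1 m).2)

end

namespace Bubble

variable {α α₁ : Equiv.Perm E} {L : Finset E} {x y z : E}

theorem loop_mem (h : Bubble α α₁ L x y z) {p : MvPolynomial E S} (hp : p ∈ cycIdeal S α₁) :
    rest S L p ∈ cycIdeal S α ∧ death S L p ∈ cycIdeal S α := by
  refine Submodule.span_induction (p := fun p _ => rest S L p ∈ cycIdeal S α ∧
    death S L p ∈ cycIdeal S α) ?_ ?_ ?_ ?_ hp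
  · rintro _ (⟨e, rfl⟩ | ⟨e, rfl⟩)
    · rw [sq, rest_mul, death_mul]
      by_cases he : e ∈ L
      · rw [rest_X_of_mem he, mul_zero, zero_mul, zero_add, mul_zero]
        exact ⟨zero_mem _, zero_mem _⟩
      · rw [rest_X_of_not_mem he, death_X_of_not_mem he, mul_zero, zero_mul, zero_add, ← sq]
        exact ⟨sq_mem_cycIdeal S α e, zero_mem _⟩
    · rw [map_sub, map_sub]
      by_cases he : e ∈ L
      · have he' := (h.inv e).2 he
        rw [rest_X_of_mem he, rest_X_of_mem he', death_X_of_mem he, death_X_of_mem he', sub_self,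
          sub_self]
        exact ⟨zero_mem _, zero_mem _⟩
      · have he' : α₁ e ∉ L := fun h' => he ((h.inv e).1 h')
        rw [rest_X_of_not_mem he, rest_X_of_not_mem he', death_X_of_not_mem he,
          death_X_of_not_mem he', sub_self]
        refine ⟨sub_mem_cycIdeal S ((h.sameCycle_iff he he').2 ?_), zero_mem _⟩
        exact Equiv.Perm.sameCycle_apply_right.2 (.refl _ _)
  · rw [map_zero, map_zero]
    exact ⟨zero_mem _, zero_mem _⟩
  · intro p q _ _ hp hq
    rw [map_add, map_add]
    exact ⟨add_mem hp.1 hq.1, add_mem hp.2 hq.2⟩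
  · intro a p _ hp
    rw [smul_eq_mul, rest_mul, death_mul]
    exact ⟨Ideal.mul_mem_left _ _ hp.1, add_mem (Ideal.mul_mem_left _ _ hp.2)
      (Ideal.mul_mem_left _ _ hp.1)⟩

theorem birth_mem (h : Bubble α α₁ L x y z) {p : MvPolynomial E S} (hp : p ∈ cycIdeal S α) :
    birth S L y p ∈ cycIdeal S α₁ := by
  have hX : ∀ e, ∃ f, birth S L y (MvPolynomial.X e) = MvPolynomial.X f ∧ f ∉ L ∧
      α.SameCycle e f := by
    intro e
    by_cases he : e ∈ L
    · exact ⟨y, birth_X_of_mem he, h.hy, h.same_of_mem he⟩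
    · exact ⟨e, birth_X_of_not_mem he, he, .refl _ _⟩
  refine Submodule.span_induction (p := fun p _ => birth S L y p ∈ cycIdeal S α₁) ?_ ?_ ?_ ?_ hp
  · rintro _ (⟨e, rfl⟩ | ⟨e, rfl⟩)
    · obtain ⟨f, hf, -⟩ := hX e
      rw [map_pow, hf]
      exact sq_mem_cycIdeal S α₁ f
    · obtain ⟨f, hf, hf', hf''⟩ := hX e
      obtain ⟨g, hg, hg', hg''⟩ := hX (α e)
      rw [map_sub, hf, hg]
      refine sub_mem_cycIdeal S ((h.sameCycle_iff hf' hg').1 (hf''.symm.trans (.trans ?_ hg'')))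
      exact Equiv.Perm.sameCycle_apply_right.2 (.refl _ _)
  · rw [map_zero]
    exact zero_mem _
  · intro p q _ _ hp hq
    rw [map_add]
    exact add_mem hp hq
  · intro a p _ hp
    rw [smul_eq_mul, map_mul]
    exact Ideal.mul_mem_left _ _ hp

theorem sub_birth_mem' (h : Bubble α α₁ L x y z) (p : MvPolynomial E S) : p - birth S L y p ∈ cycIdeal S α :=
  sub_birth_mem (fun _ he => h.same_of_mem he) p

theorem decomposition (h : Bubble α α₁ L x y z) (p : MvPolynomial E S) :
    p - (MvPolynomial.X z * birth S L y (death S L p) +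
      birth S L y (death S L (MvPolynomial.X z * p))) ∈ cycIdeal S α₁ := by
  have e : ∀ p : MvPolynomial E S, death S L (MvPolynomial.X z * p) = rest S L p := fun p => by
    rw [death_mul, rest_X_of_mem h.hz, death_X_of_mem h.hz, zero_mul, zero_add, one_mul]
  rw [e]
  induction p using MvPolynomial.induction_on with
  | C s =>
    rw [death_C, rest_C, map_zero, mul_zero, zero_add, birth, MvPolynomial.aeval_C]
    simp
  | add p q hp hq =>
    rw [map_add, map_add, map_add, map_add]
    convert add_mem hp hq using 1
    ring
  | mul_X p f hp =>
    rw [death_mul, rest_mul]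
    by_cases hf : f ∈ L
    · rw [rest_X_of_mem hf, death_X_of_mem hf, mul_zero, mul_zero, mul_one, add_zero, map_zero,
        add_zero]
      have h1 := sub_mem_cycIdeal S (h.same f hf)
      have h2 := Ideal.mul_mem_left _ (birth S L y (death S L p)) (sq_mem_cycIdeal S α₁ z)
      convert add_mem (add_mem (Ideal.mul_mem_right (MvPolynomial.X z) _ hp)
        (Ideal.mul_mem_left _ p h1)) h2 using 1
      ring
    · rw [rest_X_of_not_mem hf, death_X_of_not_mem hf, mul_zero, zero_add, map_mul, map_mul,
        birth_X_of_not_mem hf]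
      convert Ideal.mul_mem_right (MvPolynomial.X f) _ hp using 1
      ring

theorem death_split (h : Bubble α α₁ L x y z) (p : MvPolynomial E S) :
    p - death S L ((MvPolynomial.X x + MvPolynomial.X y) * p) ∈ cycIdeal S α := by
  have e : ∀ p : MvPolynomial E S, death S L ((MvPolynomial.X x + MvPolynomial.X y) * p) =
      rest S L p + MvPolynomial.X y * death S L p := fun p => by
    rw [death_mul, map_add, map_add, rest_X_of_mem h.hx, death_X_of_mem h.hx,
      rest_X_of_not_mem h.hy, death_X_of_not_mem h.hy]
    ring
  rw [e]
  induction p using MvPolynomial.induction_on with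
  | C s => rw [death_C, rest_C, mul_zero, add_zero, sub_self]; exact zero_mem _
  | add p q hp hq =>
    rw [map_add, map_add]
    convert add_mem hp hq using 1
    ring
  | mul_X p f hp =>
    rw [death_mul, rest_mul]
    by_cases hf : f ∈ L
    · rw [rest_X_of_mem hf, death_X_of_mem hf, mul_zero, mul_zero, mul_one, add_zero, zero_add]
      have h1 := sub_mem_cycIdeal S (h.same_of_mem hf)
      have h2 := Ideal.mul_mem_left _ (death S L p) (sq_mem_cycIdeal S α y)
      convert add_mem (add_mem (Ideal.mul_mem_right (MvPolynomial.X y) _ hp)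
        (Ideal.mul_mem_left _ p h1)) h2 using 1
      ring
    · rw [rest_X_of_not_mem hf, death_X_of_not_mem hf, mul_zero, zero_add]
      convert Ideal.mul_mem_right (MvPolynomial.X f) _ hp using 1
      ring

end Bubble

end Bubble

section Formal

/-- The digit number `i` of a number in base `4`. A permutation or a partition of `{0, 1, 2, 3}` is
coded by the digits of a number. -/
def digit (c i : ℕ) : ℕ := Nat.shiftRight c (2 * i) % 4

/-- The code with given digits. -/
def ofDigits (f : ℕ → ℕ) : ℕ := f 0 + 4 * f 1 + 16 * f 2 + 64 * f 3

/-- The product of coded permutations. -/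
def cmul (c d : ℕ) : ℕ := ofDigits fun i => digit c (digit d i)

/-- The inverse of a coded permutation. -/
def cinv (c : ℕ) : ℕ :=
  4 ^ digit c 1 + 2 * 4 ^ digit c 2 + 3 * 4 ^ digit c 3

/-- The code of a transposition. -/
def cswap (i j : ℕ) : ℕ := ofDigits fun n => if n = i then j else if n = j then i else n

/-- The first transpositions of a factorization. -/
def factorAux : List ℕ → ℕ → List (ℕ × ℕ)
  | [], _ => []
  | i :: l, c =>
    if digit c i = i then factorAux l c
    else (i, digit c i) :: factorAux l (cmul (cswap i (digit c i)) c)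

/-- A shortest factorization of a coded permutation into transpositions. -/
def factor (c : ℕ) : List (ℕ × ℕ) := factorAux [0, 1, 2] c

/-- The partition into cycles; each cycle is labelled by its least element. -/
def cycleLabels (c : ℕ) : ℕ :=
  ofDigits fun i => min (min i (digit c i)) (min (digit c (digit c i)) (digit c (digit c (digit c i))))

/-- The pairs that join different parts of a partition. -/
def joins : ℕ → List (ℕ × ℕ) → List (ℕ × ℕ)
  | _, [] => []
  | p, (x, y) :: l =>
    if digit p x = digit p y then joins p l
    else (x, y) :: joins (ofDigits fun i => if digit p i = digit p y then digit p x else digit p i) l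

/-- The factors by which the product of the maps of two permutations differs from the map of their
product. -/
def cocycle (c d : ℕ) : List (ℕ × ℕ) :=
  let w := factor c
  let w' := factor d
  let j := joins (cycleLabels (cmul c d)) (w ++ w')
  match w with
  | [] => []
  | (x, _) :: _ =>
    j ++ List.replicate ((w.length + w'.length - (factor (cmul c d)).length) / 2 - j.length) (x, x)

/-- A linear combination of square-free monomials, which are coded by bit masks. -/
abbrev Monos := List (ℕ × ℤ)

/-- Multiplication of a square-free monomial by the variable of the part of `i`. -/
def insertVar (p m i : ℕ) : Option ℕ :=
  if Nat.testBit m (digit p i) then none else some (Nat.lor m (2 ^ digit p i))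

/-- Multiplication of a square-free monomial by the variables of `n` with index in the list. -/
def insertVars (p n : ℕ) : List ℕ → ℕ → Option ℕ
  | [], m => some m
  | i :: l, m =>
    if Nat.testBit n i then
      match insertVar p m i with
      | none => none
      | some m' => insertVars p n l m'
    else insertVars p n l m

/-- Multiplication of a square-free monomial by linear factors. -/
def expand (p : ℕ) : List (ℕ × ℕ) → ℕ → List ℕ
  | [], m => [m]
  | (x, y) :: l, m =>
    (match insertVar p m x with
      | none => []
      | some m' => expand p l m') ++
    (match insertVar p m y with
      | none => []
      | some m' => expand p l m')

/-- Addition of a term. -/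
def addMono (m : ℕ) (z : ℤ) : Monos → Monos
  | [] => [(m, z)]
  | (m', z') :: l =>
    if m = m' then
      if z + z' = 0 then l else (m', z + z') :: l
    else (m', z') :: addMono m z l

/-- Addition of several terms with the same coefficient. -/
def addMonos (z : ℤ) : List ℕ → Monos → Monos
  | [], l => l
  | m :: t, l => addMonos z t (addMono m z l)

/-- The product of two terms. -/
def mulTerm (p : ℕ) (L : List (ℕ × ℕ)) (m : ℕ) (n : ℕ) : List ℕ :=
  match insertVars p m [0, 1, 2, 3] 0 with
  | none => []
  | some m' =>
    match insertVars p n [0, 1, 2, 3] m' with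
    | none => []
    | some m'' => expand p L m''

/-- The product of a term and a linear combination, added to a linear combination. -/
def mulAux (p : ℕ) (L : List (ℕ × ℕ)) (m : ℕ) (z : ℤ) : Monos → Monos → Monos
  | [], acc => acc
  | (n, y) :: l, acc => mulAux p L m z l (addMonos (z * y) (mulTerm p L m n) acc)

/-- The product, added to a linear combination. -/
def mulAdd (p : ℕ) (L : List (ℕ × ℕ)) : Monos → Monos → Monos → Monos
  | [], _, acc => acc
  | (m, z) :: l, y, acc => mulAdd p L l y (mulAux p L m z y acc)

/-- The composition of the maps `x M_c` and `y M_d`. -/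
def compose (c d : ℕ) (x y : Monos) : Monos := mulAdd (cycleLabels (cmul c d)) (cocycle c d) x y []

/-- A summand, with the code of its permutation, its degrees, and its row of the coboundary. -/
structure Row where
  id : ℕ
  code : ℕ
  h : ℕ
  q : ℕ
  ents : List (ℕ × Monos)

/-- The terms of a row with a given target. -/
def entry (n : ℕ) : List (ℕ × Monos) → Monos
  | [] => []
  | (m, x) :: l => if m = n then x ++ entry n l else entry n l

/-- The summand with a given name. -/
def findRow (n : ℕ) : List Row → Option Row
  | [] => none
  | r :: l => if r.id = n then some r else findRow n l

/-- Addition of all terms of a linear combination. -/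
def sumMonos : Monos → Monos → Monos
  | [], l => l
  | (m, z) :: t, l => sumMonos t (addMono m z l)

/-- Addition of an entry to a row. -/
def addEntry (n : ℕ) (x : Monos) : List (ℕ × Monos) → List (ℕ × Monos)
  | [] => if x = [] then [] else [(n, x)]
  | (m, y) :: l =>
    if m = n then
      match sumMonos x y with
      | [] => l
      | y' => (m, y') :: l
    else (m, y) :: addEntry n x l

/-- Subtraction of a multiple of the pivot row. -/
def reduceRow (st : List Row) (k t c : ℕ) (d : ℕ) (x : Monos) :
    List (ℕ × Monos) → List (ℕ × Monos) → List (ℕ × Monos)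
  | [], acc => acc
  | (j, y) :: l, acc =>
    if j = t ∨ j = k then reduceRow st k t c d x l acc
    else match findRow j st with
      | none => reduceRow st k t c d x l acc
      | some r =>
        reduceRow st k t c d x l
          (addEntry j (compose (cmul (cinv c) d) (cmul (cinv d) r.code) x y) acc)

/-- The terms multiplied by an integer. -/
def scale (u : ℤ) : Monos → Monos
  | [] => []
  | (m, z) :: l => (m, u * z) :: scale u l

/-- The entries with other targets than the pivot. -/
def dropPivot (k t : ℕ) : List (ℕ × Monos) → List (ℕ × Monos)
  | [] => []
  | (j, y) :: l => if j = t ∨ j = k then dropPivot k t l else (j, y) :: dropPivot k t l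

/-- Elimination of the pivot with coefficient `u`, for one row. -/
def elimRow (st : List Row) (rk : Row) (t : ℕ) (u : ℤ) (r : Row) : Row :=
  let e := dropPivot rk.id t r.ents
  match entry t r.ents with
  | [] => { r with ents := e }
  | x => { r with ents := reduceRow st rk.id t r.code rk.code (scale (-u) x) rk.ents e }

/-- Elimination of the pivot with coefficient `u`, for a list of rows. -/
def elimRows (st : List Row) (rk : Row) (t : ℕ) (u : ℤ) : List Row → List Row
  | [] => []
  | r :: l =>
    if r.id = rk.id ∨ r.id = t then elimRows st rk t u l
    else elimRow st rk t u r :: elimRows st rk t u l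

/-- The row of a pivot: an entry `±1` between equal permutations. -/
def findPivotIn (st : List Row) (r : Row) : List (ℕ × Monos) → Option (ℕ × ℤ)
  | [] => none
  | (t, [(0, u)]) :: l =>
    if u * u = 1 then
      match findRow t st with
      | none => findPivotIn st r l
      | some s => if s.code = r.code ∧ s.q = r.q then some (t, u) else findPivotIn st r l
    else findPivotIn st r l
  | _ :: l => findPivotIn st r l

/-- A pivot. -/
def findPivot (st : List Row) : List Row → Option (Row × ℕ × ℤ)
  | [] => none
  | r :: l =>
    match findPivotIn st r r.ents with
    | none => findPivot st l
    | some x => some (r, x)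

/-- The row of a pivot with given name, target and coefficient. -/
def pivotRow (st : List Row) (n t : ℕ) (u : ℤ) : Option Row :=
  match findRow n st with
  | none => none
  | some r =>
    match findRow t st with
    | none => none
    | some s =>
      if s.code = r.code ∧ s.q = r.q ∧ s.h = r.h + 1 ∧ u * u = 1 ∧ entry t r.ents = [(0, u)] then
        some r
      else none

/-- Elimination of pivots as long as there are any. -/
def reduce : ℕ → List Row → List Row
  | 0, st => st
  | n + 1, st =>
    match findPivot st st with
    | none => st
    | some (r, t, u) =>
      match pivotRow st r.id t u with
      | none => st
      | some r => reduce n (elimRows st r t u st)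

/-- The code of the permutation after the smoothing of a crossing with the upward strand `j` and the
downward strand `o`. -/
def turnback (j o c : ℕ) : ℕ := cmul c (cswap o (digit (cinv c) j))

/-- The monomial of the loop. -/
def loopTerm (o : ℕ) (b : Bool) : Monos := [(if b then 2 ^ o else 0, 1)]

/-- The coefficient of the variable of the loop. -/
def loopCoeff (o : ℕ) : Monos → Monos
  | [] => []
  | (m, z) :: l => if Nat.testBit m o then (Nat.xor m (2 ^ o), z) :: loopCoeff o l else loopCoeff o l

/-- The map induced on the smoothings with turnbacks; the flags say whether the variable of the loop
is multiplied in before or after. -/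
def induced (j o c d : ℕ) (b b' : Bool) (x : Monos) : Monos :=
  let c' := turnback j o c
  let d' := turnback j o d
  loopCoeff o (compose (cmul (cinv c') d) (cmul (cinv d) d')
    (compose (cmul (cinv c') c) (cmul (cinv c) d) (loopTerm o b) x) (loopTerm o b'))

/-- Whether the turnback closes up to a loop. -/
def isLoop (j o c : ℕ) : Bool := digit c o == j

/-- The entries between smoothings with turnbacks. -/
def turnbackEnts (st : List Row) (j o c : ℕ) (b : Bool) : List (ℕ × Monos) → List (ℕ × Monos)
  | [] => []
  | (n, x) :: l =>
    match findRow n st with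
    | none => turnbackEnts st j o c b l
    | some r =>
      if isLoop j o r.code then
        addEntry (3 * n + 1) (induced j o c r.code b true x)
          (addEntry (3 * n + 2) (induced j o c r.code b false x) (turnbackEnts st j o c b l))
      else addEntry (3 * n + 1) (induced j o c r.code b false x) (turnbackEnts st j o c b l)

/-- The entries between smoothings without turnbacks. -/
def straightEnts : List (ℕ × Monos) → List (ℕ × Monos)
  | [] => []
  | (n, x) :: l => (3 * n, x) :: straightEnts l

/-- The summand for the smoothing without turnbacks. -/
def straightRow (j o : ℕ) (r : Row) : Row :=
  let s : ℤ := if r.h % 2 = 0 then 1 else -1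
  ⟨3 * r.id, r.code, r.h, r.q,
    if isLoop j o r.code then
      (3 * r.id + 1, [(2 ^ o, s)]) :: (3 * r.id + 2, [(0, s)]) :: straightEnts r.ents
    else (3 * r.id + 1, [(0, s)]) :: straightEnts r.ents⟩

/-- The summands for the smoothing with turnbacks. -/
def turnRow (st : List Row) (j o : ℕ) (b : Bool) (r : Row) : Row :=
  ⟨if b then 3 * r.id + 2 else 3 * r.id + 1, turnback j o r.code, r.h + 1,
    r.q + (if isLoop j o r.code then if b then 0 else 2 else 1),
    turnbackEnts st j o r.code b r.ents⟩

/-- The summands of the two smoothings of a crossing. -/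
def stepRow (st : List Row) (j o : ℕ) (r : Row) : List Row :=
  if isLoop j o r.code then [straightRow j o r, turnRow st j o false r, turnRow st j o true r]
  else [straightRow j o r, turnRow st j o false r]

/-- The complex after one more crossing. -/
def stepRows (st : List Row) (j o : ℕ) : List Row → List Row
  | [] => []
  | r :: l => stepRow st j o r ++ stepRows st j o l

/-- The summands of degree at least `b`. -/
def truncate (b : ℕ) : List Row → List Row
  | [] => []
  | r :: l => if b ≤ r.h then r :: truncate b l else truncate b l

end Formal

section Codes

/-- The code of a permutation. -/
def code (a : Equiv.Perm (Fin 4)) : ℕ := ofDigits fun i => a (Fin.ofNat 4 i)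

/-- A factorization into transpositions. -/
def factors (a : Equiv.Perm (Fin 4)) : List (Fin 4 × Fin 4) :=
  (factor (code a)).map fun p => (Fin.ofNat 4 p.1, Fin.ofNat 4 p.2)

/-- The factors of the composition of the maps of two permutations. -/
def cocycles (a b : Equiv.Perm (Fin 4)) : List (Fin 4 × Fin 4) :=
  (cocycle (code a) (code b)).map fun p => (Fin.ofNat 4 p.1, Fin.ofNat 4 p.2)

/-- The colouring with given values. -/
def col (b₀ b₁ b₂ b₃ : Bool) (i : Fin 4) : Bool :=
  match i with
  | 0 => b₀
  | 1 => b₁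
  | 2 => b₂
  | 3 => b₃

theorem col_eq (g : Fin 4 → Bool) : col (g 0) (g 1) (g 2) (g 3) = g := by
  funext i
  fin_cases i <;> rfl

theorem code_mul : ∀ a b, code (a * b) = cmul (code a) (code b) := by decide +kernel

theorem code_inv : ∀ a, code a⁻¹ = cinv (code a) := by decide +kernel

theorem code_injective : ∀ a b, code a = code b → a = b := by decide +kernel

theorem digit_code : ∀ a (i : Fin 4), digit (code a) i = a i := by decide +kernel

theorem code_swap : ∀ i j : Fin 4, code (Equiv.swap i j) = cswap i j := by decide +kernel

theorem prod_factors : ∀ a, ((factors a).map fun p => Equiv.swap p.1 p.2).prod = a := by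
  decide +kernel

theorem factors_proper : ∀ a, ∀ p ∈ factors a, p.1 ≠ p.2 := by decide +kernel

theorem factors_one : factors 1 = [] := by decide +kernel

theorem factors_fixed : ∀ a i, a i = i → ∀ p ∈ factors a, p.1 ≠ i ∧ p.2 ≠ i := by decide +kernel

theorem labels_col : ∀ a b₀ b₁ b₂ b₃, (∀ i, col b₀ b₁ b₂ b₃ (a i) = col b₀ b₁ b₂ b₃ i) →
    ∀ i : Fin 4, col b₀ b₁ b₂ b₃ (Fin.ofNat 4 (digit (cycleLabels (code a)) i)) =
      col b₀ b₁ b₂ b₃ i := by decide +kernel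

/-- The colouring agrees on the pairs. -/
def agrees (g : Fin 4 → Bool) (l : List (Fin 4 × Fin 4)) : Bool := l.all fun p => g p.1 == g p.2

theorem agrees_iff {g : Fin 4 → Bool} {l : List (Fin 4 × Fin 4)} :
    agrees g l = true ↔ ∀ p ∈ l, g p.1 = g p.2 := by
  simp [agrees]

theorem agrees_factors : ∀ a b₀ b₁ b₂ b₃, agrees (col b₀ b₁ b₂ b₃) (factors a) = true ↔
    ∀ i, col b₀ b₁ b₂ b₃ (a i) = col b₀ b₁ b₂ b₃ i := by decide +kernel

theorem agrees_append : ∀ a b b₀ b₁ b₂ b₃,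
    agrees (col b₀ b₁ b₂ b₃) (factors a ++ factors b) =
      (agrees (col b₀ b₁ b₂ b₃) (factors (a * b)) &&
        agrees (col b₀ b₁ b₂ b₃) (cocycles a b)) := by decide +kernel

theorem cocycles_count : ∀ a b b₀ b₁ b₂ b₃,
    agrees (col b₀ b₁ b₂ b₃) (factors a ++ factors b) = true →
      ∀ ε, (factors a ++ factors b).countP (fun p => col b₀ b₁ b₂ b₃ p.1 == ε) =
        (factors (a * b)).countP (fun p => col b₀ b₁ b₂ b₃ p.1 == ε) +
          2 * (cocycles a b).countP (fun p => col b₀ b₁ b₂ b₃ p.1 == ε) := by decide +kernel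

end Codes

section Evaluation

variable {Q : Type} [CommRing Q] (x : Fin 4 → Q)

/-- The value of a square-free monomial. -/
def maskVal (m : ℕ) : Q := ∏ i : Fin 4, if Nat.testBit m i then x i else 1

/-- The value of a linear combination of monomials. -/
def monosVal : Monos → Q
  | [] => 0
  | (m, z) :: l => (z : Q) * maskVal x m + monosVal l

/-- The value of a product of linear factors. -/
def linVal : List (ℕ × ℕ) → Q
  | [] => 1
  | (i, j) :: l => (x (Fin.ofNat 4 i) + x (Fin.ofNat 4 j)) * linVal l

/-- The sum of the values of monomials. -/
def masksVal : List ℕ → Q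
  | [] => 0
  | m :: l => maskVal x m + masksVal l

theorem masksVal_append (l l' : List ℕ) : masksVal x (l ++ l') = masksVal x l + masksVal x l' := by
  induction l with
  | nil => simp [masksVal]
  | cons m l ih => simp [masksVal, ih, add_assoc]

theorem maskVal_lor {m : ℕ} {d : Fin 4} (h : Nat.testBit m d = false) :
    maskVal x (Nat.lor m (2 ^ (d : ℕ))) = x d * maskVal x m := by
  have h1 : ∀ i : Fin 4, Nat.testBit (Nat.lor m (2 ^ (d : ℕ))) i = (Nat.testBit m i || decide (d = i)) := by
    intro i
    change Nat.testBit (m ||| 2 ^ (d : ℕ)) i = _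
    rw [Nat.testBit_or, Nat.testBit_two_pow]
    simp [Fin.ext_iff]
  unfold maskVal
  rw [← Finset.mul_prod_erase _ _ (Finset.mem_univ d), ← Finset.mul_prod_erase (a := d) _ (fun i : Fin 4 =>
    if Nat.testBit m i then x i else 1) (Finset.mem_univ d), h1, h]
  simp only [Bool.false_or, decide_true, if_true, Bool.false_eq_true, if_false, one_mul]
  congr 1
  refine Finset.prod_congr rfl fun i hi => ?_
  have : d ≠ i := fun e => (Finset.ne_of_mem_erase hi) e.symm
  rw [h1]
  simp [this]

theorem maskVal_of_testBit {m : ℕ} {d : Fin 4} (h : Nat.testBit m d = true) :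
    ∃ q, maskVal x m = x d * q := by
  refine ⟨∏ i ∈ Finset.univ.erase d, if Nat.testBit m i then x i else 1, ?_⟩
  unfold maskVal
  rw [← Finset.mul_prod_erase _ _ (Finset.mem_univ d), if_pos h]

theorem maskVal_zero : maskVal x 0 = 1 := by
  simp [maskVal]

/-- The variables have square zero and agree on the parts of the partition. -/
structure Adapted (p : ℕ) : Prop where
  sq : ∀ i, x i * x i = 0
  label : ∀ i : Fin 4, x (Fin.ofNat 4 (digit p i)) = x i

variable {x} {p : ℕ}

theorem Adapted.insertVar (h : Adapted x p) (m : ℕ) (i : Fin 4) :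
    x i * maskVal x m = match insertVar p m i with
      | none => 0
      | some m' => maskVal x m' := by
  have hlt : digit p i < 4 := Nat.mod_lt _ (by norm_num)
  obtain ⟨d, hd⟩ : ∃ d : Fin 4, (d : ℕ) = digit p i := ⟨⟨_, hlt⟩, rfl⟩
  have hx : x d = x i := by
    rw [← h.label i]
    congr 1
    rw [← hd]
    exact (Fin.ofNat_val_eq_self d).symm
  rw [Khovanov.insertVar, ← hx, ← hd]
  cases hb : Nat.testBit m d with
  | true =>
    obtain ⟨q, hq⟩ := maskVal_of_testBit x hb
    simp only [if_true]
    rw [hq, ← mul_assoc, h.sq, zero_mul]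
  | false =>
    simp only [Bool.false_eq_true, if_false]
    rw [maskVal_lor x hb]

theorem Adapted.insertVars (h : Adapted x p) (n : ℕ) (l : List (Fin 4)) (m : ℕ) :
    (l.map fun i : Fin 4 => if Nat.testBit n i then x i else 1).prod * maskVal x m =
      match insertVars p n (l.map fun i : Fin 4 => (i : ℕ)) m with
      | none => 0
      | some m' => maskVal x m' := by
  induction l generalizing m with
  | nil => simp [Khovanov.insertVars]
  | cons i l ih =>
    rw [List.map_cons, List.map_cons, List.prod_cons, Khovanov.insertVars]
    cases hb : Nat.testBit n i with
    | true =>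
      simp only [if_true]
      have := h.insertVar m i
      rw [mul_right_comm, this]
      cases hi : Khovanov.insertVar p m i with
      | none => simp
      | some m' => simp only; rw [mul_comm, ih]
    | false =>
      simp only [Bool.false_eq_true, if_false, one_mul]
      exact ih m

theorem Adapted.insertVars' (h : Adapted x p) (n m : ℕ) :
    maskVal x n * maskVal x m = match Khovanov.insertVars p n [0, 1, 2, 3] m with
      | none => 0
      | some m' => maskVal x m' := by
  have := h.insertVars n [0, 1, 2, 3] m
  have e : maskVal x n = (([0, 1, 2, 3] : List (Fin 4)).map fun i : Fin 4 =>
      if Nat.testBit n i then x i else 1).prod := by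
    simp [maskVal, Fin.prod_univ_four, mul_assoc]
  rw [e]
  exact this

theorem Adapted.expand (h : Adapted x p) (l : List (ℕ × ℕ)) (hl : ∀ q ∈ l, q.1 < 4 ∧ q.2 < 4)
    (m : ℕ) : linVal x l * maskVal x m = masksVal x (expand p l m) := by
  induction l generalizing m with
  | nil => simp [linVal, Khovanov.expand, masksVal]
  | cons q l ih =>
    obtain ⟨i, j⟩ := q
    have ih' := ih fun q hq => hl q (List.mem_cons_of_mem _ hq)
    have hij := hl (i, j) List.mem_cons_self
    rw [linVal, Khovanov.expand, masksVal_append]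
    have key : ∀ i : ℕ, i < 4 → x (Fin.ofNat 4 i) * (linVal x l * maskVal x m) =
        masksVal x (match Khovanov.insertVar p m i with
          | none => []
          | some m' => Khovanov.expand p l m') := by
      intro i hi
      have h1 := h.insertVar m (Fin.ofNat 4 i)
      rw [show ((Fin.ofNat 4 i : Fin 4) : ℕ) = i from Nat.mod_eq_of_lt hi] at h1
      rw [mul_left_comm, h1]
      cases Khovanov.insertVar p m i with
      | none => simp [masksVal]
      | some m' => exact ih' m'
    refine Eq.trans ?_ (congrArg₂ (· + ·) (key i hij.1) (key j hij.2))
    ring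

theorem monosVal_addMono (m : ℕ) (z : ℤ) (l : Monos) :
    monosVal x (addMono m z l) = (z : Q) * maskVal x m + monosVal x l := by
  induction l with
  | nil => rfl
  | cons t l ih =>
    obtain ⟨m', z'⟩ := t
    rw [addMono]
    split_ifs with h1 h2
    · subst h1
      have : (z : Q) + z' = 0 := by exact_mod_cast congrArg (Int.cast : ℤ → Q) h2
      rw [monosVal, ← add_assoc, ← add_mul, this, zero_mul, zero_add]
    · subst h1
      rw [monosVal, monosVal]
      push_cast
      ring
    · rw [monosVal, ih, monosVal]
      ring

theorem monosVal_addMonos (z : ℤ) (t : List ℕ) (l : Monos) :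
    monosVal x (addMonos z t l) = (z : Q) * masksVal x t + monosVal x l := by
  induction t generalizing l with
  | nil => simp [addMonos, masksVal]
  | cons m t ih =>
    rw [addMonos, ih, monosVal_addMono, masksVal]
    ring

theorem monosVal_append (l l' : Monos) : monosVal x (l ++ l') = monosVal x l + monosVal x l' := by
  induction l with
  | nil => simp [monosVal]
  | cons t l ih => obtain ⟨m, z⟩ := t; simp [monosVal, ih, add_assoc]

theorem monosVal_sumMonos (t l : Monos) :
    monosVal x (sumMonos t l) = monosVal x t + monosVal x l := by
  induction t generalizing l with
  | nil => simp [sumMonos, monosVal]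
  | cons t t' ih =>
    obtain ⟨m, z⟩ := t
    rw [sumMonos, ih, monosVal_addMono, monosVal]
    ring

theorem monosVal_scale (u : ℤ) (l : Monos) : monosVal x (scale u l) = u * monosVal x l := by
  induction l with
  | nil => simp [scale, monosVal]
  | cons t l ih =>
    obtain ⟨m, z⟩ := t
    rw [scale, monosVal, monosVal, ih]
    push_cast
    ring

theorem Adapted.mulTerm (h : Adapted x p) (L : List (ℕ × ℕ)) (hL : ∀ q ∈ L, q.1 < 4 ∧ q.2 < 4)
    (m n : ℕ) :
    masksVal x (mulTerm p L m n) = maskVal x m * maskVal x n * linVal x L := by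
  have h1 := h.insertVars' m 0
  rw [maskVal_zero, mul_one] at h1
  rw [Khovanov.mulTerm, h1]
  cases Khovanov.insertVars p m [0, 1, 2, 3] 0 with
  | none => simp [masksVal]
  | some m' =>
    simp only
    rw [mul_comm (maskVal x m'), h.insertVars' n m']
    cases Khovanov.insertVars p n [0, 1, 2, 3] m' with
    | none => simp [masksVal]
    | some m'' =>
      simp only
      rw [mul_comm, h.expand L hL]

theorem Adapted.mulAux (h : Adapted x p) (L : List (ℕ × ℕ)) (hL : ∀ q ∈ L, q.1 < 4 ∧ q.2 < 4)
    (m : ℕ) (z : ℤ) (l acc : Monos) : monosVal x (mulAux p L m z l acc) =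
      z * maskVal x m * monosVal x l * linVal x L + monosVal x acc := by
  induction l generalizing acc with
  | nil => simp [Khovanov.mulAux, monosVal]
  | cons t l ih =>
    obtain ⟨n, y⟩ := t
    rw [Khovanov.mulAux, ih, monosVal_addMonos, h.mulTerm L hL, monosVal]
    push_cast
    ring

theorem Adapted.mulAdd (h : Adapted x p) (L : List (ℕ × ℕ)) (hL : ∀ q ∈ L, q.1 < 4 ∧ q.2 < 4)
    (l y acc : Monos) : monosVal x (mulAdd p L l y acc) =
      monosVal x l * monosVal x y * linVal x L + monosVal x acc := by
  induction l generalizing acc with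
  | nil => simp [Khovanov.mulAdd, monosVal]
  | cons t l ih =>
    obtain ⟨m, z⟩ := t
    rw [Khovanov.mulAdd, ih, h.mulAux L hL, monosVal]
    ring

theorem cocycle_lt : ∀ a b, ∀ q ∈ cocycle (code a) (code b), q.1 < 4 ∧ q.2 < 4 := by
  decide +kernel

theorem Adapted.compose {a b : Equiv.Perm (Fin 4)} (h : Adapted x (cycleLabels (code (a * b))))
    (y z : Monos) : monosVal x (compose (code a) (code b) y z) =
      monosVal x y * monosVal x z * linVal x (cocycle (code a) (code b)) := by
  rw [code_mul] at h
  rw [Khovanov.compose, h.mulAdd _ (cocycle_lt a b), monosVal, add_zero]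

variable {Q' : Type} [CommRing Q'] (f : Q →+* Q')

theorem map_maskVal (m : ℕ) : f (maskVal x m) = maskVal (fun i => f (x i)) m := by
  rw [maskVal, maskVal, map_prod]
  refine Finset.prod_congr rfl fun i _ => ?_
  split_ifs
  · rfl
  · exact map_one f

theorem map_monosVal (l : Monos) : f (monosVal x l) = monosVal (fun i => f (x i)) l := by
  induction l with
  | nil => exact map_zero f
  | cons t l ih =>
    obtain ⟨m, z⟩ := t
    rw [monosVal, monosVal, map_add, map_mul, map_intCast, map_maskVal, ih]

theorem map_linVal (l : List (ℕ × ℕ)) : f (linVal x l) = linVal (fun i => f (x i)) l := by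
  induction l with
  | nil => exact map_one f
  | cons t l ih =>
    obtain ⟨i, j⟩ := t
    rw [linVal, linVal, map_mul, map_add, ih]

end Evaluation

section Gluing

/-- The edges of the diagram. -/
abbrev E4 : Type := Edge 3 14

/-- The edges on the closing strands. -/
def src (i : Fin 4) : E4 := (i, 0)

theorem src_injective : Function.Injective src := fun _ _ h => congrArg Prod.fst h

/-- A permutation of the closing strands as a permutation of the edges. -/
def hat (a : Equiv.Perm (Fin 4)) : Equiv.Perm E4 where
  toFun e := if e.2 = 0 then (a e.1, 0) else e
  invFun e := if e.2 = 0 then (a⁻¹ e.1, 0) else e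
  left_inv e := by
    by_cases h : e.2 = 0
    · ext1 <;> simp [h]
    · simp [h]
  right_inv e := by
    by_cases h : e.2 = 0
    · ext1 <;> simp [h]
    · simp [h]

theorem hat_src (a : Equiv.Perm (Fin 4)) (i : Fin 4) : hat a (src i) = src (a i) := rfl

theorem hat_of_ne (a : Equiv.Perm (Fin 4)) {e : E4} (h : e.2 ≠ 0) : hat a e = e := if_neg h

theorem hat_mul (a b : Equiv.Perm (Fin 4)) : hat (a * b) = hat a * hat b := by
  refine Equiv.ext fun e => ?_
  by_cases h : e.2 = 0
  · simp [hat, h]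
  · rw [Equiv.Perm.mul_apply, hat_of_ne _ h, hat_of_ne _ h, hat_of_ne _ h]

theorem hat_one : hat 1 = 1 := by
  refine Equiv.ext fun e => ?_
  by_cases h : e.2 = 0
  · obtain ⟨i, t⟩ := e
    simp only at h
    subst h
    rfl
  · rw [hat_of_ne _ h, Equiv.Perm.one_apply]

theorem hat_inv (a : Equiv.Perm (Fin 4)) : hat a⁻¹ = (hat a)⁻¹ := by
  rw [eq_inv_iff_mul_eq_one, ← hat_mul, inv_mul_cancel, hat_one]

theorem hat_swap (i j : Fin 4) : hat (Equiv.swap i j) = Equiv.swap (src i) (src j) := by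
  refine Equiv.ext fun e => ?_
  by_cases h : e.2 = 0
  · obtain ⟨l, t⟩ := e
    simp only at h
    subst h
    change hat _ (src l) = Equiv.swap (src i) (src j) (src l)
    rw [hat_src, src_injective.swap_apply]
  · rw [hat_of_ne _ h, Equiv.swap_apply_of_ne_of_ne]
    · rintro rfl; exact h rfl
    · rintro rfl; exact h rfl

/-- The pairs of closing strands for pairs of positions. -/
def srcPairs (l : List (Fin 4 × Fin 4)) : List (E4 × E4) := l.map fun p => (src p.1, src p.2)

/-- The sequence of merges and splits of a permutation of the closing strands. -/
def srcWord (a : Equiv.Perm (Fin 4)) : List (E4 × E4) := srcPairs (factors a)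

theorem wordPerm_srcPairs (α : Equiv.Perm E4) (l : List (Fin 4 × Fin 4)) :
    wordPerm α (srcPairs l) = α * hat (l.map fun p => Equiv.swap p.1 p.2).prod := by
  induction l generalizing α with
  | nil => simp [srcPairs, wordPerm, hat_one]
  | cons p l ih =>
    rw [srcPairs, List.map_cons, wordPerm, ← srcPairs, ih, List.map_cons, List.prod_cons, hat_mul,
      hat_swap, mul_assoc]

theorem wordPerm_srcWord (α : Equiv.Perm E4) (a : Equiv.Perm (Fin 4)) :
    wordPerm α (srcWord a) = α * hat a := by
  rw [srcWord, wordPerm_srcPairs, prod_factors]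

theorem srcWord_proper (a : Equiv.Perm (Fin 4)) : Proper (srcWord a) := by
  intro p hp
  obtain ⟨q, hq, rfl⟩ := List.mem_map.1 hp
  exact fun h => factors_proper a q hq (src_injective h)

theorem compat_srcPairs {γ : E4 → Bool} {l : List (Fin 4 × Fin 4)} :
    Compat γ (srcPairs l) ↔ agrees (γ ∘ src) l = true := by
  rw [agrees_iff]
  constructor
  · intro h p hp
    exact h (src p.1, src p.2) (List.mem_map.2 ⟨p, hp, rfl⟩)
  · rintro h _ hp
    obtain ⟨q, hq, rfl⟩ := List.mem_map.1 hp
    exact h q hq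

theorem cnt_srcPairs (γ : E4 → Bool) (ε : Bool) (l : List (Fin 4 × Fin 4)) :
    cnt γ ε (srcPairs l) = l.countP fun p => (γ ∘ src) p.1 == ε := by
  rw [cnt, srcPairs, List.countP_map]
  rfl

theorem compat_srcWord {γ : E4 → Bool} {a : Equiv.Perm (Fin 4)} :
    Compat γ (srcWord a) ↔ ∀ i, γ (src (a i)) = γ (src i) := by
  rw [srcWord, compat_srcPairs, ← col_eq (γ ∘ src), agrees_factors, col_eq]
  rfl

variable (S : Type) [CommRing S]

/-- The merges and splits from the gluing `a` to the gluing `b`. -/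
def gluePoly (α : Equiv.Perm E4) (a b : Equiv.Perm (Fin 4)) : MvPolynomial E4 S :=
  wordPoly 0 (α * hat a) (srcWord (a⁻¹ * b))

/-- The value of a formal linear combination. -/
def mval (x : Monos) : MvPolynomial E4 S := monosVal (fun i => MvPolynomial.X (src i)) x

/-- The map between the algebras of two gluings given by formal data. -/
def morPoly (α : Equiv.Perm E4) (a b : Equiv.Perm (Fin 4)) (x : Monos) : MvPolynomial E4 S :=
  mval S x * gluePoly S α a b

variable {S} {α : Equiv.Perm E4} {a b c : Equiv.Perm (Fin 4)}

theorem wordPerm_glue (α : Equiv.Perm E4) (a b : Equiv.Perm (Fin 4)) :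
    wordPerm (α * hat a) (srcWord (a⁻¹ * b)) = α * hat b := by
  rw [wordPerm_srcWord, mul_assoc, ← hat_mul, mul_inv_cancel_left]

theorem gluePoly_self (α : Equiv.Perm E4) (a : Equiv.Perm (Fin 4)) : gluePoly S α a a = 1 := by
  rw [gluePoly, inv_mul_cancel, srcWord, factors_one]
  rfl

theorem gluePoly_mul_mem {p : MvPolynomial E4 S} (hp : p ∈ cycIdeal S (α * hat a)) :
    gluePoly S α a b * p ∈ cycIdeal S (α * hat b) := by
  have := wordPoly_mul_mem S (srcWord_proper (a⁻¹ * b)) hp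
  rwa [wordPerm_glue] at this

theorem morPoly_mul_mem (x : Monos) {p : MvPolynomial E4 S} (hp : p ∈ cycIdeal S (α * hat a)) :
    morPoly S α a b x * p ∈ cycIdeal S (α * hat b) := by
  rw [morPoly, mul_assoc]
  exact Ideal.mul_mem_left _ _ (gluePoly_mul_mem hp)

theorem linPoly_cocycle (a b : Equiv.Perm (Fin 4)) : linPoly 0 (srcPairs (cocycles a b)) =
    linVal (fun i => (MvPolynomial.X (src i) : MvPolynomial E4 S)) (cocycle (code a) (code b)) := by
  rw [cocycles]
  induction cocycle (code a) (code b) with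
  | nil => rfl
  | cons p l ih =>
    obtain ⟨i, j⟩ := p
    rw [linVal, ← ih, List.map_cons, srcPairs, List.map_cons, linPoly, ← srcPairs, MvPolynomial.C_0,
      sub_zero]

theorem gluePoly_comp (α : Equiv.Perm E4) (a b c : Equiv.Perm (Fin 4)) :
    gluePoly S α a b * gluePoly S α b c -
      linVal (fun i => MvPolynomial.X (src i)) (cocycle (code (a⁻¹ * b)) (code (b⁻¹ * c))) *
        gluePoly S α a c ∈ cycIdeal S (α * hat c) := by
  have e : a⁻¹ * b * (b⁻¹ * c) = a⁻¹ * c := by group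
  have h1 : wordPerm (α * hat a) (srcWord (a⁻¹ * b) ++ srcWord (b⁻¹ * c)) = α * hat c := by
    rw [wordPerm_append, wordPerm_glue, wordPerm_glue]
  have h2 : srcWord (a⁻¹ * b) ++ srcWord (b⁻¹ * c) =
      srcPairs (factors (a⁻¹ * b) ++ factors (b⁻¹ * c)) := by
    simp only [srcWord, srcPairs, List.map_append]
  have key := wordPoly_congr S (α := α * hat a) (w₁ := srcWord (a⁻¹ * b) ++ srcWord (b⁻¹ * c))
    (w₂ := srcWord (a⁻¹ * c)) (L := srcPairs (cocycles (a⁻¹ * b) (b⁻¹ * c)))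
    (fun p hp => (List.mem_append.1 hp).elim (srcWord_proper _ p) (srcWord_proper _ p))
    (srcWord_proper _) (by rw [h1, wordPerm_glue]) (fun γ _ => by
      have A := agrees_append (a⁻¹ * b) (b⁻¹ * c) (γ (src 0)) (γ (src 1)) (γ (src 2)) (γ (src 3))
      have B := cocycles_count (a⁻¹ * b) (b⁻¹ * c) (γ (src 0)) (γ (src 1)) (γ (src 2)) (γ (src 3))
      have hc : col (γ (src 0)) (γ (src 1)) (γ (src 2)) (γ (src 3)) = γ ∘ src := col_eq (γ ∘ src)
      rw [hc, e] at A B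
      rw [h2, srcWord, compat_srcPairs, compat_srcPairs, compat_srcPairs, A, Bool.and_eq_true]
      refine ⟨Iff.rfl, fun h ε => ?_⟩
      rw [cnt_srcPairs, cnt_srcPairs, cnt_srcPairs]
      exact B (by rw [A, Bool.and_eq_true]; exact h) ε)
  rw [h1, wordPoly_append, wordPerm_glue, linPoly_cocycle] at key
  exact key

theorem labels_glue (α : Equiv.Perm E4) (a c : Equiv.Perm (Fin 4)) (i : Fin 4) :
    (MvPolynomial.X (src (Fin.ofNat 4 (digit (cycleLabels (code (a⁻¹ * c))) i))) -
      MvPolynomial.X (src i)) * gluePoly S α a c ∈ cycIdeal S (α * hat c) := by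
  have := sub_mul_wordPoly_mem S (α := α * hat a) (srcWord_proper (a⁻¹ * c))
    (x := src (Fin.ofNat 4 (digit (cycleLabels (code (a⁻¹ * c))) i))) (y := src i) (fun γ hγ => by
      have hc : col (γ (src 0)) (γ (src 1)) (γ (src 2)) (γ (src 3)) = γ ∘ src := col_eq (γ ∘ src)
      have h1 := labels_col (a⁻¹ * c) (γ (src 0)) (γ (src 1)) (γ (src 2)) (γ (src 3))
      rw [hc] at h1
      exact h1 (fun i => compat_srcWord.1 hγ i) i)
  rwa [wordPerm_glue] at this

/-- The formal composition computes the composition of the maps. -/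
theorem morPoly_comp (α : Equiv.Perm E4) (a b c : Equiv.Perm (Fin 4)) (x y : Monos) :
    morPoly S α a b x * morPoly S α b c y -
      morPoly S α a c (compose (code (a⁻¹ * b)) (code (b⁻¹ * c)) x y) ∈ cycIdeal S (α * hat c) := by
  let J : Ideal (MvPolynomial E4 S) := Submodule.comap
    (LinearMap.mulLeft (MvPolynomial E4 S) (gluePoly S α a c)) (cycIdeal S (α * hat c))
  have hJ : ∀ z, z ∈ J ↔ z * gluePoly S α a c ∈ cycIdeal S (α * hat c) := fun z => by
    rw [mul_comm]; exact Iff.rfl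
  have e : a⁻¹ * b * (b⁻¹ * c) = a⁻¹ * c := by group
  have had : Adapted (fun i => Ideal.Quotient.mk J (MvPolynomial.X (src i)))
      (cycleLabels (code (a⁻¹ * b * (b⁻¹ * c)))) := by
    constructor
    · intro i
      rw [← map_mul, Ideal.Quotient.eq_zero_iff_mem, hJ, ← sq]
      exact Ideal.mul_mem_right _ _ (sq_mem_cycIdeal S _ _)
    · intro i
      rw [Ideal.Quotient.eq, hJ, e]
      exact labels_glue α a c i
  have h1 := had.compose x y
  rw [← map_monosVal, ← map_monosVal, ← map_monosVal, ← map_linVal, ← map_mul, ← map_mul,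
    Ideal.Quotient.eq, hJ] at h1
  have h2 := Ideal.mul_mem_left _ (mval S x * mval S y) (gluePoly_comp (S := S) α a b c)
  convert sub_mem h2 h1 using 1
  simp only [morPoly, mval]
  ring

theorem mval_append (x y : Monos) : mval S (x ++ y) = mval S x + mval S y := monosVal_append x y

theorem morPoly_append (x y : Monos) :
    morPoly S α a b (x ++ y) = morPoly S α a b x + morPoly S α a b y := by
  rw [morPoly, mval_append, add_mul]; rfl

theorem mval_one : mval S [(0, 1)] = 1 := by
  simp [mval, monosVal, maskVal_zero]

theorem morPoly_self (α : Equiv.Perm E4) (a : Equiv.Perm (Fin 4)) (x : Monos) :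
    morPoly S α a a x = mval S x := by
  rw [morPoly, gluePoly_self, mul_one]

theorem morPoly_nil : morPoly S α a b [] = 0 := zero_mul _

/-- Gluings at different places commute. -/
theorem gluePoly_natural (α : Equiv.Perm E4) {x y : E4} (hxy : x ≠ y) (a b : Equiv.Perm (Fin 4)) :
    stepPoly 0 (α * hat a) (hat a⁻¹ x) (hat a⁻¹ y) * gluePoly S (α * Equiv.swap x y) a b -
      gluePoly S α a b * stepPoly 0 (α * hat b) (hat b⁻¹ x) (hat b⁻¹ y) ∈
        cycIdeal S (α * Equiv.swap x y * hat b) := by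
  have hs : ∀ c : Equiv.Perm (Fin 4), α * hat c * Equiv.swap (hat c⁻¹ x) (hat c⁻¹ y) =
      α * Equiv.swap x y * hat c := fun c => by
    rw [hat_inv, Equiv.swap_apply_apply]
    group
  have hp : ∀ c : Equiv.Perm (Fin 4), Proper [(hat c⁻¹ x, hat c⁻¹ y)] := fun c p hp => by
    rw [List.mem_singleton.1 hp]
    exact (hat c⁻¹).injective.ne hxy
  have h1 : wordPerm (α * hat a) ((hat a⁻¹ x, hat a⁻¹ y) :: srcWord (a⁻¹ * b)) =
      α * Equiv.swap x y * hat b := by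
    rw [wordPerm, hs, wordPerm_glue]
  have hcol : ∀ γ : E4 → Bool, Compat γ (srcWord (a⁻¹ * b)) → ∀ e, γ (hat a⁻¹ e) = γ (hat b⁻¹ e) := by
    intro γ hγ e
    by_cases he : e.2 = 0
    · obtain ⟨i, t⟩ := e
      simp only at he
      subst he
      change γ (hat a⁻¹ (src i)) = γ (hat b⁻¹ (src i))
      rw [hat_src, hat_src]
      have := compat_srcWord.1 hγ (b⁻¹ i)
      simpa using this
    · rw [hat_of_ne _ he, hat_of_ne _ he]
  have key := wordPoly_congr S (α := α * hat a)
    (w₁ := (hat a⁻¹ x, hat a⁻¹ y) :: srcWord (a⁻¹ * b))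
    (w₂ := srcWord (a⁻¹ * b) ++ [(hat b⁻¹ x, hat b⁻¹ y)]) (L := [])
    (fun p h => (List.mem_cons.1 h).elim (fun h => hp a p (List.mem_singleton.2 h))
      (srcWord_proper _ p))
    (fun p h => (List.mem_append.1 h).elim (srcWord_proper _ p) (hp b p))
    (by rw [h1, wordPerm_append, wordPerm_glue, wordPerm, wordPerm, hs])
    (fun γ _ => by
      constructor
      · constructor
        · intro h
          have h' : Compat γ (srcWord (a⁻¹ * b)) := fun q hq => h q (List.mem_cons_of_mem _ hq)
          refine ⟨fun p hp => ?_, fun p hp => by simp at hp⟩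
          rcases List.mem_append.1 hp with hp | hp
          · exact h' p hp
          · rw [List.mem_singleton.1 hp, ← hcol γ h', ← hcol γ h']
            exact h _ List.mem_cons_self
        · rintro ⟨h, -⟩
          have h' : Compat γ (srcWord (a⁻¹ * b)) := fun q hq => h q (List.mem_append_left _ hq)
          intro p hp
          rcases List.mem_cons.1 hp with hp | hp
          · rw [hp, hcol γ h', hcol γ h']
            exact h _ (List.mem_append_right _ (List.mem_singleton_self _))
          · exact h' p hp
      · intro h ε
        have h' : Compat γ (srcWord (a⁻¹ * b)) := fun q hq => h q (List.mem_cons_of_mem _ hq)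
        simp only [cnt, List.countP_cons, List.countP_append, List.countP_nil, hcol γ h']
        omega)
  rw [h1, wordPoly, hs, wordPoly_append, wordPerm_glue, linPoly, one_mul, wordPoly, wordPoly,
    mul_one] at key
  exact key

theorem gluePoly_isWeightedHomogeneous (α : Equiv.Perm E4) (a b : Equiv.Perm (Fin 4)) :
    MvPolynomial.IsWeightedHomogeneous (wt (E := E4)) (gluePoly S α a b)
      ((cycles (α * hat a) : ℤ) - cycles (α * hat b) - (factors (a⁻¹ * b)).length) := by
  have := wordPoly_isWeightedHomogeneous S (α := α * hat a) (srcWord_proper (a⁻¹ * b))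
  rw [wordPerm_glue] at this
  rw [srcWord, srcPairs, List.length_map] at this
  exact this

end Gluing

section Turnback

/-- The strand that runs upwards at a crossing. -/
def ev (k : Fin 14) : Fin 4 := if wordL3 k = 0 then 0 else 2

/-- The strand that runs downwards at a crossing. -/
def od (k : Fin 14) : Fin 4 := if wordL3 k = 2 then 3 else 1

theorem even_ev : ∀ k, Even (ev k : ℕ) := by decide

theorem not_even_od : ∀ k, ¬ Even (od k : ℕ) := by decide

/-- The edges that enter a crossing. -/
def enter (k : Fin 14) : E4 × E4 := ((ev k, k), (od k, k + 1))

theorem enter_eq : ∀ k, (inc ((wordL3 k).castSucc, k) = (enter k).1 ∧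
      inc ((wordL3 k).succ, k) = (enter k).2) ∨
    (inc ((wordL3 k).castSucc, k) = (enter k).2 ∧ inc ((wordL3 k).succ, k) = (enter k).1) := by
  decide +kernel

theorem od_ne_ev (k l : Fin 14) : od k ≠ ev l := fun h => not_even_od k (h ▸ even_ev l)

theorem enter_ne (k : Fin 14) : (enter k).1 ≠ (enter k).2 := fun h =>
  od_ne_ev k k (congrArg Prod.fst h).symm

theorem next_eq_low {v : Fin 14 → Bool} {k : Fin 14} (hv : v k = true) :
    next wordL3 v = next wordL3 (low v k) * Equiv.swap (enter k).1 (enter k).2 := by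
  rw [next_low wordL3 hv]
  rcases enter_eq k with ⟨h1, h2⟩ | ⟨h1, h2⟩
  · rw [h1, h2]
  · rw [h1, h2, Equiv.swap_comm]

theorem next_even {v : Fin 14 → Bool} {i : Fin 4} {t : Fin 14} (hi : Even (i : ℕ))
    (hv : v t = false) : next wordL3 v (i, t) = (i, t + 1) := by
  have h := next_inc wordL3 v (i, t)
  simpa [inc, out, turn, hi, hv] using h

theorem next_odd {v : Fin 14 → Bool} {i : Fin 4} {t : Fin 14} (hi : ¬ Even (i : ℕ))
    (hv : v t = false) : next wordL3 v (i, t + 1) = (i, t) := by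
  have h := next_inc wordL3 v (i, t)
  simpa [inc, out, turn, hi, hv] using h

/-- The edges of the loop that closes up when the crossing is smoothed. -/
def loopSet (k : Fin 14) : Finset E4 :=
  Finset.univ.filter fun e => (e.1 = od k ∧ e.2 ≤ k) ∨ (e.1 = ev k ∧ 0 < e.2 ∧ e.2 ≤ k)

theorem mem_loopSet {k : Fin 14} {e : E4} :
    e ∈ loopSet k ↔ (e.1 = od k ∧ e.2 ≤ k) ∨ (e.1 = ev k ∧ 0 < e.2 ∧ e.2 ≤ k) := by
  simp [loopSet]

theorem src_mem_loopSet {k : Fin 14} {i : Fin 4} : src i ∈ loopSet k ↔ i = od k := by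
  simp [mem_loopSet, src]

theorem fin_pred : ∀ t k : Fin 14, t ≤ k → t ≠ 0 → ∃ s, t = s + 1 ∧ s < k ∧ (s : ℕ) + 1 = t := by
  decide +kernel

theorem fin_succ : ∀ t k : Fin 14, t < k → 0 < t + 1 ∧ t + 1 ≤ k ∧ ((t + 1 : Fin 14) : ℕ) = t + 1 := by
  decide +kernel

theorem enter_avoids : ∀ k t : Fin 14, k ≤ t → t + 1 ≠ 0 → (enter t).2 ∉ loopSet k := by
  decide +kernel

theorem enter_avoids' : ∀ k t : Fin 14, k < t → (enter t).1 ∉ loopSet k := by decide +kernel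

theorem hat_inv_enter_avoids {k t : Fin 14} (hkt : k ≤ t) {c : Equiv.Perm (Fin 4)}
    (hc : c (od k) = ev k) : hat c⁻¹ (enter t).2 ∉ loopSet k := by
  by_cases h : t + 1 = 0
  · have : (enter t).2 = src (od t) := by rw [enter, h]; rfl
    rw [this, hat_src, src_mem_loopSet]
    intro h'
    have : c (c⁻¹ (od t)) = ev k := by rw [h', hc]
    rw [← Equiv.Perm.mul_apply, mul_inv_cancel, Equiv.Perm.one_apply] at this
    exact od_ne_ev t k this
  · rw [hat_of_ne _ (by exact h)]
    exact enter_avoids k t hkt h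

theorem hat_inv_enter_avoids' {k t : Fin 14} (hkt : k < t) (c : Equiv.Perm (Fin 4)) :
    hat c⁻¹ (enter t).1 ∉ loopSet k := by
  rw [hat_of_ne _ (fun h : t = 0 => by subst h; exact absurd hkt (by simp))]
  exact enter_avoids' k t hkt

theorem swap_conj (α : Equiv.Perm E4) (c : Equiv.Perm (Fin 4)) (x y : E4) :
    α * hat c * Equiv.swap (hat c⁻¹ x) (hat c⁻¹ y) = α * Equiv.swap x y * hat c := by
  rw [hat_inv, Equiv.swap_apply_apply]
  group

section

variable {k : Fin 14} {v : Fin 14 → Bool} {c : Equiv.Perm (Fin 4)}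

theorem next_enter (hk : v k = true) : next wordL3 v (ev k, k) = (od k, k) := by
  rw [next_eq_low hk, Equiv.Perm.mul_apply]
  change next wordL3 (low v k) (Equiv.swap (enter k).1 (enter k).2 (enter k).1) = _
  rw [Equiv.swap_apply_left]
  exact next_odd (not_even_od k) (by simp)

theorem loop_step (hv : ∀ t < k, v t = false) (hk : v k = true) (hc : c (od k) = ev k) {e : E4}
    (he : e ∈ loopSet k) : ((next wordL3 v * hat c) e ∈ loopSet k) ∧
      (e.1 = od k → e.2 = 0 ∨ ∃ s : Fin 14, e = (od k, s + 1) ∧ (s : ℕ) + 1 = e.2 ∧ s ≤ k ∧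
        (next wordL3 v * hat c) e = (od k, s)) ∧
      (e.1 = ev k → (next wordL3 v * hat c) e = (od k, k) ∨
        (e.2 < k ∧ (next wordL3 v * hat c) e = (ev k, e.2 + 1))) := by
  obtain ⟨i, t⟩ := e
  rw [Equiv.Perm.mul_apply]
  rcases mem_loopSet.1 he with ⟨h1, h2⟩ | ⟨h1, h2, h3⟩
  · simp only at h1 h2
    subst h1
    by_cases ht : t = 0
    · subst ht
      refine ⟨?_, fun _ => Or.inl rfl, fun h => absurd h (od_ne_ev k k)⟩
      change next wordL3 v (hat c (src (od k))) ∈ _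
      rw [hat_src, hc]
      by_cases hk0 : k = 0
      · have := next_enter hk
        rw [src, ← hk0, this, mem_loopSet]
        simp
      · have h0 : 0 < k := Fin.pos_iff_ne_zero.2 hk0
        rw [src, next_even (even_ev k) (hv 0 h0), mem_loopSet]
        exact Or.inr ⟨rfl, (fin_succ 0 k h0).1, (fin_succ 0 k h0).2.1⟩
    · obtain ⟨s, rfl, hs, hs'⟩ := fin_pred t k h2 ht
      rw [hat_of_ne _ ht, next_odd (not_even_od k) (hv s hs), mem_loopSet]
      exact ⟨Or.inl ⟨rfl, hs.le⟩, fun _ => Or.inr ⟨s, rfl, hs', hs.le, rfl⟩,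
        fun h => absurd h (od_ne_ev k k)⟩
  · simp only at h1 h2 h3
    subst h1
    rw [hat_of_ne _ h2.ne']
    rcases h3.lt_or_eq with h | rfl
    · rw [next_even (even_ev k) (hv t h), mem_loopSet]
      exact ⟨Or.inr ⟨rfl, (fin_succ t k h).1, (fin_succ t k h).2.1⟩,
        fun h => absurd h.symm (od_ne_ev k k), fun _ => Or.inr ⟨h, rfl⟩⟩
    · rw [next_enter hk, mem_loopSet]
      exact ⟨Or.inl ⟨rfl, le_rfl⟩, fun h => absurd h.symm (od_ne_ev _ _), fun _ => Or.inl rfl⟩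

/-- The loop that closes up when the crossing is smoothed. -/
theorem bubble (hv : ∀ t < k, v t = false) (hk : v k = true) (hc : c (od k) = ev k) :
    Bubble (next wordL3 (low v k) * hat c) (next wordL3 v * hat c) (loopSet k)
      (hat c⁻¹ (enter k).1) (hat c⁻¹ (enter k).2) (src (od k)) := by
  have hmap : ∀ e ∈ loopSet k, (next wordL3 v * hat c) e ∈ loopSet k :=
    fun e he => (loop_step hv hk hc he).1
  have hodd : ∀ (n : ℕ) (t : Fin 14), (t : ℕ) = n → t ≤ k →
      (next wordL3 v * hat c).SameCycle (od k, t) (src (od k)) := by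
    intro n
    induction n with
    | zero =>
      intro t ht _
      have : t = 0 := Fin.ext ht
      subst this
      exact .refl _ _
    | succ n ih =>
      intro t ht htk
      rcases (loop_step (c := c) hv hk hc (e := (od k, t)) (mem_loopSet.2 (Or.inl ⟨rfl, htk⟩))).2.1 rfl
        with h | ⟨s, h1, h2, h3, h4⟩
      · simp only at h
        subst h
        simp at ht
      · rw [← Equiv.Perm.sameCycle_apply_left, h4]
        simp only at h2
        exact ih s (by omega) h3
  have hev : ∀ (n : ℕ) (t : Fin 14), (k : ℕ) - t = n → 0 < t → t ≤ k →
      (next wordL3 v * hat c).SameCycle (ev k, t) (src (od k)) := by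
    intro n
    induction n with
    | zero =>
      intro t ht h0 htk
      rcases (loop_step (c := c) hv hk hc (e := (ev k, t))
        (mem_loopSet.2 (Or.inr ⟨rfl, h0, htk⟩))).2.2 rfl with h | ⟨h, -⟩
      · rw [← Equiv.Perm.sameCycle_apply_left, h]
        exact hodd _ k rfl le_rfl
      · simp only at h
        have : (t : ℕ) < k := h
        omega
    | succ n ih =>
      intro t ht h0 htk
      rcases (loop_step (c := c) hv hk hc (e := (ev k, t))
        (mem_loopSet.2 (Or.inr ⟨rfl, h0, htk⟩))).2.2 rfl with h | ⟨h, h'⟩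
      · rw [← Equiv.Perm.sameCycle_apply_left, h]
        exact hodd _ k rfl le_rfl
      · rw [← Equiv.Perm.sameCycle_apply_left, h']
        simp only at h
        obtain ⟨h1, h2, h3⟩ := fin_succ t k h
        exact ih (t + 1) (by omega) h1 h2
  refine ⟨?_, ?_, ?_, hat_inv_enter_avoids le_rfl hc, src_mem_loopSet.2 rfl, ?_⟩
  · rw [swap_conj, ← next_eq_low hk]
  · intro e
    refine ⟨fun h => ?_, hmap e⟩
    have him : (loopSet k).image (next wordL3 v * hat c) = loopSet k :=
      Finset.eq_of_subset_of_card_le (fun f hf => by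
        obtain ⟨g, hg, rfl⟩ := Finset.mem_image.1 hf
        exact hmap g hg)
        (Finset.card_image_of_injective _ (next wordL3 v * hat c).injective).ge
    rw [← him] at h
    obtain ⟨g, hg, hge⟩ := Finset.mem_image.1 h
    rwa [← (next wordL3 v * hat c).injective hge]
  · by_cases hk0 : k = 0
    · have : (enter k).1 = src (ev k) := by rw [enter, hk0]; rfl
      rw [this, hat_src, src_mem_loopSet, ← hc, ← Equiv.Perm.mul_apply, inv_mul_cancel,
        Equiv.Perm.one_apply]
    · rw [hat_of_ne _ (by exact hk0), mem_loopSet]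
      exact Or.inr ⟨rfl, Fin.pos_iff_ne_zero.2 hk0, le_rfl⟩
  · rintro ⟨i, t⟩ he
    rcases mem_loopSet.1 he with ⟨h1, h2⟩ | ⟨h1, h2, h3⟩
    · simp only at h1 h2
      subst h1
      exact hodd _ t rfl h2
    · simp only at h1 h2 h3
      subst h1
      exact hev _ t rfl h2 h3

end

/-- The gluing after the smoothing of a crossing. -/
def tb (k : Fin 14) (a : Equiv.Perm (Fin 4)) : Equiv.Perm (Fin 4) :=
  a * Equiv.swap (od k) (a⁻¹ (ev k))

theorem tb_od (k : Fin 14) (a : Equiv.Perm (Fin 4)) : tb k a (od k) = ev k := by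
  simp [tb]

theorem code_tb (k : Fin 14) (a : Equiv.Perm (Fin 4)) :
    code (tb k a) = turnback (ev k) (od k) (code a) := by
  rw [tb, code_mul, code_swap, turnback, ← code_inv, digit_code]

theorem tb_eq_self {k : Fin 14} {a : Equiv.Perm (Fin 4)} (h : a (od k) = ev k) : tb k a = a := by
  rw [tb, ← h, ← Equiv.Perm.mul_apply, inv_mul_cancel, Equiv.Perm.one_apply, Equiv.swap_self]
  rfl

theorem isLoop_iff {k : Fin 14} {a : Equiv.Perm (Fin 4)} :
    isLoop (ev k) (od k) (code a) = true ↔ a (od k) = ev k := by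
  rw [isLoop, digit_code, beq_iff_eq, Fin.ext_iff]

variable {S : Type} [CommRing S]

theorem mval_loopTerm (o : Fin 4) (b : Bool) :
    mval S (loopTerm o b) = if b then MvPolynomial.X (src o) else 1 := by
  cases b with
  | false => exact mval_one
  | true =>
    have h := maskVal_lor (fun i => (MvPolynomial.X (src i) : MvPolynomial E4 S)) (m := 0) (d := o)
      (by simp)
    have e : Nat.lor 0 (2 ^ (o : ℕ)) = 2 ^ (o : ℕ) := Nat.zero_or _
    rw [e, maskVal_zero, mul_one] at h
    simp [mval, loopTerm, monosVal, h]

theorem avoids_maskVal {k : Fin 14} {m : ℕ} (h : Nat.testBit m (od k) = false) :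
    Avoids (loopSet k) (maskVal (fun i => (MvPolynomial.X (src i) : MvPolynomial E4 S)) m) := by
  rw [maskVal]
  refine Finset.prod_induction _ (Avoids (loopSet k)) (fun _ _ => Avoids.mul) Avoids.one
    fun i _ => ?_
  split_ifs with hi
  · refine Avoids.X fun h' => ?_
    rw [src_mem_loopSet] at h'
    subst h'
    rw [h] at hi
    exact absurd hi (by simp)
  · exact Avoids.one

theorem death_mval (k : Fin 14) (x : Monos) :
    death S (loopSet k) (mval S x) = mval S (loopCoeff (od k) x) := by
  induction x with
  | nil => exact map_zero _
  | cons t l ih =>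
    obtain ⟨m, z⟩ := t
    have hz : ∀ q : MvPolynomial E4 S, death S (loopSet k) ((z : MvPolynomial E4 S) * q) =
        (z : MvPolynomial E4 S) * death S (loopSet k) q := fun q => by
      rw [← zsmul_eq_mul, ← zsmul_eq_mul, map_zsmul]
    rw [mval, monosVal, map_add, hz, loopCoeff]
    rw [mval] at ih
    rw [ih]
    split_ifs with h
    · have hx : Nat.testBit (Nat.xor m (2 ^ (od k : ℕ))) (od k) = false := by
        change Nat.testBit (m ^^^ 2 ^ (od k : ℕ)) (od k) = false
        rw [Nat.testBit_xor, h, Nat.testBit_two_pow_self]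
        rfl
      have e : Nat.lor (Nat.xor m (2 ^ (od k : ℕ))) (2 ^ (od k : ℕ)) = m := by
        change (m ^^^ 2 ^ (od k : ℕ)) ||| 2 ^ (od k : ℕ) = m
        refine Nat.eq_of_testBit_eq fun i => ?_
        rw [Nat.testBit_or, Nat.testBit_xor, Nat.testBit_two_pow]
        by_cases hi : (od k : ℕ) = i
        · rw [← hi, h]; simp
        · simp [hi]
      have h1 := maskVal_lor (fun i => (MvPolynomial.X (src i) : MvPolynomial E4 S)) hx
      rw [e] at h1
      rw [h1, (avoids_maskVal hx).death_mul, death_X_of_mem (src_mem_loopSet.2 rfl), one_mul]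
      rfl
    · rw [(avoids_maskVal (by simpa using h)).1, mul_zero, zero_add, mval]

end Turnback

section LoopMaps

variable (S : Type) [CommRing S]

/-- The map that creates the loop at the crossing. -/
def inMap (k : Fin 14) (v : Fin 14 → Bool) (a : Equiv.Perm (Fin 4)) (s : Bool) :
    MvPolynomial E4 S →ₗ[S] MvPolynomial E4 S :=
  mulBy (morPoly S (next wordL3 v) (tb k a) a (loopTerm (od k) s)) ∘ₗ
    (birth S (loopSet k) (hat (tb k a)⁻¹ (enter k).2)).toLinearMap

/-- The map that removes the loop at the crossing. -/
def outMap (k : Fin 14) (v : Fin 14 → Bool) (a : Equiv.Perm (Fin 4)) (s : Bool) :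
    MvPolynomial E4 S →ₗ[S] MvPolynomial E4 S :=
  death S (loopSet k) ∘ₗ mulBy (morPoly S (next wordL3 v) a (tb k a) (loopTerm (od k) s))

/-- The map of the change of a crossing, for a given gluing. -/
def saddle (t : Fin 14) (v : Fin 14 → Bool) (a : Equiv.Perm (Fin 4)) : MvPolynomial E4 S :=
  stepPoly 0 (next wordL3 v * hat a) (hat a⁻¹ (enter t).1) (hat a⁻¹ (enter t).2)

/-- Whether the variable of the loop is multiplied in before the loop is removed. -/
def outFlag (k : Fin 14) (a : Equiv.Perm (Fin 4)) (s : Bool) : Bool :=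
  decide (a (od k) = ev k) && !s

variable {S} {k : Fin 14} {v : Fin 14 → Bool} {a b c : Equiv.Perm (Fin 4)}

theorem inMap_apply (s : Bool) (p : MvPolynomial E4 S) : inMap S k v a s p =
    morPoly S (next wordL3 v) (tb k a) a (loopTerm (od k) s) *
      birth S (loopSet k) (hat (tb k a)⁻¹ (enter k).2) p := rfl

theorem outMap_apply (s : Bool) (p : MvPolynomial E4 S) : outMap S k v a s p =
    death S (loopSet k) (morPoly S (next wordL3 v) a (tb k a) (loopTerm (od k) s) * p) := rfl

theorem inMap_mem (hv : ∀ t < k, v t = false) (hk : v k = true) (s : Bool) {p : MvPolynomial E4 S}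
    (hp : p ∈ cycIdeal S (next wordL3 (low v k) * hat (tb k a))) :
    inMap S k v a s p ∈ cycIdeal S (next wordL3 v * hat a) := by
  rw [inMap_apply]
  exact morPoly_mul_mem _ ((bubble hv hk (tb_od k a)).birth_mem hp)

theorem outMap_mem (hv : ∀ t < k, v t = false) (hk : v k = true) (s : Bool) {p : MvPolynomial E4 S}
    (hp : p ∈ cycIdeal S (next wordL3 v * hat a)) :
    outMap S k v a s p ∈ cycIdeal S (next wordL3 (low v k) * hat (tb k a)) := by
  rw [outMap_apply]
  exact ((bubble hv hk (tb_od k a)).loop_mem (morPoly_mul_mem _ hp)).2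

theorem wordPoly_bubble (hv : ∀ t < k, v t = false) (hk : v k = true)
    (l : List (Fin 4 × Fin 4)) (hl : ∀ p ∈ l, p.1 ≠ od k ∧ p.2 ≠ od k)
    (hc : c (od k) = ev k) : wordPoly (0 : S) (next wordL3 v * hat c) (srcPairs l) =
      wordPoly 0 (next wordL3 (low v k) * hat c) (srcPairs l) := by
  induction l generalizing c with
  | nil => rfl
  | cons p l ih =>
    have hp := hl p List.mem_cons_self
    have h1 := (bubble hv hk hc).sameCycle_iff (e := src p.1) (f := src p.2)
      (fun h => hp.1 (src_mem_loopSet.1 h)) (fun h => hp.2 (src_mem_loopSet.1 h))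
    have h2 := ih (fun q hq => hl q (List.mem_cons_of_mem _ hq)) (c := c * Equiv.swap p.1 p.2) (by
      rw [Equiv.Perm.mul_apply, Equiv.swap_apply_of_ne_of_ne hp.1.symm hp.2.symm, hc])
    rw [hat_mul, hat_swap, ← mul_assoc, ← mul_assoc] at h2
    rw [srcPairs, List.map_cons, wordPoly, wordPoly, ← srcPairs, h2, stepPoly, stepPoly]
    simp only [h1]

theorem gluePoly_bubble (hv : ∀ t < k, v t = false) (hk : v k = true)
    (ha : a (od k) = ev k) (hb : b (od k) = ev k) :
    gluePoly S (next wordL3 v) a b = gluePoly S (next wordL3 (low v k)) a b := by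
  refine wordPoly_bubble hv hk _ (factors_fixed _ _ ?_) ha
  rw [Equiv.Perm.mul_apply, hb, ← ha, ← Equiv.Perm.mul_apply, inv_mul_cancel, Equiv.Perm.one_apply]

theorem avoids_gluePoly (α : Equiv.Perm E4) (ha : a (od k) = ev k) (hb : b (od k) = ev k) :
    Avoids (loopSet k) (gluePoly S α a b) := by
  refine Avoids.wordPoly (fun p hp => ?_) _
  obtain ⟨q, hq, rfl⟩ := List.mem_map.1 hp
  have := factors_fixed (a⁻¹ * b) (od k) (by
    rw [Equiv.Perm.mul_apply, hb, ← ha, ← Equiv.Perm.mul_apply, inv_mul_cancel,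
      Equiv.Perm.one_apply]) q hq
  exact ⟨fun h => this.1 (src_mem_loopSet.1 h), fun h => this.2 (src_mem_loopSet.1 h)⟩

/-- The map induced between the smoothings with loops removed. -/
theorem outMap_morPoly_inMap (hv : ∀ t < k, v t = false) (hk : v k = true) (s t : Bool) (x : Monos)
    (p : MvPolynomial E4 S) :
    outMap S k v b t (morPoly S (next wordL3 v) a b x * inMap S k v a s p) -
      morPoly S (next wordL3 (low v k)) (tb k a) (tb k b)
        (induced (ev k) (od k) (code a) (code b) s t x) * p ∈
      cycIdeal S (next wordL3 (low v k) * hat (tb k b)) := by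
  have hB := bubble hv hk (tb_od k b)
  have hA := bubble hv hk (tb_od k a)
  set β := next wordL3 v
  set l := loopTerm (od k) s
  set l' := loopTerm (od k) t
  set m := compose (code ((tb k a)⁻¹ * b)) (code (b⁻¹ * tb k b))
    (compose (code ((tb k a)⁻¹ * a)) (code (a⁻¹ * b)) l x) l' with hm
  have hind : induced (ev k) (od k) (code a) (code b) s t x = loopCoeff (od k) m := by
    rw [hm, induced]
    simp only [code_mul, code_inv, code_tb]
    rfl
  set y := birth S (loopSet k) (hat (tb k a)⁻¹ (enter k).2) p with hy
  have h1 := morPoly_comp (S := S) β (tb k a) a b l x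
  have h2 := morPoly_comp (S := S) β (tb k a) b (tb k b)
    (compose (code ((tb k a)⁻¹ * a)) (code (a⁻¹ * b)) l x) l'
  rw [← hm] at h2
  have h3 := morPoly_mul_mem (b := tb k b) l' h1
  have h4 : morPoly S β b (tb k b) l' * (morPoly S β a b x * (morPoly S β (tb k a) a l * y)) -
      mval S m * (gluePoly S β (tb k a) (tb k b) * y) ∈ cycIdeal S (β * hat (tb k b)) := by
    convert Ideal.mul_mem_right y _ (add_mem h3 h2) using 1
    have : morPoly S β (tb k a) (tb k b) m = mval S m * gluePoly S β (tb k a) (tb k b) := rfl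
    rw [this]
    ring
  have h5 := (hB.loop_mem h4).2
  rw [map_sub, ((avoids_gluePoly β (tb_od k a) (tb_od k b)).mul (avoids_birth hA.hy p)).death_mul,
    death_mval, gluePoly_bubble hv hk (tb_od k a) (tb_od k b)] at h5
  have h6 := morPoly_mul_mem (b := tb k b) (loopCoeff (od k) m) (hA.sub_birth_mem' p)
  rw [hind]
  convert sub_mem h5 h6 using 1
  have : morPoly S (next wordL3 (low v k)) (tb k a) (tb k b) (loopCoeff (od k) m) =
    mval S (loopCoeff (od k) m) * gluePoly S (next wordL3 (low v k)) (tb k a) (tb k b) := rfl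
  rw [outMap_apply, inMap_apply, this]
  ring

theorem induced_one : ∀ (k : Fin 14) (a : Equiv.Perm (Fin 4)) (s s' : Bool),
    (s = true → a (od k) = ev k) → (s' = true → a (od k) = ev k) →
    induced (ev k) (od k) (code a) (code a) s (outFlag k a s') [(0, 1)] =
      if s = s' then [(0, 1)] else [] := by decide +kernel

theorem outMap_inMap (hv : ∀ t < k, v t = false) (hk : v k = true) {s s' : Bool}
    (hs : s = true → a (od k) = ev k) (hs' : s' = true → a (od k) = ev k) (p : MvPolynomial E4 S) :
    outMap S k v a (outFlag k a s') (inMap S k v a s p) - (if s = s' then p else 0) ∈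
      cycIdeal S (next wordL3 (low v k) * hat (tb k a)) := by
  have := outMap_morPoly_inMap (a := a) (b := a) hv hk s (outFlag k a s') [(0, 1)] p
  rw [induced_one k a s s' hs hs', morPoly_self, mval_one, one_mul, morPoly_self] at this
  split_ifs with h
  · rwa [if_pos h, mval_one, one_mul] at this
  · rw [if_neg h] at this
    simpa [mval, monosVal] using this

theorem inMap_outMap_of_loop (hv : ∀ t < k, v t = false) (hk : v k = true) (ha : a (od k) = ev k)
    (p : MvPolynomial E4 S) :
    p - (inMap S k v a true (outMap S k v a (outFlag k a true) p) +
      inMap S k v a false (outMap S k v a (outFlag k a false) p)) ∈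
      cycIdeal S (next wordL3 v * hat a) := by
  have h := (bubble hv hk ha).decomposition p
  simp only [inMap_apply, outMap_apply, outFlag, ha, tb_eq_self ha, morPoly_self, mval_loopTerm]
  simpa using h

theorem factors_swap : ∀ i j : Fin 4, i ≠ j → factors (Equiv.swap i j) = [(i, j)] ∨
    factors (Equiv.swap i j) = [(j, i)] := by decide +kernel

theorem tb_inv_mul (k : Fin 14) (a : Equiv.Perm (Fin 4)) :
    (tb k a)⁻¹ * a = Equiv.swap (od k) (a⁻¹ (ev k)) := by
  rw [tb, mul_inv_rev, inv_mul_cancel_right, Equiv.swap_inv]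

theorem inMap_outMap_of_not_loop (hv : ∀ t < k, v t = false) (hk : v k = true)
    (ha : a (od k) ≠ ev k) (p : MvPolynomial E4 S) :
    p - inMap S k v a false (outMap S k v a (outFlag k a false) p) ∈
      cycIdeal S (next wordL3 v * hat a) := by
  have hB := bubble hv hk (tb_od k a)
  have hne : od k ≠ a⁻¹ (ev k) := fun h => ha (by
    rw [h, ← Equiv.Perm.mul_apply, mul_inv_cancel, Equiv.Perm.one_apply])
  have hL : src (a⁻¹ (ev k)) ∉ loopSet k := fun h => hne (src_mem_loopSet.1 h).symm
  have hsame : ∀ e ∈ loopSet k,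
      ¬ (next wordL3 v * hat (tb k a)).SameCycle e (src (a⁻¹ (ev k))) := fun e he h =>
    hL ((hB.mem_iff h).1 he)
  have hglue : gluePoly S (next wordL3 v) (tb k a) a = 1 := by
    rw [gluePoly, tb_inv_mul, srcWord]
    rcases factors_swap _ _ hne with h | h
    · rw [h]
      simp only [srcPairs, List.map_cons, List.map_nil, wordPoly, stepPoly]
      rw [if_neg (hsame _ (src_mem_loopSet.2 rfl)), one_mul]
    · rw [h]
      simp only [srcPairs, List.map_cons, List.map_nil, wordPoly, stepPoly]
      rw [if_neg (fun h => hsame _ (src_mem_loopSet.2 rfl) h.symm), one_mul]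
  have hin : ∀ q, inMap S k v a false q =
      birth S (loopSet k) (hat (tb k a)⁻¹ (enter k).2) q := fun q => by
    rw [inMap_apply, morPoly, hglue, mval_loopTerm]
    simp
  have hperm : next wordL3 v * hat a =
      next wordL3 v * hat (tb k a) * Equiv.swap (src (od k)) (src (a⁻¹ (ev k))) := by
    rw [← hat_swap, mul_assoc, ← hat_mul, tb, mul_assoc, Equiv.swap_mul_self, mul_one]
  have hcyc : ∀ e ∈ loopSet k, (next wordL3 v * hat a).SameCycle e (src (a⁻¹ (ev k))) := by
    intro e he
    rw [hperm, sameCycle_mul_swap_iff (src_injective.ne hne) (hsame _ (src_mem_loopSet.2 rfl))]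
    exact Or.inr (Or.inl ⟨hB.same e he, .refl _ _⟩)
  set q := birth S (loopSet k) (src (a⁻¹ (ev k))) p with hq
  have h1 : p - q ∈ cycIdeal S (next wordL3 v * hat a) := sub_birth_mem hcyc p
  have h2 : inMap S k v a false q = q := by rw [hin, birth_of_avoids (avoids_birth hL p)]
  have h3 := outMap_inMap (a := a) (s := false) (s' := false) hv hk (by simp) (by simp) q
  rw [if_pos rfl, h2] at h3
  have h4 := inMap_mem hv hk false h3
  have h5 := inMap_mem hv hk false (outMap_mem hv hk (outFlag k a false) h1)
  rw [map_sub, h2] at h4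
  rw [map_sub, map_sub] at h5
  convert sub_mem h1 (add_mem h4 h5) using 1
  ring

theorem outMap_saddle (hv : ∀ t < k, v t = false) (hk : v k = true) (s : Bool)
    (p : MvPolynomial E4 S) :
    outMap S k v a s (saddle S k (low v k) a * p) -
      morPoly S (next wordL3 (low v k)) a (tb k a) (loopTerm (od k) s) * p ∈
      cycIdeal S (next wordL3 (low v k) * hat (tb k a)) := by
  have hB := bubble hv hk (tb_od k a)
  have h1 := gluePoly_natural (S := S) (next wordL3 (low v k)) (enter_ne k) a (tb k a)
  rw [← next_eq_low hk] at h1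
  have h2 := (hB.loop_mem (Ideal.mul_mem_right p _
    (Ideal.mul_mem_left _ (mval S (loopTerm (od k) s)) h1))).2
  have h3 := hB.death_split (morPoly S (next wordL3 (low v k)) a (tb k a) (loopTerm (od k) s) * p)
  have h4 : stepPoly (0 : S) (next wordL3 (low v k) * hat (tb k a)) (hat (tb k a)⁻¹ (enter k).1)
      (hat (tb k a)⁻¹ (enter k).2) = MvPolynomial.X (hat (tb k a)⁻¹ (enter k).1) +
        MvPolynomial.X (hat (tb k a)⁻¹ (enter k).2) := by
    rw [stepPoly, if_pos hB.same_split, MvPolynomial.C_0, sub_zero]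
  rw [h4] at h2
  rw [outMap_apply]
  convert sub_mem h2 h3 using 1
  rw [mul_sub, sub_mul, map_sub, saddle, morPoly, morPoly]
  have e1 : mval S (loopTerm (od k) s) * gluePoly S (next wordL3 v) a (tb k a) *
      (stepPoly 0 (next wordL3 (low v k) * hat a) (hat a⁻¹ (enter k).1) (hat a⁻¹ (enter k).2) * p) =
      mval S (loopTerm (od k) s) * (stepPoly 0 (next wordL3 (low v k) * hat a)
        (hat a⁻¹ (enter k).1) (hat a⁻¹ (enter k).2) * gluePoly S (next wordL3 v) a (tb k a)) * p := by
    ring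
  have e2 : mval S (loopTerm (od k) s) * (gluePoly S (next wordL3 (low v k)) a (tb k a) *
      (MvPolynomial.X (hat (tb k a)⁻¹ (enter k).1) +
        MvPolynomial.X (hat (tb k a)⁻¹ (enter k).2))) * p =
      (MvPolynomial.X (hat (tb k a)⁻¹ (enter k).1) +
        MvPolynomial.X (hat (tb k a)⁻¹ (enter k).2)) *
        (mval S (loopTerm (od k) s) * gluePoly S (next wordL3 (low v k)) a (tb k a) * p) := by
    ring
  rw [e1, e2]
  ring

theorem outMap_saddle_inMap {t : Fin 14} (hkt : k < t) (hv : ∀ t < k, v t = false)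
    (hk : v k = true) (ht : v t = true) {s s' : Bool}
    (hs : s = true → a (od k) = ev k) (hs' : s' = true → a (od k) = ev k) (p : MvPolynomial E4 S) :
    outMap S k v a (outFlag k a s') (saddle S t (low v t) a * inMap S k (low v t) a s p) -
      (if s = s' then saddle S t (low (low v k) t) (tb k a) * p else 0) ∈
      cycIdeal S (next wordL3 (low v k) * hat (tb k a)) := by
  have hkt' : k ≠ t := hkt.ne
  have hv' : ∀ r < k, low v t r = false := fun r hr => by
    rw [low_ne v (hr.trans hkt).ne, hv r hr]
  have hk' : low v t k = true := by rw [low_ne v hkt', hk]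
  have hB := bubble hv' hk' (tb_od k a)
  have hcomm : low (low v k) t = low (low v t) k := Function.update_comm hkt' _ _ _
  have hav : Avoids (loopSet k) (saddle S t (low (low v k) t) (tb k a)) :=
    Avoids.stepPoly (hat_inv_enter_avoids' hkt _) (hat_inv_enter_avoids hkt.le (tb_od k a)) _
  have hsad : saddle S t (low v t) (tb k a) = saddle S t (low (low v k) t) (tb k a) := by
    rw [saddle, saddle, stepPoly, stepPoly, hcomm]
    simp only [hB.sameCycle_iff (hat_inv_enter_avoids' hkt _)
      (hat_inv_enter_avoids hkt.le (tb_od k a))]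
  have h1 := gluePoly_natural (S := S) (next wordL3 (low v t)) (enter_ne t) (tb k a) a
  rw [← next_eq_low ht] at h1
  change saddle S t (low v t) (tb k a) * _ - _ * saddle S t (low v t) a ∈ _ at h1
  rw [hsad] at h1
  set σ := saddle S t (low (low v k) t) (tb k a)
  set y := birth S (loopSet k) (hat (tb k a)⁻¹ (enter k).2) p with hy
  have h2 : saddle S t (low v t) a * inMap S k (low v t) a s p - inMap S k v a s (σ * p) ∈
      cycIdeal S (next wordL3 v * hat a) := by
    have h3 := Ideal.mul_mem_right y _ (Ideal.mul_mem_left _ (mval S (loopTerm (od k) s)) h1)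
    convert neg_mem h3 using 1
    rw [inMap_apply, inMap_apply, map_mul, birth_of_avoids hav, ← hy, morPoly, morPoly]
    ring
  have h3 := outMap_mem hv hk (outFlag k a s') h2
  have h4 := outMap_inMap hv hk hs hs' (σ * p)
  rw [map_sub] at h3
  convert add_mem h3 h4 using 1
  ring

end LoopMaps

section Represented

variable {E : Type} [Fintype E] [DecidableEq E] {S : Type} [CommRing S] {e : E × E}
  {A B C : Equiv.Perm E × ℤ}

/-- The map of bimodules is induced by the map of polynomials. -/
def Rep (f : cycObj S e A ⟶ cycObj S e B) (φ : MvPolynomial E S → MvPolynomial E S) : Prop :=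
  ∀ p, f.toLin (elt S e A p) = elt S e B (φ p)

theorem Good.rep {φ : MvPolynomial E S →ₗ[S] MvPolynomial E S} (h : Good e A B φ) :
    Rep (polyHom e A B φ) φ := h.polyHom_elt

theorem Rep.comp {f : cycObj S e A ⟶ cycObj S e B} {g : cycObj S e B ⟶ cycObj S e C}
    {φ ψ : MvPolynomial E S → MvPolynomial E S} (hf : Rep f φ) (hg : Rep g ψ) :
    Rep (f ≫ g) fun p => ψ (φ p) := fun p => by
  change g.toLin (f.toLin (elt S e A p)) = _
  rw [hf, hg]

theorem Rep.add {f g : cycObj S e A ⟶ cycObj S e B} {φ ψ : MvPolynomial E S → MvPolynomial E S}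
    (hf : Rep f φ) (hg : Rep g ψ) : Rep (f + g) fun p => φ p + ψ p := fun p => by
  change f.toLin (elt S e A p) + g.toLin (elt S e A p) = _
  rw [hf, hg, map_add]

theorem Rep.sub {f g : cycObj S e A ⟶ cycObj S e B} {φ ψ : MvPolynomial E S → MvPolynomial E S}
    (hf : Rep f φ) (hg : Rep g ψ) : Rep (f - g) fun p => φ p - ψ p := fun p => by
  change f.toLin (elt S e A p) - g.toLin (elt S e A p) = _
  rw [hf, hg, map_sub]

theorem Rep.zero : Rep (0 : cycObj S e A ⟶ cycObj S e B) fun _ => 0 := fun p => by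
  rw [map_zero]
  rfl

theorem Rep.id : Rep (𝟙 (cycObj S e A)) fun p => p := fun _ => rfl

theorem Rep.sum {ι : Type} (s : Finset ι) {f : ι → (cycObj S e A ⟶ cycObj S e B)}
    {φ : ι → MvPolynomial E S → MvPolynomial E S} (h : ∀ i ∈ s, Rep (f i) (φ i)) :
    Rep (∑ i ∈ s, f i) fun p => ∑ i ∈ s, φ i p := by
  classical
  induction s using Finset.induction_on with
  | empty => simpa using Rep.zero
  | insert i s hi ih =>
    simp only [Finset.sum_insert hi]
    exact (h i (Finset.mem_insert_self i s)).add (ih fun j hj => h j (Finset.mem_insert_of_mem hj))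

theorem Rep.congr {f : cycObj S e A ⟶ cycObj S e B} {φ ψ : MvPolynomial E S → MvPolynomial E S}
    (hf : Rep f φ) (h : ∀ p, φ p - ψ p ∈ cycIdeal S B.1) : Rep f ψ := fun p => by
  rw [hf, elt_eq_iff]
  exact h p

theorem Rep.ext {f g : cycObj S e A ⟶ cycObj S e B} {φ ψ : MvPolynomial E S → MvPolynomial E S}
    (hf : Rep f φ) (hg : Rep g ψ) (h : ∀ p, φ p - ψ p ∈ cycIdeal S B.1) : f = g :=
  cycObj_hom_ext fun p => by rw [hf.congr h, hg]

theorem Rep.eq_zero {f : cycObj S e A ⟶ cycObj S e B} {φ : MvPolynomial E S → MvPolynomial E S}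
    (hf : Rep f φ) (h : ∀ p, φ p ∈ cycIdeal S B.1) : f = 0 :=
  hf.ext Rep.zero fun p => by simpa using h p

variable (S e) in
/-- The direct sum of the bimodules of a family of permutations. -/
abbrev cycMat {I : Type} [Fintype I] (A : I → Equiv.Perm E × ℤ) : Mat_ (GrBimod S) :=
  ⟨I, fun i => cycObj S e (A i)⟩

open Classical in
/-- Replacing each summand by several summands. -/
theorem Tw.exists_subst {I J : Type} [Fintype I] [Fintype J] {A : I → Equiv.Perm E × ℤ}
    {A' : J → Equiv.Perm E × ℤ} {h : I → ℤ} {d : cycMat S e A ⟶ cycMat S e A} (hd : d ≫ d = 0)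
    (hdeg : HasDeg h h 1 d) (β : J → I) {h' : J → ℤ} (hh : ∀ j, h' j = h (β j)) (φ ψ : J → MvPolynomial E S →ₗ[S] MvPolynomial E S)
    (hφ : ∀ j, Good e (A (β j)) (A' j) (φ j)) (hψ : ∀ j, Good e (A' j) (A (β j)) (ψ j))
    (h1 : ∀ i p, p - ∑ j, (if β j = i then ψ j (φ j p) else 0) ∈ cycIdeal S (A i).1)
    (h2 : ∀ j j', β j = β j' → ∀ p, φ j' (ψ j p) - (if j = j' then p else 0) ∈
      cycIdeal S (A' j').1) :
    ∃ hd' hdeg', (⟨cycMat S e A, h, d, hd, hdeg⟩ : Tw (GrBimod S)).Equiv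
      ⟨cycMat S e A', h', fun j j' => polyHom e _ _ (ψ j) ≫ d (β j) (β j') ≫
        polyHom e _ _ (φ j'), hd', hdeg'⟩ := by
  obtain rfl : h' = h ∘ β := funext hh
  let f : cycMat S e A ⟶ cycMat S e A' := fun i j =>
    polyHom e (A i) (A' j) (if β j = i then φ j else 0)
  let g : cycMat S e A' ⟶ cycMat S e A := fun j i =>
    polyHom e (A' j) (A i) (if β j = i then ψ j else 0)
  have hf0 : ∀ i j, β j ≠ i → f i j = 0 := fun i j hij => by
    simp only [f, if_neg hij, polyHom_zero]
  have hg0 : ∀ j i, β j ≠ i → g j i = 0 := fun j i hij => by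
    simp only [g, if_neg hij, polyHom_zero]
  have hf1 : ∀ j, f (β j) j = polyHom e _ _ (φ j) := fun j => by simp only [f, if_true]
  have hg1 : ∀ j, g j (β j) = polyHom e _ _ (ψ j) := fun j => by simp only [g, if_true]
  have hfr : ∀ i j, Rep (f i j) fun p => if β j = i then φ j p else 0 := fun i j => by
    by_cases hij : β j = i
    · subst hij
      rw [hf1]
      simpa using (hφ j).rep
    · rw [hf0 i j hij]
      simpa [hij] using Rep.zero
  have hgr : ∀ j i, Rep (g j i) fun p => if β j = i then ψ j p else 0 := fun j i => by
    by_cases hij : β j = i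
    · subst hij
      rw [hg1]
      simpa using (hψ j).rep
    · rw [hg0 j i hij]
      simpa [hij] using Rep.zero
  have hfg : f ≫ g = 𝟙 _ := by
    funext i i'
    rw [Mat_.comp_apply]
    have hr := Rep.sum Finset.univ fun j _ => (hfr i j).comp (hgr j i')
    by_cases hii : i = i'
    · subst hii
      rw [Mat_.id_apply_self]
      refine hr.ext Rep.id fun p => ?_
      have := neg_mem (h1 i p)
      rw [neg_sub] at this
      have hs : ∑ j, (if β j = i then ψ j (if β j = i then φ j p else 0) else 0) =
          ∑ j, if β j = i then ψ j (φ j p) else 0 :=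
        Finset.sum_congr rfl fun j _ => by split_ifs <;> rfl
      rw [← hs] at this
      exact this
    · rw [Mat_.id_apply_of_ne _ _ _ hii]
      refine hr.eq_zero fun p => sum_mem fun j _ => ?_
      by_cases e1 : β j = i'
      · rw [if_pos e1, if_neg (fun e2 => hii (e2.symm.trans e1)), map_zero]
        exact zero_mem _
      · rw [if_neg e1]
        exact zero_mem _
  have hgf : g ≫ f = 𝟙 _ := by
    funext j j'
    rw [Mat_.comp_apply]
    by_cases hb : β j = β j'
    · have hs : ∑ i, g j i ≫ f i j' = g j (β j) ≫ f (β j) j' :=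
        Finset.sum_eq_single _ (fun i _ hi => by rw [hg0 j i hi.symm, zero_comp])
          (fun h => absurd (Finset.mem_univ _) h)
      rw [hs]
      have hr := (hgr j (β j)).comp (hfr (β j) j')
      by_cases hjj : j = j'
      · subst hjj
        rw [Mat_.id_apply_self]
        refine hr.ext Rep.id fun p => ?_
        simpa using h2 j j rfl p
      · rw [Mat_.id_apply_of_ne _ _ _ hjj]
        refine hr.eq_zero fun p => ?_
        simpa [hb, hjj] using h2 j j' hb p
    · rw [Mat_.id_apply_of_ne _ _ _ (fun h => hb (congrArg β h))]
      refine Finset.sum_eq_zero fun i _ => ?_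
      by_cases hi : β j = i
      · rw [hf0 i j' (fun h => hb (hi.trans h.symm)), comp_zero]
      · rw [hg0 j i hi, zero_comp]
  have hfd : HasDeg h (h ∘ β) 0 f := fun i j hij => hf0 i j fun hb => hij (by
    subst hb; simp)
  have hgd : HasDeg (h ∘ β) h 0 g := fun j i hij => hg0 j i fun hb => hij (by
    subst hb; simp)
  have hE := Tw.equiv_conj ⟨cycMat S e A, h, d, hd, hdeg⟩ (cycMat S e A') (h ∘ β) f g hfd hgd hfg hgf
  rw [Tw.conj] at hE
  have hdd : g ≫ d ≫ f = fun j j' => polyHom e _ _ (ψ j) ≫ d (β j) (β j') ≫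
      polyHom e _ _ (φ j') := by
    funext j j'
    rw [Mat_.comp_apply, Finset.sum_eq_single (β j), Mat_.comp_apply,
      Finset.sum_eq_single (β j'), hf1, hg1]
    · intro i _ hi
      rw [hf0 i j' hi.symm, comp_zero]
    · exact fun h => absurd (Finset.mem_univ _) h
    · intro i _ hi
      rw [hg0 j i hi.symm, zero_comp]
    · exact fun h => absurd (Finset.mem_univ _) h
  have key : ∀ (d' : cycMat S e A' ⟶ cycMat S e A') (x : g ≫ d ≫ f = d') (y) (z),
      (⟨cycMat S e A, h, d, hd, hdeg⟩ : Tw (GrBimod S)).Equiv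
        ⟨cycMat S e A', h ∘ β, g ≫ d ≫ f, y, z⟩ →
      ∃ hd' hdeg', (⟨cycMat S e A, h, d, hd, hdeg⟩ : Tw (GrBimod S)).Equiv
        ⟨cycMat S e A', h ∘ β, d', hd', hdeg'⟩ := by
    rintro _ rfl y z hE
    exact ⟨y, z, hE⟩
  exact key _ hdd _ _ hE

end Represented

section Entries

variable {S : Type} [CommRing S]

theorem mval_addEntry (n m : ℕ) (x : Monos) (l : List (ℕ × Monos)) :
    mval S (entry n (addEntry m x l)) = (if m = n then mval S x else 0) + mval S (entry n l) := by
  induction l with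
  | nil =>
    rw [addEntry]
    split_ifs with h1 h2 h2
    · subst h1; simp [mval, monosVal, entry]
    · subst h1; simp [mval, monosVal, entry]
    · simp [entry, h2, mval, monosVal]
    · simp [entry, h2, mval, monosVal]
  | cons t l ih =>
    obtain ⟨j, y⟩ := t
    rw [addEntry]
    by_cases hj : j = m
    · subst hj
      rw [if_pos rfl]
      have hs := monosVal_sumMonos (x := fun i => (MvPolynomial.X (src i) : MvPolynomial E4 S)) x y
      by_cases hn : j = n
      · subst hn
        rw [if_pos rfl, entry, if_pos rfl, mval_append, ← add_assoc]
        have : mval S x + mval S y = mval S (sumMonos x y) := hs.symm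
        rw [this]
        cases sumMonos x y with
        | nil => simp [mval, monosVal]
        | cons a b => simp only [entry, if_true]; rw [mval_append]
      · rw [if_neg hn, zero_add, entry, if_neg hn]
        cases sumMonos x y with
        | nil => rfl
        | cons a b => simp only [entry, if_neg hn]
    · rw [if_neg hj, entry, entry]
      split_ifs with h1 h2 h2
      · rw [mval_append, mval_append, ih, if_pos h2]
        ring
      · rw [mval_append, mval_append, ih, if_neg h2]
        ring
      · rw [ih, if_pos h2]
      · rw [ih, if_neg h2]

theorem entry_dropPivot {n k t : ℕ} (hn : ¬ (n = t ∨ n = k)) (l : List (ℕ × Monos)) :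
    entry n (dropPivot k t l) = entry n l := by
  induction l with
  | nil => rfl
  | cons x l ih =>
    obtain ⟨j, y⟩ := x
    rw [dropPivot]
    split_ifs with h
    · rw [ih, entry, if_neg]
      rintro rfl
      exact hn h
    · rw [entry, entry, ih]

theorem morPoly_addEntry (α : Equiv.Perm E4) (a b : Equiv.Perm (Fin 4)) (n m : ℕ) (x : Monos)
    (l : List (ℕ × Monos)) : morPoly S α a b (entry n (addEntry m x l)) =
      (if m = n then morPoly S α a b x else 0) + morPoly S α a b (entry n l) := by
  rw [morPoly, mval_addEntry, add_mul]
  split_ifs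
  · rfl
  · rw [zero_mul]; rfl

theorem morPoly_reduceRow (α : Equiv.Perm E4) (a b c : Equiv.Perm (Fin 4)) {st : List Row}
    {k t n : ℕ} (hn : ¬ (n = t ∨ n = k)) {r : Row} (hr : findRow n st = some r)
    (hc : r.code = code c) (x : Monos) (l acc : List (ℕ × Monos)) :
    morPoly S α a c (entry n (reduceRow st k t (code a) (code b) x l acc)) -
      (morPoly S α a c (entry n acc) + morPoly S α a b x * morPoly S α b c (entry n l)) ∈
      cycIdeal S (α * hat c) := by
  induction l generalizing acc with
  | nil =>
    rw [reduceRow, entry, morPoly_nil, mul_zero, add_zero, sub_self]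
    exact zero_mem _
  | cons q l ih =>
    obtain ⟨j, y⟩ := q
    rw [reduceRow]
    by_cases hj : j = t ∨ j = k
    · rw [if_pos hj, entry, if_neg (by rintro rfl; exact hn hj)]
      exact ih acc
    · rw [if_neg hj]
      by_cases hjn : j = n
      · subst hjn
        rw [hr]
        simp only
        have h1 := ih (addEntry j (compose (cmul (cinv (code a)) (code b))
          (cmul (cinv (code b)) r.code) x y) acc)
        rw [morPoly_addEntry, if_pos rfl, hc, ← code_inv, ← code_inv, ← code_mul, ← code_mul] at h1
        have h2 := morPoly_comp (S := S) α a b c x y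
        rw [entry, if_pos rfl, morPoly_append, hc, ← code_inv, ← code_inv, ← code_mul, ← code_mul]
        convert sub_mem h1 h2 using 1
        ring
      · rw [entry, if_neg hjn]
        cases findRow j st with
        | none => exact ih acc
        | some s =>
          have h1 := ih (addEntry j (compose (cmul (cinv (code a)) (code b))
            (cmul (cinv (code b)) s.code) x y) acc)
          rwa [morPoly_addEntry, if_neg hjn, zero_add] at h1

theorem mval_scale (u : ℤ) (x : Monos) : mval S (scale u x) = (u : MvPolynomial E4 S) * mval S x :=
  monosVal_scale u x

theorem morPoly_elimRow (α : Equiv.Perm E4) (a b c : Equiv.Perm (Fin 4)) {st : List Row}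
    {rk r s : Row} {t n : ℕ} {u : ℤ} (hn : ¬ (n = t ∨ n = rk.id)) (hs : findRow n st = some s)
    (ha : r.code = code a) (hb : rk.code = code b) (hc : s.code = code c) :
    morPoly S α a c (entry n (elimRow st rk t u r).ents) -
      (morPoly S α a c (entry n r.ents) - (u : MvPolynomial E4 S) *
        morPoly S α a b (entry t r.ents) * morPoly S α b c (entry n rk.ents)) ∈
      cycIdeal S (α * hat c) := by
  rw [elimRow]
  cases he : entry t r.ents with
  | nil =>
    simp only
    rw [entry_dropPivot hn, morPoly_nil, mul_zero, zero_mul, sub_zero, sub_self]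
    exact zero_mem _
  | cons y l =>
    simp only
    have h1 := morPoly_reduceRow (S := S) α a b c hn hs hc (scale (-u) (y :: l)) rk.ents
      (dropPivot rk.id t r.ents)
    rw [entry_dropPivot hn, ← ha, ← hb] at h1
    convert h1 using 2
    have : morPoly S α a b (scale (-u) (y :: l)) =
        -((u : MvPolynomial E4 S) * morPoly S α a b (y :: l)) := by
      rw [morPoly, mval_scale, morPoly]
      push_cast
      ring
    rw [this]
    ring

theorem findRow_id {n : ℕ} {st : List Row} {r : Row} (h : findRow n st = some r) : r.id = n := by
  induction st with
  | nil => simp [findRow] at h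
  | cons s st ih =>
    rw [findRow] at h
    split_ifs at h with hs
    · obtain rfl := Option.some.inj h
      exact hs
    · exact ih h

theorem findRow_mem {n : ℕ} {st : List Row} {r : Row} (h : findRow n st = some r) : r ∈ st := by
  induction st with
  | nil => simp [findRow] at h
  | cons s st ih =>
    rw [findRow] at h
    split_ifs at h with hs
    · obtain rfl := Option.some.inj h
      exact List.mem_cons_self
    · exact List.mem_cons_of_mem _ (ih h)

theorem elimRow_fields (st : List Row) (rk : Row) (t : ℕ) (u : ℤ) (r : Row) :
    (elimRow st rk t u r).id = r.id ∧ (elimRow st rk t u r).code = r.code ∧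
      (elimRow st rk t u r).h = r.h ∧ (elimRow st rk t u r).q = r.q := by
  rw [elimRow]
  cases entry t r.ents <;> exact ⟨rfl, rfl, rfl, rfl⟩

theorem findRow_elimRows {st : List Row} {rk : Row} {t : ℕ} {u : ℤ} {n : ℕ}
    (hn : ¬ (n = rk.id ∨ n = t)) {l : List Row} {r : Row} (h : findRow n l = some r) :
    findRow n (elimRows st rk t u l) = some (elimRow st rk t u r) := by
  induction l with
  | nil => simp [findRow] at h
  | cons s l ih =>
    rw [findRow] at h
    rw [elimRows]
    split_ifs at h with hs
    · obtain rfl := Option.some.inj h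
      subst hs
      rw [if_neg hn, findRow, if_pos (elimRow_fields st rk t u s).1]
    · split_ifs
      · exact ih h
      · rw [findRow, if_neg (by rwa [(elimRow_fields st rk t u s).1])]
        exact ih h

theorem mem_elimRows {st : List Row} {rk : Row} {t : ℕ} {u : ℤ} {l : List Row} {r : Row}
    (h : r ∈ elimRows st rk t u l) :
    ∃ s ∈ l, ¬ (s.id = rk.id ∨ s.id = t) ∧ r.id = s.id ∧ r.h = s.h ∧
      r.code = s.code := by
  induction l with
  | nil => simp [elimRows] at h
  | cons s l ih =>
    rw [elimRows] at h
    split_ifs at h with hs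
    · obtain ⟨x, hx, hx'⟩ := ih h
      exact ⟨x, List.mem_cons_of_mem _ hx, hx'⟩
    · rcases List.mem_cons.1 h with rfl | h
      · have := elimRow_fields st rk t u s
        exact ⟨s, List.mem_cons_self, hs, this.1, this.2.2.1, this.2.1⟩
      · obtain ⟨x, hx, hx'⟩ := ih h
        exact ⟨x, List.mem_cons_of_mem _ hx, hx'⟩

theorem pivotRow_spec {st : List Row} {n t : ℕ} {u : ℤ} {r : Row} (h : pivotRow st n t u = some r) :
    findRow n st = some r ∧ ∃ s, findRow t st = some s ∧ s.code = r.code ∧ s.q = r.q ∧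
      s.h = r.h + 1 ∧ u * u = 1 ∧ entry t r.ents = [(0, u)] := by
  rw [pivotRow] at h
  cases hn : findRow n st with
  | none => simp [hn] at h
  | some r' =>
    cases ht : findRow t st with
    | none => simp [hn, ht] at h
    | some s =>
      simp only [hn, ht] at h
      split_ifs at h with hc
      obtain rfl := Option.some.inj h
      exact ⟨rfl, s, rfl, hc⟩

end Entries

section EliminateBlock

universe u

variable {C : Type u} [Category.{0} C] [Preadditive C]

open Classical in
/-- Elimination of an isomorphism between two families of summands. -/
theorem Tw.exists_elim_block {Y V : Type} [Fintype Y] [Fintype V] {X : Y × V → C} {h : Y × V → ℤ}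
    {d : (⟨Y × V, X⟩ : Mat_ C) ⟶ ⟨Y × V, X⟩} (hd : d ≫ d = 0) (hdeg : HasDeg h h 1 d) {yk yt : Y}
    (hne : yk ≠ yt) (hoff : ∀ y y' v v', y ≠ y' → v ≠ v' → d (y, v) (y', v') = 0)
    (c : ∀ v, X (yt, v) ⟶ X (yk, v)) (h1 : ∀ v, d (yk, v) (yt, v) ≫ c v = 𝟙 _)
    (h2 : ∀ v, c v ≫ d (yk, v) (yt, v) = 𝟙 _) (hh : ∀ v, h (yt, v) = h (yk, v) + 1) :
    ∃ (d' : (⟨{y : Y // y ≠ yk ∧ y ≠ yt} × V, fun i => X (i.1.1, i.2)⟩ : Mat_ C) ⟶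
        ⟨{y : Y // y ≠ yk ∧ y ≠ yt} × V, fun i => X (i.1.1, i.2)⟩) (hd' : d' ≫ d' = 0)
      (hdeg' : HasDeg (fun i : {y : Y // y ≠ yk ∧ y ≠ yt} × V => h (i.1.1, i.2))
        (fun i : {y : Y // y ≠ yk ∧ y ≠ yt} × V => h (i.1.1, i.2)) 1 d'),
      (⟨⟨Y × V, X⟩, h, d, hd, hdeg⟩ : Tw C).Equiv ⟨_, _, d', hd', hdeg'⟩ ∧
      (∀ i j : {y : Y // y ≠ yk ∧ y ≠ yt} × V, i.2 ≠ j.2 → d' i j = d (i.1.1, i.2) (j.1.1, j.2)) ∧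
      ∀ (y y' : {y : Y // y ≠ yk ∧ y ≠ yt}) (v : V), d' (y, v) (y', v) = d (y.1, v) (y'.1, v) -
        d (y.1, v) (yt, v) ≫ c v ≫ d (yk, v) (y'.1, v) := by
  let M : Tw C := ⟨⟨Y × V, X⟩, h, d, hd, hdeg⟩
  let r : {y : Y // y ≠ yk ∧ y ≠ yt} × V → M.obj.ι := fun i => (i.1.1, i.2)
  let κ : V → M.obj.ι := fun v => (yk, v)
  let τ : V → M.obj.ι := fun v => (yt, v)
  have hb : Function.Bijective (Sum.elim r (Sum.elim κ τ)) := by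
    constructor
    · rintro (⟨y, v⟩ | v | v) (⟨y', v'⟩ | v' | v') hE <;>
        replace hE := Prod.mk.inj hE
      · rw [show y = y' from Subtype.ext hE.1, show v = v' from hE.2]
      · exact absurd hE.1 y.2.1
      · exact absurd hE.1 y.2.2
      · exact absurd hE.1.symm y'.2.1
      · rw [hE.2]
      · exact absurd hE.1 hne
      · exact absurd hE.1.symm y'.2.2
      · exact absurd hE.1.symm hne
      · rw [hE.2]
    · rintro ⟨y, v⟩
      by_cases h1 : y = yk
      · subst h1; exact ⟨Sum.inr (Sum.inl v), rfl⟩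
      by_cases h2 : y = yt
      · subst h2; exact ⟨Sum.inr (Sum.inr v), rfl⟩
      · exact ⟨Sum.inl (⟨y, h1, h2⟩, v), rfl⟩
  obtain ⟨c', hc0, hc1⟩ : ∃ c' : matSel M.obj τ ⟶ matSel M.obj κ,
      (∀ v v' : V, v ≠ v' → c' v v' = 0) ∧ ∀ v : V, c' v v = c v :=
    ⟨fun v v' => if e : v = v' then c v ≫ eqToHom (by rw [e]) else 0, fun v v' e => dif_neg e,
      fun v => by simp⟩
  have hblock : ∀ v v', (matIncl M.obj κ ≫ M.d ≫ matProj M.obj τ) v v' = d (yk, v) (yt, v') :=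
    fun v v' => by
      rw [matIncl_comp_apply, comp_matProj_apply]
  obtain ⟨hd', hdeg', hE⟩ := M.exists_elim r κ τ hb c'
    (by
      funext v v'
      rw [Mat_.comp_apply]
      by_cases h : v = v'
      · subst h
        rw [Finset.sum_eq_single v (fun w _ hw => by rw [hc0 w v hw, comp_zero])
          (fun h => absurd (Finset.mem_univ _) h), hblock, Mat_.id_apply_self, hc1, h1]
      · rw [Mat_.id_apply_of_ne _ _ _ h]
        refine Finset.sum_eq_zero fun w _ => ?_
        by_cases hw : v = w
        · subst hw
          rw [hc0 v v' h, comp_zero]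
        · rw [hblock, hoff _ _ _ _ hne hw, zero_comp])
    (by
      funext v v'
      rw [Mat_.comp_apply]
      by_cases h : v = v'
      · subst h
        rw [Finset.sum_eq_single v (fun w _ hw => by rw [hc0 v w hw.symm, zero_comp])
          (fun h => absurd (Finset.mem_univ _) h), hblock, Mat_.id_apply_self, hc1, h2]
      · rw [Mat_.id_apply_of_ne _ _ _ h]
        refine Finset.sum_eq_zero fun w _ => ?_
        by_cases hw : v = w
        · subst hw
          rw [hblock, hoff _ _ _ _ hne h, comp_zero]
        · rw [hc0 v w hw, zero_comp])
    (fun v v' e => by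
      by_cases hv : v = v'
      · subst hv
        exact absurd (show h (yk, v) = h (yt, v) + -1 by rw [hh]; ring) e
      · exact hc0 v v' hv)
  have hterm : ∀ (y y' : Y) (v v' : V), y ≠ yt →
      ∑ w', (∑ w, d (y, v) (yt, w) ≫ c' w w') ≫ d (yk, w') (y', v') =
        d (y, v) (yt, v) ≫ c v ≫ d (yk, v) (y', v') := by
    intro y y' v v' hy
    have h1 : ∀ w', ∑ w, d (y, v) (yt, w) ≫ c' w w' = d (y, v) (yt, v) ≫ c' v w' := fun w' =>
      Finset.sum_eq_single v (fun w _ hw => by rw [hoff _ _ _ _ hy hw.symm, zero_comp])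
        (fun h => absurd (Finset.mem_univ _) h)
    rw [Finset.sum_eq_single v (fun w _ hw => by rw [h1, hc0 v w hw.symm, comp_zero, zero_comp])
        (fun h => absurd (Finset.mem_univ _) h), h1, hc1, Category.assoc]
  refine ⟨_, hd', hdeg', hE, ?_, ?_⟩
  · rintro ⟨⟨y, hy⟩, v⟩ ⟨⟨y', hy'⟩, v'⟩ hv
    refine (congrArg (d (y, v) (y', v') - ·) (hterm y y' v v' hy.2)).trans ?_
    simp only
    rw [hoff _ _ _ _ hy'.1.symm hv, comp_zero, comp_zero, sub_zero]
  · rintro ⟨y, hy⟩ ⟨y', hy'⟩ v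
    exact congrArg (d (y, v) (y', v) - ·) (hterm y y' v v hy.2)

end EliminateBlock

section Stages

/-- The smoothings in which the first `k` crossings have their `0`-smoothings. -/
abbrev Later (k : ℕ) : Type := {v : Fin 14 → Bool // ∀ t : Fin 14, (t : ℕ) < k → v t = false}

/-- The edges of the basepoints. -/
def base : E4 × E4 := ((2, 0), (3, 12))

/-- The permutation and the degree of `1` for a smoothing with a gluing. -/
def ob (a : Equiv.Perm (Fin 4)) (v : Fin 14 → Bool) (q : ℤ) : Equiv.Perm E4 × ℤ :=
  (next wordL3 v * hat a, cycles (next wordL3 v * hat a) + height v + 14 + q)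

variable (S : Type) [CommRing S]

/-- The map between two smoothings for a given gluing. -/
def cubePoly (a : Equiv.Perm (Fin 4)) (v v' : Fin 14 → Bool) : MvPolynomial E4 S :=
  ∑ t, if v' t = true ∧ v = low v' t then (sgn v' t : MvPolynomial E4 S) * saddle S t v a else 0

/-- A complex in which the first `k` crossings have been simplified; the summands are smoothings
with gluings. -/
structure Stage (k : ℕ) where
  Y : Type
  [fin : Fintype Y]
  a : Y → Equiv.Perm (Fin 4)
  h : Y → ℕ
  q : Y → ℕ
  d : cycMat S base (fun i : Y × Later k => ob (a i.1) i.2.1 (q i.1)) ⟶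
    cycMat S base (fun i : Y × Later k => ob (a i.1) i.2.1 (q i.1))
  d_sq : d ≫ d = 0
  deg : HasDeg (fun i : Y × Later k => (h i.1 : ℤ) + height i.2.1)
    (fun i : Y × Later k => (h i.1 : ℤ) + height i.2.1) 1 d

attribute [instance] Stage.fin

variable {S} {k : ℕ}

/-- The underlying complex. -/
def Stage.toTw (X : Stage S k) : Tw (GrBimod S) :=
  ⟨cycMat S base (fun i : X.Y × Later k => ob (X.a i.1) i.2.1 (X.q i.1)),
    fun i => (X.h i.1 : ℤ) + height i.2.1, X.d, X.d_sq, X.deg⟩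

open Classical in
/-- The coboundary is the formal one, at least between the summands that carry a label; the others
have degree less than `B`. -/
structure Stage.Computes (X : Stage S k) (label : X.Y → Option ℕ) (st : List Row) (B : ℕ) : Prop where
  off : ∀ i j, i.2 ≠ j.2 → Rep (X.d i j) fun p => if i.1 = j.1 then
    (-1) ^ X.h i.1 * (cubePoly S (X.a i.1) i.2.1 j.2.1 * p) else 0
  row : ∀ y n, label y = some n → ∃ r, findRow n st = some r ∧ r.code = code (X.a y) ∧
    r.h = X.h y ∧ r.q = X.q y ∧ ∀ y' n' v, label y' = some n' →
      Rep (X.d (y, v) (y', v)) fun p =>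
        morPoly S (next wordL3 v.1) (X.a y) (X.a y') (entry n' r.ents) * p
  inj : ∀ y y' n, label y = some n → label y' = some n → y = y'
  low : ∀ y, label y = none → X.h y < B
  surj : ∀ r ∈ st, ∃ y, label y = some r.id ∧ X.h y = r.h ∧ code (X.a y) = r.code

theorem Good.zsmul_id {E : Type} [Fintype E] [DecidableEq E] {e : E × E}
    {A B : Equiv.Perm E × ℤ} (h : A = B) (u : ℤ) :
    Good e A B (u • (LinearMap.id : MvPolynomial E S →ₗ[S] _)) := by
  subst h
  exact (Good.id e A).zsmul u

theorem Stage.Computes.eliminate {X : Stage S k} {label : X.Y → Option ℕ} {st : List Row} {B : ℕ}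
    (hX : X.Computes label st B) {n t : ℕ} {u : ℤ} {rk : Row} (hp : pivotRow st n t u = some rk) :
    ∃ (X' : Stage S k) (label' : X'.Y → Option ℕ),
      X'.Computes label' (elimRows st rk t u st) B ∧ X.toTw.Equiv X'.toTw := by
  classical
  obtain ⟨hn, s, ht, hcode, hq, hh, huu, hent⟩ := pivotRow_spec hp
  have hid : rk.id = n := findRow_id hn
  obtain ⟨yk, hyk, -⟩ := hX.surj rk (findRow_mem hn)
  obtain ⟨yt, hyt, -⟩ := hX.surj s (findRow_mem ht)
  rw [hid] at hyk
  rw [findRow_id ht] at hyt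
  obtain ⟨r1, e1, hka, hkh, hkq, hkd⟩ := hX.row yk n hyk
  rw [hn] at e1
  obtain rfl := Option.some.inj e1
  obtain ⟨r2, e2, hta, hth, htq, -⟩ := hX.row yt t hyt
  rw [ht] at e2
  obtain rfl := Option.some.inj e2
  have ha : X.a yk = X.a yt := code_injective _ _ (by rw [← hka, ← hta, hcode])
  have hqq : X.q yk = X.q yt := by rw [← hkq, ← htq, hq]
  have hne : yk ≠ yt := by
    rintro rfl
    omega
  have hob : ∀ v : Later k, ob (X.a yt) v.1 (X.q yt) = ob (X.a yk) v.1 (X.q yk) := fun v => by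
    rw [ha, hqq]
  have huu' : ∀ p : MvPolynomial E4 S, u • u • p = p := fun p => by
    rw [smul_smul, huu, one_smul]
  have hpiv : ∀ v, Rep (X.d (yk, v) (yt, v)) fun p => u • p := fun v => by
    have := hkd yt t v hyt
    rw [hent, ← ha, morPoly_self] at this
    convert this using 2
    simp [mval, monosVal, maskVal_zero]
  have hoff : ∀ {y y' : X.Y} {v v' : Later k}, y ≠ y' → v ≠ v' → X.d (y, v) (y', v') = 0 :=
    fun {y y' v v'} h1 h2 => (hX.off (y, v) (y', v') h2).eq_zero fun p => by
      simp only [if_neg h1]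
      exact zero_mem _
  obtain ⟨φ, hφ, hφ'⟩ : ∃ φ : MvPolynomial E4 S →ₗ[S] MvPolynomial E4 S, (∀ p, φ p = u • p) ∧
      ∀ v : Later k, Good base (ob (X.a yt) v.1 (X.q yt)) (ob (X.a yk) v.1 (X.q yk)) φ :=
    ⟨_, fun _ => rfl, fun v => Good.zsmul_id (hob v) u⟩
  have hc : ∀ v : Later k, Rep (polyHom base (ob (X.a yt) v.1 (X.q yt))
      (ob (X.a yk) v.1 (X.q yk)) φ) fun p => u • p := fun v p => by
    simp only [← hφ]
    exact (hφ' v).rep p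
  obtain ⟨d', hd', hdeg', hE, hd1, hd2⟩ := Tw.exists_elim_block X.d_sq X.deg hne
    (fun y y' v v' h1 h2 => hoff h1 h2)
    (fun v => polyHom base (ob (X.a yt) v.1 (X.q yt)) (ob (X.a yk) v.1 (X.q yk)) φ)
    (fun v => ((hpiv v).comp (hc v)).ext Rep.id fun p => by
      rw [huu', sub_self]; exact zero_mem _)
    (fun v => ((hc v).comp (hpiv v)).ext Rep.id fun p => by
      rw [huu', sub_self]; exact zero_mem _)
    (fun v => by simp only; omega)
  refine ⟨⟨{y : X.Y // y ≠ yk ∧ y ≠ yt}, fun y => X.a y.1, fun y => X.h y.1, fun y => X.q y.1,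
    d', hd', hdeg'⟩, fun y => label y.1, ?_, hE⟩
  constructor
  · rintro ⟨⟨y, hy⟩, v⟩ ⟨⟨y', hy'⟩, v'⟩ hv
    have h1 := hX.off (y, v) (y', v') hv
    intro p
    have h3 := h1 p
    simp only [Subtype.mk.injEq]
    rw [← h3]
    exact congrArg (fun f : cycObj S base _ ⟶ cycObj S base _ => f.toLin (elt S base _ p))
      (hd1 (⟨y, hy⟩, v) (⟨y', hy'⟩, v') hv)
  · rintro ⟨y, hy⟩ m hm
    simp only at hm
    obtain ⟨ry, hry, hya, hyh, hyq, hyd⟩ := hX.row y m hm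
    have hmk : ¬ (m = rk.id ∨ m = t) := by
      rintro (h | h)
      · exact hy.1 (hX.inj y yk m hm (by rw [h, hid]; exact hyk))
      · exact hy.2 (hX.inj y yt m hm (by rw [h]; exact hyt))
    have hf := elimRow_fields st rk t u ry
    refine ⟨_, findRow_elimRows hmk hry, hf.2.1.trans hya, hf.2.2.1.trans hyh,
      hf.2.2.2.trans hyq, ?_⟩
    rintro ⟨y', hy'⟩ m' v hm'
    simp only at hm'
    obtain ⟨ry', hry', hya', -, -, -⟩ := hX.row y' m' hm'
    have hmk' : ¬ (m' = t ∨ m' = rk.id) := by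
      rintro (h | h)
      · exact hy'.2 (hX.inj y' yt m' hm' (by rw [h]; exact hyt))
      · exact hy'.1 (hX.inj y' yk m' hm' (by rw [h, hid]; exact hyk))
    have h2 : Rep (X.d (y, v) (y', v) - X.d (y, v) (yt, v) ≫ polyHom base _ _ φ ≫
        X.d (yk, v) (y', v)) fun p => morPoly S (next wordL3 v.1) (X.a y) (X.a y')
          (entry m' (elimRow st rk t u ry).ents) * p := by
      refine ((hyd y' m' v hm').sub ((hyd yt t v hyt).comp ((hc v).comp
        (hkd y' m' v hm')))).congr fun p => ?_
      have h3 := Ideal.mul_mem_right p _ (morPoly_elimRow (S := S) (next wordL3 v.1) (X.a y)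
        (X.a yk) (X.a y') (u := u) hmk' hry' hya hka hya')
      have e : morPoly S (next wordL3 v.1) (X.a y) (X.a y') (entry m' ry.ents) * p -
          morPoly S (next wordL3 v.1) (X.a yk) (X.a y') (entry m' rk.ents) *
            u • (morPoly S (next wordL3 v.1) (X.a y) (X.a yt) (entry t ry.ents) * p) -
          morPoly S (next wordL3 v.1) (X.a y) (X.a y')
            (entry m' (elimRow st rk t u ry).ents) * p ∈
          cycIdeal S (next wordL3 v.1 * hat (X.a y')) := by
        convert neg_mem h3 using 1
        rw [← ha, zsmul_eq_mul]
        ring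
      exact e
    intro p
    rw [← h2 p]
    exact congrArg (fun f : cycObj S base _ ⟶ cycObj S base _ => f.toLin (elt S base _ p))
      (hd2 ⟨y, hy⟩ ⟨y', hy'⟩ v)
  · rintro ⟨y, hy⟩ ⟨y', hy'⟩ m h1 h2
    exact Subtype.ext (hX.inj y y' m h1 h2)
  · rintro ⟨y, hy⟩ h
    exact hX.low y h
  · intro r' hr'
    obtain ⟨s', hs', h1, h2, h3, h4⟩ := mem_elimRows hr'
    obtain ⟨y, hy1, hy2, hy3⟩ := hX.surj s' hs'
    refine ⟨⟨y, ?_, ?_⟩, ?_, ?_, ?_⟩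
    · rintro rfl
      exact h1 (Or.inl (by rw [hid]; exact Option.some.inj (hy1.symm.trans hyk)))
    · rintro rfl
      exact h1 (Or.inr (Option.some.inj (hy1.symm.trans hyt)))
    · rw [h2]; exact hy1
    · rw [h3]; exact hy2
    · rw [h4]; exact hy3

end Stages

section StepDegrees

variable {S : Type} [CommRing S]

/-- The shift of the degree for the summands of a smoothing with a turnback. -/
def qStep (k : Fin 14) (a : Equiv.Perm (Fin 4)) (s : Bool) : ℕ :=
  if a (od k) = ev k then if s then 0 else 2 else 1

theorem length_factors_tb : ∀ (k : Fin 14) (a : Equiv.Perm (Fin 4)),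
    ((factors ((tb k a)⁻¹ * a)).length = if a (od k) = ev k then 0 else 1) ∧
      (factors (a⁻¹ * tb k a)).length = if a (od k) = ev k then 0 else 1 := by decide +kernel

theorem base_avoids : ∀ k : Fin 14, base.1 ∉ loopSet k ∧ base.2 ∉ loopSet k := by decide +kernel

theorem mval_loopTerm_isWeightedHomogeneous (o : Fin 4) (s : Bool) :
    MvPolynomial.IsWeightedHomogeneous (wt (E := E4)) (mval S (loopTerm o s))
      (if s then -2 else 0) := by
  rw [mval_loopTerm]
  cases s
  · exact MvPolynomial.isWeightedHomogeneous_one _ _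
  · exact MvPolynomial.isWeightedHomogeneous_X _ _ _

theorem morPoly_loopTerm_isWeightedHomogeneous (α : Equiv.Perm E4) (a b : Equiv.Perm (Fin 4))
    (o : Fin 4) (s : Bool) : MvPolynomial.IsWeightedHomogeneous (wt (E := E4))
      (morPoly S α a b (loopTerm o s)) ((if s then -2 else 0) +
        ((cycles (α * hat a) : ℤ) - cycles (α * hat b) - (factors (a⁻¹ * b)).length)) :=
  (mval_loopTerm_isWeightedHomogeneous o s).mul (gluePoly_isWeightedHomogeneous α a b)

variable {k : Fin 14} {v : Fin 14 → Bool} {a : Equiv.Perm (Fin 4)}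

theorem Good.inMap (hv : ∀ t < k, v t = false) (hk : v k = true) {s : Bool}
    (hs : s = true → a (od k) = ev k) (q : ℕ) :
    Good base (ob (tb k a) (low v k) (q + qStep k a s : ℕ)) (ob a v q) (inMap S k v a s) where
  ideal p hp := inMap_mem hv hk s hp
  left p := by
    rw [inMap_apply, inMap_apply, map_mul, birth_X_of_not_mem (base_avoids k).1, mul_left_comm,
      sub_self]
    exact zero_mem _
  right p := by
    rw [inMap_apply, inMap_apply, map_mul, birth_X_of_not_mem (base_avoids k).2, mul_left_comm,
      sub_self]
    exact zero_mem _
  deg d p hp := by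
    refine ⟨_, ?_, by rw [sub_self]; exact zero_mem _⟩
    rw [inMap_apply]
    convert (morPoly_loopTerm_isWeightedHomogeneous (S := S) (next wordL3 v) (tb k a) a (od k) s).mul
      (birth_isWeightedHomogeneous hp) using 1
    have h1 := (bubble hv hk (tb_od k a)).cycles_eq
    have h2 := height_low hk
    have h3 := (length_factors_tb k a).1
    simp only [ob]
    rw [h3, h1, ← h2]
    by_cases h : a (od k) = ev k
    · cases s <;> simp [qStep, h] <;> ring
    · have : s = false := by
        cases s
        · rfl
        · exact absurd (hs rfl) h
      subst this
      simp [qStep, h]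
      ring

theorem Good.outMap (hv : ∀ t < k, v t = false) (hk : v k = true) {s : Bool}
    (hs : s = true → a (od k) = ev k) (q : ℕ) :
    Good base (ob a v q) (ob (tb k a) (low v k) (q + qStep k a s : ℕ))
      (outMap S k v a (outFlag k a s)) where
  ideal p hp := outMap_mem hv hk _ hp
  left p := by
    rw [outMap_apply, outMap_apply, mul_left_comm, mul_comm (MvPolynomial.X _),
      (Avoids.X (base_avoids k).1).death_mul, mul_comm, sub_self]
    exact zero_mem _
  right p := by
    rw [outMap_apply, outMap_apply, mul_left_comm, mul_comm (MvPolynomial.X _),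
      (Avoids.X (base_avoids k).2).death_mul, mul_comm, sub_self]
    exact zero_mem _
  deg d p hp := by
    refine ⟨_, ?_, by rw [sub_self]; exact zero_mem _⟩
    rw [outMap_apply]
    convert (loop_isWeightedHomogeneous ((morPoly_loopTerm_isWeightedHomogeneous (S := S)
      (next wordL3 v) a (tb k a) (od k) (outFlag k a s)).mul hp)).2 using 1
    have h1 := (bubble hv hk (tb_od k a)).cycles_eq
    have h2 := height_low hk
    have h3 := (length_factors_tb k a).2
    simp only [ob]
    rw [h3, h1, ← h2]
    by_cases h : a (od k) = ev k
    · cases s <;> simp [qStep, outFlag, h] <;> ring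
    · have : s = false := by
        cases s
        · rfl
        · exact absurd (hs rfl) h
      subst this
      simp [qStep, outFlag, h]
      ring

end StepDegrees

section StepFormal

variable {S : Type} [CommRing S]

theorem findRow_append_of_ne {n : ℕ} {l l' : List Row} (h : ∀ r ∈ l, r.id ≠ n) :
    findRow n (l ++ l') = findRow n l' := by
  induction l with
  | nil => rfl
  | cons r l ih =>
    rw [List.cons_append, findRow, if_neg (h r List.mem_cons_self)]
    exact ih fun s hs => h s (List.mem_cons_of_mem _ hs)

theorem mem_stepRow {st : List Row} {j o : ℕ} {r r' : Row} (h : r' ∈ stepRow st j o r) :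
    r' = straightRow j o r ∨ r' = turnRow st j o false r ∨
      (isLoop j o r.code = true ∧ r' = turnRow st j o true r) := by
  rw [stepRow] at h
  split_ifs at h with hl <;> simp only [List.mem_cons, List.not_mem_nil, or_false] at h <;> tauto

theorem mem_stepRows {st : List Row} {j o : ℕ} {l : List Row} {r' : Row}
    (h : r' ∈ stepRows st j o l) : ∃ r ∈ l, r' ∈ stepRow st j o r := by
  induction l with
  | nil => simp [stepRows] at h
  | cons s l ih =>
    rw [stepRows, List.mem_append] at h
    rcases h with h | h
    · exact ⟨s, List.mem_cons_self, h⟩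
    · obtain ⟨r, hr, hr'⟩ := ih h
      exact ⟨r, List.mem_cons_of_mem _ hr, hr'⟩

theorem findRow_stepRows {st : List Row} {j o : ℕ} {l : List Row} {n : ℕ} {r : Row}
    (h : findRow n l = some r) :
    findRow (3 * n) (stepRows st j o l) = some (straightRow j o r) ∧
      findRow (3 * n + 1) (stepRows st j o l) = some (turnRow st j o false r) ∧
      (isLoop j o r.code = true →
        findRow (3 * n + 2) (stepRows st j o l) = some (turnRow st j o true r)) := by
  induction l with
  | nil => simp [findRow] at h
  | cons s l ih =>
    rw [findRow] at h
    split_ifs at h with hs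
    · obtain rfl := Option.some.inj h
      subst hs
      rw [stepRows, stepRow]
      split_ifs with hl <;> simp [findRow, straightRow, turnRow, hl]
    · obtain ⟨h1, h2, h3⟩ := ih h
      have hne : ∀ m, (m = 3 * n ∨ m = 3 * n + 1 ∨ m = 3 * n + 2) →
          ∀ r' ∈ stepRow st j o s, r'.id ≠ m := by
        intro m hm r' hr'
        rcases mem_stepRow hr' with rfl | rfl | ⟨-, rfl⟩ <;>
          simp only [straightRow, turnRow, if_true, if_false, Bool.false_eq_true] <;> omega
      rw [stepRows, findRow_append_of_ne (hne _ (Or.inl rfl)),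
        findRow_append_of_ne (hne _ (Or.inr (Or.inl rfl))),
        findRow_append_of_ne (hne _ (Or.inr (Or.inr rfl)))]
      exact ⟨h1, h2, h3⟩

theorem entry_straightEnts (n : ℕ) (l : List (ℕ × Monos)) :
    entry (3 * n) (straightEnts l) = entry n l ∧ entry (3 * n + 1) (straightEnts l) = [] ∧
      entry (3 * n + 2) (straightEnts l) = [] := by
  induction l with
  | nil => exact ⟨rfl, rfl, rfl⟩
  | cons t l ih =>
    obtain ⟨m, x⟩ := t
    rw [straightEnts, entry, entry, entry, entry, if_neg (show ¬ 3 * m = 3 * n + 1 by omega),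
      if_neg (show ¬ 3 * m = 3 * n + 2 by omega), ih.1]
    refine ⟨?_, ih.2⟩
    by_cases h : m = n
    · rw [if_pos h, if_pos (by rw [h])]
    · rw [if_neg h, if_neg (by omega)]

/-- The name of a summand for the smoothing with a turnback. -/
def turnId (n : ℕ) (s : Bool) : ℕ := if s then 3 * n + 2 else 3 * n + 1

theorem entry_straightRow (j o n : ℕ) (r : Row) :
    entry (3 * n) (straightRow j o r).ents = entry n r.ents := by
  by_cases h : isLoop j o r.code = true
  · rw [straightRow, if_pos h]
    simp only [entry]
    rw [if_neg (by omega), if_neg (by omega), (entry_straightEnts n _).1]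
  · rw [straightRow, if_neg h]
    simp only [entry]
    rw [if_neg (by omega), (entry_straightEnts n _).1]

theorem mval_entry_straightRow {k : Fin 14} {a b : Equiv.Perm (Fin 4)} {r : Row}
    (hr : r.code = code a) {s : Bool} (hs : s = true → b (od k) = ev k) (n : ℕ)
    (hab : n = r.id → a = b) :
    mval S (entry (turnId n s) (straightRow (ev k) (od k) r).ents) =
      if n = r.id then (-1) ^ r.h * mval S (loopTerm (od k) (outFlag k b s)) else 0 := by
  have hmv : ∀ (m : ℕ) (x : ℤ), mval S [(m, x)] = (x : MvPolynomial E4 S) * mval S [(m, 1)] := by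
    intro m x
    simp [mval, monosVal]
  have hsg : (((if r.h % 2 = 0 then 1 else -1 : ℤ)) : MvPolynomial E4 S) = (-1) ^ r.h := by
    split_ifs with h
    · rw [Int.cast_one, Even.neg_one_pow (Nat.even_iff.2 h)]
    · rw [Int.cast_neg, Int.cast_one, Odd.neg_one_pow (Nat.odd_iff.2 (by omega))]
  have h1 := (entry_straightEnts n r.ents).2
  have hnil : mval S [] = 0 := rfl
  have hd : ∀ m, ¬ 3 * r.id + 1 = 3 * m + 2 := by omega
  have hd' : ∀ m, ¬ 3 * r.id + 2 = 3 * m + 1 := by omega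
  by_cases hl : a (od k) = ev k
  · rw [straightRow, hr, if_pos (isLoop_iff.2 hl)]
    simp only [entry]
    by_cases hn : n = r.id
    · have hb := hab hn
      subst hb hn
      cases s <;> simp only [turnId, Bool.false_eq_true, if_false, hd, hd', h1, if_pos]
      · rw [List.append_nil, hmv, hsg]
        simp [outFlag, hl, loopTerm]
      · rw [List.append_nil, hmv, hsg]
        simp [outFlag, hl, loopTerm]
    · have e1 : ¬ 3 * r.id + 1 = 3 * n + 1 := by omega
      have e2 : ¬ 3 * r.id + 2 = 3 * n + 2 := by omega
      cases s <;> simp only [turnId, Bool.false_eq_true, if_false, if_true, hd, hd', h1, e1, e2,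
        hn, hnil]
  · rw [straightRow, hr, if_neg (fun h => hl (isLoop_iff.1 h))]
    simp only [entry]
    by_cases hn : n = r.id
    · have hb := hab hn
      subst hb hn
      have : s = false := by
        cases s
        · rfl
        · exact absurd (hs rfl) hl
      subst this
      simp only [turnId, Bool.false_eq_true, if_false, h1, if_pos]
      rw [List.append_nil, hmv, hsg]
      simp [outFlag, hl, loopTerm]
    · have e1 : ¬ 3 * r.id + 1 = 3 * n + 1 := by omega
      cases s <;> simp only [turnId, Bool.false_eq_true, if_false, if_true, hd, h1, e1, hn, hnil]

theorem mval_entry_turnbackEnts (st : List Row) (j o c : ℕ) (b : Bool) (n : ℕ)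
    (l : List (ℕ × Monos)) : mval S (entry (3 * n) (turnbackEnts st j o c b l)) = 0 := by
  induction l with
  | nil => rfl
  | cons t l ih =>
    obtain ⟨m, x⟩ := t
    rw [turnbackEnts]
    cases findRow m st with
    | none => exact ih
    | some r =>
      simp only
      split_ifs
      · rw [mval_addEntry, mval_addEntry, if_neg (by omega), if_neg (by omega), ih, add_zero,
          add_zero]
      · rw [mval_addEntry, if_neg (by omega), ih, add_zero]

theorem outMap_entry_inMap {k : Fin 14} {v : Fin 14 → Bool} (hv : ∀ t < k, v t = false)
    (hk : v k = true) {a b : Equiv.Perm (Fin 4)} {st : List Row} {n : ℕ} {r : Row}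
    (hr : findRow n st = some r) (hb : r.code = code b) (s : Bool) {s' : Bool}
    (hs' : s' = true → b (od k) = ev k) (l : List (ℕ × Monos)) (p : MvPolynomial E4 S) :
    outMap S k v b (outFlag k b s') (morPoly S (next wordL3 v) a b (entry n l) *
        inMap S k v a s p) -
      morPoly S (next wordL3 (low v k)) (tb k a) (tb k b)
        (entry (turnId n s') (turnbackEnts st (ev k) (od k) (code a) s l)) * p ∈
      cycIdeal S (next wordL3 (low v k) * hat (tb k b)) := by
  induction l with
  | nil =>
    rw [turnbackEnts, entry, entry, morPoly_nil, morPoly_nil, zero_mul, zero_mul, map_zero, sub_self]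
    exact zero_mem _
  | cons t l ih =>
    obtain ⟨m, x⟩ := t
    rw [turnbackEnts]
    by_cases hm : m = n
    · subst hm
      rw [hr, entry, if_pos rfl, morPoly_append, add_mul, map_add]
      simp only [hb]
      have h1 := outMap_morPoly_inMap (S := S) (a := a) (b := b) hv hk s (outFlag k b s') x p
      have key : morPoly S (next wordL3 (low v k)) (tb k a) (tb k b) (entry (turnId m s')
          (if isLoop (ev k) (od k) (code b) = true then
            addEntry (3 * m + 1) (induced (ev k) (od k) (code a) (code b) s true x)
              (addEntry (3 * m + 2) (induced (ev k) (od k) (code a) (code b) s false x)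
                (turnbackEnts st (ev k) (od k) (code a) s l))
          else addEntry (3 * m + 1) (induced (ev k) (od k) (code a) (code b) s false x)
            (turnbackEnts st (ev k) (od k) (code a) s l))) =
          morPoly S (next wordL3 (low v k)) (tb k a) (tb k b)
            (induced (ev k) (od k) (code a) (code b) s (outFlag k b s') x) +
          morPoly S (next wordL3 (low v k)) (tb k a) (tb k b)
            (entry (turnId m s') (turnbackEnts st (ev k) (od k) (code a) s l)) := by
        by_cases hl : b (od k) = ev k
        · rw [if_pos (isLoop_iff.2 hl), morPoly_addEntry, morPoly_addEntry]
          cases s' <;> simp [turnId, outFlag, hl]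
        · have : s' = false := by
            cases s'
            · rfl
            · exact absurd (hs' rfl) hl
          subst this
          rw [if_neg (fun h => hl (isLoop_iff.1 h)), morPoly_addEntry]
          simp [turnId, outFlag, hl]
      rw [key]
      convert add_mem h1 ih using 1
      ring
    · rw [entry, if_neg hm]
      cases findRow m st with
      | none => exact ih
      | some r' =>
        simp only
        have e1 : ∀ i, (i = 1 ∨ i = 2) → ¬ 3 * m + i = turnId n s' := by
          intro i hi
          rw [turnId]
          split_ifs <;> omega
        split_ifs
        · rw [morPoly_addEntry, morPoly_addEntry, if_neg (e1 1 (Or.inl rfl)),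
            if_neg (e1 2 (Or.inr rfl)), zero_add, zero_add]
          exact ih
        · rw [morPoly_addEntry, if_neg (e1 1 (Or.inl rfl)), zero_add]
          exact ih

end StepFormal

section StepVertices

variable {k : Fin 14}

/-- A smoothing with the `0`-smoothing of the next crossing. -/
def Later.stay (u : Later (k + 1)) : Later k := ⟨u.1, fun t ht => u.2 t (by omega)⟩

/-- A smoothing with the `1`-smoothing of the next crossing. -/
def Later.up (u : Later (k + 1)) : Later k :=
  ⟨Function.update u.1 k true, fun t ht => by
    rw [Function.update_of_ne (by rintro rfl; exact lt_irrefl _ ht)]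
    exact u.2 t (by omega)⟩

variable (u u' : Later (k + 1))

theorem Later.apply_self : u.1 k = false := u.2 k (Nat.lt_succ_self _)

theorem Later.up_self : u.up.1 k = true := Function.update_self _ _ _

theorem Later.up_of_ne {t : Fin 14} (h : t ≠ k) : u.up.1 t = u.1 t := Function.update_of_ne h _ _

theorem Later.up_lt {t : Fin 14} (h : t < k) : u.up.1 t = false := u.up.2 t h

theorem Later.low_up : low u.up.1 k = u.1 := by
  funext t
  by_cases h : t = k
  · subst h
    rw [u.apply_self]
    simp
  · rw [low_ne _ h, u.up_of_ne h]

theorem Later.height_up : height u.up.1 = height u.1 + 1 := by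
  rw [← height_low u.up_self, u.low_up]

variable {u u'}

theorem Later.stay_injective : Function.Injective (Later.stay (k := k)) := fun _ _ h =>
  Subtype.ext (congrArg (fun x : Later k => x.1) h)

theorem Later.up_injective : Function.Injective (Later.up (k := k)) := fun u u' h => by
  have := congrArg (fun x : Later k => low x.1 k) h
  simp only [low_up] at this
  exact Subtype.ext this

theorem Later.stay_ne_up : u.stay ≠ u'.up := fun h => by
  have h1 := congrArg (fun x : Later k => x.1 k) h
  simp only [up_self] at h1
  have h2 : u.1 k = true := h1
  rw [u.apply_self] at h2
  exact absurd h2 (by simp)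

theorem Later.exists_stay {v : Later k} (h : v.1 k = false) : ∃ u : Later (k + 1), u.stay = v :=
  ⟨⟨v.1, fun t ht => by
    by_cases e : t = k
    · rw [e, h]
    · exact v.2 t (by have : (t : ℕ) ≠ k := fun h => e (Fin.ext h)
                      omega)⟩, rfl⟩

theorem Later.exists_up {v : Later k} (h : v.1 k = true) : ∃ u : Later (k + 1), u.up = v :=
  ⟨⟨low v.1 k, fun t ht => by
    by_cases e : t = k
    · rw [e]; simp
    · rw [low_ne _ e]
      exact v.2 t (by have : (t : ℕ) ≠ k := fun h => e (Fin.ext h)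
                      omega)⟩, Subtype.ext (by
    funext t
    by_cases e : t = k
    · rw [e, up_self, h]
    · rw [up_of_ne _ e]
      exact low_ne _ e)⟩

variable {S : Type} [CommRing S] {a : Equiv.Perm (Fin 4)}

theorem cubePoly_stay_up [Decidable (u = u')] : cubePoly S a u.1 u'.up.1 =
    if u = u' then saddle S k u.1 a else 0 := by
  have h0 : ∀ t, t ≠ k → ¬ (u'.up.1 t = true ∧ u.1 = low u'.up.1 t) := by
    rintro t ht ⟨-, h⟩
    have := congrFun h k
    rw [low_ne _ ht.symm, u'.up_self, u.apply_self] at this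
    exact absurd this (by simp)
  rw [cubePoly, Finset.sum_eq_single k (fun t _ ht => if_neg (h0 t ht))
    (fun h => absurd (Finset.mem_univ _) h), u'.low_up]
  by_cases h : u = u'
  · subst h
    rw [if_pos ⟨u.up_self, rfl⟩, if_pos rfl]
    have : sgn u.up.1 k = 1 := by
      have e : (Finset.univ.filter fun s => s < k ∧ u.up.1 s = true) = ∅ := by
        refine Finset.filter_eq_empty_iff.2 fun s _ hs => ?_
        rw [u.up_lt hs.1] at hs
        exact absurd hs.2 (by simp)
      rw [sgn, e, Finset.card_empty, pow_zero]
    rw [this, Int.cast_one, one_mul]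
  · rw [if_neg (fun e => h (Subtype.ext e.2)), if_neg h]

theorem cubePoly_up_stay : cubePoly S a u.up.1 u'.1 = 0 := by
  refine Finset.sum_eq_zero fun t _ => if_neg ?_
  rintro ⟨-, h⟩
  have := congrFun h k
  rw [u.up_self] at this
  by_cases e : t = k
  · subst e; simp at this
  · rw [low_ne _ (Ne.symm e), u'.apply_self] at this
    exact absurd this (by simp)

theorem outMap_cubePoly_inMap {s s' : Bool} (hs : s = true → a (od k) = ev k)
    (hs' : s' = true → a (od k) = ev k) (p : MvPolynomial E4 S) :
    outMap S k u'.up.1 a (outFlag k a s') (cubePoly S a u.up.1 u'.up.1 *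
        inMap S k u.up.1 a s p) -
      (if s = s' then -(cubePoly S (tb k a) u.1 u'.1 * p) else 0) ∈
      cycIdeal S (next wordL3 u'.1 * hat (tb k a)) := by
  have hterm : ∀ t, outMap S k u'.up.1 a (outFlag k a s') ((if u'.up.1 t = true ∧
        u.up.1 = low u'.up.1 t then (sgn u'.up.1 t : MvPolynomial E4 S) *
          saddle S t u.up.1 a else 0) * inMap S k u.up.1 a s p) -
      (if s = s' then -((if u'.1 t = true ∧ u.1 = low u'.1 t then
        (sgn u'.1 t : MvPolynomial E4 S) * saddle S t u.1 (tb k a) else 0) * p) else 0) ∈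
      cycIdeal S (next wordL3 u'.1 * hat (tb k a)) := by
    intro t
    by_cases ht : k < t
    · have hne : t ≠ k := ht.ne'
      have hiff : (u'.up.1 t = true ∧ u.up.1 = low u'.up.1 t) ↔ (u'.1 t = true ∧
          u.1 = low u'.1 t) := by
        rw [u'.up_of_ne hne]
        refine and_congr_right fun _ => ⟨fun h => ?_, fun h => ?_⟩
        · rw [← u.low_up, h, ← u'.low_up]
          exact Function.update_comm hne _ _ _
        · change Function.update u.1 k true = low (Function.update u'.1 k true) t
          rw [h]
          exact Function.update_comm hne _ _ _
      by_cases hc : u'.1 t = true ∧ u.1 = low u'.1 t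
      · have hc' := hiff.2 hc
        rw [if_pos hc', if_pos hc]
        have h1 := outMap_saddle_inMap (S := S) (a := a) ht (fun _ h => u'.up_lt h) u'.up_self hc'.1
          hs hs' p
        rw [← hc'.2, u'.low_up, ← hc.2] at h1
        have h2 : sgn u'.1 t = -sgn u'.up.1 t := by
          rw [← u'.low_up]
          exact sgn_low_of_lt _ ht u'.up_self
        rw [h2, mul_assoc, ← zsmul_eq_mul, map_zsmul]
        convert zsmul_mem h1 (sgn u'.up.1 t) using 1
        split_ifs
        · rw [smul_sub, zsmul_eq_mul, zsmul_eq_mul]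
          push_cast
          ring
        · rw [smul_sub, smul_zero]
      · rw [if_neg hc, if_neg (fun h => hc (hiff.1 h)), zero_mul, zero_mul, map_zero, neg_zero,
          ite_self, sub_self]
        exact zero_mem _
    · have h1 : ¬ (u'.1 t = true ∧ u.1 = low u'.1 t) := by
        rintro ⟨h, -⟩
        rw [u'.2 t (by have : (t : ℕ) ≤ k := not_lt.1 ht
                       omega)] at h
        exact absurd h (by simp)
      have h2 : ¬ (u'.up.1 t = true ∧ u.up.1 = low u'.up.1 t) := by
        rintro ⟨h, h'⟩
        rcases (not_lt.1 ht).lt_or_eq with e | rfl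
        · rw [u'.up_lt e] at h
          exact absurd h (by simp)
        · have := congrFun h' t
          rw [u.up_self] at this
          simp at this
      rw [if_neg h1, if_neg h2, zero_mul, zero_mul, map_zero, neg_zero, ite_self, sub_self]
      exact zero_mem _
  rw [cubePoly, cubePoly, Finset.sum_mul, map_sum, Finset.sum_mul]
  convert sum_mem (t := Finset.univ) fun t _ => hterm t using 1
  rw [Finset.sum_sub_distrib]
  congr 1
  split_ifs
  · rw [Finset.sum_neg_distrib]
  · rw [Finset.sum_const_zero]

end StepVertices

section Step

variable {S : Type} [CommRing S] {k : Fin 14}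

/-- The summands after one more crossing. -/
abbrev Stage.StepIdx (X : Stage S k) : Type :=
  X.Y ⊕ {z : X.Y × Bool // z.2 = true → X.a z.1 (od k) = ev k}

variable (X : Stage S k)

/-- The gluings after one more crossing. -/
def Stage.stepA : X.StepIdx → Equiv.Perm (Fin 4)
  | .inl y => X.a y
  | .inr z => tb k (X.a z.1.1)

/-- The homological degrees after one more crossing. -/
def Stage.stepH : X.StepIdx → ℕ
  | .inl y => X.h y
  | .inr z => X.h z.1.1 + 1

/-- The quantum degrees after one more crossing. -/
def Stage.stepQ : X.StepIdx → ℕ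
  | .inl y => X.q y
  | .inr z => X.q z.1.1 + qStep k (X.a z.1.1) z.1.2

/-- The summand from which a summand is split off. -/
def Stage.stepSource : X.StepIdx × Later (k + 1) → X.Y × Later k
  | (.inl y, u) => (y, u.stay)
  | (.inr z, u) => (z.1.1, u.up)

/-- The inclusions of the new summands. -/
def Stage.stepIn : X.StepIdx × Later (k + 1) → MvPolynomial E4 S →ₗ[S] MvPolynomial E4 S
  | (.inl _, _) => LinearMap.id
  | (.inr z, u) => inMap S k u.up.1 (X.a z.1.1) z.1.2

/-- The projections to the new summands. -/
def Stage.stepOut : X.StepIdx × Later (k + 1) → MvPolynomial E4 S →ₗ[S] MvPolynomial E4 S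
  | (.inl _, _) => LinearMap.id
  | (.inr z, u) => outMap S k u.up.1 (X.a z.1.1) (outFlag k (X.a z.1.1) z.1.2)

theorem Stage.good_stepOut (j : X.StepIdx × Later (k + 1)) :
    Good base (ob (X.a (X.stepSource j).1) (X.stepSource j).2.1 (X.q (X.stepSource j).1))
      (ob (X.stepA j.1) j.2.1 (X.stepQ j.1)) (X.stepOut j) := by
  obtain ⟨y | z, u⟩ := j
  · exact Good.id _ _
  · have := Good.outMap (S := S) (a := X.a z.1.1) (fun _ h => u.up_lt h) u.up_self z.2 (X.q z.1.1)
    rw [u.low_up] at this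
    exact this

theorem Stage.good_stepIn (j : X.StepIdx × Later (k + 1)) :
    Good base (ob (X.stepA j.1) j.2.1 (X.stepQ j.1))
      (ob (X.a (X.stepSource j).1) (X.stepSource j).2.1 (X.q (X.stepSource j).1)) (X.stepIn j) := by
  obtain ⟨y | z, u⟩ := j
  · exact Good.id _ _
  · have := Good.inMap (S := S) (a := X.a z.1.1) (fun _ h => u.up_lt h) u.up_self z.2 (X.q z.1.1)
    rw [u.low_up] at this
    exact this

open Classical in
theorem Stage.sum_stepIn_stepOut (i : X.Y × Later k) (p : MvPolynomial E4 S) :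
    p - ∑ j, (if X.stepSource j = i then X.stepIn j (X.stepOut j p) else 0) ∈
      cycIdeal S (next wordL3 i.2.1 * hat (X.a i.1)) := by
  obtain ⟨y, v⟩ := i
  by_cases hv : v.1 k = true
  · obtain ⟨u, rfl⟩ := Later.exists_up hv
    let z0 : {z : X.Y × Bool // z.2 = true → X.a z.1 (od k) = ev k} := ⟨(y, false), by simp⟩
    by_cases ha : X.a y (od k) = ev k
    · let z1 : {z : X.Y × Bool // z.2 = true → X.a z.1 (od k) = ev k} := ⟨(y, true), fun _ => ha⟩
      rw [Finset.sum_eq_add (Sum.inr z1, u) (Sum.inr z0, u),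
        if_pos (show X.stepSource (Sum.inr z1, u) = (y, u.up) from rfl),
        if_pos (show X.stepSource (Sum.inr z0, u) = (y, u.up) from rfl)]
      · exact inMap_outMap_of_loop (fun _ h => u.up_lt h) u.up_self ha p
      · intro h
        have := congrArg (fun z : {z : X.Y × Bool // z.2 = true → X.a z.1 (od k) = ev k} => z.1.2)
          (Sum.inr.inj (Prod.mk.inj h).1)
        exact absurd this (by simp [z0, z1])
      · rintro ⟨y' | ⟨⟨y', s⟩, hs⟩, u'⟩ - h
        · exact if_neg fun h' => Later.stay_ne_up (Prod.mk.inj h').2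
        · refine if_neg fun h' => ?_
          obtain ⟨e1, e2⟩ := Prod.mk.inj h'
          obtain rfl := Later.up_injective e2
          simp only at e1
          subst e1
          cases s
          · exact h.2 rfl
          · exact h.1 rfl
      · exact fun h => absurd (Finset.mem_univ _) h
      · exact fun h => absurd (Finset.mem_univ _) h
    · rw [Finset.sum_eq_single (Sum.inr z0, u),
        if_pos (show X.stepSource (Sum.inr z0, u) = (y, u.up) from rfl)]
      · exact inMap_outMap_of_not_loop (fun _ h => u.up_lt h) u.up_self ha p
      · rintro ⟨y' | ⟨⟨y', s⟩, hs⟩, u'⟩ - h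
        · exact if_neg fun h' => Later.stay_ne_up (Prod.mk.inj h').2
        · refine if_neg fun h' => ?_
          obtain ⟨e1, e2⟩ := Prod.mk.inj h'
          obtain rfl := Later.up_injective e2
          simp only at e1
          subst e1
          cases s
          · exact h rfl
          · exact ha (hs rfl)
      · exact fun h => absurd (Finset.mem_univ _) h
  · obtain ⟨u, rfl⟩ := Later.exists_stay (by simpa using hv)
    rw [Finset.sum_eq_single (Sum.inl y, u),
      if_pos (show X.stepSource (Sum.inl y, u) = (y, u.stay) from rfl)]
    · simp [stepIn, stepOut]
    · rintro ⟨y' | z, u'⟩ - h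
      · refine if_neg fun h' => h ?_
        obtain ⟨e1, e2⟩ := Prod.mk.inj h'
        rw [Later.stay_injective e2, e1]
      · exact if_neg fun h' => Later.stay_ne_up (Prod.mk.inj h').2.symm
    · exact fun h => absurd (Finset.mem_univ _) h

open Classical in
theorem Stage.stepOut_stepIn (j j' : X.StepIdx × Later (k + 1))
    (h : X.stepSource j = X.stepSource j') (p : MvPolynomial E4 S) :
    X.stepOut j' (X.stepIn j p) - (if j = j' then p else 0) ∈
      cycIdeal S (next wordL3 j'.2.1 * hat (X.stepA j'.1)) := by
  obtain ⟨y | ⟨⟨y, s⟩, hs⟩, u⟩ := j <;> obtain ⟨y' | ⟨⟨y', s'⟩, hs'⟩, u'⟩ := j' <;>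
    obtain ⟨e1, e2⟩ := Prod.mk.inj h
  · rw [Later.stay_injective e2, e1, if_pos rfl]
    simp [stepIn, stepOut]
  · exact absurd e2 Later.stay_ne_up
  · exact absurd e2.symm Later.stay_ne_up
  · obtain rfl := Later.up_injective e2
    simp only at e1
    subst e1
    have := outMap_inMap (S := S) (a := X.a y) (fun _ h => u.up_lt h) u.up_self hs hs' p
    rw [u.low_up] at this
    have e : (if ((Sum.inr ⟨(y, s), hs⟩, u) : X.StepIdx × Later (k + 1)) =
        (Sum.inr ⟨(y, s'), hs'⟩, u) then p else 0) = if s = s' then p else 0 := by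
      by_cases h : s = s'
      · subst h
        rw [if_pos rfl, if_pos rfl]
      · rw [if_neg h, if_neg]
        intro h'
        exact h (congrArg (fun z : {z : X.Y × Bool // z.2 = true → X.a z.1 (od k) = ev k} => z.1.2)
          (Sum.inr.inj (Prod.mk.inj h').1))
    rw [e]
    exact this

/-- The names of the summands after one more crossing. -/
def Stage.stepLabel (label : X.Y → Option ℕ) : X.StepIdx → Option ℕ
  | .inl y => (label y).map (3 * ·)
  | .inr z => (label z.1.1).map (turnId · z.1.2)

variable {X}

theorem Stage.Computes.step {label : X.Y → Option ℕ} {st : List Row} {B B' : ℕ}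
    (hX : X.Computes label st B) (hB : ∀ n < B, n + 1 < B') :
    ∃ (X' : Stage S (k + 1)) (label' : X'.Y → Option ℕ),
      X'.Computes label' (stepRows st (ev k) (od k) st) B' ∧ X.toTw.Equiv X'.toTw := by
  classical
  obtain ⟨hd', hdeg', hE⟩ := Tw.exists_subst
    (A := fun i : X.Y × Later k => ob (X.a i.1) i.2.1 (X.q i.1))
    (A' := fun j : X.StepIdx × Later (k + 1) => ob (X.stepA j.1) j.2.1 (X.stepQ j.1))
    X.d_sq X.deg X.stepSource
    (h' := fun j : X.StepIdx × Later (k + 1) => (X.stepH j.1 : ℤ) + height j.2.1)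
    (by
      rintro ⟨y | z, u⟩
      · rfl
      · simp only [stepH, stepSource, u.height_up]
        push_cast
        ring)
    X.stepOut X.stepIn (fun j => X.good_stepOut j) (fun j => X.good_stepIn j)
    (by
      intro i p
      convert X.sum_stepIn_stepOut i p
      rfl)
    (by
      intro j j' h p
      convert X.stepOut_stepIn j j' h p
      rfl)
  refine ⟨⟨X.StepIdx, X.stepA, X.stepH, X.stepQ, _, hd', hdeg'⟩, X.stepLabel label, ?_, hE⟩
  have hrep : ∀ (j j' : X.StepIdx × Later (k + 1)) (φ : MvPolynomial E4 S → MvPolynomial E4 S),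
      Rep (X.d (X.stepSource j) (X.stepSource j')) φ →
      Rep (polyHom base (ob (X.stepA j.1) j.2.1 (X.stepQ j.1)) _ (X.stepIn j) ≫
        X.d (X.stepSource j) (X.stepSource j') ≫
        polyHom base _ (ob (X.stepA j'.1) j'.2.1 (X.stepQ j'.1)) (X.stepOut j'))
        fun p => X.stepOut j' (φ (X.stepIn j p)) := fun j j' φ h =>
    ((X.good_stepIn j).rep.comp (h.comp (X.good_stepOut j').rep))
  have hneg : ∀ (n : ℕ) (q r : MvPolynomial E4 S), (-1) ^ n * (q * r) =
      ((-1 : ℤ) ^ n) • (q * r) := fun n q r => by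
    rw [zsmul_eq_mul]
    push_cast
    rfl
  constructor
  · rintro ⟨y | ⟨⟨y, s⟩, hs⟩, u⟩ ⟨y' | ⟨⟨y', s'⟩, hs'⟩, u'⟩ hu <;> simp only at hu
    · have h1 := hX.off (y, u.stay) (y', u'.stay) (fun h => hu (Later.stay_injective h))
      refine (hrep (Sum.inl y, u) (Sum.inl y', u') _ h1).congr fun p => ?_
      simp only [Sum.inl.injEq]
      rw [sub_eq_zero.2]
      · exact zero_mem _
      · rfl
    · have h1 := hX.off (y, u.stay) (y', u'.up) Later.stay_ne_up
      refine (hrep (Sum.inl y, u) (Sum.inr ⟨(y', s'), hs'⟩, u') _ h1).congr fun p => ?_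
      have h2 : cubePoly S (X.a y) u.stay.1 u'.up.1 = 0 := by
        refine (cubePoly_stay_up (u := u) (u' := u')).trans (if_neg hu)
      simp only [h2, zero_mul, mul_zero, ite_self, map_zero, reduceCtorEq, if_false, sub_self]
      exact zero_mem _
    · have h1 := hX.off (y, u.up) (y', u'.stay) Later.stay_ne_up.symm
      refine (hrep (Sum.inr ⟨(y, s), hs⟩, u) (Sum.inl y', u') _ h1).congr fun p => ?_
      have h2 : cubePoly S (X.a y) u.up.1 u'.stay.1 = 0 := cubePoly_up_stay (u := u) (u' := u')
      simp only [h2, zero_mul, mul_zero, ite_self, map_zero, reduceCtorEq, if_false, sub_self]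
      exact zero_mem _
    · have h1 := hX.off (y, u.up) (y', u'.up) (fun h => hu (Later.up_injective h))
      refine (hrep (Sum.inr ⟨(y, s), hs⟩, u) (Sum.inr ⟨(y', s'), hs'⟩, u') _ h1).congr fun p => ?_
      by_cases hy : y = y'
      · subst hy
        have h2 := outMap_cubePoly_inMap (S := S) (u := u) (u' := u') hs hs' p
        have h3 := zsmul_mem h2 ((-1) ^ X.h y)
        have e : (@ite _ ((Sum.inr ⟨(y, s), hs⟩ : X.StepIdx) = Sum.inr ⟨(y, s'), hs'⟩)
            (Classical.propDecidable _)
            ((-1) ^ (X.h y + 1) * (cubePoly S (tb k (X.a y)) u.1 u'.1 * p)) 0) =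
            ((-1 : ℤ) ^ X.h y) • (if s = s' then -(cubePoly S (tb k (X.a y)) u.1 u'.1 * p) else 0) := by
          by_cases h : s = s'
          · subst h
            rw [if_pos rfl, if_pos rfl, hneg, pow_succ]
            simp
          · rw [if_neg h, smul_zero, if_neg]
            intro h'
            exact h (congrArg (fun z : {z : X.Y × Bool // z.2 = true → X.a z.1 (od k) = ev k} =>
              z.1.2) (Sum.inr.inj h'))
        have e2 : outMap S k u'.up.1 (X.a y) (outFlag k (X.a y) s') (if y = y then
            (-1) ^ X.h y * (cubePoly S (X.a y) u.up.1 u'.up.1 * inMap S k u.up.1 (X.a y) s p)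
            else 0) = ((-1 : ℤ) ^ X.h y) • outMap S k u'.up.1 (X.a y) (outFlag k (X.a y) s')
              (cubePoly S (X.a y) u.up.1 u'.up.1 * inMap S k u.up.1 (X.a y) s p) := by
          rw [if_pos rfl, hneg, map_zsmul]
        rw [smul_sub, ← e, ← e2] at h3
        exact h3
      · have hz : ¬ (Sum.inr ⟨(y, s), hs⟩ : X.StepIdx) = Sum.inr ⟨(y', s'), hs'⟩ := fun h' =>
          hy (congrArg (fun z : {z : X.Y × Bool // z.2 = true → X.a z.1 (od k) = ev k} =>
            z.1.1) (Sum.inr.inj h'))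
        simp only [if_neg hz, if_neg hy, map_zero, sub_self]
        exact zero_mem _
  · rintro (y | ⟨⟨y, s⟩, hs⟩) n hn
    · obtain ⟨m, hm, rfl⟩ := Option.map_eq_some_iff.1 hn
      obtain ⟨r, hr, hra, hrh, hrq, hrd⟩ := hX.row y m hm
      refine ⟨straightRow (ev k) (od k) r, (findRow_stepRows hr).1, hra, hrh, hrq, ?_⟩
      rintro (y' | ⟨⟨y', s'⟩, hs'⟩) n' u hn'
      · obtain ⟨m', hm', rfl⟩ := Option.map_eq_some_iff.1 hn'
        refine (hrep (Sum.inl y, u) (Sum.inl y', u) _ (hrd y' m' u.stay hm')).congr fun p => ?_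
        simp only [entry_straightRow]
        rw [sub_eq_zero.2]
        · exact zero_mem _
        · rfl
      · obtain ⟨m', hm', rfl⟩ := Option.map_eq_some_iff.1 hn'
        have h1 := hX.off (y, u.stay) (y', u.up) Later.stay_ne_up
        refine (hrep (Sum.inl y, u) (Sum.inr ⟨(y', s'), hs'⟩, u) _ h1).congr fun p => ?_
        have hid := findRow_id hr
        have h2 := mval_entry_straightRow (S := S) (k := k) (b := X.a y') hra hs' m' (fun h => by
          rw [hX.inj y y' m hm (by rw [hm', h, hid])])
        have hc : cubePoly S (X.a y) u.stay.1 u.up.1 = saddle S k u.1 (X.a y) :=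
          (cubePoly_stay_up (u := u) (u' := u)).trans (if_pos rfl)
        have e : outMap S k u.up.1 (X.a y') (outFlag k (X.a y') s') (if y = y' then
            (-1) ^ X.h y * (cubePoly S (X.a y) u.stay.1 u.up.1 * p) else 0) -
            morPoly S (next wordL3 u.1) (X.a y) (tb k (X.a y'))
              (entry (turnId m' s') (straightRow (ev k) (od k) r).ents) * p ∈
            cycIdeal S (next wordL3 u.1 * hat (tb k (X.a y'))) := by
          by_cases hy : y = y'
          · subst hy
            have hmm : m' = r.id := by rw [hid]; exact Option.some.inj (hm'.symm.trans hm)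
            rw [morPoly, h2, if_pos hmm, if_pos rfl, hc, hneg, map_zsmul, hrh]
            have h3 := outMap_saddle (S := S) (a := X.a y) (fun _ h => u.up_lt h) u.up_self
              (outFlag k (X.a y) s') p
            rw [u.low_up] at h3
            convert zsmul_mem h3 ((-1) ^ X.h y) using 1
            rw [smul_sub, morPoly, zsmul_eq_mul, zsmul_eq_mul]
            push_cast
            ring
          · have hmm : ¬ m' = r.id := fun h => hy (hX.inj y y' m hm (by rw [hm', h, hid]))
            rw [morPoly, h2, if_neg hmm, if_neg hy, map_zero, zero_mul, zero_mul, sub_self]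
            exact zero_mem _
        exact e
    · obtain ⟨m, hm, rfl⟩ := Option.map_eq_some_iff.1 hn
      obtain ⟨r, hr, hra, hrh, hrq, hrd⟩ := hX.row y m hm
      refine ⟨turnRow st (ev k) (od k) s r, ?_, ?_, ?_, ?_, ?_⟩
      · cases s
        · exact (findRow_stepRows hr).2.1
        · exact (findRow_stepRows hr).2.2 (by rw [hra]; exact isLoop_iff.2 (hs rfl))
      · change turnback (ev k) (od k) r.code = code (tb k (X.a y))
        rw [hra, code_tb]
      · change r.h + 1 = X.h y + 1
        rw [hrh]
      · change r.q + _ = X.q y + qStep k (X.a y) s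
        rw [hrq, qStep, hra]
        simp only [isLoop_iff]
      rintro (y' | ⟨⟨y', s'⟩, hs'⟩) n' u hn'
      · obtain ⟨m', hm', rfl⟩ := Option.map_eq_some_iff.1 hn'
        have h1 := hX.off (y, u.up) (y', u.stay) Later.stay_ne_up.symm
        refine (hrep (Sum.inr ⟨(y, s), hs⟩, u) (Sum.inl y', u) _ h1).congr fun p => ?_
        have h2 : cubePoly S (X.a y) u.up.1 u.stay.1 = 0 := cubePoly_up_stay (u := u) (u' := u)
        have h3 : mval S (entry (3 * m') (turnRow st (ev k) (od k) s r).ents) = 0 :=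
          mval_entry_turnbackEnts _ _ _ _ _ _ _
        simp only [h2, h3, morPoly, zero_mul, mul_zero, ite_self, map_zero, sub_self]
        exact zero_mem _
      · obtain ⟨m', hm', rfl⟩ := Option.map_eq_some_iff.1 hn'
        obtain ⟨r', hr', hra', -⟩ := hX.row y' m' hm'
        refine (hrep (Sum.inr ⟨(y, s), hs⟩, u) (Sum.inr ⟨(y', s'), hs'⟩, u) _
          (hrd y' m' u.up hm')).congr fun p => ?_
        have h3 := outMap_entry_inMap (S := S) (a := X.a y) (fun _ h => u.up_lt h) u.up_self hr' hra' s hs'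
          r.ents p
        rw [u.low_up, ← hra] at h3
        exact h3
  · rintro (y | ⟨⟨y, s⟩, hs⟩) (y' | ⟨⟨y', s'⟩, hs'⟩) n h1 h2 <;>
      obtain ⟨m, hm, rfl⟩ := Option.map_eq_some_iff.1 h1 <;>
      obtain ⟨m', hm', h⟩ := Option.map_eq_some_iff.1 h2 <;> try simp only [turnId] at h
    · obtain rfl : m' = m := by omega
      rw [hX.inj y y' m' hm hm']
    · split_ifs at h <;> omega
    · split_ifs at h <;> omega
    · obtain ⟨rfl, rfl⟩ : m' = m ∧ s' = s := by
        cases s <;> cases s' <;> simp only [if_true, if_false, Bool.false_eq_true] at h <;>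
          first
            | exact ⟨by omega, rfl⟩
            | omega
      obtain rfl := hX.inj y y' m' hm hm'
      rfl
  · rintro (y | ⟨⟨y, s⟩, hs⟩) h
    · have := hB _ (hX.low y (Option.map_eq_none_iff.1 h))
      change X.h y < B'
      omega
    · exact hB _ (hX.low y (Option.map_eq_none_iff.1 h))
  · intro r' hr'
    obtain ⟨r, hr, hrr⟩ := mem_stepRows hr'
    obtain ⟨y, hy, hyh, hya⟩ := hX.surj r hr
    rcases mem_stepRow hrr with rfl | rfl | ⟨hl, rfl⟩
    · exact ⟨Sum.inl y, Option.map_eq_some_iff.2 ⟨_, hy, rfl⟩, hyh, hya⟩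
    · refine ⟨Sum.inr ⟨(y, false), by simp⟩, Option.map_eq_some_iff.2 ⟨_, hy, rfl⟩,
        congrArg (· + 1) hyh, ?_⟩
      change code (tb k (X.a y)) = turnback (ev k) (od k) r.code
      rw [code_tb, hya]
    · refine ⟨Sum.inr ⟨(y, true), fun _ => isLoop_iff.1 (by rw [hya]; exact hl)⟩,
        Option.map_eq_some_iff.2 ⟨_, hy, rfl⟩, congrArg (· + 1) hyh, ?_⟩
      change code (tb k (X.a y)) = turnback (ev k) (od k) r.code
      rw [code_tb, hya]

end Step

section Run

variable {S : Type} [CommRing S] {k : ℕ}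

theorem findRow_truncate {b n : ℕ} {st : List Row} {r : Row} (h : findRow n st = some r)
    (hb : b ≤ r.h) : findRow n (truncate b st) = some r := by
  induction st with
  | nil => simp [findRow] at h
  | cons s st ih =>
    rw [findRow] at h
    rw [truncate]
    split_ifs at h with hs
    · obtain rfl := Option.some.inj h
      rw [if_pos hb, findRow, if_pos hs]
    · split_ifs
      · rw [findRow, if_neg hs]
        exact ih h
      · exact ih h

theorem mem_truncate {b : ℕ} {st : List Row} {r : Row} (h : r ∈ truncate b st) :
    r ∈ st ∧ b ≤ r.h := by
  induction st with
  | nil => simp [truncate] at h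
  | cons s st ih =>
    rw [truncate] at h
    split_ifs at h with hs
    · rcases List.mem_cons.1 h with rfl | h
      · exact ⟨List.mem_cons_self, hs⟩
      · exact ⟨List.mem_cons_of_mem _ (ih h).1, (ih h).2⟩
    · exact ⟨List.mem_cons_of_mem _ (ih h).1, (ih h).2⟩

theorem Stage.Computes.truncate {X : Stage S k} {label : X.Y → Option ℕ} {st : List Row} {B : ℕ}
    (hX : X.Computes label st B) {b : ℕ} (hb : B ≤ b) :
    X.Computes (fun y => if X.h y < b then none else label y) (truncate b st) b := by
  have hl : ∀ y n, (if X.h y < b then none else label y) = some n → b ≤ X.h y ∧ label y = some n := by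
    intro y n h
    split_ifs at h with h'
    exact ⟨not_lt.1 h', h⟩
  constructor
  · exact hX.off
  · intro y n hn
    obtain ⟨h1, h2⟩ := hl y n hn
    obtain ⟨r, hr, ha, hh, hq, hd⟩ := hX.row y n h2
    exact ⟨r, findRow_truncate hr (hh ▸ h1), ha, hh, hq, fun y' n' v hn' => hd y' n' v (hl y' n' hn').2⟩
  · exact fun y y' n h h' => hX.inj y y' n (hl y n h).2 (hl y' n h').2
  · intro y h
    by_contra hlt
    simp only [if_neg hlt] at h
    exact hlt ((hX.low y h).trans_le hb)
  · intro r hr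
    obtain ⟨y, h1, h2, h3⟩ := hX.surj r (mem_truncate hr).1
    exact ⟨y, by rw [if_neg (not_lt.2 (h2 ▸ (mem_truncate hr).2)), h1], h2, h3⟩

theorem Stage.Computes.reduce {X : Stage S k} {label : X.Y → Option ℕ} {st : List Row} {B : ℕ}
    (hX : X.Computes label st B) (n : ℕ) :
    ∃ (X' : Stage S k) (label' : X'.Y → Option ℕ),
      X'.Computes label' (reduce n st) B ∧ X.toTw.Equiv X'.toTw := by
  induction n generalizing X st with
  | zero => exact ⟨X, label, hX, .refl _⟩
  | succ n ih =>
    rw [Khovanov.reduce]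
    cases findPivot st st with
    | none => exact ⟨X, label, hX, .refl _⟩
    | some x =>
      obtain ⟨r, t, u⟩ := x
      simp only
      cases hp : pivotRow st r.id t u with
      | none => exact ⟨X, label, hX, .refl _⟩
      | some rk =>
        obtain ⟨X', label', h1, h2⟩ := hX.eliminate hp
        obtain ⟨X'', label'', h3, h4⟩ := ih h1
        exact ⟨X'', label'', h3, h2.trans h4⟩

/-- The complexes of the successive crossings. -/
def run : ℕ → List Row
  | 0 => [⟨0, 228, 0, 0, []⟩]
  | n + 1 => reduce 1000 (truncate (n + 1 - 7)
      (stepRows (run n) (ev (Fin.ofNat 14 n)) (od (Fin.ofNat 14 n)) (run n)))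

theorem Stage.Computes.run {X : Stage S 0} {label : X.Y → Option ℕ}
    (hX : X.Computes label (run 0) 0) (n : ℕ) (hn : n ≤ 14) :
    ∃ (X' : Stage S n) (label' : X'.Y → Option ℕ),
      X'.Computes label' (Khovanov.run n) (n - 7) ∧ X.toTw.Equiv X'.toTw := by
  induction n with
  | zero => exact ⟨X, label, hX, .refl _⟩
  | succ n ih =>
    obtain ⟨X₁, l₁, h₁, e₁⟩ := ih (by omega)
    let f : Fin 14 := ⟨n, hn⟩
    have hf : Fin.ofNat 14 n = f := Fin.ext (Nat.mod_eq_of_lt hn)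
    obtain ⟨X₂, l₂, h₂, e₂⟩ := Stage.Computes.step (k := f) (B' := n + 1 - 7) h₁ (by omega)
    obtain ⟨X₃, l₃, h₃, e₃⟩ := (h₂.truncate le_rfl).reduce 1000
    refine ⟨X₃, l₃, ?_, e₁.trans (e₂.trans e₃)⟩
    rw [Khovanov.run, hf]
    exact h₃

end Run

section ClosingFormal

/-- The linear factors of a sequence of merges and splits of the strands of a closed diagram. -/
def glueAux : List (ℕ × ℕ) → ℕ → List (ℕ × ℕ)
  | [], _ => []
  | (x, y) :: l, c =>
    (if digit (cycleLabels c) x = digit (cycleLabels c) y then [(x, y)] else []) ++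
      glueAux l (cmul c (cswap x y))

/-- The linear factors of the map between two closed diagrams. -/
def glueList (c d : ℕ) : List (ℕ × ℕ) := glueAux (factor (cmul (cinv c) d)) c

/-- Whether the basepoints are on the same circle. -/
def joined (c : ℕ) : Bool := digit (cycleLabels c) 2 == digit (cycleLabels c) 3

/-- The circle of a strand: `2` and `3` for the circles of the basepoints, and `0` otherwise. -/
def closeDigit (c i : ℕ) : ℕ :=
  if digit (cycleLabels c) i = digit (cycleLabels c) 2 then 2
  else if digit (cycleLabels c) i = digit (cycleLabels c) 3 then 3 else 0

/-- The partition of the strands into circles. -/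
def closeLabels (c : ℕ) : ℕ := ofDigits (closeDigit c)

/-- Whether the circle of the first strand is free of basepoints. -/
def looped (c : ℕ) : Bool := closeDigit c 0 == 0

/-- The gluing that is left when the free circle is removed. -/
def canonCode (c : ℕ) : ℕ := if joined c then 57 else 27

/-- The gluings with at most one free circle, which contains the first strand. -/
def closable (c : ℕ) : Bool := [27, 57, 120, 147, 177, 201, 216, 225].contains c

/-- The terms without the variable of the free circle. -/
def dropLoop : Monos → Monos
  | [] => []
  | (m, z) :: l => if Nat.testBit m 0 then dropLoop l else (m, z) :: dropLoop l

/-- The coefficient of a monomial. -/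
def coeffOf (m : ℕ) : Monos → ℤ
  | [] => 0
  | (n, z) :: l => if m = n then z + coeffOf m l else coeffOf m l

/-- The map between two closed diagrams, in terms of the circles. -/
def closeTerms (c d : ℕ) (s : Bool) (x : Monos) : Monos :=
  mulAdd (closeLabels d) (glueList c d) x [(if s then 1 else 0, 1)] []

/-- The part of the map between the summands that remain when the free circles are removed. -/
def closePart (c d : ℕ) (s t : Bool) (x : Monos) : Monos :=
  if t then loopCoeff 0 (closeTerms c d s x) else dropLoop (closeTerms c d s x)

/-- The map between the summands that remain, as a multiple of the standard map. -/
def closeEntry (c d : ℕ) (s t : Bool) (x : Monos) : Monos :=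
  let u := closePart c d s t x
  if joined c && !joined d then
    (if coeffOf 4 u = 0 then [] else [(0, coeffOf 4 u)]) ++
      (if coeffOf 12 u = 0 then [] else [(4, coeffOf 12 u)])
  else u

/-- The variables that occur are the right ones. -/
def closeVars (d : ℕ) (u : Monos) : Bool :=
  u.all fun t => !Nat.testBit t.1 1 && (looped d || !Nat.testBit t.1 0)

/-- The linear combination in terms of the variables of the circles. -/
def normalForm (c : ℕ) (x : Monos) : Monos := mulAdd (closeLabels c) [] x [(0, 1)] []

/-- The standard map, multiplied by the entry, is the right one. -/
def closeCheck (c d : ℕ) (s t : Bool) (x : Monos) : Bool :=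
  closeVars d (closeTerms c d s x) &&
    (sumMonos (scale (-1) (closePart c d s t x)) (mulAdd (closeLabels (canonCode d))
      (glueList (canonCode c) (canonCode d)) (closeEntry c d s t x) [(0, 1)] [])).isEmpty

/-- The entries of a row after the removal of free circles. -/
def closeEnts (st : List Row) (c : ℕ) (s : Bool) : List (ℕ × Monos) → List (ℕ × Monos)
  | [] => []
  | (n, x) :: l =>
    match findRow n st with
    | none => closeEnts st c s l
    | some r =>
      if looped r.code then
        addEntry (2 * n) (closeEntry c r.code s false x)
          (addEntry (2 * n + 1) (closeEntry c r.code s true x) (closeEnts st c s l))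
      else addEntry (2 * n) (closeEntry c r.code s false x) (closeEnts st c s l)

/-- The summands that remain when the free circle is removed. -/
def closeRow (st : List Row) (s : Bool) (r : Row) : Row :=
  ⟨if s then 2 * r.id + 1 else 2 * r.id, canonCode r.code, r.h,
    if looped r.code then if s then r.q - 1 else r.q + 1 else r.q, closeEnts st r.code s r.ents⟩

/-- The complex after the removal of free circles. -/
def closeRows (st : List Row) : List Row → List Row
  | [] => []
  | r :: l =>
    (if looped r.code then [closeRow st false r, closeRow st true r] else [closeRow st false r]) ++
      closeRows st l

/-- The conditions for the removal of free circles. -/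
def closeOk (st : List Row) : Bool :=
  st.all fun r => closable r.code && (1 ≤ r.q) && r.ents.all fun e =>
    match findRow e.1 st with
    | none => true
    | some r' => [false, true].all fun s => [false, true].all fun t =>
      (s && !looped r.code) || (t && !looped r'.code) || closeCheck r.code r'.code s t e.2

/-- Division of the coefficients by `2`. -/
def half : Monos → Monos
  | [] => []
  | (m, z) :: l => (m, z / 2) :: half l

/-- The row multiplied by `1 / 2` if it has the name `n`, and with the entries to `n` multiplied
by `2`. -/
def halveEnts (n : ℕ) : List (ℕ × Monos) → List (ℕ × Monos)
  | [] => []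
  | (m, x) :: l => (m, if m = n then scale 2 x else x) :: halveEnts n l

/-- Division of all coefficients by `2`. -/
def halfEnts : List (ℕ × Monos) → List (ℕ × Monos)
  | [] => []
  | (m, x) :: l => (m, half x) :: halfEnts l

/-- Multiplication of the generator of one summand by `1 / 2`. -/
def halveRows (n : ℕ) : List Row → List Row
  | [] => []
  | r :: l =>
    { r with ents := if r.id = n then halfEnts r.ents else halveEnts n r.ents } :: halveRows n l

/-- The coefficients of the row with the name `n` are even. -/
def evenRow (n : ℕ) (st : List Row) : Bool :=
  st.all fun r => r.id ≠ n || r.ents.all fun e => e.1 ≠ n && e.2.all fun t => t.2 % 2 == 0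

/-- The elimination of a pivot. -/
def elimAt (n t : ℕ) (u : ℤ) (st : List Row) : List Row :=
  match pivotRow st n t u with
  | none => st
  | some r => elimRows st r t u st

/-- Multiplication of one generator by `1 / 2`, if this is possible. -/
def halveAt (n : ℕ) (st : List Row) : List Row := if evenRow n st then halveRows n st else st

end ClosingFormal

section ClosedDiagram

variable {S : Type} [CommRing S] {v : Fin 14 → Bool}

theorem next_fst (hv : ∀ t, v t = false) (e : E4) : (next wordL3 v e).1 = e.1 := by
  obtain ⟨i, t⟩ := e
  by_cases hi : Even (i : ℕ)
  · rw [next_even hi (hv t)]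
  · have := next_odd (t := t - 1) hi (hv _)
    rw [sub_add_cancel] at this
    rw [this]

theorem glued_fst (hv : ∀ t, v t = false) (a : Equiv.Perm (Fin 4)) (e : E4) :
    ((next wordL3 v * hat a) e).1 = if e.2 = 0 then a e.1 else e.1 := by
  rw [Equiv.Perm.mul_apply, next_fst hv]
  obtain ⟨i, t⟩ := e
  by_cases ht : t = 0
  · subst ht
    rfl
  · rw [hat_of_ne _ ht, if_neg ht]

theorem fin_last : ∀ t : Fin 14, t + 1 ≠ 0 → ((t + 1 : Fin 14) : ℕ) = t + 1 := by decide +kernel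

theorem sameCycle_src (hv : ∀ t, v t = false) (a : Equiv.Perm (Fin 4)) (e : E4) :
    (next wordL3 v * hat a).SameCycle e (src e.1) := by
  obtain ⟨i, t⟩ := e
  by_cases hi : Even (i : ℕ)
  · obtain ⟨n, hn⟩ : ∃ n, n + (t : ℕ) = 14 := ⟨14 - t, by omega⟩
    induction n generalizing t with
    | zero => omega
    | succ n ih =>
      by_cases ht : t = 0
      · subst ht
        exact .refl _ _
      · rw [← Equiv.Perm.sameCycle_apply_left, Equiv.Perm.mul_apply, hat_of_ne _ ht,
          next_even hi (hv t)]
        by_cases h : t + 1 = 0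
        · rw [h]
          exact .refl _ _
        · exact ih (t + 1) (by rw [fin_last t h]; omega)
  · obtain ⟨n, hn⟩ : ∃ n, (t : ℕ) = n := ⟨_, rfl⟩
    induction n generalizing t with
    | zero =>
      obtain rfl : t = 0 := Fin.ext hn
      exact .refl _ _
    | succ n ih =>
      have ht : t ≠ 0 := by
        rintro rfl
        simp at hn
      obtain ⟨s, rfl, -, hs⟩ := fin_pred t t le_rfl ht
      rw [← Equiv.Perm.sameCycle_apply_left, Equiv.Perm.mul_apply, hat_of_ne _ ht,
        next_odd hi (hv s)]
      exact ih s (by omega)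

theorem sameCycle_src_apply (hv : ∀ t, v t = false) (a : Equiv.Perm (Fin 4)) (i : Fin 4) :
    (next wordL3 v * hat a).SameCycle (src i) (src (a i)) := by
  rw [← Equiv.Perm.sameCycle_apply_left]
  have h := sameCycle_src hv a ((next wordL3 v * hat a) (src i))
  rw [glued_fst hv, if_pos (show (src i).2 = 0 from rfl)] at h
  exact h

theorem cycleLabels_apply : ∀ (a : Equiv.Perm (Fin 4)) (i : Fin 4),
    digit (cycleLabels (code a)) (a i) = digit (cycleLabels (code a)) i := by decide +kernel

theorem exists_pow_of_labels : ∀ (a : Equiv.Perm (Fin 4)) (i j : Fin 4),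
    digit (cycleLabels (code a)) i = digit (cycleLabels (code a)) j →
      ∃ n : Fin 4, (a ^ (n : ℕ)) i = j := by decide +kernel

theorem sameCycle_src_iff (hv : ∀ t, v t = false) (a : Equiv.Perm (Fin 4)) (i j : Fin 4) :
    (next wordL3 v * hat a).SameCycle (src i) (src j) ↔
      digit (cycleLabels (code a)) i = digit (cycleLabels (code a)) j := by
  constructor
  · intro h
    have := sameCycle_iff_forall_inv.1 h
      (fun e => decide (digit (cycleLabels (code a)) i = digit (cycleLabels (code a)) e.1))
      (fun e => by
        simp only
        rw [glued_fst hv]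
        split_ifs
        · rw [cycleLabels_apply]
        · rfl)
    exact (of_decide_eq_true (this.symm.trans (decide_eq_true rfl))).symm ▸ rfl
  · intro h
    obtain ⟨n, rfl⟩ := exists_pow_of_labels a i j h
    have key : ∀ n : ℕ, (next wordL3 v * hat a).SameCycle (src i) (src ((a ^ n) i)) := by
      intro n
      induction n with
      | zero => exact .refl _ _
      | succ n ih =>
        rw [pow_succ', Equiv.Perm.mul_apply]
        exact ih.trans (sameCycle_src_apply hv a _)
    exact key n

theorem wordPoly_closed (hv : ∀ t, v t = false) (l : List (ℕ × ℕ))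
    (hl : ∀ p ∈ l, p.1 < 4 ∧ p.2 < 4) (a : Equiv.Perm (Fin 4)) :
    wordPoly (0 : S) (next wordL3 v * hat a)
      (srcPairs (l.map fun p => (Fin.ofNat 4 p.1, Fin.ofNat 4 p.2))) =
      linVal (fun i => MvPolynomial.X (src i)) (glueAux l (code a)) := by
  induction l generalizing a with
  | nil => rfl
  | cons p l ih =>
    obtain ⟨x, y⟩ := p
    obtain ⟨hx, hy⟩ := hl (x, y) List.mem_cons_self
    have ih' := ih (fun q hq => hl q (List.mem_cons_of_mem _ hq))
      (a * Equiv.swap (Fin.ofNat 4 x) (Fin.ofNat 4 y))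
    have ex : ((Fin.ofNat 4 x : Fin 4) : ℕ) = x := Nat.mod_eq_of_lt hx
    have ey : ((Fin.ofNat 4 y : Fin 4) : ℕ) = y := Nat.mod_eq_of_lt hy
    rw [hat_mul, hat_swap, ← mul_assoc, code_mul, code_swap, ex, ey] at ih'
    rw [List.map_cons, srcPairs, List.map_cons, wordPoly, ← srcPairs, ih', stepPoly, glueAux]
    have hs := sameCycle_src_iff hv a (Fin.ofNat 4 x) (Fin.ofNat 4 y)
    rw [ex, ey] at hs
    simp only [hs]
    split_ifs
    · simp [linVal]
    · simp

theorem factor_lt : ∀ a, ∀ q ∈ factor (code a), q.1 < 4 ∧ q.2 < 4 := by decide +kernel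

theorem gluePoly_closed (hv : ∀ t, v t = false) (a b : Equiv.Perm (Fin 4)) :
    gluePoly S (next wordL3 v) a b =
      linVal (fun i => MvPolynomial.X (src i)) (glueList (code a) (code b)) := by
  rw [gluePoly, srcWord, factors, wordPoly_closed hv _ (factor_lt _), glueList, code_mul, code_inv]

theorem cycles_word (hv : ∀ t, v t = false) (l : List (ℕ × ℕ))
    (hl : ∀ p ∈ l, p.1 < 4 ∧ p.2 < 4 ∧ p.1 ≠ p.2) (a : Equiv.Perm (Fin 4)) :
    cycles (wordPerm (next wordL3 v * hat a)
      (srcPairs (l.map fun p => (Fin.ofNat 4 p.1, Fin.ofNat 4 p.2)))) + l.length =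
      cycles (next wordL3 v * hat a) + 2 * (glueAux l (code a)).length := by
  induction l generalizing a with
  | nil => rfl
  | cons p l ih =>
    obtain ⟨x, y⟩ := p
    obtain ⟨hx, hy, hne⟩ := hl (x, y) List.mem_cons_self
    have ih' := ih (fun q hq => hl q (List.mem_cons_of_mem _ hq))
      (a * Equiv.swap (Fin.ofNat 4 x) (Fin.ofNat 4 y))
    have ex : ((Fin.ofNat 4 x : Fin 4) : ℕ) = x := Nat.mod_eq_of_lt hx
    have ey : ((Fin.ofNat 4 y : Fin 4) : ℕ) = y := Nat.mod_eq_of_lt hy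
    have hne' : src (Fin.ofNat 4 x) ≠ src (Fin.ofNat 4 y) := fun h => hne (by
      rw [← ex, ← ey, src_injective h])
    rw [hat_mul, hat_swap, ← mul_assoc, code_mul, code_swap, ex, ey] at ih'
    have hs := sameCycle_src_iff hv a (Fin.ofNat 4 x) (Fin.ofNat 4 y)
    rw [ex, ey] at hs
    rw [List.map_cons, srcPairs, List.map_cons, wordPerm, ← srcPairs, glueAux, List.length_append,
      List.length_cons]
    by_cases h : digit (cycleLabels (code a)) x = digit (cycleLabels (code a)) y
    · have := cycles_split hne' (hs.2 h)
      rw [if_pos h, List.length_singleton]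
      simp only at ih' ⊢
      omega
    · have := cycles_merge hne' (fun h' => h (hs.1 h'))
      rw [if_neg h, List.length_nil]
      simp only at ih' ⊢
      omega

theorem factor_ne : ∀ a, ∀ q ∈ factor (code a), q.1 < 4 ∧ q.2 < 4 ∧ q.1 ≠ q.2 := by
  decide +kernel

theorem cycles_glue (hv : ∀ t, v t = false) (a b : Equiv.Perm (Fin 4)) :
    cycles (next wordL3 v * hat b) + (factor (cmul (cinv (code a)) (code b))).length =
      cycles (next wordL3 v * hat a) + 2 * (glueList (code a) (code b)).length := by
  have h := cycles_word hv (factor (code (a⁻¹ * b))) (factor_ne _) a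
  have e : srcPairs ((factor (code (a⁻¹ * b))).map fun p => (Fin.ofNat 4 p.1, Fin.ofNat 4 p.2)) =
    srcWord (a⁻¹ * b) := rfl
  rw [e, wordPerm_glue, code_mul, code_inv] at h
  rw [glueList]
  exact h

/-- The gluing that is left when the free circle is removed. -/
def canonPerm (a : Equiv.Perm (Fin 4)) : Equiv.Perm (Fin 4) :=
  if joined (code a) then finRotate 4 else Equiv.swap 0 3 * Equiv.swap 1 2

theorem code_canonPerm : ∀ a, code (canonPerm a) = canonCode (code a) := by decide +kernel

theorem closeDigit_apply : ∀ (a : Equiv.Perm (Fin 4)) (i : Fin 4),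
    closeDigit (code a) (a i) = closeDigit (code a) i := by decide +kernel

theorem closeDigit_two : ∀ a, closeDigit (code a) 2 = 2 := by decide +kernel

theorem closeDigit_label : ∀ (a : Equiv.Perm (Fin 4)) (i : Fin 4), closable (code a) = true →
    digit (cycleLabels (code a)) (Fin.ofNat 4 (closeDigit (code a) i) : Fin 4) =
      digit (cycleLabels (code a)) i := by decide +kernel

theorem closeDigit_digit : ∀ (a : Equiv.Perm (Fin 4)) (i : Fin 4), closable (code a) = true →
    closeDigit (code a) (Fin.ofNat 4 (digit (closeLabels (code a)) i) : Fin 4) =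
      closeDigit (code a) i ∧ digit (closeLabels (code a)) i = closeDigit (code a) i := by
  decide +kernel

theorem closeDigit_canon : ∀ (a : Equiv.Perm (Fin 4)) (i : Fin 4), closable (code a) = true →
    closeDigit (code a) (Fin.ofNat 4 (closeDigit 27 i) : Fin 4) =
      closeDigit (code (canonPerm a)) i := by decide +kernel

theorem closeDigit_eq_zero : ∀ (a : Equiv.Perm (Fin 4)) (i : Fin 4), closable (code a) = true →
    closeDigit (code a) i = 0 → looped (code a) = true := by decide +kernel

theorem closable_canon : ∀ a, closable (code (canonPerm a)) = true ∧
    looped (code (canonPerm a)) = false := by decide +kernel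

theorem cycles_canon_aux : ∀ a, closable (code a) = true →
    2 * (glueList (code a) (code (canonPerm a))).length + (if looped (code a) then 1 else 0) =
      (factor (cmul (cinv (code a)) (code (canonPerm a)))).length := by decide +kernel

theorem cycles_canon (hv : ∀ t, v t = false) {a : Equiv.Perm (Fin 4)}
    (ha : closable (code a) = true) :
    cycles (next wordL3 v * hat (canonPerm a)) + (if looped (code a) then 1 else 0) =
      cycles (next wordL3 v * hat a) := by
  have h1 := cycles_glue hv a (canonPerm a)
  have h2 := cycles_canon_aux a ha
  omega

end ClosedDiagram

section ClosingMaps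

variable {S : Type} [CommRing S]

theorem rename_isWeightedHomogeneous {E : Type} (f : E → E) {p : MvPolynomial E S} {d : ℤ}
    (hp : MvPolynomial.IsWeightedHomogeneous (wt (E := E)) p d) :
    MvPolynomial.IsWeightedHomogeneous (wt (E := E)) (MvPolynomial.rename f p) d := by
  intro m hm
  obtain ⟨u, rfl, hu⟩ := MvPolynomial.coeff_rename_ne_zero _ _ _ hm
  rw [← hp hu, Finsupp.weight_apply, Finsupp.weight_apply, Finsupp.sum_mapDomain_index]
  · exact fun _ => zero_smul _ _
  · exact fun _ _ _ => add_smul _ _ _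

/-- The edge that represents the circle of an edge. -/
def repr (c : ℕ) (e : E4) : E4 := src (Fin.ofNat 4 (closeDigit c e.1))

/-- The edges of the free circle. -/
def freeSet (c : ℕ) : Finset E4 := Finset.univ.filter fun e => closeDigit c e.1 = 0

theorem mem_freeSet {c : ℕ} {e : E4} : e ∈ freeSet c ↔ closeDigit c e.1 = 0 := by
  simp [freeSet]

variable (S) in
/-- The inclusion of a summand without free circle. -/
def closeIn (s : Bool) : MvPolynomial E4 S →ₗ[S] MvPolynomial E4 S :=
  mulBy (if s then MvPolynomial.X (src 0) else 1) ∘ₗ (MvPolynomial.rename (repr 27)).toLinearMap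

variable (S) in
/-- The projection to a summand without free circle. -/
def closeOut (c : ℕ) (s : Bool) : MvPolynomial E4 S →ₗ[S] MvPolynomial E4 S :=
  (MvPolynomial.rename (repr c)).toLinearMap ∘ₗ
    (if s then death S (freeSet c) else rest S (freeSet c))

theorem closeIn_apply (s : Bool) (p : MvPolynomial E4 S) : closeIn S s p =
    (if s then MvPolynomial.X (src 0) else 1) * MvPolynomial.rename (repr 27) p := rfl

theorem closeOut_false (c : ℕ) (p : MvPolynomial E4 S) :
    closeOut S c false p = MvPolynomial.rename (repr c) (rest S (freeSet c) p) := rfl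

theorem closeOut_true (c : ℕ) (p : MvPolynomial E4 S) :
    closeOut S c true p = MvPolynomial.rename (repr c) (death S (freeSet c) p) := rfl

theorem closeOut_mul (c : ℕ) (s : Bool) {p q : MvPolynomial E4 S} (hq : Avoids (freeSet c) q) :
    closeOut S c s (p * q) = closeOut S c s p * MvPolynomial.rename (repr c) q := by
  cases s
  · rw [closeOut_false, closeOut_false, rest_mul, hq.2, map_mul]
  · rw [closeOut_true, closeOut_true, hq.death_mul, map_mul]

theorem closeDigit_three : ∀ a, closeDigit (code a) 3 ≠ 0 := by decide +kernel

theorem labels_canon : ∀ a, closable (code a) = true →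
    digit (cycleLabels (code (canonPerm a))) (Fin.ofNat 4 (closeDigit (code a) 3) : Fin 4) =
      digit (cycleLabels (code (canonPerm a))) 3 := by decide +kernel

theorem closeDigit_canonPerm : ∀ (a : Equiv.Perm (Fin 4)) (i : Fin 4), closable (code a) = true →
    digit (cycleLabels (code a)) (Fin.ofNat 4 (closeDigit 27 (canonPerm a i)) : Fin 4) =
      digit (cycleLabels (code a)) (Fin.ofNat 4 (closeDigit 27 i) : Fin 4) := by decide +kernel

theorem closeDigit_idem : ∀ (a : Equiv.Perm (Fin 4)) (i : Fin 4), closeDigit (code a) i ≠ 0 →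
    closeDigit 27 (Fin.ofNat 4 (closeDigit (code a) i) : Fin 4) = closeDigit (code a) i := by
  decide +kernel

theorem closeDigit_27 : ∀ i : Fin 4, closeDigit 27 i = 2 ∨ closeDigit 27 i = 3 := by decide +kernel

theorem repr_two (a : Equiv.Perm (Fin 4)) {e : E4} (he : e.1 = 2) :
    repr (code a) e = src 2 := by
  rw [repr, he, show closeDigit (code a) ((2 : Fin 4) : ℕ) = 2 from closeDigit_two a]
  rfl

theorem repr_27 (e : E4) : repr 27 e = src 2 ∨ repr 27 e = src 3 := by
  rw [repr]
  rcases closeDigit_27 e.1 with h | h <;> rw [h]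
  · exact Or.inl rfl
  · exact Or.inr rfl

theorem src_not_mem_freeSet (a : Equiv.Perm (Fin 4)) (e : E4) : repr 27 e ∉ freeSet (code a) := by
  rw [mem_freeSet]
  rcases repr_27 e with h | h <;> rw [h]
  · intro h'
    exact absurd ((closeDigit_two a).symm.trans h') (by norm_num)
  · exact closeDigit_three a

theorem avoids_rename (a : Equiv.Perm (Fin 4)) (p : MvPolynomial E4 S) :
    Avoids (freeSet (code a)) (MvPolynomial.rename (repr 27) p) := by
  induction p using MvPolynomial.induction_on with
  | C s => rw [MvPolynomial.rename_C]; exact Avoids.C s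
  | add p q hp hq => rw [map_add]; exact hp.add hq
  | mul_X p e hp =>
    rw [map_mul, MvPolynomial.rename_X]
    exact hp.mul (Avoids.X (src_not_mem_freeSet a e))

variable {v : Fin 14 → Bool} {a b : Equiv.Perm (Fin 4)}

theorem closeDigit_glued (hv : ∀ t, v t = false) (a : Equiv.Perm (Fin 4)) (e : E4) :
    closeDigit (code a) ((next wordL3 v * hat a) e).1 = closeDigit (code a) e.1 := by
  rw [glued_fst hv]
  split_ifs
  · exact closeDigit_apply a e.1
  · rfl

theorem X_sub_X_mem (hv : ∀ t, v t = false) {e f : E4}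
    (h : digit (cycleLabels (code a)) e.1 = digit (cycleLabels (code a)) f.1) :
    (MvPolynomial.X e - MvPolynomial.X f : MvPolynomial E4 S) ∈
      cycIdeal S (next wordL3 v * hat a) := by
  refine sub_mem_cycIdeal S ?_
  exact (sameCycle_src hv a e).trans (((sameCycle_src_iff hv a e.1 f.1).2 h).trans
    (sameCycle_src hv a f).symm)

theorem closeOut_mem (hv : ∀ t, v t = false) (s : Bool)
    {p : MvPolynomial E4 S} (hp : p ∈ cycIdeal S (next wordL3 v * hat a)) :
    closeOut S (code a) s p ∈ cycIdeal S (next wordL3 v * hat (canonPerm a)) := by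
  suffices h : closeOut S (code a) false p ∈ cycIdeal S (next wordL3 v * hat (canonPerm a)) ∧
      closeOut S (code a) true p ∈ cycIdeal S (next wordL3 v * hat (canonPerm a)) by
    cases s
    exacts [h.1, h.2]
  refine Submodule.span_induction (p := fun p _ => closeOut S (code a) false p ∈
    cycIdeal S (next wordL3 v * hat (canonPerm a)) ∧ closeOut S (code a) true p ∈
    cycIdeal S (next wordL3 v * hat (canonPerm a))) ?_ ?_ ?_ ?_ hp
  · rintro _ (⟨e, rfl⟩ | ⟨e, rfl⟩)
    · by_cases he : e ∈ freeSet (code a)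
      · simp only [closeOut_false, closeOut_true, sq, rest_mul, death_mul, rest_X_of_mem he,
          mul_zero, zero_mul, map_zero, add_zero]
        exact ⟨zero_mem _, zero_mem _⟩
      · simp only [closeOut_false, closeOut_true, sq, rest_mul, death_mul, rest_X_of_not_mem he,
          death_X_of_not_mem he, mul_zero, zero_mul, map_zero, add_zero]
        refine ⟨?_, zero_mem _⟩
        rw [map_mul, MvPolynomial.rename_X, ← sq]
        exact sq_mem_cycIdeal S _ _
    · have h := closeDigit_glued hv a e
      have hr : repr (code a) ((next wordL3 v * hat a) e) = repr (code a) e := by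
        rw [repr, repr, h]
      by_cases he : e ∈ freeSet (code a)
      · have he' : (next wordL3 v * hat a) e ∈ freeSet (code a) := by
          rw [mem_freeSet] at he ⊢
          rw [h, he]
        simp only [closeOut_false, closeOut_true, map_sub, rest_X_of_mem he, rest_X_of_mem he',
          death_X_of_mem he, death_X_of_mem he', sub_self]
        exact ⟨zero_mem _, zero_mem _⟩
      · have he' : (next wordL3 v * hat a) e ∉ freeSet (code a) := by
          rw [mem_freeSet] at he ⊢
          rwa [h]
        simp only [closeOut_false, closeOut_true, map_sub, rest_X_of_not_mem he,
          rest_X_of_not_mem he', death_X_of_not_mem he, death_X_of_not_mem he', map_zero, sub_self,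
          MvPolynomial.rename_X, hr]
        exact ⟨zero_mem _, zero_mem _⟩
  · simp only [map_zero]
    exact ⟨zero_mem _, zero_mem _⟩
  · rintro p q - - hp hq
    simp only [map_add]
    exact ⟨add_mem hp.1 hq.1, add_mem hp.2 hq.2⟩
  · rintro q p - hp
    simp only [closeOut_false, closeOut_true] at hp ⊢
    simp only [smul_eq_mul, rest_mul, death_mul, map_add, map_mul]
    exact ⟨Ideal.mul_mem_left _ _ hp.1,
      add_mem (Ideal.mul_mem_left _ _ hp.2) (Ideal.mul_mem_left _ _ hp.1)⟩

theorem closeIn_mem (hv : ∀ t, v t = false) (ha : closable (code a) = true) (s : Bool)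
    {p : MvPolynomial E4 S} (hp : p ∈ cycIdeal S (next wordL3 v * hat (canonPerm a))) :
    closeIn S s p ∈ cycIdeal S (next wordL3 v * hat a) := by
  rw [closeIn_apply]
  refine Ideal.mul_mem_left _ _ ?_
  refine Submodule.span_induction (p := fun p _ => MvPolynomial.rename (repr 27) p ∈
    cycIdeal S (next wordL3 v * hat a)) ?_ ?_ ?_ ?_ hp
  · rintro _ (⟨e, rfl⟩ | ⟨e, rfl⟩)
    · simp only [map_pow, MvPolynomial.rename_X]
      exact sq_mem_cycIdeal S _ _
    · simp only [map_sub, MvPolynomial.rename_X]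
      refine X_sub_X_mem hv ?_
      simp only [repr, src]
      rw [glued_fst hv]
      split_ifs
      · first
          | exact closeDigit_canonPerm a e.1 ha
          | exact (closeDigit_canonPerm a e.1 ha).symm
      · rfl
  · rw [map_zero]
    exact zero_mem _
  · rintro p q - - hp hq
    rw [map_add]
    exact add_mem hp hq
  · rintro q p - hp
    rw [smul_eq_mul, map_mul]
    exact Ideal.mul_mem_left _ _ hp

theorem rename_rename_mem (hv : ∀ t, v t = false) (ha : closable (code a) = true)
    (p : MvPolynomial E4 S) :
    p - MvPolynomial.rename (repr (code a)) (MvPolynomial.rename (repr 27) p) ∈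
      cycIdeal S (next wordL3 v * hat (canonPerm a)) := by
  refine sub_mem_of_subst ((MvPolynomial.rename (repr (code a))).comp
    (MvPolynomial.rename (repr 27))) (fun e => ?_) p
  rw [AlgHom.comp_apply, MvPolynomial.rename_X, MvPolynomial.rename_X]
  refine X_sub_X_mem hv ?_
  have h1 := closeDigit_canon a e.1 ha
  have h2 := closeDigit_label (canonPerm a) e.1 (closable_canon a).1
  simp only [repr, src] at h1 ⊢
  rw [h1, h2]

theorem closeOut_closeIn (hv : ∀ t, v t = false) (ha : closable (code a) = true) {s s' : Bool}
    (hs : s = true → looped (code a) = true) (p : MvPolynomial E4 S) :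
    closeOut S (code a) s' (closeIn S s p) - (if s = s' then p else 0) ∈
      cycIdeal S (next wordL3 v * hat (canonPerm a)) := by
  have h := rename_rename_mem (S := S) hv ha p
  have h' := neg_mem h
  rw [neg_sub] at h'
  rw [closeIn_apply, closeOut_mul _ _ (avoids_rename a p)]
  cases s
  · cases s'
    · simpa [closeOut_false, rest_one] using h'
    · simp [closeOut_true, death_one]
  · have h0 : src 0 ∈ freeSet (code a) := by
      rw [mem_freeSet]
      have := hs rfl
      rw [looped, beq_iff_eq] at this
      exact this
    cases s'
    · simp [closeOut_false, rest_X_of_mem h0]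
    · simpa [closeOut_true, death_X_of_mem h0] using h'

theorem closeIn_closeOut (hv : ∀ t, v t = false) (ha : closable (code a) = true)
    (p : MvPolynomial E4 S) :
    p - (closeIn S false (closeOut S (code a) false p) +
      closeIn S true (closeOut S (code a) true p)) ∈ cycIdeal S (next wordL3 v * hat a) := by
  induction p using MvPolynomial.induction_on with
  | C s =>
    simp [closeIn_apply, closeOut_false, closeOut_true, rest_C, death_C]
  | add p q hp hq =>
    convert add_mem hp hq using 1
    simp only [map_add]
    ring
  | mul_X p e hp =>
    have hd : (MvPolynomial.X (repr (code a) e) - MvPolynomial.X e : MvPolynomial E4 S) ∈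
        cycIdeal S (next wordL3 v * hat a) := X_sub_X_mem hv (closeDigit_label a e.1 ha)
    by_cases he : e ∈ freeSet (code a)
    · have hr : repr (code a) e = src 0 := by
        rw [repr, mem_freeSet.1 he]
        rfl
      rw [hr] at hd
      have h2 := sq_mem_cycIdeal S (next wordL3 v * hat a) (src 0)
      simp only [closeIn_apply, closeOut_false, closeOut_true, rest_mul, death_mul,
        rest_X_of_mem he, death_X_of_mem he, mul_zero, mul_one, add_zero, map_zero, zero_add, if_true,
        Bool.false_eq_true, if_false, one_mul] at hp ⊢
      convert add_mem (sub_mem (Ideal.mul_mem_right (MvPolynomial.X (src 0)) _ hp)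
        (Ideal.mul_mem_left _ p hd)) (Ideal.mul_mem_left _ (MvPolynomial.rename (repr 27)
          (MvPolynomial.rename (repr (code a)) (death S (freeSet (code a)) p))) h2) using 1
      ring
    · have hr : repr 27 (repr (code a) e) = repr (code a) e := by
        have := closeDigit_idem a e.1 (fun h => he (mem_freeSet.2 h))
        simp only [repr, src]
        rw [this]
      simp only [closeIn_apply, closeOut_false, closeOut_true, rest_mul, death_mul,
        rest_X_of_not_mem he, death_X_of_not_mem he, mul_zero, zero_add, map_mul,
        MvPolynomial.rename_X, hr, if_true, Bool.false_eq_true, if_false, one_mul] at hp ⊢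
      convert sub_mem (Ideal.mul_mem_right (MvPolynomial.X (repr (code a) e)) _ hp)
        (Ideal.mul_mem_left _ p hd) using 1
      ring

theorem freeSet_eq_empty (ha : closable (code a) = true) (hl : looped (code a) = false) :
    freeSet (code a) = ∅ := by
  refine Finset.eq_empty_of_forall_notMem fun e he => ?_
  have := closeDigit_eq_zero a e.1 ha (mem_freeSet.1 he)
  rw [hl] at this
  exact absurd this (by simp)

theorem death_empty (p : MvPolynomial E4 S) : death S ∅ p = 0 := by
  induction p using MvPolynomial.induction_on with
  | C s => exact death_C s
  | add p q hp hq => rw [map_add, hp, hq, add_zero]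
  | mul_X p e hp => rw [death_mul, hp, death_X_of_not_mem (by simp), mul_zero, zero_mul, add_zero]

theorem closeIn_closeOut_of_not_looped (hv : ∀ t, v t = false) (ha : closable (code a) = true)
    (hl : looped (code a) = false) (p : MvPolynomial E4 S) :
    p - closeIn S false (closeOut S (code a) false p) ∈ cycIdeal S (next wordL3 v * hat a) := by
  have h := closeIn_closeOut (S := S) hv ha p
  rwa [closeOut_true, freeSet_eq_empty ha hl, death_empty, map_zero, map_zero, add_zero] at h

/-- The degree of the summands that remain. -/
def closeQ (c : ℕ) (s : Bool) (q : ℕ) : ℕ :=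
  if looped c then if s then q - 1 else q + 1 else q

theorem Good.closeIn (hv : ∀ t, v t = false) (ha : closable (code a) = true) {s : Bool}
    (hs : s = true → looped (code a) = true) {q : ℕ} (hq : 1 ≤ q) :
    Good base (ob (canonPerm a) v (closeQ (code a) s q)) (ob a v q) (closeIn S s) where
  ideal p hp := closeIn_mem hv ha s hp
  left p := by
    rw [closeIn_apply, closeIn_apply, map_mul, MvPolynomial.rename_X]
    have : repr 27 base.1 = base.1 := by decide +kernel
    rw [this, mul_left_comm, sub_self]
    exact zero_mem _
  right p := by
    rw [closeIn_apply, closeIn_apply, map_mul, MvPolynomial.rename_X]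
    have h : (MvPolynomial.X (repr 27 base.2) - MvPolynomial.X base.2 : MvPolynomial E4 S) ∈
        cycIdeal S (next wordL3 v * hat a) := by
      refine X_sub_X_mem hv ?_
      rw [show (repr 27 base.2).1 = base.2.1 by decide +kernel]
    have e : ∀ x y z w : MvPolynomial E4 S, x * (y * z) - w * (x * z) = (y - w) * (x * z) :=
      fun x y z w => by ring
    rw [e]
    exact Ideal.mul_mem_right _ _ h
  deg d p hp := by
    refine ⟨_, ?_, by rw [sub_self]; exact zero_mem _⟩
    rw [closeIn_apply]
    have hX : MvPolynomial.IsWeightedHomogeneous (wt (E := E4))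
        (if s = true then MvPolynomial.X (src 0) else 1 : MvPolynomial E4 S)
        (if s then -2 else 0) := by
      cases s
      · exact MvPolynomial.isWeightedHomogeneous_one _ _
      · exact MvPolynomial.isWeightedHomogeneous_X _ _ _
    convert hX.mul (rename_isWeightedHomogeneous (repr 27) hp) using 1
    have h1 := cycles_canon hv ha
    simp only [ob, closeQ]
    rw [← h1]
    cases hl : looped (code a)
    · cases s
      · simp
      · exact absurd (hs rfl) (by simp [hl])
    · cases s
      · simp; ring
      · simp [hq]; ring

theorem Good.closeOut (hv : ∀ t, v t = false) (ha : closable (code a) = true) {s : Bool}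
    (hs : s = true → looped (code a) = true) {q : ℕ} (hq : 1 ≤ q) :
    Good base (ob a v q) (ob (canonPerm a) v (closeQ (code a) s q)) (closeOut S (code a) s) where
  ideal p hp := closeOut_mem hv s hp
  left p := by
    have h : base.1 ∉ freeSet (code a) := fun h =>
      absurd ((closeDigit_two a).symm.trans (mem_freeSet.1 h)) (by norm_num)
    rw [mul_comm, closeOut_mul _ _ (Avoids.X h), MvPolynomial.rename_X, repr_two a rfl, mul_comm]
    change _ - MvPolynomial.X (src 2) * _ ∈ _
    rw [sub_self]
    exact zero_mem _
  right p := by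
    have h : base.2 ∉ freeSet (code a) := fun h => closeDigit_three a (mem_freeSet.1 h)
    rw [mul_comm, closeOut_mul _ _ (Avoids.X h), MvPolynomial.rename_X, mul_comm, ← sub_mul]
    exact Ideal.mul_mem_right _ _ (X_sub_X_mem hv (labels_canon a ha))
  deg d p hp := by
    refine ⟨_, ?_, by rw [sub_self]; exact zero_mem _⟩
    have h0 := loop_isWeightedHomogeneous (L := freeSet (code a)) hp
    have h1 := cycles_canon hv ha
    cases s
    · rw [closeOut_false]
      convert rename_isWeightedHomogeneous (repr (code a)) h0.1 using 1
      simp only [ob, closeQ]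
      rw [← h1]
      cases hl : looped (code a)
      · simp
      · simp; ring
    · rw [closeOut_true]
      convert rename_isWeightedHomogeneous (repr (code a)) h0.2 using 1
      simp only [ob, closeQ]
      rw [← h1, hs rfl]
      simp [hq]
      ring

end ClosingMaps

section ClosingEntries

theorem maskVal_congr {Q : Type} [CommRing Q] {x y : Fin 4 → Q} {m : ℕ}
    (h : ∀ i : Fin 4, Nat.testBit m i = true → x i = y i) : maskVal x m = maskVal y m := by
  refine Finset.prod_congr rfl fun i _ => ?_
  split_ifs with hi
  · exact h i hi
  · rfl

theorem monosVal_congr {Q : Type} [CommRing Q] {x y : Fin 4 → Q} {u : Monos}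
    (h : ∀ t ∈ u, ∀ i : Fin 4, Nat.testBit t.1 i = true → x i = y i) :
    monosVal x u = monosVal y u := by
  induction u with
  | nil => rfl
  | cons t u ih =>
    obtain ⟨m, z⟩ := t
    rw [monosVal, monosVal, maskVal_congr (h (m, z) List.mem_cons_self),
      ih fun t ht => h t (List.mem_cons_of_mem _ ht)]

theorem testBit_xor_one (m : ℕ) (h : Nat.testBit m 0 = true) :
    Nat.testBit (Nat.xor m (2 ^ 0)) 0 = false ∧ Nat.lor (Nat.xor m (2 ^ 0)) (2 ^ 0) = m ∧
      Nat.testBit (Nat.xor m (2 ^ 0)) 1 = Nat.testBit m 1 := by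
  change Nat.testBit (m ^^^ 2 ^ 0) 0 = false ∧ (m ^^^ 2 ^ 0) ||| 2 ^ 0 = m ∧
    Nat.testBit (m ^^^ 2 ^ 0) 1 = Nat.testBit m 1
  refine ⟨?_, Nat.eq_of_testBit_eq fun i => ?_, ?_⟩
  · rw [Nat.testBit_xor, h, Nat.testBit_two_pow_self]
    rfl
  · rw [Nat.testBit_or, Nat.testBit_xor, Nat.testBit_two_pow]
    by_cases hi : 0 = i
    · rw [← hi, h]; simp
    · simp [hi]
  · rw [Nat.testBit_xor, Nat.testBit_two_pow]
    simp

/-- Only the variables of the basepoints occur. -/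
def Based (u : Monos) : Prop := ∀ t ∈ u, Nat.testBit t.1 0 = false ∧ Nat.testBit t.1 1 = false

theorem based_dropLoop {u : Monos} (hu : ∀ t ∈ u, Nat.testBit t.1 1 = false) :
    Based (dropLoop u) := by
  induction u with
  | nil => exact fun t ht => by simp [dropLoop] at ht
  | cons t u ih =>
    obtain ⟨m, z⟩ := t
    have ih' := ih fun t ht => hu t (List.mem_cons_of_mem _ ht)
    rw [dropLoop]
    split_ifs with h
    · exact ih'
    · intro t ht
      rcases List.mem_cons.1 ht with rfl | ht
      · exact ⟨by simpa using h, hu _ List.mem_cons_self⟩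
      · exact ih' t ht

theorem based_loopCoeff {u : Monos} (hu : ∀ t ∈ u, Nat.testBit t.1 1 = false) :
    Based (loopCoeff 0 u) := by
  induction u with
  | nil => exact fun t ht => by simp [loopCoeff] at ht
  | cons t u ih =>
    obtain ⟨m, z⟩ := t
    have ih' := ih fun t ht => hu t (List.mem_cons_of_mem _ ht)
    rw [loopCoeff]
    split_ifs with h
    · intro t ht
      rcases List.mem_cons.1 ht with rfl | ht
      · have := testBit_xor_one m h
        exact ⟨this.1, this.2.2.trans (hu _ List.mem_cons_self)⟩
      · exact ih' t ht
    · exact ih'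

theorem dropLoop_eq_self {u : Monos} (hu : ∀ t ∈ u, Nat.testBit t.1 0 = false) :
    dropLoop u = u := by
  induction u with
  | nil => rfl
  | cons t u ih =>
    obtain ⟨m, z⟩ := t
    rw [dropLoop, hu _ List.mem_cons_self, ih fun t ht => hu t (List.mem_cons_of_mem _ ht)]
    rfl

variable {S : Type} [CommRing S]

theorem avoids_maskVal_of {L : Finset E4} {m : ℕ}
    (h : ∀ i : Fin 4, Nat.testBit m i = true → src i ∉ L) :
    Avoids L (maskVal (fun i => (MvPolynomial.X (src i) : MvPolynomial E4 S)) m) := by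
  rw [maskVal]
  refine Finset.prod_induction _ (Avoids L) (fun _ _ => Avoids.mul) Avoids.one fun i _ => ?_
  split_ifs with hi
  · exact Avoids.X (h i hi)
  · exact Avoids.one

theorem loop_mval {L : Finset E4} (h0 : src 0 ∈ L) (h2 : src 2 ∉ L) (h3 : src 3 ∉ L) {u : Monos}
    (hu : ∀ t ∈ u, Nat.testBit t.1 1 = false) :
    rest S L (mval S u) = mval S (dropLoop u) ∧ death S L (mval S u) = mval S (loopCoeff 0 u) := by
  have key : ∀ m, Nat.testBit m 0 = false → Nat.testBit m 1 = false →
      Avoids L (maskVal (fun i => (MvPolynomial.X (src i) : MvPolynomial E4 S)) m) := by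
    intro m hm0 hm1
    refine avoids_maskVal_of fun i hi => ?_
    fin_cases i
    · exact absurd (hm0.symm.trans hi) (by simp)
    · exact absurd (hm1.symm.trans hi) (by simp)
    · exact h2
    · exact h3
  induction u with
  | nil => exact ⟨map_zero _, map_zero _⟩
  | cons t u ih =>
    obtain ⟨m, z⟩ := t
    obtain ⟨ih1, ih2⟩ := ih fun t ht => hu t (List.mem_cons_of_mem _ ht)
    have hm1 := hu (m, z) List.mem_cons_self
    have hz : ∀ (f : MvPolynomial E4 S →ₗ[S] MvPolynomial E4 S) (q : MvPolynomial E4 S),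
        f ((z : MvPolynomial E4 S) * q) = (z : MvPolynomial E4 S) * f q := fun f q => by
      rw [← zsmul_eq_mul, ← zsmul_eq_mul, map_zsmul]
    rw [mval] at ih1 ih2
    rw [mval, monosVal, map_add, map_add, hz, hz, dropLoop, loopCoeff, ih1, ih2]
    by_cases hm0 : Nat.testBit m 0 = true
    · obtain ⟨e1, e2, e3⟩ := testBit_xor_one m hm0
      have h1 := maskVal_lor (fun i => (MvPolynomial.X (src i) : MvPolynomial E4 S)) (d := 0) e1
      change maskVal _ (Nat.lor _ (2 ^ 0)) = _ at h1
      rw [e2] at h1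
      have hA := key _ e1 (e3.trans hm1)
      rw [if_pos hm0, if_pos hm0, h1, rest_mul, rest_X_of_mem h0, zero_mul, mul_zero, zero_add,
        hA.death_mul, death_X_of_mem h0, one_mul]
      exact ⟨rfl, rfl⟩
    · have hA := key m (by simpa using hm0) hm1
      rw [if_neg hm0, if_neg hm0, hA.1, hA.2, mul_zero, zero_add]
      exact ⟨rfl, rfl⟩

theorem rest_empty (p : MvPolynomial E4 S) : rest S ∅ p = p := by
  induction p using MvPolynomial.induction_on with
  | C s => exact rest_C s
  | add p q hp hq => rw [map_add, hp, hq]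
  | mul_X p e hp => rw [rest_mul, hp, rest_X_of_not_mem (by simp)]

variable {v : Fin 14 → Bool} {a b : Equiv.Perm (Fin 4)}

theorem adapted_closeLabels (hv : ∀ t, v t = false) (ha : closable (code a) = true) :
    Adapted (fun i => Ideal.Quotient.mk (cycIdeal S (next wordL3 v * hat a))
      (MvPolynomial.X (src i))) (closeLabels (code a)) := by
  constructor
  · intro i
    rw [← map_mul, Ideal.Quotient.eq_zero_iff_mem, ← sq]
    exact sq_mem_cycIdeal S _ _
  · intro i
    rw [Ideal.Quotient.eq]
    refine X_sub_X_mem hv ?_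
    have h := closeDigit_label a i ha
    rw [← (closeDigit_digit a i ha).2] at h
    exact h

theorem glueList_lt : ∀ a b, ∀ q ∈ glueList (code a) (code b), q.1 < 4 ∧ q.2 < 4 := by
  decide +kernel

theorem mval_mulAdd_mem (hv : ∀ t, v t = false) (hb : closable (code b) = true) (x y : Monos) :
    mval S (mulAdd (closeLabels (code b)) (glueList (code a) (code b)) x y []) -
      morPoly S (next wordL3 v) a b x * mval S y ∈ cycIdeal S (next wordL3 v * hat b) := by
  have h := (adapted_closeLabels (S := S) hv hb).mulAdd _ (glueList_lt a b) x y []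
  rw [← Ideal.Quotient.eq, mval, morPoly, mval, mval, gluePoly_closed hv, map_mul, map_mul,
    map_monosVal, map_monosVal, map_monosVal, map_linVal, h, monosVal, add_zero]
  ring

theorem mval_loop (s : Bool) : mval S [(if s then 1 else 0, 1)] =
    if s then MvPolynomial.X (src 0) else 1 := mval_loopTerm 0 s

theorem rename_mval_mem (hv : ∀ t, v t = false) (ha : closable (code a) = true) {u : Monos}
    (hu : Based u) : MvPolynomial.rename (repr (code a)) (mval S u) - mval S u ∈
      cycIdeal S (next wordL3 v * hat (canonPerm a)) := by
  rw [← Ideal.Quotient.eq, mval]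
  have e := map_monosVal ((Ideal.Quotient.mk (cycIdeal S (next wordL3 v * hat (canonPerm a)))).comp
    (MvPolynomial.rename (repr (code a)) : MvPolynomial E4 S →ₐ[S] MvPolynomial E4 S).toRingHom)
    (x := fun i => MvPolynomial.X (src i)) u
  rw [map_monosVal]
  refine e.trans (monosVal_congr fun t ht i hi => ?_)
  change Ideal.Quotient.mk _ (MvPolynomial.rename _ (MvPolynomial.X _)) = _
  rw [MvPolynomial.rename_X, Ideal.Quotient.eq]
  fin_cases i
  · exact absurd ((hu t ht).1.symm.trans hi) (by simp)
  · exact absurd ((hu t ht).2.symm.trans hi) (by simp)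
  · change MvPolynomial.X (repr (code a) (src 2)) - MvPolynomial.X (src 2) ∈ _
    rw [repr_two a rfl, sub_self]
    exact zero_mem _
  · exact X_sub_X_mem hv (labels_canon a ha)

theorem closeOut_mval (hb : closable (code b) = true) {t : Bool}
    (ht : t = true → looped (code b) = true) {u : Monos} (hu : closeVars (code b) u = true) :
    Based (if t then loopCoeff 0 u else dropLoop u) ∧ closeOut S (code b) t (mval S u) =
      MvPolynomial.rename (repr (code b)) (mval S (if t then loopCoeff 0 u else dropLoop u)) := by
  have hu' : ∀ t ∈ u, Nat.testBit t.1 1 = false ∧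
      (looped (code b) = true ∨ Nat.testBit t.1 0 = false) := by
    simpa [closeVars] using hu
  have hu1 : ∀ t ∈ u, Nat.testBit t.1 1 = false := fun t ht => (hu' t ht).1
  refine ⟨?_, ?_⟩
  · cases t
    · exact based_dropLoop hu1
    · exact based_loopCoeff hu1
  · by_cases hl : looped (code b) = true
    · have h0 : src 0 ∈ freeSet (code b) := by
        rw [mem_freeSet]
        rw [looped, beq_iff_eq] at hl
        exact hl
      have h2 : src 2 ∉ freeSet (code b) := fun h =>
        absurd ((closeDigit_two b).symm.trans (mem_freeSet.1 h)) (by norm_num)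
      have h3 : src 3 ∉ freeSet (code b) := fun h => closeDigit_three b (mem_freeSet.1 h)
      have h := loop_mval (S := S) h0 h2 h3 hu1
      cases t
      · rw [closeOut_false, h.1]
        rfl
      · rw [closeOut_true, h.2]
        rfl
    · cases t
      · rw [closeOut_false, freeSet_eq_empty hb (by simpa using hl), rest_empty]
        simp only [Bool.false_eq_true, if_false]
        rw [dropLoop_eq_self fun t ht => (hu' t ht).2.resolve_left hl]
      · exact absurd (ht rfl) hl

/-- The map between the summands that remain when the free circles are removed. -/
theorem closeOut_morPoly_closeIn (hv : ∀ t, v t = false) (hb : closable (code b) = true)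
    {s t : Bool} (ht : t = true → looped (code b) = true) {x : Monos}
    (hx : closeCheck (code a) (code b) s t x = true) (p : MvPolynomial E4 S) :
    closeOut S (code b) t (morPoly S (next wordL3 v) a b x * closeIn S s p) -
      morPoly S (next wordL3 v) (canonPerm a) (canonPerm b)
        (closeEntry (code a) (code b) s t x) * p ∈
      cycIdeal S (next wordL3 v * hat (canonPerm b)) := by
  rw [closeCheck, Bool.and_eq_true, List.isEmpty_iff] at hx
  obtain ⟨hx1, hx2⟩ := hx
  have h1 := mval_mulAdd_mem (S := S) (a := a) hv hb x [(if s then 1 else 0, 1)]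
  rw [mval_loop] at h1
  change mval S (closeTerms (code a) (code b) s x) - _ ∈ _ at h1
  have h2 := closeOut_mem hv t (Ideal.mul_mem_right (MvPolynomial.rename (repr 27) p) _ h1)
  rw [sub_mul, map_sub, closeOut_mul _ _ (avoids_rename b p)] at h2
  obtain ⟨h3, h4⟩ := closeOut_mval (S := S) hb ht hx1
  change Based (closePart (code a) (code b) s t x) at h3
  change _ = MvPolynomial.rename _ (mval S (closePart (code a) (code b) s t x)) at h4
  have h5 := rename_mval_mem (S := S) hv hb h3
  have h6 := rename_rename_mem (S := S) hv hb p
  have h7 := mval_mulAdd_mem (S := S) (a := canonPerm a) (b := canonPerm b) hv (closable_canon b).1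
    (closeEntry (code a) (code b) s t x) [(0, 1)]
  rw [mval_one, mul_one, code_canonPerm, code_canonPerm] at h7
  have h8 := monosVal_sumMonos (x := fun i => (MvPolynomial.X (src i) : MvPolynomial E4 S))
    (scale (-1) (closePart (code a) (code b) s t x)) (mulAdd (closeLabels (canonCode (code b)))
      (glueList (canonCode (code a)) (canonCode (code b))) (closeEntry (code a) (code b) s t x)
      [(0, 1)] [])
  rw [hx2, monosVal_scale] at h8
  have h9 : mval S (mulAdd (closeLabels (canonCode (code b)))
      (glueList (canonCode (code a)) (canonCode (code b))) (closeEntry (code a) (code b) s t x)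
      [(0, 1)] []) = mval S (closePart (code a) (code b) s t x) := by
    simp only [monosVal] at h8
    push_cast at h8
    rw [mval, mval]
    linear_combination -h8
  rw [h9] at h7
  rw [h4] at h2
  set P := mval S (closePart (code a) (code b) s t x)
  set M := morPoly S (next wordL3 v) (canonPerm a) (canonPerm b)
    (closeEntry (code a) (code b) s t x)
  have e : closeIn S s p = (if s = true then MvPolynomial.X (src 0) else 1) *
    MvPolynomial.rename (repr 27) p := rfl
  rw [e, ← mul_assoc]
  convert add_mem (sub_mem (Ideal.mul_mem_right (MvPolynomial.rename (repr (code b))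
    (MvPolynomial.rename (repr 27) p)) _ h5) h2) (sub_mem (Ideal.mul_mem_right p _ h7)
      (Ideal.mul_mem_left _ P h6)) using 1
  ring

end ClosingEntries

section Close

variable {S : Type} [CommRing S]

/-- The name of a summand that remains when a free circle is removed. -/
def closeId (n : ℕ) (s : Bool) : ℕ := if s then 2 * n + 1 else 2 * n

theorem closeId_inj {n n' : ℕ} {s s' : Bool} (h : closeId n s = closeId n' s') : n = n' ∧ s = s' := by
  cases s <;> cases s' <;> simp only [closeId, if_true, if_false, Bool.false_eq_true] at h <;>
    first
      | exact ⟨by omega, rfl⟩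
      | omega

theorem closeOk_spec {st : List Row} (h : closeOk st = true) {r : Row} (hr : r ∈ st) :
    closable r.code = true ∧ 1 ≤ r.q ∧ ∀ e ∈ r.ents, ∀ r', findRow e.1 st = some r' →
      ∀ s t : Bool, (s = true → looped r.code = true) → (t = true → looped r'.code = true) →
        closeCheck r.code r'.code s t e.2 = true := by
  rw [closeOk, List.all_eq_true] at h
  have h1 := h r hr
  rw [Bool.and_eq_true, Bool.and_eq_true, List.all_eq_true] at h1
  obtain ⟨⟨h1, h2⟩, h3⟩ := h1
  refine ⟨h1, by simpa using h2, fun e he r' hr' s t hs ht => ?_⟩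
  have h4 := h3 e he
  rw [hr'] at h4
  simp only [List.all_eq_true] at h4
  have h5 := h4 s (by cases s <;> simp) t (by cases t <;> simp)
  rw [Bool.or_eq_true, Bool.or_eq_true] at h5
  rcases h5 with (h5 | h5) | h5
  · rw [Bool.and_eq_true] at h5
    simp [hs h5.1] at h5
  · rw [Bool.and_eq_true] at h5
    simp [ht h5.1] at h5
  · exact h5

theorem mem_closeRows {st l : List Row} {r' : Row} (h : r' ∈ closeRows st l) :
    ∃ r ∈ l, r' = closeRow st false r ∨ (looped r.code = true ∧ r' = closeRow st true r) := by
  induction l with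
  | nil => simp [closeRows] at h
  | cons r l ih =>
    rw [closeRows, List.mem_append] at h
    rcases h with h | h
    · refine ⟨r, List.mem_cons_self, ?_⟩
      split_ifs at h with hl <;> simp only [List.mem_cons, List.not_mem_nil, or_false] at h <;> tauto
    · obtain ⟨s, hs, hs'⟩ := ih h
      exact ⟨s, List.mem_cons_of_mem _ hs, hs'⟩

theorem findRow_closeRows {st l : List Row} {n : ℕ} {r : Row} (h : findRow n l = some r) {s : Bool}
    (hs : s = true → looped r.code = true) :
    findRow (closeId n s) (closeRows st l) = some (closeRow st s r) := by
  induction l with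
  | nil => simp [findRow] at h
  | cons r₀ l ih =>
    rw [findRow] at h
    split_ifs at h with hr
    · obtain rfl := Option.some.inj h
      subst hr
      rw [closeRows]
      split_ifs with hl
      · cases s <;> simp [findRow, closeRow, closeId]
      · cases s
        · simp [findRow, closeRow, closeId]
        · exact absurd (hs rfl) hl
    · rw [closeRows, findRow_append_of_ne]
      · exact ih h
      · intro r' hr' h'
        have e : ∃ t, r'.id = closeId r₀.id t := by
          split_ifs at hr' <;> simp only [List.mem_cons, List.not_mem_nil, or_false] at hr'
          · rcases hr' with rfl | rfl
            exacts [⟨false, rfl⟩, ⟨true, rfl⟩]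
          · rw [hr']
            exact ⟨false, rfl⟩
        obtain ⟨t, ht⟩ := e
        exact hr (closeId_inj (ht.symm.trans h')).1

theorem closeOut_entry_closeIn {v : Fin 14 → Bool} (hv : ∀ t, v t = false)
    {a b : Equiv.Perm (Fin 4)} {st : List Row} {n : ℕ} {r : Row}
    (hr : findRow n st = some r) (hb : r.code = code b) (hcl : closable (code b) = true) {s t : Bool}
    (ht : t = true → looped (code b) = true) (l : List (ℕ × Monos))
    (hl : ∀ e ∈ l, e.1 = n → closeCheck (code a) (code b) s t e.2 = true) (p : MvPolynomial E4 S) :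
    closeOut S (code b) t (morPoly S (next wordL3 v) a b (entry n l) * closeIn S s p) -
      morPoly S (next wordL3 v) (canonPerm a) (canonPerm b)
        (entry (closeId n t) (closeEnts st (code a) s l)) * p ∈
      cycIdeal S (next wordL3 v * hat (canonPerm b)) := by
  induction l with
  | nil =>
    rw [closeEnts, entry, entry, morPoly_nil, morPoly_nil, zero_mul, zero_mul, map_zero, sub_self]
    exact zero_mem _
  | cons e l ih =>
    obtain ⟨m, x⟩ := e
    have ih' := ih fun e he => hl e (List.mem_cons_of_mem _ he)
    rw [closeEnts]
    by_cases hm : m = n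
    · subst hm
      rw [hr, entry, if_pos rfl, morPoly_append, add_mul, map_add]
      simp only [hb]
      have h1 := closeOut_morPoly_closeIn (S := S) (a := a) (b := b) hv hcl ht
        (hl (m, x) List.mem_cons_self rfl) p
      have key : morPoly S (next wordL3 v) (canonPerm a) (canonPerm b) (entry (closeId m t)
          (if looped (code b) = true then
            addEntry (2 * m) (closeEntry (code a) (code b) s false x)
              (addEntry (2 * m + 1) (closeEntry (code a) (code b) s true x)
                (closeEnts st (code a) s l))
          else addEntry (2 * m) (closeEntry (code a) (code b) s false x)
            (closeEnts st (code a) s l))) =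
          morPoly S (next wordL3 v) (canonPerm a) (canonPerm b)
            (closeEntry (code a) (code b) s t x) +
          morPoly S (next wordL3 v) (canonPerm a) (canonPerm b)
            (entry (closeId m t) (closeEnts st (code a) s l)) := by
        by_cases hlo : looped (code b) = true
        · rw [if_pos hlo, morPoly_addEntry, morPoly_addEntry]
          cases t <;> simp [closeId]
        · have : t = false := by
            cases t
            · rfl
            · exact absurd (ht rfl) hlo
          subst this
          rw [if_neg hlo, morPoly_addEntry]
          simp [closeId]
      rw [key]
      convert add_mem h1 ih' using 1
      ring
    · rw [entry, if_neg hm]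
      cases findRow m st with
      | none => exact ih'
      | some r' =>
        simp only
        have e0 : ¬ 2 * m = closeId n t := fun h => hm (closeId_inj (s := false) h).1
        have e1 : ¬ 2 * m + 1 = closeId n t := fun h => hm (closeId_inj (s := true) h).1
        split_ifs
        · rw [morPoly_addEntry, morPoly_addEntry, if_neg e0, if_neg e1, zero_add,
            zero_add]
          exact ih'
        · rw [morPoly_addEntry, if_neg e0, zero_add]
          exact ih'

theorem Later.eq_of_closed (u u' : Later 14) : u = u' :=
  Subtype.ext (funext fun t => by rw [u.2 t t.isLt, u'.2 t t.isLt])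

variable (X : Stage S 14) (label : X.Y → Option ℕ)

/-- The summands that remain when the free circles are removed. -/
abbrev Stage.CloseIdx : Type := {y : X.Y // label y = none} ⊕
  {z : X.Y × Bool // label z.1 ≠ none ∧ (z.2 = true → looped (code (X.a z.1)) = true)}

/-- The gluings that remain. -/
def Stage.closeA : X.CloseIdx label → Equiv.Perm (Fin 4)
  | .inl y => X.a y.1
  | .inr z => canonPerm (X.a z.1.1)

/-- The homological degrees that remain. -/
def Stage.closeH : X.CloseIdx label → ℕ
  | .inl y => X.h y.1
  | .inr z => X.h z.1.1

/-- The quantum degrees that remain. -/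
def Stage.closeDeg : X.CloseIdx label → ℕ
  | .inl y => X.q y.1
  | .inr z => closeQ (code (X.a z.1.1)) z.1.2 (X.q z.1.1)

/-- The summand from which a summand is split off. -/
def Stage.closeSource : X.CloseIdx label × Later 14 → X.Y × Later 14
  | (.inl y, u) => (y.1, u)
  | (.inr z, u) => (z.1.1, u)

/-- The inclusions of the summands that remain. -/
def Stage.closeIncl : X.CloseIdx label × Later 14 → MvPolynomial E4 S →ₗ[S] MvPolynomial E4 S
  | (.inl _, _) => LinearMap.id
  | (.inr z, _) => closeIn S z.1.2

/-- The projections to the summands that remain. -/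
def Stage.closeProj : X.CloseIdx label × Later 14 → MvPolynomial E4 S →ₗ[S] MvPolynomial E4 S
  | (.inl _, _) => LinearMap.id
  | (.inr z, _) => closeOut S (code (X.a z.1.1)) z.1.2

/-- The names of the summands that remain. -/
def Stage.closeLabel : X.CloseIdx label → Option ℕ
  | .inl _ => none
  | .inr z => (label z.1.1).map (closeId · z.1.2)

variable {X label}

theorem Later.apply_closed (u : Later 14) (t : Fin 14) : u.1 t = false := u.2 t t.isLt

theorem Stage.good_closeProj (hc : ∀ y, label y ≠ none → closable (code (X.a y)) = true ∧ 1 ≤ X.q y)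
    (j : X.CloseIdx label × Later 14) :
    Good base (ob (X.a (X.closeSource label j).1) (X.closeSource label j).2.1
      (X.q (X.closeSource label j).1)) (ob (X.closeA label j.1) j.2.1 (X.closeDeg label j.1))
      (X.closeProj label j) := by
  obtain ⟨y | z, u⟩ := j
  · exact Good.id _ _
  · exact Good.closeOut u.apply_closed (hc _ z.2.1).1 z.2.2 (hc _ z.2.1).2

theorem Stage.good_closeIncl (hc : ∀ y, label y ≠ none → closable (code (X.a y)) = true ∧ 1 ≤ X.q y)
    (j : X.CloseIdx label × Later 14) :
    Good base (ob (X.closeA label j.1) j.2.1 (X.closeDeg label j.1))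
      (ob (X.a (X.closeSource label j).1) (X.closeSource label j).2.1
        (X.q (X.closeSource label j).1)) (X.closeIncl label j) := by
  obtain ⟨y | z, u⟩ := j
  · exact Good.id _ _
  · exact Good.closeIn u.apply_closed (hc _ z.2.1).1 z.2.2 (hc _ z.2.1).2

open Classical in
theorem Stage.sum_closeIncl_closeProj
    (hc : ∀ y, label y ≠ none → closable (code (X.a y)) = true ∧ 1 ≤ X.q y) (i : X.Y × Later 14)
    (p : MvPolynomial E4 S) :
    p - ∑ j, (if X.closeSource label j = i then X.closeIncl label j (X.closeProj label j p) else 0) ∈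
      cycIdeal S (next wordL3 i.2.1 * hat (X.a i.1)) := by
  obtain ⟨y, u⟩ := i
  by_cases hy : label y = none
  · rw [Finset.sum_eq_single (Sum.inl ⟨y, hy⟩, u),
      if_pos (show X.closeSource label (Sum.inl ⟨y, hy⟩, u) = (y, u) from rfl)]
    · simp [closeIncl, closeProj]
    · rintro ⟨⟨y', hy'⟩ | ⟨⟨y', s⟩, hz⟩, u'⟩ - h
      · refine if_neg fun h' => h ?_
        obtain ⟨e1, e2⟩ := Prod.mk.inj h'
        simp only at e1
        subst e1 e2
        rfl
      · refine if_neg fun h' => hz.1 ?_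
        obtain ⟨e1, e2⟩ := Prod.mk.inj h'
        simp only at e1 ⊢
        rw [e1, hy]
    · exact fun h => absurd (Finset.mem_univ _) h
  · let z0 : {z : X.Y × Bool // label z.1 ≠ none ∧ (z.2 = true → looped (code (X.a z.1)) = true)} :=
      ⟨(y, false), hy, by simp⟩
    have hrest : ∀ j : X.CloseIdx label × Later 14, j ≠ (Sum.inr z0, u) →
        (∀ h, j ≠ (Sum.inr ⟨(y, true), hy, h⟩, u)) → X.closeSource label j ≠ (y, u) := by
      rintro ⟨⟨y', hy'⟩ | ⟨⟨y', s⟩, hz⟩, u'⟩ h h' h''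
      · obtain ⟨e1, e2⟩ := Prod.mk.inj h''
        simp only at e1
        exact hy (e1 ▸ hy')
      · obtain ⟨e1, e2⟩ := Prod.mk.inj h''
        simp only at e1
        subst e1 e2
        cases s
        · exact h rfl
        · exact h' (hz.2) rfl
    by_cases hl : looped (code (X.a y)) = true
    · let z1 : {z : X.Y × Bool // label z.1 ≠ none ∧ (z.2 = true → looped (code (X.a z.1)) = true)} :=
        ⟨(y, true), hy, fun _ => hl⟩
      rw [Finset.sum_eq_add (Sum.inr z0, u) (Sum.inr z1, u),
        if_pos (show X.closeSource label (Sum.inr z0, u) = (y, u) from rfl),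
        if_pos (show X.closeSource label (Sum.inr z1, u) = (y, u) from rfl)]
      · exact closeIn_closeOut u.apply_closed (hc y hy).1 p
      · intro h
        have := congrArg (fun z : {z : X.Y × Bool // label z.1 ≠ none ∧
          (z.2 = true → looped (code (X.a z.1)) = true)} => z.1.2) (Sum.inr.inj (Prod.mk.inj h).1)
        exact absurd this (by simp [z0, z1])
      · exact fun j _ h => if_neg (hrest j h.1 fun _ => h.2)
      · exact fun h => absurd (Finset.mem_univ _) h
      · exact fun h => absurd (Finset.mem_univ _) h
    · rw [Finset.sum_eq_single (Sum.inr z0, u),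
        if_pos (show X.closeSource label (Sum.inr z0, u) = (y, u) from rfl)]
      · exact closeIn_closeOut_of_not_looped u.apply_closed (hc y hy).1 (by simpa using hl) p
      · exact fun j _ h => if_neg (hrest j h fun h' => absurd (h' rfl) hl)
      · exact fun h => absurd (Finset.mem_univ _) h

open Classical in
theorem Stage.closeProj_closeIncl
    (hc : ∀ y, label y ≠ none → closable (code (X.a y)) = true ∧ 1 ≤ X.q y)
    (j j' : X.CloseIdx label × Later 14) (h : X.closeSource label j = X.closeSource label j')
    (p : MvPolynomial E4 S) :
    X.closeProj label j' (X.closeIncl label j p) - (if j = j' then p else 0) ∈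
      cycIdeal S (next wordL3 j'.2.1 * hat (X.closeA label j'.1)) := by
  obtain ⟨⟨y, hy⟩ | ⟨⟨y, s⟩, hz⟩, u⟩ := j <;> obtain ⟨⟨y', hy'⟩ | ⟨⟨y', s'⟩, hz'⟩, u'⟩ := j' <;>
    obtain ⟨e1, e2⟩ := Prod.mk.inj h <;> simp only at e1 <;> subst e1 e2
  · rw [if_pos rfl]
    simp [closeIncl, closeProj]
  · exact absurd hy hz'.1
  · exact absurd hy' hz.1
  · have := closeOut_closeIn (S := S) (s' := s') u.apply_closed (hc y hz.1).1 hz.2 p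
    have e : (if ((Sum.inr ⟨(y, s), hz⟩, u) : X.CloseIdx label × Later 14) =
        (Sum.inr ⟨(y, s'), hz'⟩, u) then p else 0) = if s = s' then p else 0 := by
      by_cases h : s = s'
      · subst h
        rw [if_pos rfl, if_pos rfl]
      · rw [if_neg h, if_neg]
        intro h'
        exact h (congrArg (fun z : {z : X.Y × Bool // label z.1 ≠ none ∧
          (z.2 = true → looped (code (X.a z.1)) = true)} => z.1.2) (Sum.inr.inj (Prod.mk.inj h').1))
    rw [e]
    exact this

theorem Stage.Computes.close {st : List Row} {B : ℕ} (hX : X.Computes label st B)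
    (hok : closeOk st = true) :
    ∃ (X' : Stage S 14) (label' : X'.Y → Option ℕ),
      X'.Computes label' (closeRows st st) B ∧ X.toTw.Equiv X'.toTw := by
  classical
  have hc : ∀ y, label y ≠ none → closable (code (X.a y)) = true ∧ 1 ≤ X.q y := by
    intro y hy
    obtain ⟨n, hn⟩ := Option.ne_none_iff_exists'.1 hy
    obtain ⟨r, hr, hra, -, hrq, -⟩ := hX.row y n hn
    have := closeOk_spec hok (findRow_mem hr)
    rw [← hra, ← hrq]
    exact ⟨this.1, this.2.1⟩
  obtain ⟨hd', hdeg', hE⟩ := Tw.exists_subst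
    (A := fun i : X.Y × Later 14 => ob (X.a i.1) i.2.1 (X.q i.1))
    (A' := fun j : X.CloseIdx label × Later 14 => ob (X.closeA label j.1) j.2.1 (X.closeDeg label j.1))
    X.d_sq X.deg (X.closeSource label)
    (h' := fun j : X.CloseIdx label × Later 14 => (X.closeH label j.1 : ℤ) + height j.2.1)
    (by
      rintro ⟨y | z, u⟩
      · rfl
      · rfl)
    (X.closeProj label) (X.closeIncl label) (fun j => X.good_closeProj hc j)
    (fun j => X.good_closeIncl hc j)
    (by
      intro i p
      convert X.sum_closeIncl_closeProj hc i p
      rfl)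
    (by
      intro j j' h p
      convert X.closeProj_closeIncl hc j j' h p
      rfl)
  refine ⟨⟨X.CloseIdx label, X.closeA label, X.closeH label, X.closeDeg label, _, hd', hdeg'⟩,
    X.closeLabel label, ?_, hE⟩
  constructor
  · exact fun i j h => absurd (Later.eq_of_closed i.2 j.2) h
  · rintro (⟨y, hy⟩ | ⟨⟨y, s⟩, hz⟩) n hn
    · exact absurd hn (by simp [closeLabel])
    obtain ⟨m, hm, rfl⟩ := Option.map_eq_some_iff.1 hn
    obtain ⟨r, hr, hra, hrh, hrq, hrd⟩ := hX.row y m hm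
    have hcr := closeOk_spec hok (findRow_mem hr)
    refine ⟨closeRow st s r, findRow_closeRows hr (by rw [hra]; exact hz.2), ?_, hrh, ?_, ?_⟩
    · change canonCode r.code = code (canonPerm (X.a y))
      rw [hra, code_canonPerm]
    · change (if looped r.code = true then if s = true then r.q - 1 else r.q + 1 else r.q) =
        closeQ (code (X.a y)) s (X.q y)
      rw [hra, hrq]
      rfl
    rintro (⟨y', hy'⟩ | ⟨⟨y', s'⟩, hz'⟩) n' u hn'
    · exact absurd hn' (by simp [closeLabel])
    obtain ⟨m', hm', rfl⟩ := Option.map_eq_some_iff.1 hn'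
    obtain ⟨r', hr', hra', -⟩ := hX.row y' m' hm'
    refine (((X.good_closeIncl hc (Sum.inr ⟨(y, s), hz⟩, u)).rep.comp ((hrd y' m' u hm').comp
      (X.good_closeProj hc (Sum.inr ⟨(y', s'), hz'⟩, u)).rep))).congr fun p => ?_
    have h := closeOut_entry_closeIn (S := S) (a := X.a y) (s := s) u.apply_closed hr' hra'
      (hc y' hz'.1).1 hz'.2 r.ents (fun e he hen => by
        have := hcr.2.2 e he r' (by rw [hen]; exact hr') s s' (by rw [hra]; exact hz.2)
          (by rw [hra']; exact hz'.2)
        rwa [hra, hra'] at this) p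
    rw [← hra] at h
    exact h
  · rintro (⟨y, hy⟩ | ⟨⟨y, s⟩, hz⟩) (⟨y', hy'⟩ | ⟨⟨y', s'⟩, hz'⟩) n h1 h2
    · exact absurd h1 (by simp [closeLabel])
    · exact absurd h1 (by simp [closeLabel])
    · exact absurd h2 (by simp [closeLabel])
    · obtain ⟨m, hm, rfl⟩ := Option.map_eq_some_iff.1 h1
      obtain ⟨m', hm', h⟩ := Option.map_eq_some_iff.1 h2
      obtain ⟨e1, e2⟩ := closeId_inj h
      simp only at e2
      subst e1 e2
      obtain rfl := hX.inj y y' m' hm hm'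
      rfl
  · rintro (⟨y, hy⟩ | ⟨⟨y, s⟩, hz⟩) h
    · exact hX.low y hy
    · exact absurd (Option.map_eq_none_iff.1 h) hz.1
  · intro r' hr'
    obtain ⟨r, hr, hrr⟩ := mem_closeRows hr'
    obtain ⟨y, hy, hyh, hya⟩ := hX.surj r hr
    have hy0 : label y ≠ none := by rw [hy]; simp
    rcases hrr with rfl | ⟨hl, rfl⟩
    · refine ⟨Sum.inr ⟨(y, false), hy0, by simp⟩, Option.map_eq_some_iff.2 ⟨_, hy, rfl⟩, hyh, ?_⟩
      change code (canonPerm (X.a y)) = canonCode r.code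
      rw [code_canonPerm, hya]
    · refine ⟨Sum.inr ⟨(y, true), hy0, fun _ => by rw [hya]; exact hl⟩,
        Option.map_eq_some_iff.2 ⟨_, hy, rfl⟩, hyh, ?_⟩
      change code (canonPerm (X.a y)) = canonCode r.code
      rw [code_canonPerm, hya]

end Close

section Halve

variable {S : Type} [CommRing S]

theorem mval_half {u : Monos} (hu : ∀ t ∈ u, t.2 % 2 = 0) : 2 * mval S (half u) = mval S u := by
  induction u with
  | nil => exact mul_zero _
  | cons t u ih =>
    obtain ⟨m, z⟩ := t
    have ih' := ih fun t ht => hu t (List.mem_cons_of_mem _ ht)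
    have hz : z % 2 = 0 := hu (m, z) List.mem_cons_self
    obtain ⟨y, rfl⟩ : ∃ y, z = 2 * y := ⟨z / 2, by omega⟩
    rw [half, mval, monosVal, mval, monosVal, mul_add]
    rw [mval, mval] at ih'
    rw [ih', Int.mul_ediv_cancel_left _ (by norm_num)]
    push_cast
    ring

theorem mval_entry_halfEnts {l : List (ℕ × Monos)} (hl : ∀ e ∈ l, ∀ t ∈ e.2, t.2 % 2 = 0) (m : ℕ) :
    2 * mval S (entry m (halfEnts l)) = mval S (entry m l) := by
  induction l with
  | nil => exact mul_zero _
  | cons e l ih =>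
    obtain ⟨j, x⟩ := e
    have ih' := ih fun e he => hl e (List.mem_cons_of_mem _ he)
    rw [halfEnts, entry, entry]
    split_ifs
    · rw [mval_append, mval_append, mul_add, ih', mval_half (hl (j, x) List.mem_cons_self)]
    · exact ih'

theorem mval_entry_halveEnts (n m : ℕ) (l : List (ℕ × Monos)) :
    mval S (entry m (halveEnts n l)) = (if m = n then 2 else 1) * mval S (entry m l) := by
  induction l with
  | nil => exact (mul_zero _).symm
  | cons e l ih =>
    obtain ⟨j, x⟩ := e
    rw [halveEnts, entry, entry]
    by_cases h : j = m
    · subst h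
      rw [if_pos rfl, if_pos rfl, mval_append, mval_append, ih]
      split_ifs
      · rw [mval_scale]
        push_cast
        ring
      · ring
    · rw [if_neg h, if_neg h, ih]

/-- The row after the multiplication of the generator of one summand by `1 / 2`. -/
def halveRow (n : ℕ) (r : Row) : Row :=
  { r with ents := if r.id = n then halfEnts r.ents else halveEnts n r.ents }

theorem findRow_halveRows {n m : ℕ} {l : List Row} {r : Row} (h : findRow m l = some r) :
    findRow m (halveRows n l) = some (halveRow n r) := by
  induction l with
  | nil => simp [findRow] at h
  | cons r₀ l ih =>
    rw [findRow] at h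
    rw [halveRows, findRow]
    split_ifs at h with hr
    · obtain rfl := Option.some.inj h
      rw [if_pos hr]
      rfl
    · rw [if_neg hr]
      exact ih h

theorem mem_halveRows {n : ℕ} {l : List Row} {r' : Row} (h : r' ∈ halveRows n l) :
    ∃ r ∈ l, r' = halveRow n r := by
  induction l with
  | nil => simp [halveRows] at h
  | cons r l ih =>
    rw [halveRows] at h
    rcases List.mem_cons.1 h with rfl | h
    · exact ⟨r, List.mem_cons_self, rfl⟩
    · obtain ⟨s, hs, hs'⟩ := ih h
      exact ⟨s, List.mem_cons_of_mem _ hs, hs'⟩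

theorem entry_eq_nil {n : ℕ} {l : List (ℕ × Monos)} (h : ∀ e ∈ l, e.1 ≠ n) : entry n l = [] := by
  induction l with
  | nil => rfl
  | cons e l ih =>
    rw [entry, if_neg (h e List.mem_cons_self)]
    exact ih fun e he => h e (List.mem_cons_of_mem _ he)

theorem Good.mulBy_C {E : Type} [Fintype E] [DecidableEq E] (e : E × E) (A : Equiv.Perm E × ℤ)
    (s : S) : Good e A A (Khovanov.mulBy (MvPolynomial.C s)) :=
  Good.mulBy (fun _ hp => Ideal.mul_mem_left _ _ hp) (by
    rw [sub_self]
    exact MvPolynomial.isWeightedHomogeneous_C _ _)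

theorem Stage.Computes.halve {k : ℕ} {X : Stage S k} {label : X.Y → Option ℕ} {st : List Row}
    {B : ℕ} (hX : X.Computes label st B) {w : S} (hw : 2 * w = 1)
    (hk : ∀ u u' : Later k, u = u') {n : ℕ} (hn : evenRow n st = true) :
    ∃ (X' : Stage S k) (label' : X'.Y → Option ℕ),
      X'.Computes label' (halveRows n st) B ∧ X.toTw.Equiv X'.toTw := by
  classical
  let c : X.Y → S := fun y => if label y = some n then 2 else 1
  let c' : X.Y → S := fun y => if label y = some n then w else 1
  have hcc : ∀ y, c' y * c y = 1 ∧ c y * c' y = 1 := by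
    intro y
    simp only [c, c']
    split_ifs
    · exact ⟨by rw [mul_comm, hw], hw⟩
    · exact ⟨one_mul _, one_mul _⟩
  obtain ⟨hd', hdeg', hE⟩ := Tw.exists_subst
    (A := fun i : X.Y × Later k => ob (X.a i.1) i.2.1 (X.q i.1))
    (A' := fun i : X.Y × Later k => ob (X.a i.1) i.2.1 (X.q i.1))
    X.d_sq X.deg id (h' := fun i : X.Y × Later k => (X.h i.1 : ℤ) + height i.2.1) (fun _ => rfl)
    (fun i => mulBy (MvPolynomial.C (c i.1))) (fun i => mulBy (MvPolynomial.C (c' i.1)))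
    (fun i => Good.mulBy_C _ _ _) (fun i => Good.mulBy_C _ _ _)
    (by
      intro i p
      have : ∑ j, (if id j = i then mulBy (MvPolynomial.C (c' j.1))
          (mulBy (MvPolynomial.C (c j.1)) p) else 0) = p := by
        rw [Finset.sum_eq_single i]
        · rw [if_pos (show id i = i from rfl), LinearMap.mulLeft_apply, LinearMap.mulLeft_apply,
            ← mul_assoc, ← MvPolynomial.C_mul, (hcc i.1).1, MvPolynomial.C_1, one_mul]
        · exact fun j _ hj => if_neg hj
        · exact fun h => absurd (Finset.mem_univ _) h
      rw [sub_eq_zero.2]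
      · exact zero_mem _
      · refine Eq.trans this.symm ?_
        congr!)
    (by
      intro j j' h p
      obtain rfl : j = j' := h
      rw [if_pos rfl, LinearMap.mulLeft_apply, LinearMap.mulLeft_apply, ← mul_assoc,
        ← MvPolynomial.C_mul, (hcc j.1).2, MvPolynomial.C_1, one_mul, sub_self]
      exact zero_mem _)
  refine ⟨⟨X.Y, X.a, X.h, X.q, _, hd', hdeg'⟩, label, ?_, hE⟩
  rw [evenRow, List.all_eq_true] at hn
  have h2 : (MvPolynomial.C w : MvPolynomial E4 S) * 2 = 1 := by
    rw [mul_comm, show (2 : MvPolynomial E4 S) = MvPolynomial.C 2 from (map_ofNat MvPolynomial.C 2).symm, ← MvPolynomial.C_mul, hw,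
      MvPolynomial.C_1]
  constructor
  · exact fun i j h => absurd (hk i.2 j.2) h
  · intro y m hm
    obtain ⟨r, hr, hra, hrh, hrq, hrd⟩ := hX.row y m hm
    have hid := findRow_id hr
    refine ⟨halveRow n r, findRow_halveRows hr, hra, hrh, hrq, ?_⟩
    intro y' m' v hm'
    refine ((Good.mulBy_C (S := S) base (ob (X.a y) v.1 (X.q y)) (c' y)).rep.comp
      ((hrd y' m' v hm').comp
        (Good.mulBy_C (S := S) base (ob (X.a y') v.1 (X.q y')) (c y')).rep)).congr fun p => ?_
    suffices h : (MvPolynomial.C (c y') : MvPolynomial E4 S) * MvPolynomial.C (c' y) *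
        mval S (entry m' r.ents) = mval S (entry m' (halveRow n r).ents) by
      rw [sub_eq_zero.2]
      · exact zero_mem _
      · simp only [LinearMap.mulLeft_apply, morPoly, ← h]
        ring
    simp only [halveRow]
    by_cases hmn : m = n
    · have hr' := hn r (findRow_mem hr)
      simp only [Bool.or_eq_true, decide_eq_true_eq, List.all_eq_true, Bool.and_eq_true,
        beq_iff_eq] at hr'
      have hr'' := hr'.resolve_left (not_not.2 (hid.trans hmn))
      have e1 := mval_entry_halfEnts (S := S) (fun e he => (hr'' e he).2) m'
      have e2 : c' y = w := if_pos (by rw [hm, hmn])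
      rw [if_pos (hid.trans hmn), ← e1, e2]
      by_cases hm'n : m' = n
      · have e3 : entry m' r.ents = [] := entry_eq_nil fun e he => by
          rw [hm'n]
          exact (hr'' e he).1
        have e4 : mval S (entry m' (halfEnts r.ents)) = 0 := by
          rw [e3] at e1
          calc _ = MvPolynomial.C w * 2 * mval S (entry m' (halfEnts r.ents)) := by
                rw [h2, one_mul]
            _ = 0 := by rw [mul_assoc, e1]; exact mul_zero _
        rw [e4, mul_zero, mul_zero]
      · have e3 : c y' = 1 := if_neg (by rw [hm']; simpa using hm'n)
        rw [e3, MvPolynomial.C_1, one_mul, ← mul_assoc, h2, one_mul]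
    · have e2 : c' y = 1 := if_neg (by rw [hm]; simpa using hmn)
      rw [if_neg (fun h => hmn (hid.symm.trans h)), mval_entry_halveEnts, e2, MvPolynomial.C_1,
        mul_one]
      simp only [c, hm', Option.some.injEq]
      split_ifs
      · rw [map_ofNat]
      · rw [MvPolynomial.C_1]
  · exact hX.inj
  · exact hX.low
  · intro r' hr'
    obtain ⟨r, hr, rfl⟩ := mem_halveRows hr'
    exact hX.surj r hr

theorem Stage.Computes.elimAt {k : ℕ} {X : Stage S k} {label : X.Y → Option ℕ} {st : List Row}
    {B : ℕ} (hX : X.Computes label st B) (n t : ℕ) (u : ℤ) :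
    ∃ (X' : Stage S k) (label' : X'.Y → Option ℕ),
      X'.Computes label' (elimAt n t u st) B ∧ X.toTw.Equiv X'.toTw := by
  rw [Khovanov.elimAt]
  cases hp : pivotRow st n t u with
  | none => exact ⟨X, label, hX, .refl _⟩
  | some rk => exact hX.eliminate hp

theorem Stage.Computes.halveAt {X : Stage S 14} {label : X.Y → Option ℕ} {st : List Row}
    {B : ℕ} (hX : X.Computes label st B) {w : S} (hw : 2 * w = 1) (n : ℕ) :
    ∃ (X' : Stage S 14) (label' : X'.Y → Option ℕ),
      X'.Computes label' (halveAt n st) B ∧ X.toTw.Equiv X'.toTw := by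
  rw [Khovanov.halveAt]
  split_ifs with h
  · exact hX.halve hw Later.eq_of_closed h
  · exact ⟨X, label, hX, .refl _⟩

/-- The steps of the last simplification: eliminations and changes of generators. -/
inductive Move
  | elim (n t : ℕ) (u : ℤ)
  | halve (n : ℕ)

/-- A step of the last simplification. -/
def Move.apply (st : List Row) : Move → List Row
  | .elim n t u => elimAt n t u st
  | .halve n => halveAt n st

/-- The last simplification. -/
def moves : List Move :=
  [.elim 4624854 4624856 (-1), .elim 4624836 4624838 1, .halve 1576802, .halve 4624848,
    .elim 4624848 4624855 1, .elim 1222022 4620572 (-1), .elim 4620570 1576316 1,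
    .elim 1576746 4624837 (-1), .halve 4624830, .elim 4624830 4624849 (-1)]

theorem Stage.Computes.moves {w : S} (hw : 2 * w = 1) (l : List Move) {X : Stage S 14}
    {label : X.Y → Option ℕ} {st : List Row} {B : ℕ} (hX : X.Computes label st B) :
    ∃ (X' : Stage S 14) (label' : X'.Y → Option ℕ),
      X'.Computes label' (l.foldl Move.apply st) B ∧ X.toTw.Equiv X'.toTw := by
  induction l generalizing X st with
  | nil => exact ⟨X, label, hX, .refl _⟩
  | cons m l ih =>
    obtain ⟨X₁, l₁, h₁, e₁⟩ : ∃ (X' : Stage S 14) (label' : X'.Y → Option ℕ),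
        X'.Computes label' (m.apply st) B ∧ X.toTw.Equiv X'.toTw := by
      cases m with
      | elim n t u => exact hX.elimAt n t u
      | halve n => exact hX.halveAt hw n
    obtain ⟨X₂, l₂, h₂, e₂⟩ := ih h₁
    exact ⟨X₂, l₂, h₂, e₁.trans e₂⟩

/-- The simplified complex. -/
def finalRows : List Row := moves.foldl Move.apply (closeRows (run 14) (run 14))

/-- The complex splits into a part of degree at most `7` and the complex of `3 X ⊗ 1 - 1 ⊗ X`. -/
def finalOk (st : List Row) : Bool :=
  match findRow 1576800 st, findRow 1576802 st with
  | some r, some r' =>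
    r.code == 27 && r.h == 8 && r.q == 10 &&
      (sumMonos [(4, -3), (8, 1)] (normalForm 27 (entry 1576802 r.ents))).isEmpty &&
      r'.code == 27 && r'.h == 9 && r'.q == 12 && st.all fun s =>
        (s.h ≤ 7 && (normalForm 27 (entry 1576800 s.ents)).isEmpty) || s.id == 1576800 ||
          s.id == 1576802
  | _, _ => false

theorem final_check : closeOk (run 14) = true ∧ finalOk finalRows = true := by
  have h : (closeOk (run 14) && finalOk finalRows) = true := by decide +kernel
  exact (Bool.and_eq_true _ _).mp h

theorem Stage.Computes.final {w : S} (hw : 2 * w = 1) {X : Stage S 0} {label : X.Y → Option ℕ}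
    (hX : X.Computes label (Khovanov.run 0) 0) :
    ∃ (X' : Stage S 14) (label' : X'.Y → Option ℕ),
      X'.Computes label' finalRows 7 ∧ X.toTw.Equiv X'.toTw := by
  obtain ⟨X₁, l₁, h₁, e₁⟩ := hX.run 14 le_rfl
  obtain ⟨X₂, l₂, h₂, e₂⟩ := h₁.close final_check.1
  obtain ⟨X₃, l₃, h₃, e₃⟩ := h₂.moves hw Khovanov.moves
  exact ⟨X₃, l₃, h₃, e₁.trans (e₂.trans e₃)⟩

end Halve

section RealizeCube

section

universe u

variable {C : Type u} [Category.{0} C] [Preadditive C]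

theorem embedding_comp_apply {X : C} {M N : Mat_ C} (f : M ⟶ (Mat_.embedding C).obj X)
    (g : (Mat_.embedding C).obj X ⟶ N) (i : M.ι) (j : N.ι) :
    (f ≫ g) i j = f i PUnit.unit ≫ g PUnit.unit j := by
  rw [Mat_.comp_apply]
  exact Fintype.sum_unique (ι := PUnit) _

/-- A complex whose modules are decomposed into summands is realized by a matrix. -/
theorem Tw.exists_realizes (K : CochainComplex C ℤ) {M : Mat_ C} {h : M.ι → ℤ}
    (pr : ∀ n, (Mat_.embedding C).obj (K.X n) ⟶ M) (inj : ∀ n, M ⟶ (Mat_.embedding C).obj (K.X n))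
    (hpi : ∀ n, pr n ≫ inj n = 𝟙 _)
    (hip : ∀ n, inj n ≫ pr n = fun i j => if h i = n then 𝟙 M i j else 0) :
    ∃ (d : M ⟶ M) (hd : d ≫ d = 0) (hdeg : HasDeg h h 1 d),
      (∀ i j, d i j =
        (inj (h i) ≫ (Mat_.embedding C).map (K.d (h i) (h i + 1)) ≫ pr (h i + 1)) i j) ∧
      Nonempty (Tw.Realizes ⟨M, h, d, hd, hdeg⟩ K) := by
  let T : Tw C := ⟨M, h, 0, comp_zero, HasDeg.zero⟩
  let D : ∀ n, (Mat_.embedding C).obj (K.X n) ⟶ (Mat_.embedding C).obj (K.X (n + 1)) :=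
    fun n => (Mat_.embedding C).map (K.d n (n + 1))
  have hip' : ∀ n, inj n ≫ pr n = T.part n := hip
  have hpr : ∀ n, pr n ≫ T.part n = pr n := fun n => by
    rw [← hip', ← Category.assoc, hpi, Category.id_comp]
  have hinj : ∀ n, T.part n ≫ inj n = inj n := fun n => by
    rw [← hip', Category.assoc, hpi, Category.comp_id]
  have hDD : ∀ n, D n ≫ D (n + 1) = 0 := fun n => by
    rw [← Functor.map_comp, K.d_comp_d, Functor.map_zero]
  let d : M ⟶ M := fun i j => (inj (h i) ≫ D (h i) ≫ pr (h i + 1)) i j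
  have hpart : ∀ n, T.part n ≫ d = inj n ≫ D n ≫ pr (n + 1) := fun n => by
    rw [← hinj, Category.assoc]
    funext i j
    rw [T.part_comp_apply, T.part_comp_apply]
    split_ifs with hi
    · subst hi
      rfl
    · rfl
  have hprd : ∀ n, pr n ≫ d = D n ≫ pr (n + 1) := fun n => by
    rw [← hpr, Category.assoc, hpart, ← Category.assoc, hpi, Category.id_comp]
  have hd : d ≫ d = 0 := by
    funext i j
    have : (T.part (h i) ≫ d ≫ d) i j = 0 := by
      rw [← Category.assoc, hpart, Category.assoc, Category.assoc, hprd, ← Category.assoc (D _),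
        hDD, zero_comp, comp_zero]
      rfl
    rw [T.part_comp_apply] at this
    exact (if_pos (c := h i = h i) rfl).symm.trans this
  have hdeg : HasDeg h h 1 d := fun i j hij => by
    change (inj (h i) ≫ D (h i) ≫ pr (h i + 1)) i j = 0
    rw [← hpr, ← Category.assoc, ← Category.assoc, T.comp_part_apply]
    exact if_neg hij
  exact ⟨d, hd, hdeg, fun i j => rfl, ⟨⟨pr, inj, hpi, hip, fun n => by
    change _ = pr n ≫ d ≫ inj (n + 1)
    rw [← Category.assoc, hprd, Category.assoc, hpi, Category.comp_id]⟩⟩⟩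

end

variable {S : Type} [CommRing S]

theorem sum_toLin_apply {M N : GrBimod S} {ι : Type} (s : Finset ι) (f : ι → (M ⟶ N)) (x : M) :
    (∑ i ∈ s, f i).toLin x = ∑ i ∈ s, (f i).toLin x :=
  map_sum (AddMonoidHom.mk' (fun g : M ⟶ N => g.toLin x) fun _ _ => rfl) f s

theorem stateIdeal_eq (v : Fin 14 → Bool) :
    stateIdeal wordL3 S v = cycIdeal S (next wordL3 v * hat 1) := by
  rw [hat_one, mul_one]
  refine le_antisymm (Ideal.span_le.2 ?_) (Ideal.span_le.2 ?_)
  · rintro _ (⟨e, rfl⟩ | ⟨e, f, h, rfl⟩)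
    · exact sq_mem_cycIdeal S _ e
    · exact sub_mem_cycIdeal S (sameCycle_of_arc wordL3 v h)
  · rintro _ (⟨e, rfl⟩ | ⟨e, rfl⟩)
    · exact X_sq_mem wordL3 S v e
    · exact (same_next wordL3 v e).sub_mem S

theorem quot_mk_eq {E : Type} [Finite E] {π : Equiv.Perm E} {e f : E} (h : π.SameCycle e f) :
    Quot.mk (fun x y => π x = y) e = Quot.mk _ f := by
  obtain ⟨k, rfl⟩ := h.exists_nat_pow_eq
  clear h
  induction k with
  | zero => rfl
  | succ k ih => exact ih.trans (Quot.sound (by rw [pow_succ', Equiv.Perm.mul_apply]))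

theorem oneDegree_eq (v : Fin 14 → Bool) : oneDegree wordL3 v = (ob 1 v 0).2 := by
  have : Nat.card (Circles wordL3 v) = cycles (next wordL3 v * hat 1) := by
    rw [hat_one, mul_one]
    refine Nat.card_congr ⟨Quot.lift (Quot.mk _) fun e f h => ?_,
      Quot.lift (Quot.mk _) fun e f h => ?_, ?_, ?_⟩
    · exact quot_mk_eq (sameCycle_of_arc wordL3 v h)
    · subst h
      exact Quot.eqvGen_sound (same_next wordL3 v e)
    · rintro ⟨e⟩
      rfl
    · rintro ⟨e⟩
      rfl
  rw [oneDegree, ob, this, add_zero]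
  rfl

/-- The cochain with given representatives. -/
def chainOf (n : ℤ) (p : (Fin 14 → Bool) → MvPolynomial E4 S) : (khL3 S).X n :=
  (fun v => cls wordL3 v.1 (p v.1) : Chain wordL3 S n)

theorem exists_chainOf {n : ℤ} (x : (khL3 S).X n) : ∃ p, chainOf n p = x := by
  obtain ⟨p, hp⟩ := exists_rep' wordL3 (k := n) x
  exact ⟨p, funext fun v => (hp v).symm⟩

theorem chainOf_add (n : ℤ) (p p' : (Fin 14 → Bool) → MvPolynomial E4 S) :
    chainOf n (p + p') = chainOf n p + chainOf n p' := funext fun v => map_add (cls wordL3 v.1) _ _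

theorem chainOf_eq_iff {n : ℤ} {p p' : (Fin 14 → Bool) → MvPolynomial E4 S} :
    chainOf n p = chainOf n p' ↔
      ∀ v, (height v : ℤ) = n → p v - p' v ∈ cycIdeal S (next wordL3 v * hat 1) := by
  simp_rw [← stateIdeal_eq, ← Ideal.Quotient.eq]
  exact ⟨fun h v hv => congrFun h ⟨v, hv⟩, fun h => funext fun v => h v.1 v.2⟩

theorem XL_smul_chainOf (n : ℤ) (p : (Fin 14 → Bool) → MvPolynomial E4 S) :
    XL S • chainOf n p = chainOf n fun v => MvPolynomial.X base.1 * p v := by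
  refine funext fun v => ?_
  change bimodAct wordL3 S (2, 0) (3, 0) n (XL S) v * cls wordL3 v.1 (p v.1) = _
  rw [bimodAct_XL, ← map_mul]
  rfl

theorem XR_smul_chainOf (n : ℤ) (p : (Fin 14 → Bool) → MvPolynomial E4 S) :
    XR S • chainOf n p = chainOf n fun v => MvPolynomial.X base.2 * p v := by
  refine funext fun v => ?_
  change bimodAct wordL3 S (2, 0) (3, 0) n (XR S) v * cls wordL3 v.1 (p v.1) = _
  rw [bimodAct_XR]
  change _ = cls wordL3 v.1 (MvPolynomial.X base.2 * p v.1)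
  rw [map_mul]
  congr 1
  rw [Ideal.Quotient.eq]
  have h1 := (Arc.strand (w := wordL3) (v := v.1) 12 3 (by decide) (by decide)).same
  have h2 := (Arc.strand (w := wordL3) (v := v.1) 13 3 (by decide) (by decide)).same
  exact (h1.trans h2).symm.sub_mem S

theorem algebraMap_smul_chainOf (n : ℤ) (s : S) (p : (Fin 14 → Bool) → MvPolynomial E4 S) :
    algebraMap S (RR S) s • chainOf n p = chainOf n fun v => s • p v := by
  refine funext fun v => ?_
  change bimodAct wordL3 S (2, 0) (3, 0) n (algebraMap S (RR S) s) v * cls wordL3 v.1 (p v.1) = _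
  rw [AlgHom.commutes, Pi.algebraMap_apply, ← Algebra.smul_def]
  rfl

theorem mem_gr_chainOf {n q : ℤ} {x : (khL3 S).X n} : x ∈ ((khL3 S).X n).gr q ↔
    ∃ p, (∀ v : Fin 14 → Bool, (height v : ℤ) = n →
      MvPolynomial.IsWeightedHomogeneous (wt (E := E4)) (p v) (q - (ob 1 v 0).2)) ∧
      x = chainOf n p := by
  simp_rw [← oneDegree_eq]
  constructor
  · intro hx
    obtain ⟨p, hp⟩ := exists_rep wordL3 (k := n) x (fun v p =>
      MvPolynomial.IsWeightedHomogeneous (fun _ : E4 => (-2 : ℤ)) p (q - oneDegree wordL3 v))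
      fun v => (mem_stateGr wordL3).1 ((mem_chainGr wordL3).1 hx v)
    exact ⟨p, fun v hv => (hp ⟨v, hv⟩).1, funext fun v => (hp v).2⟩
  · rintro ⟨p, hp, rfl⟩
    exact (mem_chainGr wordL3).2 fun v => (mem_stateGr wordL3).2 ⟨p v.1, hp v.1 v.2, rfl⟩

theorem d_chainOf (n : ℤ) (p : (Fin 14 → Bool) → MvPolynomial E4 S) :
    ((khL3 S).d n (n + 1)).toLin (chainOf n p) = chainOf (n + 1) (dPoly wordL3 S p) := by
  have : (khL3 S).d n (n + 1) = khD wordL3 S (2, 0) (3, 0) n := CochainComplex.of_d _ _ _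
  rw [this]
  exact funext fun v => dAdd_cls wordL3 (k := n) (fun _ => rfl) v

open Classical in
/-- The projection of the cochains to a vertex of the cube. -/
def cubePr (v : Fin 14 → Bool) (n : ℤ) : (khL3 S).X n ⟶ cycObj S base (ob 1 v 0) :=
  let f : (khL3 S).X n →+ cycObj S base (ob 1 v 0) :=
    if h : (height v : ℤ) = n then
      (Ideal.Quotient.factor (stateIdeal_eq (S := S) v).le).toAddMonoidHom.comp
        (Pi.evalAddMonoidHom (fun v : Vertex 14 n => StateAlg wordL3 S v.1) ⟨v, h⟩) else 0
  have hf : ∀ p, f (chainOf n p) = if (height v : ℤ) = n then elt S base _ (p v) else 0 :=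
    fun p => by
      by_cases h : (height v : ℤ) = n
      · exact (congrArg (fun g : _ →+ _ => g (chainOf n p)) (dif_pos h)).trans (if_pos h).symm
      · exact (congrArg (fun g : _ →+ _ => g (chainOf n p)) (dif_neg h)).trans (if_neg h).symm
  { toLin :=
      { toFun := f
        map_add' := map_add f
        map_smul' := map_rr_smul f
          (fun s m => by
            obtain ⟨p, rfl⟩ := exists_chainOf m
            rw [algebraMap_smul_chainOf, hf, hf, smul_ite, algebraMap_smul_elt, smul_zero])
          (fun m => by
            obtain ⟨p, rfl⟩ := exists_chainOf m
            rw [XL_smul_chainOf, hf, hf, smul_ite, XL_smul_elt, smul_zero])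
          (fun m => by
            obtain ⟨p, rfl⟩ := exists_chainOf m
            rw [XR_smul_chainOf, hf, hf, smul_ite, XR_smul_elt, smul_zero]) }
    map_gr := by
      intro q m hm
      obtain ⟨p, hp, rfl⟩ := mem_gr_chainOf.1 hm
      change f _ ∈ _
      rw [hf]
      split_ifs with h
      · exact mem_gr_iff.2 ⟨_, hp v h, rfl⟩
      · exact zero_mem _ }

open Classical in
theorem cubePr_chainOf (v : Fin 14 → Bool) (n : ℤ) (p : (Fin 14 → Bool) → MvPolynomial E4 S) :
    (cubePr v n).toLin (chainOf n p) = if (height v : ℤ) = n then elt S base _ (p v) else 0 := by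
  by_cases h : (height v : ℤ) = n
  · exact (congrArg (fun g : _ →+ _ => g (chainOf n p)) (dif_pos h)).trans (if_pos h).symm
  · exact (congrArg (fun g : _ →+ _ => g (chainOf n p)) (dif_neg h)).trans (if_neg h).symm

open Classical in
/-- The inclusion of a vertex of the cube into the cochains. -/
def cubeInj (v : Fin 14 → Bool) (n : ℤ) : cycObj S base (ob 1 v 0) ⟶ (khL3 S).X n :=
  let f : cycObj S base (ob 1 v 0) →+ (khL3 S).X n :=
    QuotientAddGroup.lift (cycIdeal S (ob 1 v 0).1).toAddSubgroup
      (AddMonoidHom.mk' (fun p => chainOf n (Pi.single v p)) fun p p' => by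
        rw [Pi.single_add, chainOf_add]) fun p hp => by
      refine (chainOf_eq_iff (p' := 0)).2 fun u _ => ?_
      rw [Pi.zero_apply, sub_zero]
      by_cases h : u = v
      · subst h
        rw [Pi.single_eq_same]
        exact hp
      · rw [Pi.single_eq_of_ne h]
        exact zero_mem _
  have hf : ∀ p, f (elt S base _ p) = chainOf n (Pi.single v p) := fun p => rfl
  { toLin :=
      { toFun := f
        map_add' := map_add f
        map_smul' := map_rr_smul f
          (fun s m => by
            obtain ⟨p, rfl⟩ := elt_surjective m
            rw [algebraMap_smul_elt, hf, hf, algebraMap_smul_chainOf]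
            exact congrArg _ (funext fun u => by simp [Pi.single_apply]))
          (fun m => by
            obtain ⟨p, rfl⟩ := elt_surjective m
            rw [XL_smul_elt, hf, hf, XL_smul_chainOf]
            exact congrArg _ (funext fun u => by simp [Pi.single_apply]))
          (fun m => by
            obtain ⟨p, rfl⟩ := elt_surjective m
            rw [XR_smul_elt, hf, hf, XR_smul_chainOf]
            exact congrArg _ (funext fun u => by simp [Pi.single_apply])) }
    map_gr := by
      intro q m hm
      obtain ⟨p, hp, rfl⟩ := mem_gr_iff.1 hm
      refine mem_gr_chainOf.2 ⟨Pi.single v p, fun u _ => ?_, hf p⟩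
      by_cases h : u = v
      · subst h
        rwa [Pi.single_eq_same]
      · rw [Pi.single_eq_of_ne h]
        exact MvPolynomial.isWeightedHomogeneous_zero _ _ _ }

open Classical in
theorem cubeInj_elt (v : Fin 14 → Bool) (n : ℤ) (p : MvPolynomial E4 S) :
    (cubeInj v n).toLin (elt S base _ p) = chainOf n (Pi.single v p) := rfl

open Classical in
theorem dPoly_single (v v' : Fin 14 → Bool) (p : MvPolynomial E4 S) :
    dPoly wordL3 S (Pi.single v p) v' - cubePoly S 1 v v' * p ∈
      cycIdeal S (next wordL3 v' * hat 1) := by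
  rw [dPoly, cubePoly, Finset.sum_mul, ← Finset.sum_sub_distrib]
  refine sum_mem fun t _ => ?_
  by_cases ht : v' t = true
  swap
  · rw [if_neg ht, if_neg fun h => ht h.1, zero_mul, sub_zero]
    exact zero_mem _
  by_cases hv : v = low v' t
  swap
  · rw [if_pos ht, if_neg fun h => hv h.2, Pi.single_eq_of_ne fun h => hv h.symm, mul_zero,
      smul_zero, zero_mul, sub_zero]
    exact zero_mem _
  subst hv
  rw [if_pos ht, if_pos ⟨ht, rfl⟩, Pi.single_eq_same, zsmul_eq_mul, mul_assoc, ← mul_sub, ← sub_mul]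
  refine Ideal.mul_mem_left _ _ (Ideal.mul_mem_right _ _ ?_)
  rw [← stateIdeal_eq, saddle, hat_one, inv_one, hat_one, mul_one, Equiv.Perm.one_apply,
    Equiv.Perm.one_apply, mult, stepPoly, MvPolynomial.C_0, sub_zero]
  simp only [← sameCircle_iff]
  have hl : low v' t t = false := Function.update_self _ _ _
  have z1 := (Arc.zeroL (w := wordL3) t hl).same
  have z2 := (Arc.zeroR (w := wordL3) t hl).same
  have o1 := ((Arc.oneB (w := wordL3) t ht).same).sub_mem S
  have o2 := ((Arc.oneT (w := wordL3) t ht).same).sub_mem S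
  have key : ∀ e f : E4, (e = botL wordL3 t ∧ f = topR wordL3 t ∨
      e = topL wordL3 t ∧ f = botR wordL3 t) →
      (if SameCircle wordL3 (low v' t) (botL wordL3 t) (botR wordL3 t) then
        MvPolynomial.X (botL wordL3 t) + MvPolynomial.X (topL wordL3 t) else 1) -
      (if SameCircle wordL3 (low v' t) e f then MvPolynomial.X e + MvPolynomial.X f else 1) ∈
        stateIdeal wordL3 S v' := by
    intro e f hef
    have hiff : SameCircle wordL3 (low v' t) e f ↔
        SameCircle wordL3 (low v' t) (botL wordL3 t) (botR wordL3 t) := by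
      rcases hef with ⟨rfl, rfl⟩ | ⟨rfl, rfl⟩
      · exact ⟨fun h => h.trans z2.symm, fun h => h.trans z2⟩
      · exact ⟨fun h => z1.trans h, fun h => z1.symm.trans h⟩
    simp only [hiff]
    split_ifs
    · rcases hef with ⟨rfl, rfl⟩ | ⟨rfl, rfl⟩
      · convert o2 using 1
        ring
      · convert o1 using 1
        ring
    · rw [sub_self]
      exact zero_mem _
  have key' : ∀ e f : E4, (e = botL wordL3 t ∧ f = topR wordL3 t ∨
      e = topL wordL3 t ∧ f = botR wordL3 t) →
      (if SameCircle wordL3 (low v' t) (botL wordL3 t) (botR wordL3 t) then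
        MvPolynomial.X (botL wordL3 t) + MvPolynomial.X (topL wordL3 t) else 1) -
      (if SameCircle wordL3 (low v' t) f e then MvPolynomial.X f + MvPolynomial.X e else 1) ∈
        stateIdeal wordL3 S v' := fun e f hef => by
    have := key e f hef
    rw [add_comm (MvPolynomial.X e)] at this
    simpa only [show SameCircle wordL3 (low v' t) f e ↔ SameCircle wordL3 (low v' t) e f from
      ⟨SameCircle.symm, SameCircle.symm⟩] using this
  rcases inc_out_crossing wordL3 t with ⟨h1, -, h2, -⟩ | ⟨h1, -, h2, -⟩ <;>
    rcases enter_eq t with ⟨h3, h4⟩ | ⟨h3, h4⟩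
  · exact key _ _ (Or.inl ⟨h3.symm.trans h1, h4.symm.trans h2⟩)
  · exact key' _ _ (Or.inl ⟨h3.symm.trans h1, h4.symm.trans h2⟩)
  · exact key _ _ (Or.inr ⟨h3.symm.trans h1, h4.symm.trans h2⟩)
  · exact key' _ _ (Or.inr ⟨h3.symm.trans h1, h4.symm.trans h2⟩)

theorem cubePoly_eq_zero {v v' : Fin 14 → Bool} (h : height v' ≠ height v + 1) :
    cubePoly S 1 v v' = 0 := by
  refine Finset.sum_eq_zero fun t _ => if_neg ?_
  rintro ⟨ht, rfl⟩
  exact h (height_low ht).symm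

theorem rep_cube (v v' : Fin 14 → Bool) :
    Rep (cubeInj v (height v) ≫ (khL3 S).d (height v) (height v + 1) ≫ cubePr v' (height v + 1))
      fun p => cubePoly S 1 v v' * p := by
  classical
  intro p
  change (cubePr v' _).toLin (((khL3 S).d _ _).toLin ((cubeInj v _).toLin (elt S base _ p))) = _
  rw [cubeInj_elt, d_chainOf, cubePr_chainOf]
  split_ifs with h
  · rw [elt_eq_iff]
    exact dPoly_single v v' p
  · rw [cubePoly_eq_zero fun h' => h (by rw [h']; push_cast; rfl)]
    simp only [zero_mul, map_zero]

theorem sum_cubePr_cubeInj {ι : Type} [Fintype ι] {u : ι → Fin 14 → Bool}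
    (hu : Function.Bijective u) (n : ℤ) :
    ∑ i, cubePr (S := S) (u i) n ≫ cubeInj (u i) n = 𝟙 _ := by
  classical
  refine GrBimod.hom_ext (LinearMap.ext fun x => ?_)
  obtain ⟨p, rfl⟩ := exists_chainOf x
  have hi : ∀ i, (cubePr (S := S) (u i) n ≫ cubeInj (u i) n).toLin (chainOf n p) =
      chainOf n (Pi.single (u i) (p (u i))) := by
    intro i
    change (cubeInj (u i) n).toLin ((cubePr (u i) n).toLin (chainOf n p)) =
      chainOf n (Pi.single (u i) (p (u i)))
    rw [cubePr_chainOf]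
    split_ifs with hi
    · rfl
    · rw [map_zero]
      refine (chainOf_eq_iff (p := 0)).2 fun v hv => ?_
      rw [Pi.single_eq_of_ne (by rintro rfl; exact hi hv), Pi.zero_apply, sub_zero]
      exact zero_mem _

  have hs := map_sum (AddMonoidHom.mk' (chainOf (S := S) n) (chainOf_add n))
    (fun i : ι => Pi.single (u i) (p (u i))) Finset.univ
  rw [sum_toLin_apply, Finset.sum_congr rfl fun i _ => hi i]
  refine hs.symm.trans (chainOf_eq_iff.2 fun v _ => ?_)
  obtain ⟨j, rfl⟩ := hu.2 v
  rw [Finset.sum_apply, Finset.sum_eq_single j, Pi.single_eq_same, sub_self]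
  · exact zero_mem _
  · intro i _ hne
    exact Pi.single_eq_of_ne (fun h => hne (hu.1 h.symm)) _
  · exact fun h => absurd (Finset.mem_univ _) h

theorem code_one : code 1 = 228 := by decide +kernel

/-- The complex of the link, before any simplification. -/
theorem exists_stage_khL3 (S : Type) [CommRing S] :
    ∃ (X : Stage S 0) (label : X.Y → Option ℕ), X.Computes label (run 0) 0 ∧
      Nonempty (X.toTw.Realizes (khL3 S)) := by
  classical
  let M : Mat_ (GrBimod S) := cycMat S base (fun i : Unit × Later 0 => ob 1 i.2.1 0)
  let h : Unit × Later 0 → ℤ := fun i => height i.2.1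
  let pr : ∀ n, (Mat_.embedding _).obj ((khL3 S).X n) ⟶ M := fun n _ i => cubePr i.2.1 n
  let inj : ∀ n, M ⟶ (Mat_.embedding _).obj ((khL3 S).X n) := fun n i _ => cubeInj i.2.1 n
  have hpi : ∀ n, pr n ≫ inj n = 𝟙 _ := fun n => by
    funext a b
    obtain rfl : a = b := rfl
    rw [Mat_.comp_apply, Mat_.id_apply_self]
    exact sum_cubePr_cubeInj (u := fun i : Unit × Later 0 => i.2.1)
      ⟨fun i j hij => Prod.ext rfl (Subtype.ext hij),
        fun v => ⟨((), ⟨v, fun _ ht => absurd ht (Nat.not_lt_zero _)⟩), rfl⟩⟩ n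
  have hip : ∀ n, inj n ≫ pr n = fun i j => if h i = n then 𝟙 M i j else 0 := fun n => by
    funext i j
    rw [embedding_comp_apply]
    refine cycObj_hom_ext fun p => ?_
    change (cubePr j.2.1 n).toLin ((cubeInj i.2.1 n).toLin (elt S base _ p)) = _
    rw [cubeInj_elt, cubePr_chainOf]
    by_cases hij : i = j
    · subst hij
      rw [Mat_.id_apply_self, Pi.single_eq_same]
      change _ = GrBimod.Hom.toLin (if (height i.2.1 : ℤ) = n then _ else _) _
      split_ifs <;> rfl
    · rw [Mat_.id_apply_of_ne _ _ _ hij, Pi.single_eq_of_ne fun h => hij (Prod.ext rfl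
        (Subtype.ext h.symm)), map_zero]
      simp only [ite_self]
      rfl
  obtain ⟨d, hd, hdeg, hdd, hr⟩ := Tw.exists_realizes (khL3 S) pr inj hpi hip
  have hrep : ∀ i j, Rep (d i j) fun p => cubePoly S 1 i.2.1 j.2.1 * p := fun i j => by
    have : d i j = cubeInj i.2.1 (height i.2.1) ≫ (khL3 S).d (height i.2.1) (height i.2.1 + 1) ≫
        cubePr j.2.1 (height i.2.1 + 1) := by
      rw [hdd, embedding_comp_apply]
      exact congrArg (cubeInj i.2.1 (height i.2.1) ≫ ·) (embedding_comp_apply _ _ _ _)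
    exact this ▸ rep_cube _ _
  have hdeg' : HasDeg (fun i : Unit × Later 0 => ((0 : ℕ) : ℤ) + height i.2.1)
      (fun i : Unit × Later 0 => ((0 : ℕ) : ℤ) + height i.2.1) 1 d := by
    simp only [Nat.cast_zero, zero_add]
    exact hdeg
  refine ⟨⟨Unit, fun _ => 1, fun _ => 0, fun _ => 0, d, hd, hdeg'⟩, fun _ => some 0,
    ⟨?_, ?_, fun _ _ _ _ _ => rfl, ?_, ?_⟩, ?_⟩
  · intro i j _
    refine (hrep i j).congr fun p => ?_
    rw [if_pos rfl, pow_zero, one_mul, sub_self]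
    exact zero_mem _
  · rintro y _ ⟨⟩
    refine ⟨_, rfl, code_one.symm, rfl, rfl, fun y' n' v _ => ?_⟩
    have : d (y, v) (y', v) = 0 := hdeg _ _ fun h => by
      change (height v.1 : ℤ) = height v.1 + 1 at h
      omega
    refine Eq.mpr (congrArg (fun f => Rep f _) this) (Rep.zero.congr fun p => ?_)
    rw [morPoly]
    change 0 - 0 * _ * p ∈ _
    rw [zero_mul, zero_mul, sub_self]
    exact zero_mem _
  · rintro y ⟨⟩
  · intro r hr
    obtain rfl := List.mem_singleton.1 hr
    exact ⟨(), rfl, rfl, code_one⟩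
  · obtain ⟨r⟩ := hr
    refine ⟨⟨r.pr, r.inj, r.pr_inj, fun n => (r.inj_pr n).trans ?_, r.map_d⟩⟩
    funext i j
    simp only [Tw.part, Stage.toTw, Nat.cast_zero, zero_add]
    rfl

end RealizeCube

section RealizeSum

universe u

variable {C : Type u} [Category.{0} C] [Preadditive C]

open Classical in
/-- The projection to the summands with a given property in a given degree. -/
def Tw.partOn (M : Tw C) (s : M.obj.ι → Prop) (n : ℤ) : M.obj ⟶ M.obj := fun i j =>
  if s i ∧ M.h i = n then 𝟙 M.obj i j else 0

open Classical in
theorem Tw.partOn_comp_apply (M : Tw C) (s : M.obj.ι → Prop) (n : ℤ) {N : Mat_ C} (f : M.obj ⟶ N)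
    (i j) : (M.partOn s n ≫ f) i j = if s i ∧ M.h i = n then f i j else 0 := by
  rw [Mat_.comp_apply]
  split_ifs with h
  · conv_rhs => rw [← Category.id_comp f, Mat_.comp_apply]
    simp only [partOn, if_pos h]
  · exact Finset.sum_eq_zero fun m _ => by simp only [partOn, if_neg h, zero_comp]

open Classical in
theorem Tw.comp_partOn_apply (M : Tw C) (s : M.obj.ι → Prop) (n : ℤ) {N : Mat_ C} (f : N ⟶ M.obj)
    (i j) : (f ≫ M.partOn s n) i j = if s j ∧ M.h j = n then f i j else 0 := by
  have hp : ∀ m, M.partOn s n m j = if s j ∧ M.h j = n then 𝟙 M.obj m j else 0 := fun m => by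
    by_cases h : m = j
    · subst h; rfl
    · simp [partOn, Mat_.id_apply_of_ne _ _ _ h]
  rw [Mat_.comp_apply]
  split_ifs with h
  · conv_rhs => rw [← Category.comp_id f, Mat_.comp_apply]
    simp only [hp, if_pos h]
  · exact Finset.sum_eq_zero fun m _ => by rw [hp, if_neg h, comp_zero]

/-- The summands with a given property make up a given complex. -/
structure Tw.RealizesOn (M : Tw C) (s : M.obj.ι → Prop) (K : CochainComplex C ℤ) where
  pr : ∀ n, (Mat_.embedding C).obj (K.X n) ⟶ M.obj
  inj : ∀ n, M.obj ⟶ (Mat_.embedding C).obj (K.X n)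
  pr_inj : ∀ n, pr n ≫ inj n = 𝟙 _
  inj_pr : ∀ n, inj n ≫ pr n = M.partOn s n
  map_d : ∀ n, (Mat_.embedding C).map (K.d n (n + 1)) = pr n ≫ M.d ≫ inj (n + 1)

variable {M : Tw C} {s t : M.obj.ι → Prop} {K L : CochainComplex C ℤ}

theorem Tw.RealizesOn.pr_comp_inj (r : M.RealizesOn s K) (r' : M.RealizesOn t L)
    {f : M.obj ⟶ M.obj} (h : ∀ i j, s i → t j → f i j = 0) (n m : ℤ) :
    r.pr n ≫ f ≫ r'.inj m = 0 := by
  have h1 : M.partOn s n ≫ f ≫ M.partOn t m = 0 := by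
    funext i j
    rw [M.partOn_comp_apply, M.comp_partOn_apply]
    split_ifs with h1 h2
    · exact h i j h1.1 h2.1
    · rfl
    · rfl
  calc r.pr n ≫ f ≫ r'.inj m
      = (r.pr n ≫ r.inj n) ≫ r.pr n ≫ f ≫ r'.inj m ≫ r'.pr m ≫ r'.inj m := by
        rw [r.pr_inj, r'.pr_inj, Category.id_comp, Category.comp_id]
    _ = r.pr n ≫ ((r.inj n ≫ r.pr n) ≫ f ≫ r'.inj m ≫ r'.pr m) ≫ r'.inj m := by
        simp only [Category.assoc]
    _ = 0 := by rw [r.inj_pr, r'.inj_pr, h1, zero_comp, comp_zero]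

/-- A complex that splits into two parts is a direct sum. -/
theorem Tw.RealizesOn.biprod [HasBinaryBiproducts C] (r : M.RealizesOn s K)
    (r' : M.RealizesOn (fun i => ¬ s i) L) (h : ∀ i j, s i → ¬ s j → M.d i j = 0)
    (h' : ∀ i j, ¬ s i → s j → M.d i j = 0) : Nonempty (M.Realizes (K ⊞ L)) := by
  classical
  let E := Mat_.embedding C
  have hid : ∀ i j, i ≠ j → 𝟙 M.obj i j = 0 := fun i j hij => Mat_.id_apply_of_ne _ _ _ hij
  have z1 : ∀ n, r.pr n ≫ r'.inj n = 0 := fun n => by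
    simpa using r.pr_comp_inj r' (f := 𝟙 _) (fun i j hi hj => hid i j fun e => hj (e ▸ hi)) n n
  have z2 : ∀ n, r'.pr n ≫ r.inj n = 0 := fun n => by
    simpa using r'.pr_comp_inj r (f := 𝟙 _) (fun i j hi hj => hid i j fun e => hi (e ▸ hj)) n n
  have z3 : ∀ n, r.pr n ≫ M.d ≫ r'.inj (n + 1) = 0 := fun n => r.pr_comp_inj r' h n _
  have z4 : ∀ n, r'.pr n ≫ M.d ≫ r.inj (n + 1) = 0 := fun n => r'.pr_comp_inj r h' n _
  let fst := fun n => E.map ((biprod.fst : K ⊞ L ⟶ K).f n)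
  let snd := fun n => E.map ((biprod.snd : K ⊞ L ⟶ L).f n)
  let inl := fun n => E.map ((biprod.inl : K ⟶ K ⊞ L).f n)
  let inr := fun n => E.map ((biprod.inr : L ⟶ K ⊞ L).f n)
  have tot : ∀ n, fst n ≫ inl n + snd n ≫ inr n = 𝟙 _ := fun n => by
    simp only [fst, snd, inl, inr, ← Functor.map_comp, ← Functor.map_add,
      ← HomologicalComplex.comp_f, ← HomologicalComplex.add_f_apply, biprod.total]
    exact E.map_id _
  have b1 : ∀ n, inl n ≫ fst n = 𝟙 _ := fun n => by
    simp only [fst, inl, ← Functor.map_comp, ← HomologicalComplex.comp_f, biprod.inl_fst]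
    exact E.map_id _
  have b2 : ∀ n, inr n ≫ snd n = 𝟙 _ := fun n => by
    simp only [snd, inr, ← Functor.map_comp, ← HomologicalComplex.comp_f, biprod.inr_snd]
    exact E.map_id _
  have b3 : ∀ n, inl n ≫ snd n = 0 := fun n => by
    simp only [snd, inl, ← Functor.map_comp, ← HomologicalComplex.comp_f, biprod.inl_snd]
    exact E.map_zero _ _
  have b4 : ∀ n, inr n ≫ fst n = 0 := fun n => by
    simp only [fst, inr, ← Functor.map_comp, ← HomologicalComplex.comp_f, biprod.inr_fst]
    exact E.map_zero _ _
  refine ⟨⟨fun n => fst n ≫ r.pr n + snd n ≫ r'.pr n, fun n => r.inj n ≫ inl n + r'.inj n ≫ inr n,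
    fun n => ?_, fun n => ?_, fun n => ?_⟩⟩
  · rw [Preadditive.add_comp, Preadditive.comp_add, Preadditive.comp_add, Category.assoc,
      Category.assoc, Category.assoc, Category.assoc, ← Category.assoc (r.pr n),
      ← Category.assoc (r.pr n), ← Category.assoc (r'.pr n), ← Category.assoc (r'.pr n), r.pr_inj,
      r'.pr_inj, z1, z2]
    simpa using tot n
  · rw [Preadditive.add_comp, Preadditive.comp_add, Preadditive.comp_add, Category.assoc,
      Category.assoc, Category.assoc, Category.assoc, ← Category.assoc (inl n),
      ← Category.assoc (inl n), ← Category.assoc (inr n), ← Category.assoc (inr n), b1, b2, b3, b4,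
      Category.id_comp, Category.id_comp, zero_comp, zero_comp, comp_zero, comp_zero, add_zero,
      zero_add, r.inj_pr, r'.inj_pr]
    funext i j
    rw [Mat_.add_apply]
    simp only [partOn, part]
    by_cases hs : s i <;> simp [hs]
  · have e1 : fst n ≫ E.map (K.d n (n + 1)) ≫ inl (n + 1) =
        fst n ≫ inl n ≫ E.map ((K ⊞ L).d n (n + 1)) := by
      simp only [inl, ← Functor.map_comp, HomologicalComplex.Hom.comm]
    have e2 : snd n ≫ E.map (L.d n (n + 1)) ≫ inr (n + 1) =
        snd n ≫ inr n ≫ E.map ((K ⊞ L).d n (n + 1)) := by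
      simp only [inr, ← Functor.map_comp, HomologicalComplex.Hom.comm]
    have e3 : E.map ((K ⊞ L).d n (n + 1)) = fst n ≫ E.map (K.d n (n + 1)) ≫ inl (n + 1) +
        snd n ≫ E.map (L.d n (n + 1)) ≫ inr (n + 1) := by
      rw [e1, e2, ← Category.assoc, ← Category.assoc, ← Preadditive.add_comp, tot,
        Category.id_comp]
    refine e3.trans ?_
    rw [r.map_d, r'.map_d, Preadditive.add_comp, Preadditive.comp_add, Preadditive.comp_add,
      Preadditive.comp_add]
    have w1 : fst n ≫ r.pr n ≫ M.d ≫ r'.inj (n + 1) ≫ inr (n + 1) = 0 := by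
      have := congrArg (fun x => fst n ≫ x ≫ inr (n + 1)) (z3 n)
      simpa using this
    have w2 : snd n ≫ r'.pr n ≫ M.d ≫ r.inj (n + 1) ≫ inl (n + 1) = 0 := by
      have := congrArg (fun x => snd n ≫ x ≫ inl (n + 1)) (z4 n)
      simpa using this
    simp only [Category.assoc, w1, w2, add_zero, zero_add]

section Entries

variable {X Y : C} {N : Mat_ C} {p : ∀ i, X ⟶ N.X i} {q : ∀ i, N.X i ⟶ Y}

/-- A matrix with one row. -/
def matRow (p : ∀ i, X ⟶ N.X i) : (Mat_.embedding C).obj X ⟶ N := fun _ i => p i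

/-- A matrix with one column. -/
def matCol (q : ∀ i, N.X i ⟶ Y) : N ⟶ (Mat_.embedding C).obj Y := fun i _ => q i

theorem matRow_matCol {f : X ⟶ Y} (h : ∑ i, p i ≫ q i = f) :
    matRow p ≫ matCol q = (Mat_.embedding C).map f := by
  funext a b
  rw [Mat_.comp_apply]
  exact h

theorem matCol_matRow_apply {q : ∀ i, N.X i ⟶ X} (i j : N.ι) :
    (matCol q ≫ matRow p) i j = q i ≫ p j :=
  embedding_comp_apply _ _ _ _

theorem comp_matCol (d : N ⟶ N) : d ≫ matCol q = matCol fun i => ∑ j, d i j ≫ q j := by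
  funext i b
  rw [Mat_.comp_apply]
  rfl

end Entries

open Classical in
/-- The complex of the direct sums of the summands with a given property. -/
theorem Tw.exists_realizesOn [HasFiniteBiproducts C] (M : Tw C) (s : M.obj.ι → Prop)
    (h : ∀ i j, s i → ¬ s j → M.d i j = 0) : ∃ F : CochainComplex C ℤ,
      Nonempty (M.RealizesOn s F) ∧
        ∀ n, F.X n = ⨁ fun i : {i // s i ∧ M.h i = n} => M.obj.X i.1 := by
  let f : ∀ n, {i // s i ∧ M.h i = n} → C := fun n i => M.obj.X i.1
  let p : ∀ n i, ⨁ f n ⟶ M.obj.X i := fun n i =>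
    if hi : s i ∧ M.h i = n then biproduct.π (f n) ⟨i, hi⟩ else 0
  let q : ∀ n i, M.obj.X i ⟶ ⨁ f n := fun n i =>
    if hi : s i ∧ M.h i = n then biproduct.ι (f n) ⟨i, hi⟩ else 0
  have hpq : ∀ n, ∑ i, p n i ≫ q n i = 𝟙 _ := fun n => by
    refine biproduct.hom_ext _ _ fun j => ?_
    rw [Preadditive.sum_comp, Finset.sum_eq_single j.1]
    · simp only [p, q, dif_pos j.2, Category.assoc]
      rw [biproduct.ι_π_self, Category.id_comp]
      exact Category.comp_id _
    · intro i _ hij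
      by_cases hi : s i ∧ M.h i = n
      · simp only [p, q, dif_pos hi, Category.assoc]
        rw [biproduct.ι_π_ne _ fun e => hij (congrArg Subtype.val e), comp_zero]
      · simp only [p, dif_neg hi, zero_comp]
    · exact fun hj => absurd (Finset.mem_univ _) hj
  have hqp : ∀ n i j, q n i ≫ p n j = M.partOn s n i j := fun n i j => by
    by_cases hi : s i ∧ M.h i = n
    · simp only [q, partOn, dif_pos hi, if_pos hi]
      by_cases hij : i = j
      · subst hij
        simp only [p, dif_pos hi]
        rw [Mat_.id_apply_self]
        exact biproduct.ι_π_self (f n) ⟨i, hi⟩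
      · rw [Mat_.id_apply_of_ne _ _ _ hij]
        by_cases hj : s j ∧ M.h j = n
        · simp only [p, dif_pos hj]
          exact biproduct.ι_π_ne (f n) (j := ⟨i, hi⟩) (j' := ⟨j, hj⟩)
            fun e => hij (congrArg Subtype.val e)
        · simp only [p, dif_neg hj, comp_zero]
    · simp only [q, partOn, dif_neg hi, if_neg hi, zero_comp]
  let pr : ∀ n, (Mat_.embedding C).obj (⨁ f n) ⟶ M.obj := fun n => matRow (p n)
  let inj : ∀ n, M.obj ⟶ (Mat_.embedding C).obj (⨁ f n) := fun n => matCol (q n)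
  have hpi : ∀ n, pr n ≫ inj n = 𝟙 _ := fun n =>
    (matRow_matCol (hpq n)).trans ((Mat_.embedding C).map_id _)
  have hip : ∀ n, inj n ≫ pr n = M.partOn s n := fun n => by
    funext i j
    exact (matCol_matRow_apply i j).trans (hqp n i j)
  have hd : ∀ n, pr n ≫ M.d ≫ M.partOn s (n + 1) = pr n ≫ M.d := fun n => by
    have : M.partOn s n ≫ M.d ≫ M.partOn s (n + 1) = M.partOn s n ≫ M.d := by
      funext i j
      rw [M.partOn_comp_apply, M.partOn_comp_apply, M.comp_partOn_apply]
      split_ifs with hi hj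
      · rfl
      · by_cases hs : s j
        · exact (M.deg i j fun e => hj ⟨hs, e.trans (by rw [hi.2])⟩).symm
        · exact (h i j hi.1 hs).symm
      · rfl
    rw [← hip, Category.assoc, Category.assoc] at this
    have := congrArg (pr n ≫ ·) this
    simp only [← Category.assoc (pr n) (inj n), hpi, Category.id_comp] at this
    exact this
  let D : ∀ n, ⨁ f n ⟶ ⨁ f (n + 1) := fun n =>
    (Mat_.embedding C).preimage (pr n ≫ M.d ≫ inj (n + 1))
  let F := CochainComplex.of (fun n => ⨁ f n) D fun n => by
      apply (Mat_.embedding C).map_injective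
      rw [Functor.map_comp, Functor.map_preimage, Functor.map_preimage, Functor.map_zero]
      simp only [Category.assoc]
      rw [← Category.assoc (inj (n + 1)), hip, ← Category.assoc M.d, ← Category.assoc (pr n), hd,
        Category.assoc, ← Category.assoc M.d, M.d_sq, zero_comp, comp_zero]
  refine ⟨F, ⟨⟨pr, inj, hpi, hip, fun n => ?_⟩⟩, fun n => rfl⟩
  have e : F.d n (n + 1) = D n := CochainComplex.of_d _ D n
  rw [e]
  exact Functor.map_preimage _ _

/-- A complex with two summands. -/
theorem Tw.exists_realizesOn_pair {i₀ i₁ : M.obj.ι} (hs : ∀ i, s i ↔ i = i₀ ∨ i = i₁) {a : ℤ}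
    (h₀ : M.h i₀ = a) (h₁ : M.h i₁ = a + 1) (φ₀ : K.X a ≅ M.obj.X i₀)
    (φ₁ : K.X (a + 1) ≅ M.obj.X i₁) (hK : ∀ n, n ≠ a → n ≠ a + 1 → IsZero (K.X n))
    (hd : K.d a (a + 1) ≫ φ₁.hom = φ₀.hom ≫ M.d i₀ i₁) : Nonempty (M.RealizesOn s K) := by
  classical
  have single : ∀ (n : ℤ) (i : M.obj.ι) (φ : K.X n ≅ M.obj.X i),
      (∀ j, s j ∧ M.h j = n ↔ j = i) → ∃ (p : ∀ j, K.X n ⟶ M.obj.X j) (q : ∀ j, M.obj.X j ⟶ K.X n),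
        ∑ j, p j ≫ q j = 𝟙 _ ∧ (∀ j k, q j ≫ p k = M.partOn s n j k) ∧ p i = φ.hom ∧ q i = φ.inv ∧
          ∀ j, j ≠ i → p j = 0 ∧ q j = 0 := by
    intro n i φ hi
    let p := Function.update (0 : ∀ j, K.X n ⟶ M.obj.X j) i φ.hom
    let q := Function.update (0 : ∀ j, M.obj.X j ⟶ K.X n) i φ.inv
    have hp : p i = φ.hom := Function.update_self _ _ _
    have hq : q i = φ.inv := Function.update_self _ _ _
    have hp' : ∀ j, j ≠ i → p j = 0 := fun j hj => Function.update_of_ne hj _ _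
    have hq' : ∀ j, j ≠ i → q j = 0 := fun j hj => Function.update_of_ne hj _ _
    refine ⟨p, q, ?_, fun j k => ?_, hp, hq, fun j hj => ⟨hp' j hj, hq' j hj⟩⟩
    · rw [Finset.sum_eq_single i (fun j _ hj => by rw [hp' j hj, zero_comp])
        fun h => absurd (Finset.mem_univ _) h, hp, hq, φ.hom_inv_id]
    · simp only [partOn, hi]
      by_cases hj : j = i
      · subst hj
        rw [if_pos rfl, hq]
        by_cases hk : k = j
        · subst hk
          rw [hp, Mat_.id_apply_self, φ.inv_hom_id]
        · rw [hp' k hk, comp_zero, Mat_.id_apply_of_ne _ _ _ (Ne.symm hk)]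
      · rw [if_neg hj, hq' j hj, zero_comp]
  have c₀ : ∀ j, s j ∧ M.h j = a ↔ j = i₀ := fun j => by
    rw [hs]
    exact ⟨fun h => h.1.resolve_right (by rintro rfl; omega), by rintro rfl; exact ⟨.inl rfl, h₀⟩⟩
  have c₁ : ∀ j, s j ∧ M.h j = a + 1 ↔ j = i₁ := fun j => by
    rw [hs]
    exact ⟨fun h => h.1.resolve_left (by rintro rfl; omega), by rintro rfl; exact ⟨.inr rfl, h₁⟩⟩
  have key : ∀ n, ∃ (p : ∀ j, K.X n ⟶ M.obj.X j) (q : ∀ j, M.obj.X j ⟶ K.X n),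
      ∑ j, p j ≫ q j = 𝟙 _ ∧ (∀ j k, q j ≫ p k = M.partOn s n j k) ∧
      (∀ e : n = a, p i₀ = (K.XIsoOfEq e).hom ≫ φ₀.hom ∧ ∀ j, j ≠ i₀ → p j = 0) ∧
      ∀ e : n = a + 1, q i₁ = φ₁.inv ≫ (K.XIsoOfEq e).inv ∧ ∀ j, j ≠ i₁ → q j = 0 := by
    intro n
    by_cases e : n = a
    · subst e
      obtain ⟨p, q, e1, e2, e3, -, e5⟩ := single n i₀ φ₀ c₀
      exact ⟨p, q, e1, e2, fun _ => ⟨by simp [e3, HomologicalComplex.XIsoOfEq_rfl],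
        fun j hj => (e5 j hj).1⟩, fun e => by omega⟩
    by_cases e' : n = a + 1
    · subst e'
      obtain ⟨p, q, e1, e2, -, e4, e5⟩ := single _ i₁ φ₁ c₁
      exact ⟨p, q, e1, e2, fun h => absurd h e, fun _ =>
        ⟨by simp [e4, HomologicalComplex.XIsoOfEq_rfl], fun j hj => (e5 j hj).2⟩⟩
    · refine ⟨0, 0, (hK n e e').eq_of_src _ _, fun j k => ?_, fun h => absurd h e,
        fun h => absurd h e'⟩
      refine zero_comp.trans (if_neg ?_).symm
      rintro ⟨hj, hj'⟩
      rcases (hs j).1 hj with rfl | rfl <;> omega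
  choose p q h1 h2 h3 h4 using key
  refine ⟨⟨fun n => matRow (p n), fun n => matCol (q n),
    fun n => (matRow_matCol (h1 n)).trans ((Mat_.embedding C).map_id _),
    fun n => funext fun i => funext fun j => (matCol_matRow_apply i j).trans (h2 n i j),
    fun n => ?_⟩⟩
  rw [comp_matCol]
  refine (matRow_matCol ?_).symm
  by_cases e : n = a
  · subst e
    rw [Finset.sum_eq_single i₀, Finset.sum_eq_single i₁, (h3 n rfl).1, (h4 (n + 1) rfl).1]
    · simp only [HomologicalComplex.XIsoOfEq_rfl, Iso.refl_hom, Iso.refl_inv, Category.id_comp,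
        Category.comp_id]
      rw [← Category.assoc, ← hd, Category.assoc, φ₁.hom_inv_id, Category.comp_id]
    · exact fun j _ hj => by rw [(h4 (n + 1) rfl).2 j hj, comp_zero]
    · exact fun h => absurd (Finset.mem_univ _) h
    · exact fun j _ hj => by rw [(h3 n rfl).2 j hj, zero_comp]
    · exact fun h => absurd (Finset.mem_univ _) h
  · by_cases e' : n = a + 1
    · exact (hK (n + 1) (by omega) (by omega)).eq_of_tgt _ _
    · exact (hK n e e').eq_of_src _ _

end RealizeSum

section FreeBimodule

variable {E : Type} [Fintype E] [DecidableEq E] {S : Type} [CommRing S] {e : E × E}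
  {A : Equiv.Perm E × ℤ}

theorem finite_cycObj (e : E × E) (A : Equiv.Perm E × ℤ) :
    Module.Finite (RR S) (cycObj S e A) := by
  have : Algebra.IsIntegral S (CycAlg S A.1) := ⟨fun x => by
    obtain ⟨p, rfl⟩ := Ideal.Quotient.mk_surjective x
    induction p using MvPolynomial.induction_on with
    | C s => exact isIntegral_algebraMap
    | add p q hp hq => rw [map_add]; exact hp.add hq
    | mul_X p i hp =>
      rw [map_mul]
      refine hp.mul ⟨Polynomial.X ^ 2, Polynomial.monic_X_pow 2, ?_⟩
      rw [Polynomial.eval₂_X_pow, ← map_pow, Ideal.Quotient.eq_zero_iff_mem]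
      exact sq_mem_cycIdeal S _ i⟩
  have hfin : Module.Finite S (CycAlg S A.1) := Algebra.IsIntegral.finite
  let _ : Module S (cycObj S e A) := inferInstanceAs (Module S (CycAlg S A.1))
  have : IsScalarTower S (RR S) (cycObj S e A) := ⟨fun s a (x : CycAlg S A.1) => by
    change cycAct S e A.1 (s • a) * x = s • (cycAct S e A.1 a * x)
    rw [map_smul, smul_mul_assoc]⟩
  have : Module.Finite S (cycObj S e A) := hfin
  exact Module.Finite.of_restrictScalars_finite S _ _

open Classical in
/-- If there are just two cycles, which contain the basepoints, then the bimodule is free. -/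
theorem exists_free_iso (hsep : ¬ A.1.SameCycle e.1 e.2)
    (hcov : ∀ x, A.1.SameCycle e.1 x ∨ A.1.SameCycle e.2 x) {k l : ℤ} (hA : A.2 = 2 + k + l) :
    ∃ φ : (GrBimod.qShift S k).obj ((GrBimod.qShift S l).obj (GrBimod.free S)) ≅ cycObj S e A,
      ∀ a : RR S, φ.hom.toLin a = a • elt S e A 1 := by
  let ρ : E → RR S := fun x => if A.1.SameCycle e.1 x then XL S else XR S
  have hρ : ∀ x p, ρ x • elt S e A p = elt S e A (MvPolynomial.X x * p) := fun x p => by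
    simp only [ρ]
    split_ifs with h
    · rw [XL_smul_elt, elt_eq_iff, ← sub_mul]
      exact Ideal.mul_mem_right _ _ (sub_mem_cycIdeal S h)
    · rw [XR_smul_elt, elt_eq_iff, ← sub_mul]
      exact Ideal.mul_mem_right _ _ (sub_mem_cycIdeal S ((hcov x).resolve_left h))
  let f : MvPolynomial E S →ₐ[S] RR S := MvPolynomial.aeval ρ
  have hfX : ∀ x, f (MvPolynomial.X x) = ρ x := fun x => MvPolynomial.aeval_X _ _
  have hI : cycIdeal S A.1 ≤ RingHom.ker f := by
    refine Ideal.span_le.2 ?_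
    rintro _ (⟨x, rfl⟩ | ⟨x, rfl⟩)
    · change f _ = 0
      rw [map_pow, hfX]
      simp only [ρ]
      split_ifs
      · exact XL_sq S
      · exact XR_sq S
    · change f _ = 0
      rw [map_sub, hfX, hfX]
      simp only [ρ, Equiv.Perm.sameCycle_apply_right, sub_self]
  have hpow : ∀ x (n : ℕ) (q : ℤ) (y : RR S), y ∈ GrBimod.freeGr S q →
      ρ x ^ n * y ∈ GrBimod.freeGr S (q - 2 * n) := by
    intro x n q y hy
    induction n with
    | zero => simpa using hy
    | succ n ih =>
      have e1 : q - 2 * ((n + 1 : ℕ) : ℤ) = q - 2 * n - 2 := by push_cast; ring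
      have e2 : ρ x ^ (n + 1) * y = ρ x * (ρ x ^ n * y) := by ring
      rw [e1, e2]
      generalize ρ x ^ n * y = z at ih
      simp only [ρ]
      split_ifs
      · exact (GrBimod.free S).XL_mem _ _ ih
      · exact (GrBimod.free S).XR_mem _ _ ih
  have hmon : ∀ d, f (MvPolynomial.monomial d 1) ∈
      GrBimod.freeGr S (2 + Finsupp.weight (wt (E := E)) d) := by
    intro d
    induction d using Finsupp.induction with
    | zero =>
      rw [map_zero, add_zero, MvPolynomial.monomial_zero', MvPolynomial.C_1, map_one]
      exact Submodule.subset_span ⟨0, 0, by norm_num, by simp⟩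
    | single_add x n d _ _ ih =>
      have e1 : MvPolynomial.monomial (Finsupp.single x n + d) (1 : S) =
          MvPolynomial.X x ^ n * MvPolynomial.monomial d 1 := by
        rw [MvPolynomial.X_pow_eq_monomial, MvPolynomial.monomial_mul, one_mul]
      rw [e1, map_mul, map_pow, hfX, map_add]
      convert hpow x n _ _ ih using 2
      rw [Finsupp.weight_single]
      simp only [wt, nsmul_eq_mul]
      ring
  have hdeg : ∀ (m : ℤ) p, MvPolynomial.IsWeightedHomogeneous (wt (E := E)) p m →
      f p ∈ GrBimod.freeGr S (2 + m) := by
    intro m p hp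
    rw [p.as_sum, map_sum]
    refine sum_mem fun d hd => ?_
    have := hp (MvPolynomial.mem_support_iff.1 hd)
    rw [← mul_one (MvPolynomial.coeff d p), ← smul_eq_mul, ← MvPolynomial.smul_monomial, map_smul,
      ← this]
    exact Submodule.smul_mem _ _ (hmon d)
  let G := (GrBimod.qShift S k).obj ((GrBimod.qShift S l).obj (GrBimod.free S))
  let u : cycObj S e A →+ G :=
    QuotientAddGroup.lift (cycIdeal S A.1).toAddSubgroup f.toRingHom.toAddMonoidHom hI
  have hu : ∀ p, u (elt S e A p) = f p := fun _ => rfl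
  let inv : cycObj S e A ⟶ G :=
    { toLin :=
        { toFun := u
          map_add' := map_add u
          map_smul' := map_rr_smul u
            (fun s m => by
              obtain ⟨p, rfl⟩ := elt_surjective m
              rw [algebraMap_smul_elt, hu, hu, map_smul]
              exact Algebra.smul_def (A := RR S) s (f p))
            (fun m => by
              obtain ⟨p, rfl⟩ := elt_surjective m
              rw [XL_smul_elt, hu, hu, map_mul, hfX]
              exact congrArg (· * f p) (if_pos (.refl _ _)))
            (fun m => by
              obtain ⟨p, rfl⟩ := elt_surjective m
              rw [XR_smul_elt, hu, hu, map_mul, hfX]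
              exact congrArg (· * f p) (if_neg hsep)) }
      map_gr := by
        intro q m hm
        obtain ⟨p, hp, rfl⟩ := mem_gr_iff.1 hm
        change f p ∈ GrBimod.freeGr S (q - k - l)
        have := hdeg _ p hp
        rwa [hA, show 2 + (q - (2 + k + l)) = q - k - l by ring] at this }
  let hom : G ⟶ cycObj S e A :=
    { toLin := (LinearMap.toSpanSingleton (RR S) (cycObj S e A) (elt S e A 1) : RR S →ₗ[RR S] _)
      map_gr := by
        intro q (m : RR S) hm
        change m • elt S e A 1 ∈ _
        have hm' : m ∈ GrBimod.freeGr S (q - k - l) := hm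
        refine Submodule.span_induction
          (p := fun m _ => m • elt S e A 1 ∈ (cycObj S e A).gr q) ?_ ?_ ?_ ?_ hm'
        · rintro _ ⟨i, j, hij, rfl⟩
          have hpow : ∀ (r : RR S) x, (∀ p, r • elt S e A p = elt S e A (MvPolynomial.X x * p)) →
              ∀ i p, r ^ i • elt S e A p = elt S e A (MvPolynomial.X x ^ i * p) := by
            intro r x hr i p
            induction i with
            | zero => rw [pow_zero, pow_zero, one_smul, one_mul]
            | succ i ih =>
              have e1 : r ^ (i + 1) = r * r ^ i := pow_succ' r i
              rw [e1, mul_smul, ih, hr, pow_succ', mul_assoc]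
          rw [mul_smul, hpow _ _ XR_smul_elt, hpow _ _ XL_smul_elt]
          refine mem_gr_iff.2 ⟨_, ?_, rfl⟩
          rw [mul_one]
          convert ((MvPolynomial.isWeightedHomogeneous_X S (wt (E := E)) e.1).pow i).mul
            ((MvPolynomial.isWeightedHomogeneous_X S (wt (E := E)) e.2).pow j) using 1
          simp only [wt, nsmul_eq_mul]
          linarith
        · rw [zero_smul]
          exact zero_mem _
        · intro x y _ _ hx hy
          rw [add_smul]
          exact add_mem hx hy
        · intro s x _ hx
          rw [Algebra.smul_def, mul_smul]
          exact (cycObj S e A).scalar_mem s q _ hx }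
  have key : ∀ p, f p • elt S e A 1 = elt S e A p := by
    intro p
    induction p using MvPolynomial.induction_on with
    | C s =>
      rw [show f (MvPolynomial.C s) = algebraMap S (RR S) s from f.commutes s, algebraMap_smul_elt,
        MvPolynomial.smul_eq_C_mul, mul_one]
    | add p q hp hq => rw [map_add, add_smul, hp, hq, map_add]
    | mul_X p x hp => rw [map_mul, mul_comm, mul_smul, hp, hfX, hρ, mul_comm]
  refine ⟨⟨hom, inv, ?_, ?_⟩, fun a => rfl⟩
  · refine GrBimod.hom_ext (LinearMap.ext fun (a : RR S) => ?_)
    change inv.toLin (a • elt S e A 1) = a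
    rw [map_smul]
    change a * f 1 = a
    rw [map_one, mul_one]
  · exact cycObj_hom_ext fun p => key p

instance : HasFiniteBiproducts (GrBimod S) :=
  have : HasFiniteProducts (GrBimod S) := hasFiniteProducts_of_has_binary_and_terminal
  HasFiniteBiproducts.of_hasFiniteProducts

theorem finite_biproduct {J : Type} [Fintype J] {f : J → GrBimod S}
    (h : ∀ j, Module.Finite (RR S) (f j)) : Module.Finite (RR S) (⨁ f : GrBimod S) := by
  classical
  refine Module.Finite.of_surjective (∑ j, (biproduct.ι f j).toLin ∘ₗ LinearMap.proj j :
    (∀ j, f j) →ₗ[RR S] (⨁ f : GrBimod S)) fun x => ⟨fun j => (biproduct.π f j).toLin x, ?_⟩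
  rw [LinearMap.sum_apply]
  have h := sum_toLin_apply Finset.univ (fun j => biproduct.π f j ≫ biproduct.ι f j) x
  rw [biproduct.total] at h
  exact h.symm

end FreeBimodule

section Splitting

variable {S : Type} [CommRing S]

theorem finalOk_spec {st : List Row} (h : finalOk st = true) : ∃ r r' : Row,
    findRow 1576800 st = some r ∧ findRow 1576802 st = some r' ∧ r.code = 27 ∧ r.h = 8 ∧
      r.q = 10 ∧ sumMonos [(4, -3), (8, 1)] (normalForm 27 (entry 1576802 r.ents)) = [] ∧
      r'.code = 27 ∧ r'.h = 9 ∧ r'.q = 12 ∧ ∀ s ∈ st,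
        (s.h ≤ 7 ∧ normalForm 27 (entry 1576800 s.ents) = []) ∨ s.id = 1576800 ∨
          s.id = 1576802 := by
  unfold finalOk at h
  split at h
  · rename_i r r' hr hr'
    simp only [Bool.and_eq_true, beq_iff_eq, List.isEmpty_iff, List.all_eq_true, Bool.or_eq_true,
      decide_eq_true_eq, or_assoc] at h
    obtain ⟨⟨⟨⟨⟨⟨⟨h1, h2⟩, h3⟩, h4⟩, h5⟩, h6⟩, h7⟩, h8⟩ := h
    exact ⟨r, r', hr, hr', h1, h2, h3, h4, h5, h6, h7, h8⟩
  · exact absurd h (by simp)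

theorem cycles_eq_two {E : Type} [Fintype E] [DecidableEq E] {π : Equiv.Perm E} {x y : E}
    (hxy : ¬ π.SameCycle x y) (h : ∀ z, π.SameCycle x z ∨ π.SameCycle y z) : cycles π = 2 := by
  refine Nat.card_eq_two_iff.2 ⟨Quot.mk _ x, Quot.mk _ y, fun he => hxy ?_, ?_⟩
  · refine (Quot.eqvGen_exact he).rec (fun a b hab => ?_) (fun _ => .refl _ _)
      (fun _ _ _ ih => ih.symm) (fun _ _ _ _ _ ih ih' => ih.trans ih')
    exact hab ▸ (Equiv.Perm.sameCycle_apply_right.2 (.refl _ _))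
  · refine Set.eq_univ_of_forall fun c => ?_
    induction c using Quot.ind with | mk z =>
    exact (h z).imp (fun h => (quot_mk_eq h).symm) fun h => (quot_mk_eq h).symm

variable {v : Fin 14 → Bool} {a b : Equiv.Perm (Fin 4)}

theorem glueList_self : ∀ a : Equiv.Perm (Fin 4), glueList (code a) (code a) = [] := by
  decide +kernel

theorem mval_normalForm_mem (hv : ∀ t, v t = false) (hb : closable (code b) = true) (x : Monos) :
    mval S (normalForm (code b) x) - mval S x ∈ cycIdeal S (next wordL3 v * hat b) := by
  have h := mval_mulAdd_mem (S := S) (a := b) hv hb x [(0, 1)]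
  rw [glueList_self, morPoly, gluePoly_self, mul_one, mval_one, mul_one] at h
  exact h

theorem mval_linear : mval S [(4, -3), (8, 1)] =
    MvPolynomial.X (src 3) - 3 * MvPolynomial.X (src 2) := by
  simp only [mval, monosVal, maskVal, Fin.prod_univ_four]
  norm_num [Nat.testBit, Nat.shiftRight_eq_div_pow]
  ring

theorem two_circles (hv : ∀ t, v t = false) (ha : code a = 27) :
    (¬ (next wordL3 v * hat a).SameCycle base.1 base.2) ∧
      ∀ x, (next wordL3 v * hat a).SameCycle base.1 x ∨
        (next wordL3 v * hat a).SameCycle base.2 x := by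
  have h : ∀ x y : E4, (next wordL3 v * hat a).SameCycle x y ↔
      digit (cycleLabels 27) x.1 = digit (cycleLabels 27) y.1 := fun x y => by
    rw [← ha, ← sameCycle_src_iff hv]
    exact ⟨fun h => (sameCycle_src hv a x).symm.trans (h.trans (sameCycle_src hv a y)),
      fun h => (sameCycle_src hv a x).trans (h.trans (sameCycle_src hv a y).symm)⟩
  simp only [h]
  exact ⟨by decide +kernel, fun x => (by decide +kernel : ∀ i : Fin 4,
    digit (cycleLabels 27) (base.1.1 : Fin 4) = digit (cycleLabels 27) i ∨
      digit (cycleLabels 27) (base.2.1 : Fin 4) = digit (cycleLabels 27) i) x.1⟩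

theorem height_closed (hv : ∀ t, v t = false) : height v = 0 := by
  rw [height, Finset.card_eq_zero, Finset.filter_eq_empty_iff]
  intro t _ h
  rw [hv t] at h
  exact absurd h (by decide)

theorem exists_iso_ob (hv : ∀ t, v t = false) (ha : code a = 27) {q : ℕ} {l : ℤ}
    (hq : (q : ℤ) = 11 + l) :
    ∃ φ : (GrBimod.qShift S 25).obj ((GrBimod.qShift S l).obj (GrBimod.free S)) ≅
        cycObj S base (ob a v q), ∀ x : RR S, φ.hom.toLin x = x • elt S base (ob a v q) 1 := by
  obtain ⟨h1, h2⟩ := two_circles hv ha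
  refine exists_free_iso (A := ob a v q) h1 h2 ?_
  simp only [ob]
  rw [cycles_eq_two h1 h2, height_closed hv, hq]
  push_cast
  ring

/-- The shifted complex of `3 X ⊗ 1 - 1 ⊗ X`. -/
abbrev target (S : Type) [CommRing S] : CochainComplex (GrBimod S) ℤ :=
  (((GrBimod.qShift S 25).mapHomologicalComplex (ComplexShape.up ℤ)).obj
    (GrBimod.twoTerm S 3))⟦(-8 : ℤ)⟧

theorem exists_target_iso (S : Type) [CommRing S] :
    ∃ (ψ₀ : (target S).X 8 ≅
        (GrBimod.qShift S 25).obj ((GrBimod.qShift S (-1)).obj (GrBimod.free S)))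
      (ψ₁ : (target S).X (8 + 1) ≅
        (GrBimod.qShift S 25).obj ((GrBimod.qShift S 1).obj (GrBimod.free S))),
      (target S).d 8 (8 + 1) ≫ ψ₁.hom =
        ψ₀.hom ≫ (GrBimod.qShift S 25).map (GrBimod.delta S 3) := by
  have h01 : (ComplexShape.up ℤ).Rel 0 1 := by simp
  refine ⟨(GrBimod.qShift S 25).mapIso (HomologicalComplex.doubleXIso₀ (GrBimod.delta S 3) h01),
    (GrBimod.qShift S 25).mapIso
      (HomologicalComplex.doubleXIso₁ (GrBimod.delta S 3) h01 (by decide)), ?_⟩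
  have hd : (target S).d 8 (8 + 1) = (GrBimod.qShift S 25).map ((GrBimod.twoTerm S 3).d 0 1) := by
    rw [CochainComplex.shiftFunctor_obj_d', Int.negOnePow_even (-8) (by decide), one_smul]
    rfl
  rw [hd]
  change (GrBimod.qShift S 25).map ((GrBimod.twoTerm S 3).d 0 1) ≫ (GrBimod.qShift S 25).map _ =
    (GrBimod.qShift S 25).map _ ≫ _
  rw [← Functor.map_comp, ← Functor.map_comp]
  congr 1
  have := HomologicalComplex.double_d (GrBimod.delta S 3) h01 (by decide)
  exact (Iso.eq_comp_inv _).1 (this.trans (Category.assoc _ _ _).symm)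

theorem isZero_target {n : ℤ} (h : n ≠ 8) (h' : n ≠ 8 + 1) : IsZero ((target S).X n) :=
  (GrBimod.qShift S 25).map_isZero
    (HomologicalComplex.isZero_double_X (GrBimod.delta S 3) _ (n + -8) (by omega) (by omega))

theorem mval_mem_of_linear (hv : ∀ t, v t = false) (hb : closable (code b) = true) {x : Monos}
    (hx : sumMonos [(4, -3), (8, 1)] (normalForm (code b) x) = []) :
    mval S x - (3 * MvPolynomial.X base.1 - MvPolynomial.X base.2) ∈
      cycIdeal S (next wordL3 v * hat b) := by
  have h1 := monosVal_sumMonos (x := fun i => MvPolynomial.X (R := S) (src i)) [(4, -3), (8, 1)]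
    (normalForm (code b) x)
  rw [hx] at h1
  change 0 = mval S _ + mval S _ at h1
  rw [mval_linear] at h1
  have h2 := mval_normalForm_mem (S := S) hv hb x
  have h3 := sub_mem_cycIdeal S (sameCycle_src hv b base.2)
  convert sub_mem h3 h2 using 1
  change _ = (MvPolynomial.X base.2 - MvPolynomial.X (src 3)) - _
  change _ - (3 * MvPolynomial.X (src 2) - _) = _
  linear_combination -h1

theorem Stage.Computes.split {X : Stage S 14} {label : X.Y → Option ℕ}
    (hX : X.Computes label finalRows 7) : ∃ F : CochainComplex (GrBimod S) ℤ,
      (∀ i, Module.Finite (RR S) (F.X i)) ∧ (∀ i, i < 0 ∨ 7 < i → IsZero (F.X i)) ∧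
        Nonempty (X.toTw.Realizes (F ⊞ target S)) := by
  classical
  obtain ⟨r, r', hr, hr', hc, hh, hq, hent, hc', hh', hq', hall⟩ := finalOk_spec final_check.2
  obtain ⟨yB, hB, -⟩ := hX.surj r (findRow_mem hr)
  obtain ⟨yP, hP, -⟩ := hX.surj r' (findRow_mem hr')
  rw [findRow_id hr] at hB
  rw [findRow_id hr'] at hP
  obtain ⟨r1, e1, hBa, hBh, hBq, hBd⟩ := hX.row yB _ hB
  obtain ⟨r2, e2, hPa, hPh, hPq, -⟩ := hX.row yP _ hP
  obtain rfl : r = r1 := Option.some.inj (hr.symm.trans e1)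
  obtain rfl : r' = r2 := Option.some.inj (hr'.symm.trans e2)
  have hab : X.a yB = X.a yP := code_injective _ _ (by rw [← hBa, ← hPa, hc, hc'])
  have hclosed : closable (code (X.a yB)) = true := by
    rw [← hBa, hc]
    decide +kernel
  let u : Later 14 := ⟨fun _ => false, fun _ _ => rfl⟩
  have hz : ∀ i : X.Y × Later 14, X.toTw.h i = X.h i.1 := fun i => by
    change (X.h i.1 : ℤ) + height i.2.1 = _
    rw [height_closed i.2.apply_closed, Nat.cast_zero, add_zero]
  let s : X.Y × Later 14 → Prop := fun i => label i.1 ≠ some 1576800 ∧ label i.1 ≠ some 1576802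
  have hs : ∀ i, ¬ s i ↔ i = (yB, u) ∨ i = (yP, u) := fun i => by
    have hi : ∀ y, i = (y, u) ↔ i.1 = y := fun y =>
      ⟨fun h => h ▸ rfl, fun h => Prod.ext h (Later.eq_of_closed _ _)⟩
    rw [hi, hi]
    constructor
    · intro h
      by_cases h1 : label i.1 = some 1576800
      · exact .inl (hX.inj _ _ _ h1 hB)
      · exact .inr (hX.inj _ _ _ (by_contra fun h2 => h ⟨h1, h2⟩) hP)
    · rintro (h | h) h'
      · exact h'.1 (h ▸ hB)
      · exact h'.2 (h ▸ hP)
  have hlow : ∀ i, s i → X.h i.1 ≤ 7 ∧ X.d i (yB, u) = 0 := by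
    intro i hi
    have hdeg : X.h i.1 < 7 → X.d i (yB, u) = 0 := fun h => X.deg _ _ (by
      change X.toTw.h _ ≠ X.toTw.h _ + 1
      rw [hz, hz]
      change (X.h yB : ℤ) ≠ _
      omega)
    cases hl : label i.1 with
    | none => exact ⟨(hX.low _ hl).le, hdeg (hX.low _ hl)⟩
    | some n =>
      obtain ⟨t, ht, hta, hth, htq, htd⟩ := hX.row _ _ hl
      rcases hall t (findRow_mem ht) with ⟨h1, h2⟩ | h | h
      · refine ⟨by omega, ?_⟩
        have hu : i = (i.1, u) := Prod.ext rfl (Later.eq_of_closed _ _)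
        rw [hu]
        refine (htd yB _ u hB).eq_zero fun p => ?_
        have h3 := mval_normalForm_mem (S := S) u.apply_closed hclosed (entry 1576800 t.ents)
        rw [← hBa, hc, h2, mval, monosVal, zero_sub] at h3
        rw [morPoly]
        exact Ideal.mul_mem_right _ _ (Ideal.mul_mem_right _ _ (neg_mem_iff.1 h3))
      · exact absurd (hl.trans (by rw [← findRow_id ht, h])) hi.1
      · exact absurd (hl.trans (by rw [← findRow_id ht, h])) hi.2
  have hcross : ∀ i j, s i → ¬ s j → X.toTw.d i j = 0 := by
    intro i j hi hj
    rcases (hs j).1 hj with rfl | rfl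
    · exact (hlow i hi).2
    · refine X.toTw.deg _ _ ?_
      rw [hz, hz]
      have := (hlow i hi).1
      change (X.h yP : ℤ) ≠ _
      omega
  have hcross' : ∀ i j, ¬ s i → s j → X.toTw.d i j = 0 := by
    intro i j hi hj
    refine X.toTw.deg _ _ ?_
    rw [hz, hz]
    have := (hlow j hj).1
    rcases (hs i).1 hi with rfl | rfl
    · change _ ≠ (X.h yB : ℤ) + 1
      omega
    · change _ ≠ (X.h yP : ℤ) + 1
      omega
  obtain ⟨F, ⟨rF⟩, hF⟩ := X.toTw.exists_realizesOn s hcross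
  refine ⟨F, fun i => ?_, fun i hi => ?_, ?_⟩
  · rw [hF]
    exact finite_biproduct fun j => finite_cycObj _ _
  · rw [hF, IsZero.iff_id_eq_zero]
    refine biproduct.hom_ext _ _ fun j => absurd j.2 ?_
    rintro ⟨h1, h2⟩
    have h3 : (X.h j.1.1 : ℤ) = i := (hz j.1).symm.trans h2
    have := (hlow _ h1).1
    omega
  obtain ⟨φ₀, h₀⟩ := exists_iso_ob (S := S) (a := X.a yB) (q := X.q yB) (l := -1) u.apply_closed
    (by rw [← hBa, hc]) (by omega)
  obtain ⟨φ₁, h₁⟩ := exists_iso_ob (S := S) (a := X.a yP) (q := X.q yP) (l := 1) u.apply_closed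
    (by rw [← hPa, hc']) (by omega)
  have hd : (GrBimod.qShift S 25).map (GrBimod.delta S 3) ≫ φ₁.hom =
      φ₀.hom ≫ X.d (yB, u) (yP, u) := by
    refine GrBimod.hom_ext (LinearMap.ext fun x => ?_)
    let x' : RR S := x
    change φ₁.hom.toLin ((((3 : ℤ) : RR S) * XL S - XR S) * x') =
      (X.d (yB, u) (yP, u)).toLin (φ₀.hom.toLin x')
    have hmem := mval_mem_of_linear (S := S) (x := entry 1576802 r.ents) u.apply_closed hclosed
      (by rw [← hBa, hc, hent])
    have hone := hBd yP _ u hP 1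
    rw [h₁, h₀, map_smul, hone, mul_comm, mul_smul]
    congr 1
    rw [sub_smul, mul_smul, XL_smul_elt, XR_smul_elt, Int.cast_smul_eq_zsmul, ← map_zsmul,
      ← map_sub]
    refine elt_eq_iff.2 ?_
    rw [morPoly, ← hab, gluePoly_self]
    convert neg_mem hmem using 1
    · simp only [ob, hab]
    · simp only [zsmul_eq_mul]
      push_cast
      ring
  obtain ⟨ψ₀, ψ₁, hψ⟩ := exists_target_iso S
  obtain ⟨rT⟩ := Tw.exists_realizesOn_pair (M := X.toTw) (K := target S) (a := 8) hs
    (by rw [hz]; change (X.h yB : ℤ) = 8; omega) (by rw [hz]; change (X.h yP : ℤ) = 8 + 1; omega)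
    (ψ₀ ≪≫ φ₀) (ψ₁ ≪≫ φ₁) (fun n => isZero_target) (by
      change (target S).d 8 (8 + 1) ≫ ψ₁.hom ≫ φ₁.hom = (ψ₀.hom ≫ φ₀.hom) ≫ X.d (yB, u) (yP, u)
      rw [← Category.assoc, hψ, Category.assoc, hd, Category.assoc])
  exact rF.biprod rT hcross hcross'

end Splitting

end Khovanov

end

theorem mainTheorem2 :
    ∃ F : CochainComplex (Khovanov.GrBimod Khovanov.Zloc3) ℤ,
      (∀ i : ℤ, Module.Finite (Khovanov.RR Khovanov.Zloc3) (F.X i)) ∧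
      (∀ i : ℤ, i < 0 ∨ 7 < i → IsZero (F.X i)) ∧
      Nonempty (HomotopyEquiv (Khovanov.khL3 Khovanov.Zloc3)
        (F ⊞ (((Khovanov.GrBimod.qShift Khovanov.Zloc3 25).mapHomologicalComplex
          (ComplexShape.up ℤ)).obj (Khovanov.GrBimod.twoTerm Khovanov.Zloc3 3))⟦(-8 : ℤ)⟧)) := by
  obtain ⟨w, hw⟩ : ∃ w : Khovanov.Zloc3, 2 * w = 1 := by
    have h : (2 : ℤ) ∈ (Ideal.span {(3 : ℤ)}).primeCompl := fun h => by
      have := Ideal.mem_span_singleton.1 h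
      omega
    have hu := IsLocalization.map_units Khovanov.Zloc3 ⟨2, h⟩
    rw [map_ofNat] at hu
    exact hu.exists_right_inv
  obtain ⟨X, label, hX, ⟨r⟩⟩ := Khovanov.exists_stage_khL3 Khovanov.Zloc3
  obtain ⟨X', label', hX', e⟩ := hX.final hw
  obtain ⟨F, hfin, hzero, ⟨r'⟩⟩ := hX'.split
  exact ⟨F, hfin, hzero, e.nonempty_homotopyEquiv r r'⟩
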